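/- **Theorem 12.4.** Let $N,n\ge 0$. For $\lambda\in\mathbb Z_{\ge0}^N$ with $|\lambda|=n$ let $\Gamma_k=\{\gamma_{k,1},\dots,\gamma_{k,\lambda_k}\}$ be variables, $\Gamma=(\Gamma_1;\dots;\Gamma_N)$, $S_\lambda=S_{\lambda_1}\times\dots\times S_{\lambda_N}$, and let $$K_\lambda=K_T(T^*\mathcal F_\lambda)\otimes\mathbb C(h)=\mathbb C[\Gamma^{\pm1}]^{S_\lambda}\otimes\mathbb C[z_1^{\pm1},\dots,z_n^{\pm1}]\otimes\mathbb C(h)\big/\big\langle f(\Gamma)=f(z)\,:\ f\in\mathbb C[z^{\pm1}]^{S_n}\big\rangle ,$$ where $\mathcal F_\lambda$ is the variety of flags $0=F_0\subset\dots\subset F_N=\mathbb C^n$ with $\dim F_i/F_{i-1}=\lambda_i$, the $\gamma_{i,j}$ are the Chern roots of $F_i/F_{i-1}$, and $z_1,\dots,z_n,h$ are the equivariant parameters of $T=(\mathbb C^\times)^n\times\mathbb C^\times$. Set $K_\lambda=0$ if $\lambda$ has a negative entry, and $K_T(\mathcal X_n)\otimes\mathbb C(h)=\bigoplus_{|\lambda|=n}K_\lambda$.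 *R-matrix and the vectors $\xi_I$.* The matrix $\mathcal R(x,h)$ on $\mathbb C^N\otimes\mathbb C^N$ fixes each $v_i\otimes v_i$, and for $i<j$ sends $v_i\otimes v_j\mapsto\frac{1-x}{1-hx}v_i\otimes v_j+\frac{(1-h)x}{1-hx}v_j\otimes v_i$ and $v_j\otimes v_i\mapsto\frac{1-h}{1-hx}v_i\otimes v_j+\frac{h(1-x)}{1-hx}v_j\otimes v_i$. For a partition $I=(I_1,\dots,I_N)$ of $\{1,\dots,n\}$ into disjoint subsets let $v_I=v_{i_1}\otimes\dots\otimes v_{i_n}$ with $i_j=k$ if $j\in I_k$; let $\mathcal I_\lambda$ be the set of those $I$ with $|I_k|=\lambda_k$ for all $k$. On $(\mathbb C^N)^{\otimes n}\otimes\mathbb C(z,h)$ let $\tilde s_i=P^{(i,i+1)}\mathcal R^{(i,i+1)}(z_i/z_{i+1},h)K_i$, where $P^{(i,i+1)}$ permutes the tensor factors $i,i+1$ and $K_i$ exchanges $z_i$ and $z_{i+1}$. There is a unique family $\xi_I\in(\mathbb C^N)^{\otimes n}\otimes\mathbb C(z,h)$ with $\xi_{s_i(I)}=\tilde s_i\xi_I$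 for all $I$ and $1\le i<n$, and $\xi_I=v_I$ whenever every element of $I_k$ is smaller than every element of $I_l$ for all $k<l$. *The map $\nu$.* Let $R(z_I)=\prod_{k<l}\prod_{a\in I_k}\prod_{b\in I_l}(1-z_b/z_a)$ and $$\nu:[f(\Gamma,z,h)]\mapsto\sum_{I\in\mathcal I_\lambda}\frac{f(z_I,z,h)}{R(z_I)}\,\xi_I ,$$ where $f(z_I,z,h)$ is obtained by the substitution $\Gamma_k\mapsto\{z_a: a\in I_k\}$ for all $k$. Let $D=\prod_{1\le b<a\le n}(1-hz_b/z_a)$. Then $\nu$ is a well defined isomorphism of $K_T(\mathcal X_n)\otimes\mathbb C(h)$ onto the space of linear combinations, with coefficients in $\mathbb C[z^{\pm1}]\otimes\mathbb C(h)$, of the elements of $(\mathbb C^N)^{\otimes n}\otimes\frac1D\,\mathbb C[z^{\pm1}]\otimes\mathbb C(h)$ that are invariant under $\tilde s_1,\dots,\tilde s_{n-1}$. *The algebra.* $U_h(\widetilde{\mathfrak{gl}}_N)$ is the unital associative $\mathbb C(h)$-algebra with generators $\tilde L_{i,j,\pm s}$ ($1\le i,j\le N$, $s\ge0$; here $+0$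 and $-0$ are different) and $\tilde L_{i,i,+0}^{-1}$, and relations $\tilde L_{i,j,+0}=\tilde L_{j,i,-0}=0$ for $i<j$, $\ \tilde L_{i,i,+0}\tilde L_{i,i,+0}^{-1}=\tilde L_{i,i,+0}^{-1}\tilde L_{i,i,+0}=1$, $\ \tilde L_{1,1,-0}=1$, $\ \tilde L_{i,i,+0}=\tilde L_{i+1,i+1,-0}$ for $i<N$, and $$\mathcal R^{(1,2)}(v/u,h)\,\tilde L^{(1)}_\alpha(u)\,\tilde L^{(2)}_\beta(v)=\tilde L^{(2)}_\beta(v)\,\tilde L^{(1)}_\alpha(u)\,\mathcal R^{(1,2)}(v/u,h),\qquad(\alpha,\beta)=(+,+),(+,-),(-,-),$$ understood as equalities of coefficients after multiplication by $u-hv$, with $\tilde L_{i,j,\pm}(u)=\sum_{s\ge0}\tilde L_{i,j,\pm s}u^{\pm s}$. Put $M_{\mathbf i,\mathbf j,\pm}(u)=\sum_{\sigma\in S_p}(-1)^\sigma\tilde L_{i_1,j_{\sigma(1)},\pm}(u)\tilde L_{i_2,j_{\sigma(2)},\pm}(uh)\cdots\tilde L_{i_p,j_{\sigma(p)},\pm}(uh^{p-1})$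 and, for $1\le p\le N-1$, with $\mathbf i=\{1,\dots,p\}$ and $\mathbf j=\{1,\dots,p-1,p+1\}$, $$E_{p,\pm}(u)=\tfrac1{1-h}M_{\mathbf j,\mathbf i,\pm}(u)M_{\mathbf i,\mathbf i,\pm}(u)^{-1},\qquad F_{p,\pm}(u)=\tfrac1{1-h}M_{\mathbf i,\mathbf i,\pm}(u)^{-1}M_{\mathbf i,\mathbf j,\pm}(u).$$ *The action.* Let $L(u)=\mathcal R^{(0,n)}(z_n/u,h)\cdots\mathcal R^{(0,1)}(z_1/u,h)\prod_{i=1}^n\frac{1-hz_i/u}{1-z_i/u}$ on $\mathbb C^N\otimes(\mathbb C^N)^{\otimes n}$, with the factors numbered $0,1,\dots,n$, viewed as a matrix $(L_{i,j}(u))_{i,j=1}^N$ with entries acting on $(\mathbb C^N)^{\otimes n}$. Let $L_{i,j,+s}$ (respectively $L_{i,j,-s}$) be the coefficient of $u^{s}$ (of $u^{-s}$) in the expansion of $L_{i,j}(u)$ at $u=0$ (at $u=\infty$). Then $\tilde L_{i,j,\pm s}\mapsto L_{i,j,\pm s}$ defines an action $\phi$ of $U_h(\widetilde{\mathfrak{gl}}_N)$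 on $(\mathbb C^N)^{\otimes n}\otimes\mathbb C(z,h)$, and through $\nu$ the space $K_T(\mathcal X_n)\otimes\mathbb C(h)$ becomes a $U_h(\widetilde{\mathfrak{gl}}_N)$-module $\rho$: $\ \nu\circ\rho(X)=\phi(X)\circ\nu$ for all $X$. *The formulas.* Let $1\le p\le N-1$ and $\alpha_p=(0,\dots,0,1,-1,0,\dots,0)$ with $p-1$ first zeros. Then $\rho(E_{p,\pm}(u)):K_{\lambda-\alpha_p}\to K_\lambda$ and $\rho(F_{p,\pm}(u)):K_{\lambda+\alpha_p}\to K_\lambda$ (in particular, these operators vanish on $K_\mu$ if $\mu+\alpha_p$, respectively $\mu-\alpha_p$, has a negative entry), and $$\rho(E_{p,+}(u)):[f]\mapsto\Big[-\sum_{i=1}^{\lambda_p}\frac{f(\Gamma^{\prime i},z,h)}{1-u/\gamma_{p,i}}\prod_{j\ne i}\frac1{1-\gamma_{p,i}/\gamma_{p,j}}\prod_{k=1}^{\lambda_{p+1}}(1-h\gamma_{p+1,k}/\gamma_{p,i})\Big],$$ $$\rho(E_{p,-}(u)):[f]\mapsto\Big[\sum_{i=1}^{\lambda_p}f(\Gamma^{\prime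 i},z,h)\frac{\gamma_{p,i}/u}{1-\gamma_{p,i}/u}\prod_{j\ne i}\frac1{1-\gamma_{p,i}/\gamma_{p,j}}\prod_{k=1}^{\lambda_{p+1}}(1-h\gamma_{p+1,k}/\gamma_{p,i})\Big],$$ $$\rho(F_{p,+}(u)):[f]\mapsto\Big[-\sum_{i=1}^{\lambda_{p+1}}f(\Gamma^{i\prime},z,h)\frac{u/\gamma_{p+1,i}}{1-u/\gamma_{p+1,i}}\prod_{j\ne i}\frac1{1-\gamma_{p+1,j}/\gamma_{p+1,i}}\prod_{k=1}^{\lambda_p}(1-h\gamma_{p+1,i}/\gamma_{p,k})\Big],$$ $$\rho(F_{p,-}(u)):[f]\mapsto\Big[\sum_{i=1}^{\lambda_{p+1}}\frac{f(\Gamma^{i\prime},z,h)}{1-\gamma_{p+1,i}/u}\prod_{j\ne i}\frac1{1-\gamma_{p+1,j}/\gamma_{p+1,i}}\prod_{k=1}^{\lambda_p}(1-h\gamma_{p+1,i}/\gamma_{p,k})\Big],$$ where $j$ runs over $1,\dots,\lambda_p$ for $E$ and over $1,\dots,\lambda_{p+1}$ for $F$; $\Gamma^{\prime i}$ is obtained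 from $\Gamma$ by moving $\gamma_{p,i}$ from $\Gamma_p$ to $\Gamma_{p+1}$, and $\Gamma^{i\prime}$ by moving $\gamma_{p+1,i}$ from $\Gamma_{p+1}$ to $\Gamma_p$. The right-hand sides are expanded in powers of $u$ for the sign $+$ and of $u^{-1}$ for the sign $-$, and each coefficient inside the brackets is a Laurent polynomial in $\Gamma,z$ over $\mathbb C(h)$, invariant under $S_\lambda$. -/

import Mathlib

/-!
Conventions. All indices are 0-based: the blocks `1, …, N` of a flag are `Fin N`, the tensor factors
`1, …, n` are `Fin n`.  A set partition `I = (I_1, …, I_N)` of `{1, …, n}` is its colouring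
`Fin n → Fin N` (the colour of `a` is the `k` with `a ∈ I_k`).
-/

noncomputable section

namespace LoopK

open Finset Matrix

/-- The field `ℂ(h)`. -/
abbrev Coef : Type := RatFunc ℂ

/-- The indeterminate `h`. -/
def hh : Coef := RatFunc.X

/-- Laurent polynomials over `ℂ(h)` in the variables indexed by `σ`. -/
abbrev Laurent (σ : Type) : Type := AddMonoidAlgebra Coef (σ →₀ ℤ)

/-- A variable, as a Laurent polynomial. -/
def var {σ : Type} (i : σ) : Laurent σ := AddMonoidAlgebra.single (Finsupp.single i 1) 1

/-- Substitution of variables: the algebra map with `x_i ↦ x_{g i}`. -/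
def rename {σ τ : Type} (g : σ → τ) : Laurent σ →ₐ[Coef] Laurent τ :=
  AddMonoidAlgebra.mapDomainAlgHom Coef Coef (Finsupp.mapDomain.addMonoidHom g)

theorem rename_rename {σ τ υ : Type} (g : σ → τ) (k : τ → υ) (f : Laurent σ) :
    rename k (rename g f) = rename (k ∘ g) f := by
  have : (rename k).comp (rename g) = rename (k ∘ g) := by
    unfold rename
    rw [← AddMonoidAlgebra.mapDomainAlgHom_comp, Finsupp.mapDomain.addMonoidHom_comp]
  exact congrArg (fun F => F f) this

theorem rename_injective {σ τ : Type} (e : σ ≃ τ) : Function.Injective (rename e) := by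
  apply AddMonoidAlgebra.mapDomain_injective
  exact Finsupp.mapDomain_injective e.injective

/-- Rational functions over `ℂ(h)` in the variables indexed by `σ`. -/
abbrev RatF (σ : Type) : Type := FractionRing (Laurent σ)

/-- A variable, as a rational function. -/
def rvar {σ : Type} (i : σ) : RatF σ := algebraMap (Laurent σ) (RatF σ) (var i)

/-- The element `h` of the field of rational functions. -/
def rh {σ : Type} : RatF σ := algebraMap Coef (RatF σ) hh

/-- The automorphism of the field of rational functions that permutes the variables. -/
def permute {σ : Type} (π : Equiv.Perm σ) : RatF σ →+* RatF σ :=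
  IsFractionRing.map (j := (rename π : Laurent σ →ₐ[Coef] Laurent σ).toRingHom)
    (rename_injective π)

/-! ### The equivariant K-theory algebras -/

/-- The Chern roots `γ_{k,j}`, `1 ≤ j ≤ λ_k`. -/
abbrev Roots {N : ℕ} (lam : Fin N → ℕ) : Type := Σ k : Fin N, Fin (lam k)

/-- `ℂ[Γ^{±1}]^{S_λ} ⊗ ℂ[z^{±1}] ⊗ ℂ(h)`: Laurent polynomials in the `γ_{k,j}` and the `z_a` that are
invariant under the permutations of the `γ`'s with the same first index. -/
def symLaurent {N : ℕ} (n : ℕ) (lam : Fin N → ℕ) : Subalgebra Coef (Laurent (Roots lam ⊕ Fin n)) where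
  carrier := {f | ∀ π : ∀ k, Equiv.Perm (Fin (lam k)),
    rename (Sum.map (Equiv.sigmaCongrRight π) id) f = f}
  mul_mem' ha hb π := by rw [map_mul, ha π, hb π]
  add_mem' ha hb π := by rw [map_add, ha π, hb π]
  algebraMap_mem' r π := AlgHom.commutes _ r

/-- The ideal generated by all `f(Γ) - f(z)` with `f` a symmetric Laurent polynomial in `n`
variables. Here `f(Γ)` is `f` evaluated at the `n` roots `γ_{k,j}`, listed in any order `e`. -/
def relIdeal {N : ℕ} (n : ℕ) (lam : Fin N → ℕ) : Ideal (symLaurent n lam) :=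
  Ideal.span {x | ∃ f : Laurent (Fin n), (∀ π : Equiv.Perm (Fin n), rename π f = f) ∧
    ∃ e : Fin n ≃ Roots lam,
      (x : Laurent (Roots lam ⊕ Fin n)) = rename (Sum.inl ∘ e) f - rename Sum.inr f}

/-- `K_λ = K_T(T^*F_λ) ⊗ ℂ(h)`. -/
abbrev KLam {N : ℕ} (n : ℕ) (lam : Fin N → ℕ) : Type := symLaurent n lam ⧸ relIdeal n lam

/-- The class `[f] ∈ K_λ`. -/
def cls {N n : ℕ} {lam : Fin N → ℕ} (f : symLaurent n lam) : KLam n lam :=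
  Ideal.Quotient.mk (relIdeal n lam) f

/-- The `λ ∈ ℤ_{≥0}^N` with `|λ| = n`. -/
abbrev Weight (N n : ℕ) : Type := {lam : Fin N → ℕ // ∑ k, lam k = n}

/-- `K_T(X_n) ⊗ ℂ(h)`, the direct sum of the `K_λ`. -/
abbrev KT (N n : ℕ) : Type := DirectSum (Weight N n) (fun lam => KLam n lam.1)

/-- The inclusion `K_λ → K_T(X_n) ⊗ ℂ(h)`. -/
def inc {N n : ℕ} (lam : Weight N n) : KLam n lam.1 →ₗ[Coef] KT N n :=
  DirectSum.lof Coef (Weight N n) (fun lam => KLam n lam.1) lam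

/-- The set partitions `I` of `{1, …, n}` with `|I_k| = λ_k`. -/
abbrev Part {N : ℕ} (n : ℕ) (lam : Fin N → ℕ) : Type :=
  {I : Fin n → Fin N // ∀ k, (univ.filter (fun a => I a = k)).card = lam k}

/-- The substitution `{γ_{k,1}, …, γ_{k,λ_k}} ↦ {z_a | a ∈ I_k}` (in increasing order of `a`). -/
def locVar {N n : ℕ} {lam : Fin N → ℕ} (I : Part n lam) (x : Roots lam) : Fin n :=
  (univ.filter (fun a => I.1 a = x.1)).orderEmbOfFin (I.2 x.1) x.2

theorem colour_locVar {N n : ℕ} {lam : Fin N → ℕ} (I : Part n lam) (x : Roots lam) :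
    I.1 (locVar I x) = x.1 :=
  (mem_filter.1 (orderEmbOfFin_mem _ (I.2 x.1) x.2)).2

theorem locVar_bijective {N n : ℕ} {lam : Fin N → ℕ} (I : Part n lam) :
    Function.Bijective (locVar I) := by
  constructor
  · rintro ⟨k, a⟩ ⟨l, b⟩ h
    have hk : k = l := by
      have := congrArg I.1 h
      rwa [colour_locVar, colour_locVar] at this
    subst hk
    have : a = b := (orderEmbOfFin _ (I.2 k)).injective h
    rw [this]
  · intro a
    have : a ∈ Set.range ((univ.filter (fun b => I.1 b = I.1 a)).orderEmbOfFin (I.2 (I.1 a))) := by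
      rw [range_orderEmbOfFin]
      simp
    obtain ⟨b, hb⟩ := this
    exact ⟨⟨I.1 a, b⟩, hb⟩

/-- The substitution `f(Γ, z, h) ↦ f(z_I, z, h)`. -/
def locPre {N n : ℕ} {lam : Fin N → ℕ} (I : Part n lam) :
    symLaurent n lam →ₐ[Coef] Laurent (Fin n) :=
  (rename (Sum.elim (locVar I) id)).comp (symLaurent n lam).val

theorem locPre_rel {N n : ℕ} {lam : Fin N → ℕ} (I : Part n lam) (x : symLaurent n lam)
    (hx : x ∈ relIdeal n lam) : locPre I x = 0 := by
  have : relIdeal n lam ≤ RingHom.ker (locPre I) := by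
    unfold relIdeal
    rw [Ideal.span_le]
    rintro y ⟨f, hf, e, hy⟩
    change rename (Sum.elim (locVar I) id) (y : Laurent (Roots lam ⊕ Fin n)) = 0
    rw [hy, map_sub, rename_rename, rename_rename]
    have h1 := hf (e.trans (Equiv.ofBijective _ (locVar_bijective I)))
    have h2 := hf (Equiv.refl _)
    have e1 : (Sum.elim (locVar I) id : Roots lam ⊕ Fin n → Fin n) ∘ Sum.inl ∘ e =
        (e.trans (Equiv.ofBijective _ (locVar_bijective I)) : Fin n → Fin n) := rfl
    have e2 : (Sum.elim (locVar I) id : Roots lam ⊕ Fin n → Fin n) ∘ Sum.inr =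
        (Equiv.refl (Fin n) : Fin n → Fin n) := rfl
    rw [e1, e2, h1, h2, sub_self]
  exact this hx

/-- The restriction to the fixed point `x_I`, `[f] ↦ f(z_I, z, h)`. -/
def loc {N n : ℕ} {lam : Fin N → ℕ} (I : Part n lam) : KLam n lam →ₐ[Coef] Laurent (Fin n) :=
  Ideal.Quotient.liftₐ (relIdeal n lam) (locPre I) (locPre_rel I)

/-! ### The trigonometric R-matrix -/

/-- `(s - h t) ℛ(t/s, h)`, a matrix with entries polynomial in `s, t, h`; the entry at
`(c, d), (a, b)` is the coefficient of `v_c ⊗ v_d` in the image of `v_a ⊗ v_b`. -/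
def Rhom {E : Type*} [CommRing E] (N : ℕ) (h s t : E) :
    Matrix (Fin N × Fin N) (Fin N × Fin N) E :=
  Matrix.of fun x y =>
    if x = y then (if y.1 = y.2 then s - h * t else if y.1 < y.2 then s - t else h * (s - t))
    else if x = y.swap then (if y.1 < y.2 then (1 - h) * t else (1 - h) * s)
    else 0

/-- The trigonometric R-matrix `ℛ(x, h)`. -/
def Rtrig {E : Type*} [Field E] (N : ℕ) (x h : E) : Matrix (Fin N × Fin N) (Fin N × Fin N) E :=
  (1 - h * x)⁻¹ • Rhom N h 1 x

/-- `ℛ^{(i,j)}(x, h)`, acting on the `i`-th and `j`-th factors of `(ℂ^N)^{⊗ m}`, in the basis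
`v_I`, `I : Fin m → Fin N`. -/
def Rij {E : Type*} [Field E] {N m : ℕ} (i j : Fin m) (x h : E) :
    Matrix (Fin m → Fin N) (Fin m → Fin N) E :=
  Matrix.of fun I J =>
    if ∀ k, k ≠ i → k ≠ j → I k = J k then Rtrig N x h (I i, I j) (J i, J j) else 0

/-! ### Vector-valued functions and the vectors `ξ_I` -/

/-- `(ℂ^N)^{⊗ n} ⊗ ℂ(z, h)`, in the coordinates with respect to the basis `v_I`. -/
abbrev V (N n : ℕ) : Type := (Fin n → Fin N) → RatF (Fin n)

/-- The operator `s̃_i = P^{(i,i+1)} ℛ^{(i,i+1)}(z_i/z_{i+1}) K_i`, where `j = i + 1` and `K_i`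
exchanges the variables `z_i` and `z_{i+1}`. -/
def sTilde {N n : ℕ} (i j : Fin n) (f : V N n) : V N n := fun I =>
  (Rij i j (rvar i / rvar j) rh *ᵥ fun J => permute (Equiv.swap i j) (f J)) (I ∘ Equiv.swap i j)

/-- The defining properties of the family of vectors `ξ_I`: `ξ_I = v_I` for
`I = ({1, …, λ_1}, {λ_1 + 1, …, λ_1 + λ_2}, …)`, and `ξ_{s_i(I)} = s̃_i ξ_I` for all `I`, `i`. -/
def IsXi {N n : ℕ} (xi : (Fin n → Fin N) → V N n) : Prop :=
  (∀ I, Monotone I → xi I = Pi.single I 1) ∧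
  ∀ I, ∀ i j : Fin n, (i : ℕ) + 1 = j → xi (I ∘ Equiv.swap i j) = sTilde i j (xi I)

/-- `R(z_I)`, the product of `1 - z_b/z_a` over `k < l`, `a ∈ I_k`, `b ∈ I_l`. -/
def Rz {N n : ℕ} (I : Fin n → Fin N) : RatF (Fin n) :=
  ∏ a, ∏ b, if I a < I b then 1 - rvar b / rvar a else 1

/-- The map `ν`, `[f] ↦ ∑_{I ∈ 𝓘_λ} f(z_I, z, h)/R(z_I) ξ_I` on `K_λ`. -/
def nuLam {N n : ℕ} (xi : (Fin n → Fin N) → V N n) (lam : Fin N → ℕ) :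
    KLam n lam →ₗ[Coef] V N n where
  toFun x := ∑ I : Part n lam,
    (algebraMap (Laurent (Fin n)) (RatF (Fin n)) (loc I x) / Rz I.1) • xi I.1
  map_add' x y := by
    simp only [map_add, add_div, add_smul, sum_add_distrib]
  map_smul' c x := by
    rw [RingHom.id_apply, smul_sum]
    refine sum_congr rfl fun I _ => ?_
    have h : algebraMap (Laurent (Fin n)) (RatF (Fin n)) (loc I (c • x)) =
        c • algebraMap (Laurent (Fin n)) (RatF (Fin n)) (loc I x) := by
      rw [map_smul, Algebra.smul_def, map_mul, ← IsScalarTower.algebraMap_apply, ← Algebra.smul_def]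
    rw [h, smul_div_assoc, smul_assoc]

/-- The map `ν` on `K_T(X_n) ⊗ ℂ(h)`. -/
def nu {N n : ℕ} (xi : (Fin n → Fin N) → V N n) : KT N n →ₗ[Coef] V N n :=
  DirectSum.toModule Coef (Weight N n) (V N n) (fun lam => nuLam xi lam.1)

/-- `D`, the product of `1 - h z_b/z_a` over `b < a`. -/
def DD (n : ℕ) : RatF (Fin n) :=
  ∏ a : Fin n, ∏ b : Fin n, if b < a then 1 - rh * (rvar b / rvar a) else 1

/-- `(1/D) 𝒱^- ⊗ ℂ(h)`: the functions with values in `(ℂ^N)^{⊗ n}` that become Laurent polynomials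
after multiplication by `D` and are invariant under all the operators `s̃_i`. -/
def DVminus (N n : ℕ) : Set (V N n) :=
  {f | (∀ I, DD n * f I ∈ Set.range (algebraMap (Laurent (Fin n)) (RatF (Fin n)))) ∧
    ∀ i j : Fin n, (i : ℕ) + 1 = j → sTilde i j f = f}

/-- `(1/D) 𝒱^- ⊗ ℂ[z^{±1}] ⊗ ℂ(h)`, as the space of combinations of the invariant functions with
coefficients in the Laurent polynomials in `z`. -/
def DVz (N n : ℕ) : Submodule (Laurent (Fin n)) (V N n) :=
  Submodule.span (Laurent (Fin n)) (DVminus N n)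

/-! ### The algebra `U_h` -/

/-- The two signs: `plus` is for the series in `u`, `minus` for the series in `u⁻¹`. -/
inductive Sgn : Type
  | plus : Sgn
  | minus : Sgn

/-- The sign as an integer. -/
def Sgn.val : Sgn → ℤ
  | .plus => 1
  | .minus => -1

/-- The generators `L̃_{i,j,±s}` and `L̃_{i,i,+0}⁻¹`. -/
inductive Gen (N : ℕ) : Type
  | L (al : Sgn) (i j : Fin N) (s : ℕ) : Gen N
  | Linv (i : Fin N) : Gen N

/-- The coefficient of `u^k` in `L̃_{i,j,α}(u)`, for `k ∈ ℤ`, in the free algebra. -/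
def Lco {N : ℕ} (al : Sgn) (i j : Fin N) (k : ℤ) : FreeAlgebra Coef (Gen N) :=
  if 0 ≤ al.val * k then FreeAlgebra.ι Coef (.L al i j k.natAbs) else 0

/-- The defining relations. The last one is the coefficient of `u^k v^l` in the matrix entry
`(a, b), (c, d)` of
`(u - h v) ℛ^{(1,2)}(v/u, h) L̃^{(1)}_α(u) L̃^{(2)}_β(v) =
  (u - h v) L̃^{(2)}_β(v) L̃^{(1)}_α(u) ℛ^{(1,2)}(v/u, h)`;
note that `(u - h v) ℛ(v/u, h) = Rhom N h 1 0 • u + Rhom N h 0 1 • v`. -/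
inductive Rel (N : ℕ) : FreeAlgebra Coef (Gen N) → FreeAlgebra Coef (Gen N) → Prop
  | upper_plus (i j : Fin N) : i < j → Rel N (Lco .plus i j 0) 0
  | lower_minus (i j : Fin N) : i < j → Rel N (Lco .minus j i 0) 0
  | mul_inv (i : Fin N) : Rel N (Lco .plus i i 0 * FreeAlgebra.ι Coef (.Linv i)) 1
  | inv_mul (i : Fin N) : Rel N (FreeAlgebra.ι Coef (.Linv i) * Lco .plus i i 0) 1
  | first (i : Fin N) : (i : ℕ) = 0 → Rel N (Lco .minus i i 0) 1
  | next (i j : Fin N) : (i : ℕ) + 1 = j → Rel N (Lco .plus i i 0) (Lco .minus j j 0)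
  | rll (al be : Sgn) (a b c d : Fin N) (k l : ℤ) : ¬ (al = .minus ∧ be = .plus) →
      Rel N
        (∑ e, ∑ f, (Rhom N hh 1 0 (a, b) (e, f) • (Lco al e c (k - 1) * Lco be f d l) +
          Rhom N hh 0 1 (a, b) (e, f) • (Lco al e c k * Lco be f d (l - 1))))
        (∑ e, ∑ f, (Rhom N hh 1 0 (e, f) (c, d) • (Lco be b f l * Lco al a e (k - 1)) +
          Rhom N hh 0 1 (e, f) (c, d) • (Lco be b f (l - 1) * Lco al a e k)))

/-- The quantum loop algebra `U_h(gl_N~)` over `ℂ(h)`. -/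
abbrev U (N : ℕ) : Type := RingQuot (Rel N)

/-- The element `L̃_{i,j,±s}` of `U_h`. -/
def LL {N : ℕ} (al : Sgn) (i j : Fin N) (s : ℕ) : U N :=
  RingQuot.mkAlgHom Coef (Rel N) (FreeAlgebra.ι Coef (.L al i j s))

/-- The series `L̃_{i,j,±}(u h^k)`, a power series in the variable `u^{±1}`. -/
def Lser {N : ℕ} (al : Sgn) (i j : Fin N) (k : ℕ) : PowerSeries (U N) :=
  PowerSeries.mk fun s => (hh ^ (al.val * (k * s : ℤ))) • LL al i j s

/-- The quantum minor
`M_{i,j,±}(u) = ∑_σ (-1)^σ L̃_{i_1,j_σ(1),±}(u) L̃_{i_2,j_σ(2),±}(u h) ⋯ L̃_{i_p,j_σ(p),±}(u h^{p-1})`. -/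
def minor {N p : ℕ} (al : Sgn) (i j : Fin p → Fin N) : PowerSeries (U N) :=
  ∑ σ : Equiv.Perm (Fin p),
    Equiv.Perm.sign σ • (List.ofFn fun k : Fin p => Lser al (i k) (j (σ k)) k).prod

/-- The index set `{1, …, p + 1}`. -/
def idxI {N p : ℕ} (hp : p + 1 < N) (k : Fin (p + 1)) : Fin N := ⟨k, by omega⟩

/-- The index set `{1, …, p, p + 2}`. -/
def idxJ {N p : ℕ} (hp : p + 1 < N) (k : Fin (p + 1)) : Fin N :=
  if (k : ℕ) = p then ⟨p + 1, hp⟩ else ⟨k, by omega⟩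

theorem Lco_zero_eq {N : ℕ} (al : Sgn) (i j : Fin N) :
    RingQuot.mkAlgHom Coef (Rel N) (Lco al i j 0) = LL al i j 0 := by
  simp [Lco, LL]

theorem isUnit_LL {N : ℕ} (al : Sgn) (i : Fin N) : IsUnit (LL al i i 0) := by
  have hplus : ∀ i : Fin N, IsUnit (LL .plus i i 0) := fun i => by
    have h1 := RingQuot.mkAlgHom_rel Coef (Rel.mul_inv i)
    have h2 := RingQuot.mkAlgHom_rel Coef (Rel.inv_mul i)
    rw [map_mul, map_one, Lco_zero_eq] at h1 h2
    exact ⟨⟨_, _, h1, h2⟩, rfl⟩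
  cases al with
  | plus => exact hplus i
  | minus =>
    by_cases h0 : (i : ℕ) = 0
    · have h1 := RingQuot.mkAlgHom_rel Coef (Rel.first i h0)
      rw [map_one, Lco_zero_eq] at h1
      rw [h1]
      exact isUnit_one
    · have h1 := RingQuot.mkAlgHom_rel Coef
        (Rel.next (⟨(i : ℕ) - 1, by omega⟩ : Fin N) i (by simp; omega))
      rw [Lco_zero_eq, Lco_zero_eq] at h1
      rw [← h1]
      exact hplus _

theorem LL_zero {N : ℕ} (al : Sgn) (i j : Fin N) (h : match al with | .plus => i < j | .minus => j < i) :
    LL al i j 0 = 0 := by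
  cases al with
  | plus =>
    have h1 := RingQuot.mkAlgHom_rel Coef (Rel.upper_plus i j h)
    rwa [map_zero, Lco_zero_eq] at h1
  | minus =>
    have h1 := RingQuot.mkAlgHom_rel Coef (Rel.lower_minus j i h)
    rwa [map_zero, Lco_zero_eq] at h1

theorem perm_moves {p : ℕ} (σ : Equiv.Perm (Fin p)) (hσ : σ ≠ 1) :
    (∃ k, k < σ k) ∧ ∃ k, σ k < k := by
  have hs : ∑ k, ((σ k : Fin p) : ℕ) = ∑ k : Fin p, (k : ℕ) :=
    Equiv.sum_comp σ (fun k : Fin p => (k : ℕ))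
  constructor
  · by_contra! h
    apply hσ
    have := (sum_eq_sum_iff_of_le (s := univ) (fun k _ => Fin.le_def.1 (h k))).1 hs
    ext k
    exact this k (mem_univ k)
  · by_contra! h
    apply hσ
    have := (sum_eq_sum_iff_of_le (s := univ) (fun k _ => Fin.le_def.1 (h k))).1 hs.symm
    ext k
    exact (this k (mem_univ k)).symm

theorem constantCoeff_Lser {N : ℕ} (al : Sgn) (i j : Fin N) (k : ℕ) :
    PowerSeries.constantCoeff (Lser al i j k) = LL al i j 0 := by
  rw [← PowerSeries.coeff_zero_eq_constantCoeff_apply, Lser, PowerSeries.coeff_mk]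
  simp

/-- The principal minors are invertible series. -/
theorem isUnit_minor {N p : ℕ} (al : Sgn) (hp : p + 1 < N) :
    IsUnit (minor al (idxI hp) (idxI hp)) := by
  rw [PowerSeries.isUnit_iff_constantCoeff]
  have hc : PowerSeries.constantCoeff (minor al (idxI hp) (idxI hp)) =
      (List.ofFn fun k : Fin (p + 1) => LL al (idxI hp k) (idxI hp k) 0).prod := by
    rw [minor, map_sum, sum_eq_single (1 : Equiv.Perm (Fin (p + 1)))]
    · rw [Equiv.Perm.sign_one, one_smul, map_list_prod, List.map_ofFn]
      congr 2
      funext k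
      exact constantCoeff_Lser al _ _ _
    · intro σ _ hσ
      rw [Units.smul_def, map_zsmul, map_list_prod, List.map_ofFn]
      rw [List.prod_eq_zero, zsmul_zero]
      rw [List.mem_ofFn]
      obtain ⟨⟨k, hk⟩, ⟨l, hl⟩⟩ := perm_moves σ hσ
      cases al with
      | plus => exact ⟨k, (constantCoeff_Lser _ _ _ _).trans (LL_zero .plus _ _ hk)⟩
      | minus => exact ⟨l, (constantCoeff_Lser _ _ _ _).trans (LL_zero .minus _ _ hl)⟩
    · intro h
      exact absurd (mem_univ _) h
  rw [hc]
  refine List.prod_isUnit fun m hm => ?_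
  rw [List.mem_ofFn] at hm
  obtain ⟨k, rfl⟩ := hm
  exact isUnit_LL al _

/-- `E_{p,±}(u) = (1 - h)⁻¹ M_{j,i,±}(u) M_{i,i,±}(u)⁻¹`, with `i = {1, …, p}`,
`j = {1, …, p - 1, p + 1}`; the argument `p` of this definition is the `p` of the formula minus 1. -/
def Eser {N p : ℕ} (al : Sgn) (hp : p + 1 < N) : PowerSeries (U N) :=
  (1 - hh)⁻¹ • (minor al (idxJ hp) (idxI hp) * ↑(isUnit_minor al hp).unit⁻¹)

/-- `F_{p,±}(u) = (1 - h)⁻¹ M_{i,i,±}(u)⁻¹ M_{i,j,±}(u)`, with the same conventions. -/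
def Fser {N p : ℕ} (al : Sgn) (hp : p + 1 < N) : PowerSeries (U N) :=
  (1 - hh)⁻¹ • (↑(isUnit_minor al hp).unit⁻¹ * minor al (idxI hp) (idxJ hp))

/-! ### The action on vector-valued functions -/

/-- `L(u) = ℛ^{(0,n)}(z_n/u) ⋯ ℛ^{(0,1)}(z_1/u) ∏_i (1 - h z_i/u)/(1 - z_i/u)`. -/
def Lop {E : Type*} [Field E] (N n : ℕ) (h : E) (z : Fin n → E) (u : E) :
    Matrix (Fin (n + 1) → Fin N) (Fin (n + 1) → Fin N) E :=
  (∏ i, (1 - h * (z i / u)) / (1 - z i / u)) •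
    (List.ofFn fun k : Fin n => Rij (N := N) (0 : Fin (n + 1)) k.succ (z k / u) h).reverse.prod

/-- The variable `u` as an element of the field of Laurent series in `u^{±1}`. -/
def uvar (n : ℕ) : Sgn → LaurentSeries (RatF (Fin n))
  | .plus => HahnSeries.single 1 1
  | .minus => HahnSeries.single (-1) 1

/-- `L_{i,j,±s}`: the coefficient of `u^{±s}` in the expansion of the entry `L_{i,j}(u)` of `L(u)` at
`u = 0` or at `u = ∞`, as a matrix in the basis `v_I`. -/
def Lcoef {N : ℕ} (n : ℕ) (al : Sgn) (i j : Fin N) (s : ℕ) :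
    Matrix (Fin n → Fin N) (Fin n → Fin N) (RatF (Fin n)) :=
  Matrix.of fun I J =>
    HahnSeries.coeff (Lop N n (HahnSeries.C rh) (fun a => HahnSeries.C (rvar a)) (uvar n al)
      (Fin.cons i I) (Fin.cons j J)) (s : ℤ)

/-! ### The symmetrization formulas -/

/-- The Chern root `γ_{k,j}` as a rational function of all the `γ`'s and `z`'s. -/
def gam {N : ℕ} (n : ℕ) (lam : Fin N → ℕ) (k : Fin N) (j : Fin (lam k)) : RatF (Roots lam ⊕ Fin n) :=
  rvar (Sum.inl ⟨k, j⟩)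

/-- A bijection `e` between the Chern roots of `μ` and those of `λ` is a substitution of the variables
`Γ` of `μ` by the sets of variables that are obtained from the `Γ` of `λ` by moving the root `y` from
its set to the `k`-th one. -/
def Moves {N : ℕ} {mu lam : Fin N → ℕ} (y : Roots lam) (k : Fin N) (e : Roots mu ≃ Roots lam) : Prop :=
  ∀ x, x.1 = if e x = y then k else (e x).1

/-- `f` with its Chern roots substituted by means of `e`, as a rational function. -/
def subst {N n : ℕ} {mu lam : Fin N → ℕ} (e : Roots mu ≃ Roots lam) (f : symLaurent n mu) :
    RatF (Roots lam ⊕ Fin n) :=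
  algebraMap (Laurent (Roots lam ⊕ Fin n)) _
    (rename (Sum.map e id) (f : Laurent (Roots mu ⊕ Fin n)))

/-- `-1/(1 - u/γ)` as a series in `u`, and `(γ/u)/(1 - γ/u)` as a series in `u⁻¹`. -/
def eKer {E : Type*} [Field E] (al : Sgn) (g : E) : PowerSeries E :=
  match al with
  | .plus => -(1 - PowerSeries.C g⁻¹ * PowerSeries.X)⁻¹
  | .minus => PowerSeries.C g * PowerSeries.X * (1 - PowerSeries.C g * PowerSeries.X)⁻¹

/-- `-(u/γ)/(1 - u/γ)` as a series in `u`, and `1/(1 - γ/u)` as a series in `u⁻¹`. -/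
def fKer {E : Type*} [Field E] (al : Sgn) (g : E) : PowerSeries E :=
  match al with
  | .plus => -(PowerSeries.C g⁻¹ * PowerSeries.X * (1 - PowerSeries.C g⁻¹ * PowerSeries.X)⁻¹)
  | .minus => (1 - PowerSeries.C g * PowerSeries.X)⁻¹

/-- The right-hand side of the formula for `E_{p,±}(u)`; `p`, `q` stand for `p`, `p + 1`. -/
def eSum {N n : ℕ} {mu lam : Fin N → ℕ} (al : Sgn) (p q : Fin N)
    (e : Fin (lam p) → (Roots mu ≃ Roots lam)) (f : symLaurent n mu) :
    PowerSeries (RatF (Roots lam ⊕ Fin n)) :=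
  ∑ i, PowerSeries.C (subst (e i) f) * eKer al (gam n lam p i) *
    PowerSeries.C ((∏ j ∈ univ.erase i, 1 / (1 - gam n lam p i / gam n lam p j)) *
      ∏ k, (1 - rh * (gam n lam q k / gam n lam p i)))

/-- The right-hand side of the formula for `F_{p,±}(u)`; `p`, `q` stand for `p`, `p + 1`. -/
def fSum {N n : ℕ} {mu lam : Fin N → ℕ} (al : Sgn) (p q : Fin N)
    (e : Fin (lam q) → (Roots mu ≃ Roots lam)) (f : symLaurent n mu) :
    PowerSeries (RatF (Roots lam ⊕ Fin n)) :=
  ∑ i, PowerSeries.C (subst (e i) f) * fKer al (gam n lam q i) *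
    PowerSeries.C ((∏ j ∈ univ.erase i, 1 / (1 - gam n lam q j / gam n lam q i)) *
      ∏ k, (1 - rh * (gam n lam q i / gam n lam p k)))

end LoopK

end

noncomputable section

namespace LoopK

open Finset Matrix

section LaurentPolynomials

variable {σ τ : Type}

theorem var_mul_single (i : σ) (k : ℤ) :
    (AddMonoidAlgebra.single (Finsupp.single i (k + 1)) 1 : Laurent σ) =
      var i * AddMonoidAlgebra.single (Finsupp.single i k) 1 := by
  rw [var, AddMonoidAlgebra.single_mul_single, one_mul, ← Finsupp.single_add, add_comm]

theorem isUnit_var (i : σ) : IsUnit (var i : Laurent σ) := by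
  refine IsUnit.of_mul_eq_one (AddMonoidAlgebra.single (Finsupp.single i (-1)) 1) ?_
  rw [← var_mul_single]
  simp [AddMonoidAlgebra.one_def]

theorem algHom_ext_var {A : Type*} [Ring A] [Algebra Coef A] {F G : Laurent σ →ₐ[Coef] A}
    (h : ∀ i, F (var i) = G (var i)) : F = G := by
  refine AddMonoidAlgebra.algHom_ext (fun m => ?_) (by ext)
  induction m using Finsupp.induction_linear with
  | zero => rw [← AddMonoidAlgebra.one_def, map_one, map_one]
  | add f g hf hg =>
    have : (AddMonoidAlgebra.single (f + g) 1 : Laurent σ) =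
        AddMonoidAlgebra.single f 1 * AddMonoidAlgebra.single g 1 := by
      rw [AddMonoidAlgebra.single_mul_single, one_mul]
    rw [this, map_mul, map_mul, hf, hg]
  | single i k =>
    induction k using Int.induction_on with
    | zero => rw [Finsupp.single_zero, ← AddMonoidAlgebra.one_def, map_one, map_one]
    | succ k ih => rw [var_mul_single, map_mul, map_mul, h, ih]
    | pred k ih =>
      have h2 := var_mul_single i (-(k : ℤ) - 1)
      rw [sub_add_cancel] at h2
      rw [h2, map_mul, map_mul, h] at ih
      exact ((isUnit_var i).map G).mul_left_cancel ih

/-- Evaluation of Laurent polynomials at units. -/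
def evalUnits {A : Type*} [CommRing A] [Algebra Coef A] (u : σ → Aˣ) : Laurent σ →ₐ[Coef] A :=
  AddMonoidAlgebra.lift Coef A (σ →₀ ℤ)
    ((Units.coeHom A).comp (AddMonoidHom.toMultiplicativeLeft
      (Finsupp.liftAddHom fun i => zmultiplesHom (Additive Aˣ) (Additive.ofMul (u i)))))

theorem evalUnits_var {A : Type*} [CommRing A] [Algebra Coef A] (u : σ → Aˣ) (i : σ) :
    evalUnits u (var i) = u i := by
  simp [evalUnits, var]

theorem rename_var (g : σ → τ) (i : σ) : rename g (var i) = var (g i) := by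
  simp [rename, var, AddMonoidAlgebra.mapDomainAlgHom]

theorem rename_id (f : Laurent σ) : rename id f = f := by
  have : rename (id : σ → σ) = AlgHom.id Coef (Laurent σ) :=
    algHom_ext_var fun i => by rw [rename_var]; rfl
  rw [this]; rfl

theorem var_comb_eq_zero {i j : σ} {c d : Coef}
    (h : algebraMap Coef (Laurent σ) c * var i - algebraMap Coef (Laurent σ) d * var j = 0) :
    (i = j ∧ c = d) ∨ (c = 0 ∧ d = 0) := by
  classical
  have h1 : c • var i = d • (var j : Laurent σ) := by
    rw [Algebra.smul_def, Algebra.smul_def]; exact sub_eq_zero.1 h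
  have h2 : (AddMonoidAlgebra.single (Finsupp.single i 1) c : Laurent σ) =
      AddMonoidAlgebra.single (Finsupp.single j 1) d := by
    simpa [var] using h1
  by_cases hij : i = j
  · subst hij
    left
    have e1 := congrArg (fun x => x.coeff (Finsupp.single i (1 : ℤ))) h2
    exact ⟨rfl, by simpa using e1⟩
  · right
    have e1 := congrArg (fun x => x.coeff (Finsupp.single i (1 : ℤ))) h2
    have e2 := congrArg (fun x => x.coeff (Finsupp.single j (1 : ℤ))) h2
    have hne : Finsupp.single i (1 : ℤ) ≠ Finsupp.single j 1 := fun hh =>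
      hij (Finsupp.single_left_injective (by norm_num) hh)
    simp [hne, hne.symm] at e1 e2
    exact ⟨e1, e2.symm⟩

/-- The Laurent polynomial `x_a - c x_b`. -/
def binom (a b : σ) (c : Coef) : Laurent σ := var a - algebraMap Coef _ c * var b

theorem binom_ne_zero {a b : σ} {c : Coef} (h : a ≠ b ∨ c ≠ 1) : binom a b c ≠ 0 := by
  intro h0
  have : algebraMap Coef (Laurent σ) 1 * var a - algebraMap Coef _ c * var b = 0 := by
    rw [map_one, one_mul]; exact h0
  rcases var_comb_eq_zero this with ⟨h1, h2⟩ | ⟨h1, -⟩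
  · rcases h with h | h
    · exact h h1
    · exact h h2.symm
  · exact one_ne_zero h1

theorem rename_binom (g : σ → τ) (a b : σ) (c : Coef) :
    rename g (binom a b c) = binom (g a) (g b) c := by
  rw [binom, map_sub, map_mul, rename_var, rename_var, AlgHom.commutes, binom]

open Classical in
/-- The specialization `x_a ↦ c x_b`. -/
def special (a b : σ) (c : Coefˣ) : Laurent σ →ₐ[Coef] Laurent σ :=
  evalUnits fun i => if i = a then
    Units.map (algebraMap Coef (Laurent σ)).toMonoidHom c * (isUnit_var b).unit
    else (isUnit_var i).unit

theorem special_self (a b : σ) (c : Coefˣ) :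
    special a b c (var a) = algebraMap Coef _ (c : Coef) * var b := by
  rw [special, evalUnits_var, if_pos rfl]; rfl

theorem special_other {a b i : σ} (c : Coefˣ) (h : i ≠ a) : special a b c (var i) = var i := by
  rw [special, evalUnits_var, if_neg h]; rfl

theorem binom_dvd_sub_special (a b : σ) (c : Coefˣ) (f : Laurent σ) :
    binom a b (c : Coef) ∣ f - special a b c f := by
  have : (Ideal.Quotient.mkₐ Coef (Ideal.span {binom a b (c : Coef)})).comp (special a b c) =
      Ideal.Quotient.mkₐ Coef (Ideal.span {binom a b (c : Coef)}) := by
    apply algHom_ext_var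
    intro i
    by_cases h : i = a
    · subst h
      rw [AlgHom.comp_apply, special_self]
      refine ((Ideal.Quotient.mk_eq_mk_iff_sub_mem _ _).2 ?_).symm
      exact Ideal.mem_span_singleton_self _
    · rw [AlgHom.comp_apply, special_other c h]
  have h := congrArg (fun F => F f) this
  exact Ideal.mem_span_singleton.1 ((Ideal.Quotient.mk_eq_mk_iff_sub_mem _ _).1 h.symm)

theorem special_binom {a b : σ} (c : Coefˣ) (hab : a ≠ b) :
    special a b c (binom a b (c : Coef)) = 0 := by
  rw [binom, map_sub, map_mul, AlgHom.commutes, special_self, special_other c hab.symm, sub_self]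

theorem binom_dvd_iff {a b : σ} (c : Coefˣ) (hab : a ≠ b) (f : Laurent σ) :
    binom a b (c : Coef) ∣ f ↔ special a b c f = 0 := by
  constructor
  · rintro ⟨g, rfl⟩
    rw [map_mul, special_binom c hab, zero_mul]
  · intro h
    have := binom_dvd_sub_special a b c f
    rwa [h, sub_zero] at this

theorem prime_binom {a b : σ} (c : Coefˣ) (hab : a ≠ b) : Prime (binom a b (c : Coef)) := by
  refine ⟨binom_ne_zero (Or.inl hab), fun hu => ?_, fun f g h => ?_⟩
  · have := (hu.map (special a b c)).ne_zero
    exact this (special_binom c hab)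
  · rw [binom_dvd_iff c hab] at h ⊢
    rw [binom_dvd_iff c hab, ← mul_eq_zero, ← map_mul, h]

/-- The variables in a binomial divisible by `x_a - c x_b` are `x_a` and `x_b`. -/
theorem eq_of_binom_dvd {a b i j : σ} {c : Coefˣ} (hab : a ≠ b) {d : Coef} (hd : d ≠ 0)
    (h : binom a b (c : Coef) ∣ binom i j d) (hij : i ≠ j) :
    (i = a ∧ j = b ∧ d = c) ∨ (i = b ∧ j = a ∧ d * c = 1) := by
  rw [binom_dvd_iff c hab, binom, map_sub, map_mul, AlgHom.commutes] at h
  by_cases h1 : i = a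
  · subst h1
    rw [special_self, special_other c hij.symm] at h
    rcases var_comb_eq_zero h with ⟨e1, e2⟩ | ⟨e1, e2⟩
    · exact Or.inl ⟨rfl, e1.symm, e2.symm⟩
    · exact absurd e2 hd
  · rw [special_other c h1] at h
    by_cases h2 : j = a
    · subst h2
      rw [special_self, ← mul_assoc, ← map_mul, ← one_mul (var i), ← map_one (algebraMap Coef _)] at h
      rcases var_comb_eq_zero h with ⟨e1, e2⟩ | ⟨e1, e2⟩
      · exact Or.inr ⟨e1, rfl, e2.symm⟩
      · exact absurd e1 one_ne_zero
    · rw [special_other c h2, ← one_mul (var i), ← map_one (algebraMap Coef _)] at h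
      rcases var_comb_eq_zero h with ⟨e1, e2⟩ | ⟨e1, e2⟩
      · exact absurd e1 hij
      · exact absurd e2 hd

end LaurentPolynomials

/-! ### Regular rational functions -/

section Regular

variable {σ : Type}

theorem algebraMap_ratF_ne_zero {d : Laurent σ} (hd : d ≠ 0) : algebraMap (Laurent σ) (RatF σ) d ≠ 0 :=
  fun h => hd ((IsFractionRing.injective (Laurent σ) (RatF σ)) (h.trans (map_zero _).symm))

/-- The rational functions that are regular at the generic point of the divisor of a prime `q`. -/
def Reg {q : Laurent σ} (hq : Prime q) : Subring (RatF σ) where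
  carrier := {x | ∃ n d : Laurent σ, ¬ q ∣ d ∧ x * algebraMap _ (RatF σ) d = algebraMap _ (RatF σ) n}
  zero_mem' := ⟨0, 1, fun h => hq.not_isUnit (isUnit_of_dvd_one h), by simp⟩
  one_mem' := ⟨1, 1, fun h => hq.not_isUnit (isUnit_of_dvd_one h), by simp⟩
  neg_mem' := by
    rintro x ⟨n, d, hd, h⟩
    exact ⟨-n, d, hd, by rw [neg_mul, h, map_neg]⟩
  add_mem' := by
    rintro x y ⟨n, d, hd, h⟩ ⟨n', d', hd', h'⟩
    refine ⟨n * d' + n' * d, d * d', fun hh => (hq.dvd_or_dvd hh).elim hd hd', ?_⟩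
    rw [map_add, map_mul, map_mul, map_mul, ← h, ← h']
    ring
  mul_mem' := by
    rintro x y ⟨n, d, hd, h⟩ ⟨n', d', hd', h'⟩
    refine ⟨n * n', d * d', fun hh => (hq.dvd_or_dvd hh).elim hd hd', ?_⟩
    rw [map_mul, map_mul, ← h, ← h']
    ring

theorem algebraMap_mem_Reg {q : Laurent σ} (hq : Prime q) (f : Laurent σ) :
    algebraMap _ (RatF σ) f ∈ Reg hq :=
  ⟨f, 1, fun h => hq.not_isUnit (isUnit_of_dvd_one h), by simp⟩

theorem inv_mem_Reg {q : Laurent σ} (hq : Prime q) {d : Laurent σ} (hd : ¬ q ∣ d) :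
    (algebraMap _ (RatF σ) d)⁻¹ ∈ Reg hq :=
  ⟨1, d, hd, by
    rw [map_one, inv_mul_cancel₀ (algebraMap_ratF_ne_zero fun h => hd (by rw [h]; exact dvd_zero q))]⟩

/-- The Laurent polynomials, as a subring of the field of rational functions. -/
def laurentRange (σ : Type) : Subring (RatF σ) := (algebraMap (Laurent σ) (RatF σ)).range

theorem mem_laurentRange_of_prod {ι : Type*} (s : Finset ι) (q : ι → Laurent σ)
    (hq : ∀ i ∈ s, Prime (q i)) {x : RatF σ}
    (hx : x * algebraMap _ (RatF σ) (∏ i ∈ s, q i) ∈ laurentRange σ)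
    (hr : ∀ i (hi : i ∈ s), x ∈ Reg (hq i hi)) : x ∈ laurentRange σ := by
  classical
  induction s using Finset.induction_on with
  | empty => simpa using hx
  | insert i s hi ih =>
    refine ih (fun j hj => hq j (mem_insert_of_mem hj)) ?_
      (fun j hj => hr j (mem_insert_of_mem hj))
    rw [prod_insert hi, map_mul] at hx
    obtain ⟨a, ha⟩ := hx
    have hqi := hq i (mem_insert_self i s)
    obtain ⟨n, d, hd, hnd⟩ := mul_mem (hr i (mem_insert_self i s))
      (algebraMap_mem_Reg hqi (∏ i ∈ s, q i))
    have h1 : a * d = n * q i := by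
      apply IsFractionRing.injective (Laurent σ) (RatF σ)
      rw [map_mul, map_mul, ha, ← hnd]
      ring
    obtain ⟨b, hb⟩ := (hqi.dvd_or_dvd (h1 ▸ dvd_mul_left (q i) n)).resolve_right hd
    refine ⟨b, ?_⟩
    have h2 : algebraMap _ (RatF σ) (q i) ≠ 0 := algebraMap_ratF_ne_zero hqi.ne_zero
    apply mul_left_cancel₀ h2
    rw [← map_mul, ← hb, ha]
    ring

end Regular

/-! ### Permutations of the variables -/

section Permute

variable {σ : Type}

theorem permute_algebraMap (π : Equiv.Perm σ) (f : Laurent σ) :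
    permute π (algebraMap _ (RatF σ) f) = algebraMap _ (RatF σ) (rename π f) := by
  rw [permute]
  exact IsLocalization.map_eq _ _

theorem permute_rvar (π : Equiv.Perm σ) (i : σ) : permute π (rvar i) = rvar (π i) := by
  rw [rvar, permute_algebraMap, rename_var, rvar]

theorem permute_coef (π : Equiv.Perm σ) (c : Coef) :
    permute π (algebraMap Coef (RatF σ) c) = algebraMap Coef (RatF σ) c := by
  rw [IsScalarTower.algebraMap_apply Coef (Laurent σ) (RatF σ), permute_algebraMap, AlgHom.commutes]

theorem permute_rh (π : Equiv.Perm σ) : permute π (rh : RatF σ) = rh := permute_coef π hh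

theorem ringHom_ext_ratF {A : Type*} [Field A] {F G : RatF σ →+* A}
    (h : ∀ f, F (algebraMap (Laurent σ) _ f) = G (algebraMap (Laurent σ) _ f)) : F = G :=
  IsLocalization.ringHom_ext (nonZeroDivisors (Laurent σ)) (RingHom.ext h)

theorem permute_permute (π ρ : Equiv.Perm σ) (x : RatF σ) :
    permute π (permute ρ x) = permute (π * ρ) x := by
  have : (permute π).comp (permute ρ) = permute (π * ρ) := by
    apply ringHom_ext_ratF
    intro f
    rw [RingHom.comp_apply, permute_algebraMap, permute_algebraMap, permute_algebraMap,
      rename_rename]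
    rfl
  exact congrArg (fun F => F x) this

theorem permute_one (x : RatF σ) : permute 1 x = x := by
  have : permute (1 : Equiv.Perm σ) = RingHom.id (RatF σ) := by
    apply ringHom_ext_ratF
    intro f
    rw [permute_algebraMap]
    exact congrArg _ (rename_id f)
  exact congrArg (fun F => F x) this

theorem rvar_ne_zero (i : σ) : (rvar i : RatF σ) ≠ 0 :=
  algebraMap_ratF_ne_zero (isUnit_var i).ne_zero

theorem algebraMap_binom (a b : σ) (c : Coef) :
    algebraMap _ (RatF σ) (binom a b c) = rvar a - algebraMap Coef _ c * rvar b := by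
  rw [binom, map_sub, map_mul, ← IsScalarTower.algebraMap_apply, rvar, rvar]

theorem hh_ne_zero : hh ≠ 0 := RatFunc.X_ne_zero

theorem hh_ne_one : hh ≠ 1 := by
  intro h
  have h1 : (algebraMap (Polynomial ℂ) Coef) Polynomial.X = algebraMap (Polynomial ℂ) Coef 1 := by
    rw [RatFunc.algebraMap_X, map_one]; exact h
  exact Polynomial.X_ne_C (1 : ℂ) (by simpa using RatFunc.algebraMap_injective ℂ h1)

theorem hh_mul_hh_ne_one : hh * hh ≠ 1 := by
  intro h
  rcases mul_self_eq_one_iff.1 h with h | h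
  · exact hh_ne_one h
  · have h1 : (algebraMap (Polynomial ℂ) Coef) Polynomial.X = algebraMap (Polynomial ℂ) Coef (-1) := by
      rw [RatFunc.algebraMap_X, map_neg, map_one]; exact h
    exact Polynomial.X_ne_C (-1 : ℂ) (by simpa using RatFunc.algebraMap_injective ℂ h1)

theorem rh_ne_zero : (rh : RatF σ) ≠ 0 := by
  rw [rh, Ne, map_eq_zero_iff _ (FaithfulSMul.algebraMap_injective Coef (RatF σ))]
  exact hh_ne_zero

theorem one_sub_rh_ne_zero : (1 - rh : RatF σ) ≠ 0 := by
  rw [rh, ← map_one (algebraMap Coef (RatF σ)), ← map_sub, Ne,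
    map_eq_zero_iff _ (FaithfulSMul.algebraMap_injective Coef (RatF σ)), sub_eq_zero]
  exact hh_ne_one.symm

theorem rvar_sub_rh_mul_ne_zero (a b : σ) : rvar a - rh * rvar b ≠ (0 : RatF σ) := by
  rw [rh, ← algebraMap_binom]
  exact algebraMap_ratF_ne_zero (binom_ne_zero (Or.inr hh_ne_one))

theorem rvar_sub_ne_zero {a b : σ} (h : a ≠ b) : rvar a - rvar b ≠ (0 : RatF σ) := by
  have := algebraMap_binom a b 1
  rw [map_one, one_mul] at this
  rw [← this]
  exact algebraMap_ratF_ne_zero (binom_ne_zero (Or.inl h))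

theorem permute_mem_Reg {q q' : Laurent σ} (hq : Prime q) (hq' : Prime q') (π : Equiv.Perm σ)
    (h : rename π q ∣ q') {x : RatF σ} (hx : x ∈ Reg hq) : permute π x ∈ Reg hq' := by
  obtain ⟨n, d, hd, hnd⟩ := hx
  refine ⟨rename π n, rename π d, fun hh => hd ?_, ?_⟩
  · have := map_dvd (rename (π⁻¹ : Equiv.Perm σ)) (h.trans hh)
    rw [rename_rename, rename_rename] at this
    have e : ((π⁻¹ : Equiv.Perm σ) : σ → σ) ∘ π = id := by ext; simp
    rwa [e, rename_id, rename_id] at this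
  · rw [← permute_algebraMap, ← map_mul, hnd, permute_algebraMap]

variable [DecidableEq σ]

theorem special_swap (a b : σ) (f : Laurent σ) :
    special a b 1 (rename (Equiv.swap a b) f) = special a b 1 f := by
  have : (special a b 1).comp (rename (Equiv.swap a b)) = special a b 1 := by
    apply algHom_ext_var
    intro i
    rw [AlgHom.comp_apply, rename_var]
    by_cases hab : a = b
    · subst hab; simp
    by_cases h1 : i = a
    · subst h1
      rw [Equiv.swap_apply_left, special_self, special_other 1 (Ne.symm hab), Units.val_one, map_one,
        one_mul]
    · by_cases h2 : i = b
      · subst h2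
        rw [Equiv.swap_apply_right, special_self, special_other 1 h1, Units.val_one, map_one, one_mul]
      · rw [Equiv.swap_apply_of_ne_of_ne h1 h2]
  exact congrArg (fun F => F f) this

theorem binom_dvd_swap_sub {a b : σ} (hab : a ≠ b) (f : Laurent σ) :
    binom a b ((1 : Coefˣ) : Coef) ∣ rename (Equiv.swap a b) f - f := by
  rw [binom_dvd_iff 1 hab, map_sub, special_swap, sub_self]

/-- A rational function with at most a simple pole at `x_a = x_b` that is invariant modulo regular
functions under the exchange of `x_a` and `x_b` is regular there. -/
theorem mem_Reg_of_swap {a b : σ} (hab : a ≠ b) {y : RatF σ}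
    (h1 : algebraMap _ (RatF σ) (binom a b ((1 : Coefˣ) : Coef)) * y ∈ Reg (prime_binom 1 hab))
    (h2 : y - permute (Equiv.swap a b) y ∈ Reg (prime_binom 1 hab)) :
    y ∈ Reg (prime_binom 1 hab) := by
  set q : Laurent σ := binom a b ((1 : Coefˣ) : Coef) with hq
  have hp : Prime q := prime_binom 1 hab
  have hq0 : algebraMap _ (RatF σ) q ≠ 0 := algebraMap_ratF_ne_zero hp.ne_zero
  have hsq : rename (Equiv.swap a b) q = -q := by
    rw [hq, rename_binom, Equiv.swap_apply_left, Equiv.swap_apply_right, binom, binom, Units.val_one,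
      map_one, one_mul, one_mul, neg_sub]
  obtain ⟨n, d, hd, hnd⟩ := h1
  have hsd : ¬ q ∣ rename (Equiv.swap a b) d := fun hh =>
    hd (by have := dvd_sub hh (binom_dvd_swap_sub hab d); rwa [sub_sub_cancel] at this)
  obtain ⟨m, hm⟩ := binom_dvd_swap_sub hab n
  obtain ⟨e, he⟩ := binom_dvd_swap_sub hab d
  have hr : algebraMap _ (RatF σ) d ≠ 0 :=
    algebraMap_ratF_ne_zero fun h => hd (by rw [h]; exact dvd_zero q)
  have hr' : algebraMap _ (RatF σ) (rename (Equiv.swap a b) d) ≠ 0 :=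
    algebraMap_ratF_ne_zero fun h => hsd (by rw [h]; exact dvd_zero q)
  have hs : -(algebraMap _ (RatF σ) q * permute (Equiv.swap a b) y) *
      algebraMap _ (RatF σ) (rename (Equiv.swap a b) d) =
        algebraMap _ (RatF σ) (rename (Equiv.swap a b) n) := by
    rw [← permute_algebraMap, ← permute_algebraMap, ← hnd, map_mul, map_mul, permute_algebraMap _ q,
      hsq, map_neg]
    ring
  have key : algebraMap _ (RatF σ) q *
      (-y - permute (Equiv.swap a b) y) = algebraMap _ (RatF σ) q * (algebraMap _ (RatF σ) (m * d - n * e) *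
        ((algebraMap _ (RatF σ) d)⁻¹ * (algebraMap _ (RatF σ) (rename (Equiv.swap a b) d))⁻¹)) := by
    have e1 : rename (Equiv.swap a b) n = n + q * m := by rw [← hm]; ring
    have e2 : rename (Equiv.swap a b) d = d + q * e := by rw [← he]; ring
    have e3 : algebraMap _ (RatF σ) q * algebraMap _ (RatF σ) (m * d - n * e) =
        algebraMap _ (RatF σ) (rename (Equiv.swap a b) n) * algebraMap _ (RatF σ) d -
          algebraMap _ (RatF σ) n * algebraMap _ (RatF σ) (rename (Equiv.swap a b) d) := by
      rw [← map_mul, ← map_mul, ← map_mul, ← map_sub, e1, e2]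
      congr 1
      ring
    rw [← mul_assoc, e3, ← hs, ← hnd]
    field_simp
    ring
  have key2 := mul_left_cancel₀ hq0 key
  have h3 : -y - permute (Equiv.swap a b) y ∈ Reg hp := by
    rw [key2]
    exact mul_mem (algebraMap_mem_Reg hp _) (mul_mem (inv_mem_Reg hp hd) (inv_mem_Reg hp hsd))
  have h4 := sub_mem h2 h3
  have h5 : y = algebraMap (Laurent σ) (RatF σ) (algebraMap Coef (Laurent σ) (2⁻¹)) *
      (y - permute (Equiv.swap a b) y - (-y - permute (Equiv.swap a b) y)) := by
    rw [← IsScalarTower.algebraMap_apply, map_inv₀, map_ofNat]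
    have : (2 : RatF σ) ≠ 0 := by
      rw [← map_ofNat (algebraMap Coef (RatF σ)) 2]
      exact (map_ne_zero_iff _ (FaithfulSMul.algebraMap_injective Coef (RatF σ))).2 two_ne_zero
    field_simp
    ring
  rw [h5]
  exact mul_mem (algebraMap_mem_Reg hp _) h4

end Permute

end LoopK

end

noncomputable section

namespace LoopK

open Finset Matrix

/-! ### R-matrices as operators on functions of a multi-index -/

section Rop

variable {E : Type*} [CommRing E] {N : ℕ}

/-- The diagonal weights of the homogeneous R-matrix. -/
def wa (h s t : E) (a b : Fin N) : E :=
  if a = b then s - h * t else if a < b then s - t else h * (s - t)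

/-- The exchange weights of the homogeneous R-matrix. -/
def wb (h s t : E) (a b : Fin N) : E :=
  if a = b then 0 else if a < b then (1 - h) * s else (1 - h) * t

theorem wa_self (h s t : E) (a : Fin N) : wa h s t a a = s - h * t := if_pos rfl
theorem wb_self (h s t : E) (a : Fin N) : wb h s t a a = 0 := if_pos rfl

theorem wa_lt (h s t : E) {a b : Fin N} (hab : a < b) : wa h s t a b = s - t := by
  rw [wa, if_neg hab.ne, if_pos hab]
theorem wa_gt (h s t : E) {a b : Fin N} (hab : b < a) : wa h s t a b = h * (s - t) := by
  rw [wa, if_neg hab.ne', if_neg hab.not_gt]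
theorem wb_lt (h s t : E) {a b : Fin N} (hab : a < b) : wb h s t a b = (1 - h) * s := by
  rw [wb, if_neg hab.ne, if_pos hab]
theorem wb_gt (h s t : E) {a b : Fin N} (hab : b < a) : wb h s t a b = (1 - h) * t := by
  rw [wb, if_neg hab.ne', if_neg hab.not_gt]

theorem wa_smul (h s t c : E) (a b : Fin N) : wa h (c * s) (c * t) a b = c * wa h s t a b := by
  unfold wa; split_ifs <;> ring
theorem wb_smul (h s t c : E) (a b : Fin N) : wb h (c * s) (c * t) a b = c * wb h s t a b := by
  unfold wb; split_ifs <;> ring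

theorem map_wa {F : Type*} [CommRing F] (φ : E →+* F) (h s t : E) (a b : Fin N) :
    φ (wa h s t a b) = wa (φ h) (φ s) (φ t) a b := by
  unfold wa; split_ifs <;> simp
theorem map_wb {F : Type*} [CommRing F] (φ : E →+* F) (h s t : E) (a b : Fin N) :
    φ (wb h s t a b) = wb (φ h) (φ s) (φ t) a b := by
  unfold wb; split_ifs <;> simp

variable {ι κ : Type*} [DecidableEq ι] [DecidableEq κ]

/-- The homogeneous R-matrix acting on the tensor factors `i` and `j`. -/
def Rop (h s t : E) (i j : ι) : Module.End E ((ι → Fin N) → E) where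
  toFun f I := wa h s t (I i) (I j) * f I + wb h s t (I i) (I j) * f (I ∘ Equiv.swap i j)
  map_add' f g := by ext I; simp only [Pi.add_apply]; ring
  map_smul' c f := by ext I; simp only [Pi.smul_apply, smul_eq_mul, RingHom.id_apply]; ring

theorem Rop_apply (h s t : E) (i j : ι) (f : (ι → Fin N) → E) (I : ι → Fin N) :
    Rop h s t i j f I =
      wa h s t (I i) (I j) * f I + wb h s t (I i) (I j) * f (I ∘ Equiv.swap i j) := rfl

theorem Rop_smul (h s t c : E) (i j : ι) :
    (Rop h (c * s) (c * t) i j : Module.End E ((ι → Fin N) → E)) = c • Rop h s t i j := by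
  ext f I
  simp only [Rop_apply, wa_smul, wb_smul, LinearMap.smul_apply, Pi.smul_apply, smul_eq_mul]
  ring

/-- The R-matrix followed by the permutation of the factors. -/
def Rch (h x y : E) (i j : ι) : Module.End E ((ι → Fin N) → E) where
  toFun f I := Rop h y x i j f (I ∘ Equiv.swap i j)
  map_add' f g := by ext I; rw [map_add]; rfl
  map_smul' c f := by ext I; rw [map_smul]; rfl

theorem Rch_apply (h x y : E) (i j : ι) (f : (ι → Fin N) → E) (I : ι → Fin N) :
    Rch h x y i j f I =
      wa h y x (I j) (I i) * f (I ∘ Equiv.swap i j) + wb h y x (I j) (I i) * f I := by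
  change Rop h y x i j f (I ∘ Equiv.swap i j) = _
  rw [Rop_apply]
  have : (I ∘ Equiv.swap i j) ∘ Equiv.swap i j = I := by ext; simp
  rw [this]
  simp

/-- The restriction of a function of a multi-index to the indices in the range of `e`. -/
def resAt (e : κ → ι) (I₀ : ι → Fin N) (f : (ι → Fin N) → E) : (κ → Fin N) → E :=
  fun K => f (Function.extend e K I₀)

theorem extend_swap {e : κ → ι} (he : Function.Injective e) (K : κ → Fin N) (I₀ : ι → Fin N)
    (i j : κ) : Function.extend e K I₀ ∘ Equiv.swap (e i) (e j) =
      Function.extend e (K ∘ Equiv.swap i j) I₀ := by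
  ext x
  congr 1
  by_cases hx : ∃ k, e k = x
  · obtain ⟨k, rfl⟩ := hx
    rw [he.extend_apply, Function.comp_apply, ← he.map_swap, he.extend_apply, Function.comp_apply]
  · rw [Function.extend_apply' _ _ _ hx, Function.comp_apply, Equiv.swap_apply_of_ne_of_ne,
      Function.extend_apply' _ _ _ hx]
    · rintro rfl; exact hx ⟨_, rfl⟩
    · rintro rfl; exact hx ⟨_, rfl⟩

theorem resAt_Rop {e : κ → ι} (he : Function.Injective e) (I₀ : ι → Fin N) (h s t : E) (i j : κ)
    (f : (ι → Fin N) → E) :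
    resAt e I₀ (Rop h s t (e i) (e j) f) = Rop h s t i j (resAt e I₀ f) := by
  ext K
  simp only [resAt, Rop_apply, he.extend_apply, extend_swap he]

theorem resAt_Rch {e : κ → ι} (he : Function.Injective e) (I₀ : ι → Fin N) (h s t : E) (i j : κ)
    (f : (ι → Fin N) → E) :
    resAt e I₀ (Rch h s t (e i) (e j) f) = Rch h s t i j (resAt e I₀ f) := by
  ext K
  simp only [resAt, Rch_apply, he.extend_apply, extend_swap he]

omit [DecidableEq ι] [DecidableEq κ] in
theorem extend_comp_self (e : κ → ι) (I : ι → Fin N) :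
    Function.extend e (I ∘ e) I = I := by
  classical
  ext x
  simp only [Function.extend]
  split_ifs with h
  · rw [Function.comp_apply, h.choose_spec]
  · rfl

omit [DecidableEq ι] [DecidableEq κ] [CommRing E] in
theorem ext_resAt (e : κ → ι) {f g : (ι → Fin N) → E} (h : ∀ I₀, resAt e I₀ f = resAt e I₀ g) :
    f = g := by
  ext I
  have := congrFun (h I) (I ∘ e)
  simpa only [resAt, extend_comp_self] using this

theorem swap01 (a b c : Fin N) : ![a, b, c] ∘ Equiv.swap (0 : Fin 3) 1 = ![b, a, c] := by
  ext x; fin_cases x <;> rfl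
theorem swap02 (a b c : Fin N) : ![a, b, c] ∘ Equiv.swap (0 : Fin 3) 2 = ![c, b, a] := by
  ext x; fin_cases x <;> rfl
theorem swap12 (a b c : Fin N) : ![a, b, c] ∘ Equiv.swap (1 : Fin 3) 2 = ![a, c, b] := by
  ext x; fin_cases x <;> rfl

theorem vec3_eta (K : Fin 3 → Fin N) : K = ![K 0, K 1, K 2] := by
  ext x; fin_cases x <;> rfl

omit [DecidableEq ι] in
theorem injective_vec3 {i j k : ι} (hij : i ≠ j) (hik : i ≠ k) (hjk : j ≠ k) :
    Function.Injective ![i, j, k] := by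
  intro x y
  fin_cases x <;> fin_cases y <;> simp [hij, hik, hjk, hij.symm, hik.symm, hjk.symm]

theorem yang_baxter (h x y z : E) {i j k : ι} (hij : i ≠ j) (hik : i ≠ k) (hjk : j ≠ k) :
    (Rop h x y i j * Rop h x z i k * Rop h y z j k : Module.End E ((ι → Fin N) → E)) =
      Rop h y z j k * Rop h x z i k * Rop h x y i j := by
  ext1 f
  apply ext_resAt ![i, j, k]
  intro I₀
  have he := injective_vec3 hij hik hjk
  have r01 := fun s t => resAt_Rop (E := E) he I₀ h s t 0 1
  have r02 := fun s t => resAt_Rop (E := E) he I₀ h s t 0 2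
  have r12 := fun s t => resAt_Rop (E := E) he I₀ h s t 1 2
  simp only [Matrix.cons_val] at r01 r02 r12
  simp only [Module.End.mul_apply, r01, r02, r12]
  generalize resAt ![i, j, k] I₀ f = g
  ext K
  rw [vec3_eta K]
  generalize K 0 = a, K 1 = b, K 2 = c
  simp only [Rop_apply, swap01, swap02, swap12, Matrix.cons_val]
  rcases lt_trichotomy a b with h1 | h1 | h1 <;> rcases lt_trichotomy b c with h2 | h2 | h2 <;>
    rcases lt_trichotomy a c with h3 | h3 | h3 <;> (try subst h1) <;> (try subst h2) <;>
    (try subst h3) <;> (try (exfalso; omega)) <;>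
    (simp only [wa_self, wb_self, wa_lt, wa_gt, wb_lt, wb_gt, *]; ring)

theorem braid_Rch (h x y z : E) {i j k : ι} (hij : i ≠ j) (hik : i ≠ k) (hjk : j ≠ k) :
    (Rch h x y i j * Rch h x z j k * Rch h y z i j : Module.End E ((ι → Fin N) → E)) =
      Rch h y z j k * Rch h x z i j * Rch h x y j k := by
  ext1 f
  apply ext_resAt ![i, j, k]
  intro I₀
  have he := injective_vec3 hij hik hjk
  have r01 := fun s t => resAt_Rch (E := E) he I₀ h s t 0 1
  have r12 := fun s t => resAt_Rch (E := E) he I₀ h s t 1 2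
  simp only [Matrix.cons_val] at r01 r12
  simp only [Module.End.mul_apply, r01, r12]
  generalize resAt ![i, j, k] I₀ f = g
  ext K
  rw [vec3_eta K]
  generalize K 0 = a, K 1 = b, K 2 = c
  simp only [Rch_apply, swap01, swap12, Matrix.cons_val]
  rcases lt_trichotomy a b with h1 | h1 | h1 <;> rcases lt_trichotomy b c with h2 | h2 | h2 <;>
    rcases lt_trichotomy a c with h3 | h3 | h3 <;> (try subst h1) <;> (try subst h2) <;>
    (try subst h3) <;> (try (exfalso; omega)) <;>
    (simp only [wa_self, wb_self, wa_lt, wa_gt, wb_lt, wb_gt, *]; ring)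

theorem intertwine_Rch (h u x y : E) {i j k : ι} (hij : i ≠ j) (hik : i ≠ k) (hjk : j ≠ k) :
    (Rop h u y i k * Rop h u x i j * Rch h x y j k : Module.End E ((ι → Fin N) → E)) =
      Rch h x y j k * Rop h u x i k * Rop h u y i j := by
  ext1 f
  apply ext_resAt ![i, j, k]
  intro I₀
  have he := injective_vec3 hij hik hjk
  have r01 := fun s t => resAt_Rop (E := E) he I₀ h s t 0 1
  have r02 := fun s t => resAt_Rop (E := E) he I₀ h s t 0 2
  have r12 := fun s t => resAt_Rch (E := E) he I₀ h s t 1 2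
  simp only [Matrix.cons_val] at r01 r02 r12
  simp only [Module.End.mul_apply, r01, r02, r12]
  generalize resAt ![i, j, k] I₀ f = g
  ext K
  rw [vec3_eta K]
  generalize K 0 = a, K 1 = b, K 2 = c
  simp only [Rop_apply, Rch_apply, swap01, swap02, swap12, Matrix.cons_val]
  rcases lt_trichotomy a b with h1 | h1 | h1 <;> rcases lt_trichotomy b c with h2 | h2 | h2 <;>
    rcases lt_trichotomy a c with h3 | h3 | h3 <;> (try subst h1) <;> (try subst h2) <;>
    (try subst h3) <;> (try (exfalso; omega)) <;>
    (simp only [wa_self, wb_self, wa_lt, wa_gt, wb_lt, wb_gt, *]; ring)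

/-- Functions that are antisymmetric in the indices `i` and `j`. -/
def Anti (i j : ι) (f : (ι → Fin N) → E) : Prop :=
  (∀ I, f (I ∘ Equiv.swap i j) = -f I) ∧ ∀ I, I i = I j → f I = 0

/-- The fusion identity. -/
theorem anti_fusion (h s t s' t' : E) (hst : h * s * t' = s' * t) {i j k : ι} (hij : i ≠ j)
    (hik : i ≠ k) (hjk : j ≠ k) {f : (ι → Fin N) → E} (hf : Anti i j f) :
    Anti i j (Rop h s t i k (Rop h s' t' j k f)) := by
  have he := injective_vec3 hij hik hjk
  have key : ∀ I₀ : ι → Fin N,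
      Anti (0 : Fin 3) 1 (Rop h s t 0 2 (Rop h s' t' 1 2 (resAt ![i, j, k] I₀ f))) := by
    intro I₀
    have hg : Anti (0 : Fin 3) 1 (resAt ![i, j, k] I₀ f) := by
      refine ⟨fun K => ?_, fun K hK => ?_⟩
      · rw [resAt, ← extend_swap he]
        exact hf.1 _
      · apply hf.2
        have e0 := he.extend_apply K I₀ 0
        have e1 := he.extend_apply K I₀ 1
        simp only [Matrix.cons_val] at e0 e1
        rw [e0, e1, hK]
    generalize resAt ![i, j, k] I₀ f = g at hg
    have h1 : ∀ a b c, g ![b, a, c] = -g ![a, b, c] := fun a b c => by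
      rw [← swap01]; exact hg.1 _
    have h2 : ∀ a c, g ![a, a, c] = 0 := fun a c => hg.2 _ rfl
    constructor
    · intro K
      rw [vec3_eta K]
      generalize K 0 = a, K 1 = b, K 2 = c
      simp only [Rop_apply, swap01, swap02, swap12, Matrix.cons_val]
      rcases lt_trichotomy a b with e1 | e1 | e1 <;> rcases lt_trichotomy b c with e2 | e2 | e2 <;>
        rcases lt_trichotomy a c with e3 | e3 | e3 <;> (try subst e1) <;> (try subst e2) <;>
        (try subst e3) <;> (try (exfalso; omega)) <;>
        (simp (disch := assumption) only [wa_self, wb_self, wa_lt, wa_gt, wb_lt, wb_gt]) <;>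
        grind
    · intro K
      rw [vec3_eta K]
      generalize K 0 = a, K 1 = b, K 2 = c
      simp only [Rop_apply, swap02, swap12, Matrix.cons_val]
      rintro rfl
      rcases lt_trichotomy a c with e3 | e3 | e3 <;> (try subst e3) <;>
        (simp (disch := assumption) only [wa_self, wb_self, wa_lt, wa_gt, wb_lt, wb_gt]) <;>
        grind
  have r02 := fun (s t : E) (I₀ : ι → Fin N) => resAt_Rop he I₀ h s t 0 2
  have r12 := fun (s t : E) (I₀ : ι → Fin N) => resAt_Rop he I₀ h s t 1 2
  simp only [Matrix.cons_val] at r02 r12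
  constructor
  · intro I
    have h1 := (key I).1 (I ∘ ![i, j, k])
    rw [← r12, ← r02] at h1
    simp only [resAt, ← extend_swap he, extend_comp_self] at h1
    exact h1
  · intro I hI
    have h1 := (key I).2 (I ∘ ![i, j, k]) hI
    rw [← r12, ← r02] at h1
    simp only [resAt, extend_comp_self] at h1
    exact h1

end Rop

end LoopK

end

noncomputable section

namespace LoopK

open Finset Matrix

theorem Rhom_apply {E : Type*} [CommRing E] {N : ℕ} (h s t : E) (a b c d : Fin N) :
    Rhom N h s t (a, b) (c, d) =
      (if c = a ∧ d = b then wa h s t a b else 0) + (if c = b ∧ d = a then wb h s t a b else 0) := by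
  rw [Rhom, Matrix.of_apply]
  by_cases h1 : c = a ∧ d = b
  · obtain ⟨rfl, rfl⟩ := h1
    by_cases h2 : c = d
    · subst h2; simp [wa, wb]
    · simp [h2, Ne.symm h2, wa]
  · have h1' : ¬ ((a, b) = (c, d)) := fun e => h1 (by simpa [eq_comm] using e)
    rw [if_neg h1', if_neg h1, zero_add]
    by_cases h2 : c = b ∧ d = a
    · obtain ⟨rfl, rfl⟩ := h2
      have h3 : c ≠ d := fun e => h1 ⟨e, e.symm⟩
      rcases lt_or_gt_of_ne h3 with h4 | h4
      · simp [h4, h4.not_gt, wb, h3.symm]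
      · simp [h4, h4.not_gt, wb, h3.symm]
    · rw [if_neg h2, if_neg]
      intro e
      simp only [Prod.swap_prod_mk, Prod.mk.injEq] at e
      exact h2 ⟨e.2.symm, e.1.symm⟩

theorem Rij_apply {E : Type*} [Field E] {N m : ℕ} (i j : Fin m) (x h : E)
    (I J : Fin m → Fin N) :
    Rij i j x h I J = (1 - h * x)⁻¹ * ((if J = I then wa h 1 x (I i) (I j) else 0) +
      if J = I ∘ Equiv.swap i j then wb h 1 x (I i) (I j) else 0) := by
  rw [Rij, Matrix.of_apply]
  by_cases h1 : ∀ k, k ≠ i → k ≠ j → I k = J k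
  · rw [if_pos h1, Rtrig, Matrix.smul_apply, smul_eq_mul, Rhom_apply]
    have e1 : J = I ↔ J i = I i ∧ J j = I j := by
      refine ⟨fun e => by simp [e], fun e => funext fun k => ?_⟩
      by_cases hi : k = i
      · rw [hi, e.1]
      by_cases hj : k = j
      · rw [hj, e.2]
      exact (h1 k hi hj).symm
    have e2 : J = I ∘ Equiv.swap i j ↔ J i = I j ∧ J j = I i := by
      refine ⟨fun e => by simp [e], fun e => funext fun k => ?_⟩
      by_cases hi : k = i
      · rw [hi, e.1]; simp
      by_cases hj : k = j
      · rw [hj, e.2]; simp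
      rw [Function.comp_apply, Equiv.swap_apply_of_ne_of_ne hi hj]
      exact (h1 k hi hj).symm
    simp only [e1, e2]
  · rw [if_neg h1, if_neg, if_neg, add_zero, mul_zero]
    · rintro rfl
      exact h1 fun k hi hj => by simp [Equiv.swap_apply_of_ne_of_ne hi hj]
    · rintro rfl
      exact h1 fun k _ _ => rfl

theorem Rij_mulVec {E : Type*} [Field E] {N m : ℕ} (i j : Fin m) (x h : E)
    (f : (Fin m → Fin N) → E) :
    Rij i j x h *ᵥ f = (1 - h * x)⁻¹ • Rop h 1 x i j f := by
  ext I
  simp only [mulVec, dotProduct, Rij_apply i j, Pi.smul_apply, Rop_apply, smul_eq_mul]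
  simp only [mul_assoc, ← mul_sum, add_mul, sum_add_distrib, ite_mul, zero_mul, sum_ite_eq', mem_univ,
    if_true]

section STilde

variable {N n : ℕ}

/-- Application of a permutation of the variables to the coordinates. -/
def permVec (π : Equiv.Perm (Fin n)) (f : V N n) : V N n := fun J => permute π (f J)

theorem sTilde_eq (i j : Fin n) (f : V N n) :
    sTilde i j f = (rvar j - rh * rvar i : RatF (Fin n))⁻¹ •
      Rch rh (rvar i) (rvar j) i j (permVec (Equiv.swap i j) f) := by
  ext I
  have hj : (rvar j : RatF (Fin n)) ≠ 0 := rvar_ne_zero j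
  have h1 : (rvar j - rh * rvar i : RatF (Fin n)) ≠ 0 := rvar_sub_rh_mul_ne_zero j i
  change (Rij i j (rvar i / rvar j) rh *ᵥ permVec (Equiv.swap i j) f) (I ∘ Equiv.swap i j) = _
  rw [Rij_mulVec i j]
  change (1 - rh * (rvar i / rvar j))⁻¹ •
      Rop rh 1 (rvar i / rvar j) i j (permVec (Equiv.swap i j) f) (I ∘ Equiv.swap i j) =
    (rvar j - rh * rvar i : RatF (Fin n))⁻¹ • Rop rh (rvar j) (rvar i) i j (permVec (Equiv.swap i j) f) (I ∘ Equiv.swap i j)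
  have h2 : (Rop rh (rvar j) (rvar i) i j :
      Module.End (RatF (Fin n)) ((Fin n → Fin N) → RatF (Fin n))) =
      (rvar j : RatF (Fin n)) • Rop rh 1 (rvar i / rvar j) i j := by
    rw [← Rop_smul, mul_one, mul_div_cancel₀ _ hj]
  rw [h2, LinearMap.smul_apply, Pi.smul_apply, ← smul_assoc, smul_eq_mul]
  congr 1
  have h3 : (1 - rh * (rvar i / rvar j) : RatF (Fin n)) = (rvar j - rh * rvar i) / rvar j := by
    field_simp
  rw [h3, inv_div, div_eq_inv_mul, smul_eq_mul]

theorem sTilde_apply (i j : Fin n) (f : V N n) (I : Fin n → Fin N) :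
    sTilde i j f I = (rvar j - rh * rvar i : RatF (Fin n))⁻¹ *
      (wa rh (rvar j) (rvar i) (I j) (I i) * permute (Equiv.swap i j) (f (I ∘ Equiv.swap i j)) +
        wb rh (rvar j) (rvar i) (I j) (I i) * permute (Equiv.swap i j) (f I)) := by
  rw [sTilde_eq i j, Pi.smul_apply, Rch_apply, smul_eq_mul]
  rfl

theorem sTilde_add (i j : Fin n) (f g : V N n) :
    sTilde i j (f + g) = sTilde i j f + sTilde i j g := by
  ext I
  simp only [Pi.add_apply, sTilde_apply i j, map_add]
  ring

theorem sTilde_smul (i j : Fin n) (c : RatF (Fin n)) (f : V N n) :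
    sTilde i j (c • f) = permute (Equiv.swap i j) c • sTilde i j f := by
  ext I
  simp only [Pi.smul_apply, smul_eq_mul, sTilde_apply i j, map_mul]
  ring

theorem sTilde_sum (i j : Fin n) {ι : Type*} (s : Finset ι) (f : ι → V N n) :
    sTilde i j (∑ k ∈ s, f k) = ∑ k ∈ s, sTilde i j (f k) :=
  map_sum (AddMonoidHom.mk' (sTilde (N := N) i j) (sTilde_add i j)) f s

theorem unitarity {E : Type*} [Field E] {x y : E} (h : E) (h1 : y - h * x ≠ 0) (h2 : x - h * y ≠ 0)
    (a b : Fin N) (w w' : E) :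
    (y - h * x)⁻¹ * (wa h y x b a * ((x - h * y)⁻¹ * (wa h x y a b * w + wb h x y a b * w')) +
      wb h y x b a * ((x - h * y)⁻¹ * (wa h x y b a * w' + wb h x y b a * w))) = w := by
  have e1 := inv_mul_cancel₀ h1
  have e2 := inv_mul_cancel₀ h2
  generalize (y - h * x)⁻¹ = u at *
  generalize (x - h * y)⁻¹ = v at *
  rcases lt_trichotomy a b with hab | hab | hab
  · simp only [wa_lt _ _ _ hab, wa_gt _ _ _ hab, wb_lt _ _ _ hab, wb_gt _ _ _ hab]
    linear_combination w * (v * (x - h * y)) * e1 + w * e2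
  · simp only [hab, wa_self, wb_self]
    linear_combination w * (v * (x - h * y)) * e1 + w * e2
  · simp only [wa_lt _ _ _ hab, wa_gt _ _ _ hab, wb_lt _ _ _ hab, wb_gt _ _ _ hab]
    linear_combination w * (v * (x - h * y)) * e1 + w * e2

theorem sTilde_sTilde (i j : Fin n) (f : V N n) : sTilde i j (sTilde i j f) = f := by
  ext I
  have e1 : (I ∘ Equiv.swap i j) ∘ Equiv.swap i j = I := by ext; simp
  have h1 : (rvar j - rh * rvar i : RatF (Fin n)) ≠ 0 := rvar_sub_rh_mul_ne_zero j i
  have h2 : (rvar i - rh * rvar j : RatF (Fin n)) ≠ 0 := rvar_sub_rh_mul_ne_zero i j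
  simp only [sTilde_apply i j, map_mul, map_add, map_inv₀, map_sub, map_wa, map_wb, permute_rvar,
    permute_rh, e1, Equiv.swap_apply_left, Equiv.swap_apply_right, Function.comp_apply,
    permute_permute, Equiv.swap_mul_self, permute_one]
  exact unitarity rh h1 h2 (I i) (I j) _ _

theorem permVec_Rch (π : Equiv.Perm (Fin n)) (x y : RatF (Fin n)) (i j : Fin n) (f : V N n) :
    permVec π (Rch rh x y i j f) = Rch rh (permute π x) (permute π y) i j (permVec π f) := by
  ext I
  simp only [permVec, Rch_apply, map_add, map_mul, map_wa, map_wb, permute_rh]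

theorem permVec_smul (π : Equiv.Perm (Fin n)) (c : RatF (Fin n)) (f : V N n) :
    permVec π (c • f) = permute π c • permVec π f := by
  ext I
  simp [permVec]

theorem permVec_permVec (π ρ : Equiv.Perm (Fin n)) (f : V N n) :
    permVec π (permVec ρ f) = permVec (π * ρ) f := by
  ext I
  simp [permVec, permute_permute]

theorem sTilde_braid {i j k : Fin n} (hij : i ≠ j) (hik : i ≠ k) (hjk : j ≠ k) (f : V N n) :
    sTilde i j (sTilde j k (sTilde i j f)) = sTilde j k (sTilde i j (sTilde j k f)) := by
  have s1 : Equiv.swap i j * (Equiv.swap j k * Equiv.swap i j) =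
      Equiv.swap j k * (Equiv.swap i j * Equiv.swap j k) := by
    rw [← mul_assoc, ← mul_assoc, Equiv.swap_mul_swap_mul_swap hij hik, Equiv.swap_comm i j,
      Equiv.swap_comm j k, Equiv.swap_mul_swap_mul_swap hjk.symm hik.symm, Equiv.swap_comm]
  simp only [sTilde_eq i j, sTilde_eq j k, permVec_smul, permVec_Rch, permVec_permVec, map_smul,
    map_inv₀, map_sub, map_mul, permute_rh, permute_rvar, Equiv.swap_apply_left,
    Equiv.swap_apply_right, Equiv.swap_apply_of_ne_of_ne hik.symm hjk.symm,
    Equiv.swap_apply_of_ne_of_ne hij hik, s1, smul_smul]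
  have h := congrArg (fun F => F (permVec (Equiv.swap j k * (Equiv.swap i j * Equiv.swap j k)) f))
    (braid_Rch (N := N) (rh : RatF (Fin n)) (rvar i) (rvar j) (rvar k) hij hik hjk)
  simp only [Module.End.mul_apply] at h
  rw [h]
  congr 1
  ring

theorem sTilde_comm {i j k l : Fin n} (hij : i ≠ j) (hkl : k ≠ l) (hik : i ≠ k) (hil : i ≠ l)
    (hjk : j ≠ k) (hjl : j ≠ l) (f : V N n) :
    sTilde i j (sTilde k l f) = sTilde k l (sTilde i j f) := by
  ext I
  have s1 : Equiv.swap i j * Equiv.swap k l = Equiv.swap k l * Equiv.swap i j :=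
    (Equiv.Perm.Disjoint.commute (Equiv.Perm.disjoint_swap_swap (by simp [hij, hik, hil, hjk, hjl, hkl])))
  have s2 : (I ∘ Equiv.swap i j) ∘ Equiv.swap k l = (I ∘ Equiv.swap k l) ∘ Equiv.swap i j := by
    have := congrArg (fun σ : Equiv.Perm (Fin n) => I ∘ σ) s1
    exact this
  simp only [sTilde_apply i j, sTilde_apply k l, map_mul, map_add, map_inv₀, map_sub, map_wa, map_wb,
    permute_rvar, permute_rh, permute_permute, s1, s2, Function.comp_apply,
    Equiv.swap_apply_of_ne_of_ne hik hil, Equiv.swap_apply_of_ne_of_ne hjk hjl,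
    Equiv.swap_apply_of_ne_of_ne hik.symm hjk.symm, Equiv.swap_apply_of_ne_of_ne hil.symm hjl.symm]
  ring

end STilde

end LoopK

end

noncomputable section

namespace LoopK

open Finset Matrix

section Inversions

variable {N n : ℕ}

/-- The pairs `(b, a)` with `b < a`. -/
def ltPairs (n : ℕ) : Finset (Fin n × Fin n) := univ.filter fun p => p.1 < p.2

theorem mem_ltPairs {p : Fin n × Fin n} : p ∈ ltPairs n ↔ p.1 < p.2 := by simp [ltPairs]

theorem swap_lt_swap {i j : Fin n} (hij : (i : ℕ) + 1 = j) {b a : Fin n} (hba : b < a)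
    (hne : ¬ (b = i ∧ a = j)) : Equiv.swap i j b < Equiv.swap i j a := by
  simp only [Equiv.swap_apply_def]
  split_ifs <;> simp only [Fin.ext_iff, Fin.lt_def] at * <;> omega

@[to_additive]
theorem prod_ltPairs_swap {M : Type*} [CommMonoid M] {i j : Fin n} (hij : (i : ℕ) + 1 = j)
    (φ : Fin n → Fin n → M) :
    (∏ p ∈ ltPairs n, φ (Equiv.swap i j p.1) (Equiv.swap i j p.2)) * φ i j =
      φ j i * ∏ p ∈ ltPairs n, φ p.1 p.2 := by
  have hm : (i, j) ∈ ltPairs n := mem_ltPairs.2 (Fin.lt_def.2 (by simp only; omega))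
  rw [← mul_prod_erase _ _ hm, ← mul_prod_erase _ (fun p : Fin n × Fin n => φ p.1 p.2) hm]
  simp only [Equiv.swap_apply_left, Equiv.swap_apply_right]
  have : ∏ p ∈ (ltPairs n).erase (i, j), φ (Equiv.swap i j p.1) (Equiv.swap i j p.2) =
      ∏ p ∈ (ltPairs n).erase (i, j), φ p.1 p.2 := by
    have hs : ∀ p ∈ (ltPairs n).erase (i, j),
        (Equiv.swap i j p.1, Equiv.swap i j p.2) ∈ (ltPairs n).erase (i, j) := by
      rintro ⟨b, a⟩ hp
      rw [mem_erase, mem_ltPairs] at hp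
      have hne : ¬ (b = i ∧ a = j) := fun h => hp.1 (by rw [h.1, h.2])
      rw [mem_erase, mem_ltPairs]
      refine ⟨fun h => ?_, swap_lt_swap hij hp.2 hne⟩
      simp only [Prod.mk.injEq] at h
      have hb : b = j := by rw [← Equiv.swap_apply_self i j b, h.1, Equiv.swap_apply_left]
      have ha : a = i := by rw [← Equiv.swap_apply_self i j a, h.2, Equiv.swap_apply_right]
      have := hp.2
      rw [hb, ha, Fin.lt_def] at this
      simp only at this
      omega
    refine prod_bij (fun p _ => (Equiv.swap i j p.1, Equiv.swap i j p.2)) hs ?_ ?_ ?_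
    · rintro ⟨b, a⟩ _ ⟨b', a'⟩ _ h
      simpa using h
    · rintro ⟨b, a⟩ hp
      exact ⟨(Equiv.swap i j b, Equiv.swap i j a), hs _ hp, by simp⟩
    · intro p _; rfl
  rw [this, mul_assoc, mul_comm _ (φ i j)]

/-- The number of inversions. -/
def inv (I : Fin n → Fin N) : ℕ := ∑ p ∈ ltPairs n, if I p.2 < I p.1 then 1 else 0

theorem inv_swap {i j : Fin n} (hij : (i : ℕ) + 1 = j) {I : Fin n → Fin N} (h : I j < I i) :
    inv I = inv (I ∘ Equiv.swap i j) + 1 := by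
  have := sum_ltPairs_swap hij (fun b a => if I a < I b then 1 else 0)
  simp only [if_pos h, if_neg h.not_gt] at this
  simp only [inv, Function.comp_apply]
  omega

theorem comp_swap_swap (i j : Fin n) (I : Fin n → Fin N) :
    (I ∘ Equiv.swap i j) ∘ Equiv.swap i j = I := by ext; simp

theorem comp_swap_of_eq {i j : Fin n} {I : Fin n → Fin N} (h : I i = I j) :
    I ∘ Equiv.swap i j = I := by
  ext x
  rw [Function.comp_apply, Equiv.swap_apply_def]
  split_ifs with h1 h2
  · rw [h1, h]
  · rw [h2, h]
  · rfl

theorem inv_swap_lt {i j : Fin n} (hij : (i : ℕ) + 1 = j) {I : Fin n → Fin N} (h : I j < I i) :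
    inv (I ∘ Equiv.swap i j) < inv I := by
  rw [inv_swap hij h]; omega

theorem inv_swap_le {i j : Fin n} (hij : (i : ℕ) + 1 = j) (I : Fin n → Fin N) :
    inv (I ∘ Equiv.swap i j) ≤ inv I + 1 := by
  rcases lt_trichotomy (I i) (I j) with h | h | h
  · have h2 : (I ∘ Equiv.swap i j) j < (I ∘ Equiv.swap i j) i := by simpa using h
    rw [inv_swap hij h2, comp_swap_swap]
  · rw [comp_swap_of_eq h]; omega
  · exact (inv_swap_lt hij h).le.trans (Nat.le_succ _)

theorem monotone_of_no_descent {I : Fin n → Fin N}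
    (h : ¬ ∃ i j : Fin n, (i : ℕ) + 1 = j ∧ I j < I i) : Monotone I := by
  push Not at h
  intro a b hab
  obtain ⟨b, hb⟩ := b
  induction b with
  | zero =>
    have : a = ⟨0, hb⟩ := Fin.ext (Nat.le_zero.1 hab)
    rw [this]
  | succ b ih =>
    rcases (Fin.le_def.1 hab).lt_or_eq with h1 | h1
    · exact (ih (by omega) (Fin.le_def.2 (Nat.lt_succ_iff.1 h1))).trans (h _ _ rfl)
    · exact (congrArg I (Fin.ext h1)).le

theorem exists_descent {I : Fin n → Fin N} (h : ¬ Monotone I) :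
    ∃ i j : Fin n, (i : ℕ) + 1 = j ∧ I j < I i := by
  by_contra h1
  exact h (monotone_of_no_descent h1)

theorem adj_ne {i j : Fin n} (hij : (i : ℕ) + 1 = j) : i ≠ j := by
  rintro rfl; omega

end Inversions

section Xi

variable {N n : ℕ}

open Classical in
/-- The vectors `ξ_I`, by recursion on the number of inversions. -/
def xiFun (I : Fin n → Fin N) : V N n :=
  if h : ∃ i j : Fin n, (i : ℕ) + 1 = j ∧ I j < I i then
    sTilde h.choose h.choose_spec.choose
      (xiFun (I ∘ Equiv.swap h.choose h.choose_spec.choose))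
  else Pi.single I 1
termination_by inv I
decreasing_by exact inv_swap_lt h.choose_spec.choose_spec.1 h.choose_spec.choose_spec.2

theorem xiFun_monotone {I : Fin n → Fin N} (hI : Monotone I) : xiFun I = Pi.single I 1 := by
  rw [xiFun, dif_neg]
  rintro ⟨i, j, hij, h⟩
  exact (hI (Fin.le_def.2 (by omega : (i : ℕ) ≤ j))).not_gt h

theorem xiFun_confluent {I : Fin n → Fin N}
    (ih : ∀ I' : Fin n → Fin N, inv I' < inv I → ∀ i j : Fin n, (i : ℕ) + 1 = j → I' j < I' i →
      xiFun I' = sTilde i j (xiFun (I' ∘ Equiv.swap i j)))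
    {i j k l : Fin n} (hij : (i : ℕ) + 1 = j) (hkl : (k : ℕ) + 1 = l) (h1 : I j < I i)
    (h2 : I l < I k) (hik : i ≤ k) :
    sTilde i j (xiFun (I ∘ Equiv.swap i j)) = sTilde k l (xiFun (I ∘ Equiv.swap k l)) := by
  rw [Fin.le_def] at hik
  have nij := adj_ne hij
  have nkl := adj_ne hkl
  rcases hik.lt_or_eq with h3 | h3
  · have nik : i ≠ k := by rintro rfl; omega
    have nil : i ≠ l := by rintro rfl; omega
    have njl : j ≠ l := by rintro rfl; omega
    by_cases h4 : j = k
    · subst h4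
      have p1 := inv_swap_lt hij h1
      have p2 := inv_swap_lt hkl h2
      have q1 : (I ∘ Equiv.swap i j) l < (I ∘ Equiv.swap i j) j := by
        simpa [Equiv.swap_apply_of_ne_of_ne nil.symm njl.symm] using h2.trans h1
      have q2 : (I ∘ Equiv.swap j l) j < (I ∘ Equiv.swap j l) i := by
        simpa [Equiv.swap_apply_of_ne_of_ne nij nil] using h2.trans h1
      have p3 := inv_swap_lt hkl q1
      have p4 := inv_swap_lt hij q2
      rw [ih _ p1 j l hkl q1, ih _ (p3.trans p1) i j hij (by
        simpa [Equiv.swap_apply_of_ne_of_ne nij nil,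
          Equiv.swap_apply_of_ne_of_ne nil.symm njl.symm] using h2),
        ih _ p2 i j hij q2, ih _ (p4.trans p2) j l hkl (by
        simpa [Equiv.swap_apply_of_ne_of_ne nij nil,
          Equiv.swap_apply_of_ne_of_ne nil.symm njl.symm] using h1), sTilde_braid nij nil njl]
      have s1 : Equiv.swap i j * Equiv.swap j l * Equiv.swap i j =
          Equiv.swap j l * Equiv.swap i j * Equiv.swap j l := by
        rw [Equiv.swap_mul_swap_mul_swap nij nil, Equiv.swap_comm i j,
          Equiv.swap_comm j l, Equiv.swap_mul_swap_mul_swap njl.symm nil.symm, Equiv.swap_comm]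
      have s2 := congrArg (fun σ : Equiv.Perm (Fin n) => I ∘ σ) s1
      simp only [Equiv.Perm.coe_mul, ← Function.comp_assoc] at s2
      rw [s2]
    · have njk : j ≠ k := h4
      have p1 := inv_swap_lt hij h1
      have p2 := inv_swap_lt hkl h2
      rw [ih _ p1 k l hkl (by
          simpa [Equiv.swap_apply_of_ne_of_ne nik.symm njk.symm,
            Equiv.swap_apply_of_ne_of_ne nil.symm njl.symm] using h2),
        ih _ p2 i j hij (by
          simpa [Equiv.swap_apply_of_ne_of_ne nik nil,
            Equiv.swap_apply_of_ne_of_ne njk njl] using h1),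
        sTilde_comm nij nkl nik nil njk njl]
      have s1 : Equiv.swap i j * Equiv.swap k l = Equiv.swap k l * Equiv.swap i j :=
        Equiv.Perm.Disjoint.commute
          (Equiv.Perm.disjoint_swap_swap (by simp [nij, nik, nil, njk, njl, nkl]))
      have s2 := congrArg (fun σ : Equiv.Perm (Fin n) => I ∘ σ) s1
      simp only [Equiv.Perm.coe_mul, ← Function.comp_assoc] at s2
      rw [s2]
  · have e1 : i = k := Fin.ext h3
    have e2 : j = l := Fin.ext (by omega)
    rw [e1, e2]

theorem xiFun_descent (I : Fin n → Fin N) : ∀ i j : Fin n, (i : ℕ) + 1 = j → I j < I i →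
    xiFun I = sTilde i j (xiFun (I ∘ Equiv.swap i j)) := by
  induction hk : inv I using Nat.strong_induction_on generalizing I with
  | _ m ih =>
    subst hk
    intro i j hij h1
    have h : ∃ i j : Fin n, (i : ℕ) + 1 = j ∧ I j < I i := ⟨i, j, hij, h1⟩
    have ih' : ∀ I' : Fin n → Fin N, inv I' < inv I → ∀ i j : Fin n, (i : ℕ) + 1 = j → I' j < I' i →
      xiFun I' = sTilde i j (xiFun (I' ∘ Equiv.swap i j)) := fun I' h' => ih _ h' I' rfl
    rw [xiFun, dif_pos h]
    obtain ⟨hkl, h2⟩ := h.choose_spec.choose_spec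
    rcases le_total i h.choose with h3 | h3
    · exact (xiFun_confluent ih' hij hkl h1 h2 h3).symm
    · exact xiFun_confluent ih' hkl hij h2 h1 h3

theorem sTilde_single {i j : Fin n} {I : Fin n → Fin N} (h : I i = I j) :
    sTilde i j (Pi.single I 1 : V N n) = Pi.single I 1 := by
  ext J
  rw [sTilde_apply]
  have h0 : (rvar j - rh * rvar i : RatF (Fin n)) ≠ 0 := rvar_sub_rh_mul_ne_zero j i
  by_cases hJ : J = I
  · subst hJ
    rw [comp_swap_of_eq h, h, wa_self, wb_self, Pi.single_eq_same, map_one, zero_mul, mul_one, add_zero,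
      inv_mul_cancel₀ h0]
  · have hJ' : J ∘ Equiv.swap i j ≠ I := fun e => hJ (by
      rw [← comp_swap_swap i j J, e, comp_swap_of_eq h])
    rw [Pi.single_eq_of_ne hJ, Pi.single_eq_of_ne hJ', map_zero, mul_zero, mul_zero, add_zero, mul_zero]

theorem xiFun_fixed (I : Fin n → Fin N) : ∀ i j : Fin n, (i : ℕ) + 1 = j → I i = I j →
    sTilde i j (xiFun I) = xiFun I := by
  induction hk : inv I using Nat.strong_induction_on generalizing I with
  | _ m ih =>
    subst hk
    intro i j hij h1
    by_cases hm : Monotone I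
    · rw [xiFun_monotone hm, sTilde_single h1]
    obtain ⟨k, l, hkl, h2⟩ := exists_descent hm
    have nij := adj_ne hij
    have nkl := adj_ne hkl
    have p1 := inv_swap_lt hkl h2
    have nik : i ≠ k := by
      rintro rfl
      have : j = l := Fin.ext (by omega)
      subst this
      exact h2.ne h1.symm
    have njl : j ≠ l := by
      rintro rfl
      exact nik (Fin.ext (by omega))
    by_cases h3 : j = k
    · subst h3
      have nil : i ≠ l := by rintro rfl; omega
      have q1 : (I ∘ Equiv.swap j l) j < (I ∘ Equiv.swap j l) i := by
        simpa [Equiv.swap_apply_of_ne_of_ne nij nil, h1] using h2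
      have p2 := inv_swap_lt hij q1
      rw [xiFun_descent I j l hkl h2, xiFun_descent _ i j hij q1, sTilde_braid nij nil njl,
        ih _ (p2.trans p1) _ rfl j l hkl]
      simp [Equiv.swap_apply_of_ne_of_ne nij nil, Equiv.swap_apply_of_ne_of_ne nil.symm njl.symm, h1]
    by_cases h4 : l = i
    · subst h4
      have nkj : k ≠ j := Ne.symm h3
      have q1 : (I ∘ Equiv.swap k l) j < (I ∘ Equiv.swap k l) l := by
        simpa [Equiv.swap_apply_of_ne_of_ne nkj.symm njl, ← h1] using h2
      have p2 := inv_swap_lt hij q1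
      rw [xiFun_descent I k l hkl h2, xiFun_descent _ l j hij q1, ← sTilde_braid nkl nkj nij,
        ih _ (p2.trans p1) _ rfl k l hkl]
      simp [Equiv.swap_apply_of_ne_of_ne nkj.symm njl, Equiv.swap_apply_of_ne_of_ne nkl nkj, h1]
    · have nil : i ≠ l := Ne.symm h4
      have njk : j ≠ k := h3
      rw [xiFun_descent I k l hkl h2, sTilde_comm nij nkl nik nil njk njl, ih _ p1 _ rfl i j hij]
      simpa [Equiv.swap_apply_of_ne_of_ne nik nil, Equiv.swap_apply_of_ne_of_ne njk njl] using h1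

theorem isXi_xiFun : IsXi (xiFun : (Fin n → Fin N) → V N n) := by
  refine ⟨fun I hI => xiFun_monotone hI, fun I i j hij => ?_⟩
  rcases lt_trichotomy (I i) (I j) with h | h | h
  · rw [xiFun_descent (I ∘ Equiv.swap i j) i j hij (by simpa using h), comp_swap_swap]
  · rw [comp_swap_of_eq h, xiFun_fixed I i j hij h]
  · rw [xiFun_descent I i j hij h, sTilde_sTilde]

/-- Induction on the number of inversions. -/
theorem inv_induction {P : (Fin n → Fin N) → Prop} (h0 : ∀ I, Monotone I → P I)
    (h1 : ∀ I : Fin n → Fin N, ∀ i j : Fin n, (i : ℕ) + 1 = j → I i < I j → P I →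
      P (I ∘ Equiv.swap i j)) (I : Fin n → Fin N) : P I := by
  induction hk : inv I using Nat.strong_induction_on generalizing I with
  | _ m ih =>
    subst hk
    by_cases hm : Monotone I
    · exact h0 I hm
    obtain ⟨i, j, hij, h2⟩ := exists_descent hm
    rw [← comp_swap_swap i j I]
    exact h1 _ i j hij (by simpa using h2) (ih _ (inv_swap_lt hij h2) _ rfl)

theorem isXi_unique {xi xi' : (Fin n → Fin N) → V N n} (h : IsXi xi) (h' : IsXi xi') : xi' = xi := by
  ext1 I
  refine inv_induction (P := fun I => xi' I = xi I) (fun I hI => ?_) (fun I i j hij _ e => ?_) I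
  · rw [h.1 I hI, h'.1 I hI]
  · rw [h.2 I i j hij, h'.2 I i j hij, e]

variable {xi : (Fin n → Fin N) → V N n}

theorem sTilde_apply_ne_zero {i j : Fin n} {f : V N n} {J : Fin n → Fin N} (h : sTilde i j f J ≠ 0) :
    f (J ∘ Equiv.swap i j) ≠ 0 ∨ f J ≠ 0 := by
  by_contra! h1
  rw [sTilde_apply, h1.1, h1.2] at h
  simp at h

theorem xi_support (hxi : IsXi xi) (I : Fin n → Fin N) :
    ∀ J, xi I J ≠ 0 → (J = I ∨ inv J < inv I) ∧ ∃ π : Equiv.Perm (Fin n), J = I ∘ π := by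
  refine inv_induction (P := fun I => ∀ J, xi I J ≠ 0 →
    (J = I ∨ inv J < inv I) ∧ ∃ π : Equiv.Perm (Fin n), J = I ∘ π) (fun I hI J hJ => ?_)
    (fun I i j hij hlt ih J hJ => ?_) I
  · rw [hxi.1 I hI] at hJ
    have : J = I := by
      by_contra h
      exact hJ (Pi.single_eq_of_ne h _)
    exact ⟨Or.inl this, 1, by rw [this]; rfl⟩
  · rw [hxi.2 I i j hij] at hJ
    have hinv : inv (I ∘ Equiv.swap i j) = inv I + 1 := by
      rw [inv_swap hij (I := I ∘ Equiv.swap i j) (by simpa using hlt), comp_swap_swap]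
    rcases sTilde_apply_ne_zero hJ with h | h
    · obtain ⟨h2, π, hπ⟩ := ih _ h
      refine ⟨?_, Equiv.swap i j * (π * Equiv.swap i j), ?_⟩
      · rcases h2 with h2 | h2
        · left; rw [← h2, comp_swap_swap]
        · right
          have h3 := inv_swap_le hij (J ∘ Equiv.swap i j)
          rw [comp_swap_swap] at h3
          omega
      · rw [← comp_swap_swap i j J, hπ]; ext x; simp
    · obtain ⟨h2, π, hπ⟩ := ih _ h
      refine ⟨?_, Equiv.swap i j * π, ?_⟩
      · right
        rcases h2 with h2 | h2
        · rw [h2]; omega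
        · omega
      · rw [hπ]; ext x; simp

end Xi

end LoopK

end

noncomputable section

namespace LoopK

open Finset Matrix

section Basis

variable {N n : ℕ} {xi : (Fin n → Fin N) → V N n}

theorem prod_ltPairs_perm {M : Type*} [CommMonoid M] (φ : Fin n → Fin n → M)
    (hφ : ∀ a b, φ a b = φ b a) (π : Equiv.Perm (Fin n)) :
    ∏ p ∈ ltPairs n, φ (π p.1) (π p.2) = ∏ p ∈ ltPairs n, φ p.1 p.2 := by
  have key : ∀ p : Fin n × Fin n, p ∈ ltPairs n →
      (if π p.1 < π p.2 then (π p.1, π p.2) else (π p.2, π p.1)) ∈ ltPairs n := by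
    intro p hp
    have h1 : π p.1 ≠ π p.2 := fun h => (mem_ltPairs.1 hp).ne (π.injective h)
    split_ifs with h
    · exact mem_ltPairs.2 h
    · exact mem_ltPairs.2 (lt_of_le_of_ne (not_lt.1 h) h1.symm)
  refine prod_bij (fun p _ => if π p.1 < π p.2 then (π p.1, π p.2) else (π p.2, π p.1)) key ?_ ?_ ?_
  · rintro ⟨a, b⟩ h1 ⟨c, d⟩ h2 h
    have l1 := mem_ltPairs.1 h1
    have l2 := mem_ltPairs.1 h2
    simp only at h l1 l2
    split_ifs at h <;> simp only [Prod.mk.injEq, EmbeddingLike.apply_eq_iff_eq] at h ⊢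
    · exact h
    · rw [h.1, h.2] at l1; exact absurd l1 l2.not_gt
    · rw [h.1, h.2] at l1; exact absurd l1 l2.not_gt
    · exact ⟨h.2, h.1⟩
  · rintro ⟨a, b⟩ h1
    have l1 := mem_ltPairs.1 h1
    simp only at l1
    rcases lt_trichotomy (π⁻¹ a) (π⁻¹ b) with h | h | h
    · exact ⟨(π⁻¹ a, π⁻¹ b), mem_ltPairs.2 h, by simp [l1]⟩
    · exact absurd (π⁻¹.injective h) l1.ne
    · exact ⟨(π⁻¹ b, π⁻¹ a), mem_ltPairs.2 h, by simp [l1.not_gt]⟩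
  · intro p _
    split_ifs
    · rfl
    · exact hφ _ _

/-- Decreasing multi-indices have the largest number of inversions. -/
theorem inv_le_of_antitone {I : Fin n → Fin N} (hI : Antitone I) (π : Equiv.Perm (Fin n)) :
    inv (I ∘ π) ≤ inv I := by
  have h1 := prod_ltPairs_perm (M := Multiplicative ℕ)
    (fun a b => Multiplicative.ofAdd (if I a ≠ I b then 1 else 0))
    (fun a b => by simp [ne_comm]) π
  rw [← ofAdd_sum, ← ofAdd_sum] at h1
  have h2 := Multiplicative.ofAdd.injective h1
  have h3 : inv I = ∑ p ∈ ltPairs n, if I p.1 ≠ I p.2 then 1 else 0 := by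
    refine sum_congr rfl fun p hp => ?_
    have := hI (mem_ltPairs.1 hp).le
    by_cases h : I p.1 = I p.2
    · simp [h]
    · rw [if_pos h, if_pos (lt_of_le_of_ne this (Ne.symm h))]
  rw [h3, ← h2, inv]
  refine sum_le_sum fun p _ => ?_
  simp only [Function.comp_apply]
  split_ifs with h h' <;> first | exact absurd h.ne' ‹_› | omega

/-- The diagonal coefficient of `ξ_I`. -/
def xiDiag (I : Fin n → Fin N) : RatF (Fin n) :=
  ∏ p ∈ ltPairs n, if I p.2 < I p.1 then (rvar p.2 - rvar p.1) / (rvar p.2 - rh * rvar p.1) else 1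

theorem xiDiag_ne_zero (I : Fin n → Fin N) : xiDiag I ≠ 0 := by
  refine prod_ne_zero_iff.2 fun p hp => ?_
  split_ifs
  · exact div_ne_zero (rvar_sub_ne_zero (mem_ltPairs.1 hp).ne') (rvar_sub_rh_mul_ne_zero _ _)
  · exact one_ne_zero

/-- The denominator of `ξ_I`. -/
def xiDen (I : Fin n → Fin N) : RatF (Fin n) :=
  ∏ p ∈ ltPairs n, if I p.2 < I p.1 then rvar p.2 - rh * rvar p.1 else 1

theorem xi_diag (hxi : IsXi xi) (I : Fin n → Fin N) : xi I I = xiDiag I := by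
  refine inv_induction (P := fun I => xi I I = xiDiag I) (fun I hI => ?_)
    (fun I i j hij hlt ih => ?_) I
  · rw [hxi.1 I hI, Pi.single_eq_same, xiDiag, prod_eq_one]
    intro p hp
    rw [if_neg (hI (mem_ltPairs.1 hp).le).not_gt]
  · have hinv : inv (I ∘ Equiv.swap i j) = inv I + 1 := by
      rw [inv_swap hij (I := I ∘ Equiv.swap i j) (by simpa using hlt), comp_swap_swap]
    have h0 : xi I (I ∘ Equiv.swap i j) = 0 := by
      by_contra h
      rcases (xi_support hxi I _ h).1 with h1 | h1
      · rw [h1] at hinv; omega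
      · omega
    have h1 := prod_ltPairs_swap hij (fun b a : Fin n =>
      if (I ∘ Equiv.swap i j) a < (I ∘ Equiv.swap i j) b then
        ((rvar a - rvar b) / (rvar a - rh * rvar b) : RatF (Fin n)) else 1)
    simp only [Function.comp_apply, Equiv.swap_apply_left, Equiv.swap_apply_right, if_pos hlt,
      if_neg hlt.not_gt, Equiv.swap_apply_self, one_mul] at h1
    have h2 : permute (Equiv.swap i j) (xiDiag I) = ∏ p ∈ ltPairs n, if I p.2 < I p.1 then
        ((rvar (Equiv.swap i j p.2) - rvar (Equiv.swap i j p.1)) /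
          (rvar (Equiv.swap i j p.2) - rh * rvar (Equiv.swap i j p.1)) : RatF (Fin n)) else 1 := by
      rw [xiDiag, map_prod]
      refine prod_congr rfl fun p _ => ?_
      rw [apply_ite (permute (Equiv.swap i j)), map_one, map_div₀, map_sub, map_sub, map_mul,
        permute_rvar, permute_rvar, permute_rh]
    rw [hxi.2 I i j hij, sTilde_apply, h0, map_zero, mul_zero, add_zero, comp_swap_swap, ih, h2]
    simp only [Function.comp_apply, Equiv.swap_apply_left, Equiv.swap_apply_right, wa_lt _ _ _ hlt]
    rw [xiDiag]
    simp only [Function.comp_apply]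
    rw [← h1, div_eq_mul_inv]
    ring

theorem permute_mem_laurentRange {σ : Type} (π : Equiv.Perm σ) {x : RatF σ} (hx : x ∈ laurentRange σ) :
    permute π x ∈ laurentRange σ := by
  obtain ⟨f, rfl⟩ := hx
  exact ⟨rename π f, (permute_algebraMap π f).symm⟩

theorem rvar_mem_laurentRange {σ : Type} (i : σ) : (rvar i : RatF σ) ∈ laurentRange σ := ⟨var i, rfl⟩

theorem coef_mem_laurentRange {σ : Type} (c : Coef) : algebraMap Coef (RatF σ) c ∈ laurentRange σ :=
  ⟨algebraMap Coef _ c, (IsScalarTower.algebraMap_apply _ _ _ _).symm⟩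

theorem rh_mem_laurentRange {σ : Type} : (rh : RatF σ) ∈ laurentRange σ := coef_mem_laurentRange hh

theorem wa_mem {E : Type*} [CommRing E] (S : Subring E) {h s t : E} (hh : h ∈ S) (hs : s ∈ S)
    (ht : t ∈ S) (a b : Fin N) : wa h s t a b ∈ S := by
  unfold wa
  split_ifs
  · exact sub_mem hs (mul_mem hh ht)
  · exact sub_mem hs ht
  · exact mul_mem hh (sub_mem hs ht)

theorem wb_mem {E : Type*} [CommRing E] (S : Subring E) {h s t : E} (hh : h ∈ S) (hs : s ∈ S)
    (ht : t ∈ S) (a b : Fin N) : wb h s t a b ∈ S := by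
  unfold wb
  split_ifs
  · exact zero_mem _
  · exact mul_mem (sub_mem (one_mem _) hh) hs
  · exact mul_mem (sub_mem (one_mem _) hh) ht

theorem xiDen_mul_xi (hxi : IsXi xi) (I : Fin n → Fin N) :
    ∀ J, xiDen I * xi I J ∈ laurentRange (Fin n) := by
  refine inv_induction (P := fun I => ∀ J, xiDen I * xi I J ∈ laurentRange (Fin n))
    (fun I hI J => ?_) (fun I i j hij hlt ih J => ?_) I
  · rw [hxi.1 I hI, xiDen, prod_eq_one, one_mul]
    · by_cases h : J = I
      · rw [h, Pi.single_eq_same]; exact one_mem _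
      · rw [Pi.single_eq_of_ne h]; exact zero_mem _
    · intro p hp
      rw [if_neg (hI (mem_ltPairs.1 hp).le).not_gt]
  · have h1 := prod_ltPairs_swap hij (fun b a : Fin n =>
      if (I ∘ Equiv.swap i j) a < (I ∘ Equiv.swap i j) b then
        (rvar a - rh * rvar b : RatF (Fin n)) else 1)
    simp only [Function.comp_apply, Equiv.swap_apply_left, Equiv.swap_apply_right, if_pos hlt,
      if_neg hlt.not_gt, Equiv.swap_apply_self, one_mul] at h1
    have h2 : permute (Equiv.swap i j) (xiDen I) = ∏ p ∈ ltPairs n, if I p.2 < I p.1 then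
        (rvar (Equiv.swap i j p.2) - rh * rvar (Equiv.swap i j p.1) : RatF (Fin n)) else 1 := by
      rw [xiDen, map_prod]
      refine prod_congr rfl fun p _ => ?_
      rw [apply_ite (permute (Equiv.swap i j)), map_one, map_sub, map_mul,
        permute_rvar, permute_rvar, permute_rh]
    rw [← h2] at h1
    rw [hxi.2 I i j hij, sTilde_apply, xiDen]
    simp only [Function.comp_apply]
    rw [← h1, mul_assoc, mul_inv_cancel_left₀ (rvar_sub_rh_mul_ne_zero j i), mul_add,
      mul_left_comm, mul_left_comm (permute _ _), ← map_mul, ← map_mul]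
    exact add_mem
      (mul_mem (wa_mem _ rh_mem_laurentRange (rvar_mem_laurentRange j) (rvar_mem_laurentRange i) _ _)
        (permute_mem_laurentRange _ (ih _)))
      (mul_mem (wb_mem _ rh_mem_laurentRange (rvar_mem_laurentRange j) (rvar_mem_laurentRange i) _ _)
        (permute_mem_laurentRange _ (ih _)))

/-- `D` up to a monomial. -/
def denD (n : ℕ) : RatF (Fin n) := ∏ p ∈ ltPairs n, (rvar p.2 - rh * rvar p.1)

theorem denD_mul_xi (hxi : IsXi xi) (I J : Fin n → Fin N) :
    denD n * xi I J ∈ laurentRange (Fin n) := by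
  have : denD n = (∏ p ∈ ltPairs n, if I p.2 < I p.1 then 1 else (rvar p.2 - rh * rvar p.1)) *
      xiDen I := by
    rw [denD, xiDen, ← prod_mul_distrib]
    refine prod_congr rfl fun p _ => ?_
    split_ifs <;> ring
  rw [this, mul_assoc]
  refine mul_mem (prod_mem fun p _ => ?_) (xiDen_mul_xi hxi I J)
  split_ifs
  · exact one_mem _
  · exact sub_mem (rvar_mem_laurentRange _) (mul_mem rh_mem_laurentRange (rvar_mem_laurentRange _))

theorem DD_eq (n : ℕ) : DD n = denD n * (∏ p ∈ ltPairs n, rvar p.2)⁻¹ := by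
  rw [DD, denD, ← prod_inv_distrib, ← prod_mul_distrib, ← prod_product', ltPairs, prod_filter]
  refine prod_bij (fun p _ => (p.2, p.1)) (by simp) (by simp +contextual) (by simp) ?_
  rintro ⟨a, b⟩ _
  simp only
  refine if_congr Iff.rfl ?_ rfl
  have := rvar_ne_zero a
  field_simp

/-- The matrix whose columns are the vectors `ξ_I`. -/
def xiMat (xi : (Fin n → Fin N) → V N n) : Matrix (Fin n → Fin N) (Fin n → Fin N) (RatF (Fin n)) :=
  Matrix.of fun J I => xi I J

theorem xi_linearIndependent (hxi : IsXi xi) : LinearIndependent (RatF (Fin n)) xi := by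
  classical
  rw [Fintype.linearIndependent_iff]
  intro c hc
  by_contra! hne
  obtain ⟨I, hI, hmax⟩ := exists_max_image (univ.filter fun I => c I ≠ 0) inv
    (by obtain ⟨I, hI⟩ := hne; exact ⟨I, by simpa using hI⟩)
  have h1 := congrFun hc I
  rw [Finset.sum_apply, sum_eq_single I] at h1
  · rw [Pi.smul_apply, xi_diag hxi, smul_eq_mul, Pi.zero_apply] at h1
    exact (mul_ne_zero (mem_filter.1 hI).2 (xiDiag_ne_zero I)) h1
  · intro I' _ hI'
    rw [Pi.smul_apply, smul_eq_mul]
    by_contra h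
    have h2 := (xi_support hxi I' I (right_ne_zero_of_mul h)).1
    have h3 := hmax I' (mem_filter.2 ⟨mem_univ _, left_ne_zero_of_mul h⟩)
    rcases h2 with h2 | h2
    · exact hI' h2.symm
    · omega
  · intro h; exact absurd (mem_univ _) h

theorem isUnit_xiMat (hxi : IsXi xi) : IsUnit (xiMat xi) := by
  rw [← Matrix.linearIndependent_cols_iff_isUnit]
  exact xi_linearIndependent hxi

theorem xiMat_mulVec (c : (Fin n → Fin N) → RatF (Fin n)) : xiMat xi *ᵥ c = ∑ I, c I • xi I := by
  ext J
  simp [mulVec, dotProduct, xiMat, mul_comm]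

/-- The coordinates of a vector in the basis `ξ_I`. -/
def xiCoord (xi : (Fin n → Fin N) → V N n) (w : V N n) : V N n := (xiMat xi)⁻¹ *ᵥ w

theorem sum_xiCoord (hxi : IsXi xi) (w : V N n) : ∑ I, xiCoord xi w I • xi I = w := by
  rw [← xiMat_mulVec, xiCoord, mulVec_mulVec, Matrix.mul_nonsing_inv _
    ((Matrix.isUnit_iff_isUnit_det _).1 (isUnit_xiMat hxi)), one_mulVec]

theorem xiCoord_unique (hxi : IsXi xi) {w : V N n} {c : (Fin n → Fin N) → RatF (Fin n)}
    (h : ∑ I, c I • xi I = w) : xiCoord xi w = c := by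
  rw [← h, ← xiMat_mulVec, xiCoord, mulVec_mulVec, Matrix.nonsing_inv_mul _
    ((Matrix.isUnit_iff_isUnit_det _).1 (isUnit_xiMat hxi)), one_mulVec]

theorem xiCoord_sTilde (hxi : IsXi xi) {i j : Fin n} (hij : (i : ℕ) + 1 = j) (w : V N n)
    (I : Fin n → Fin N) :
    xiCoord xi (sTilde i j w) (I ∘ Equiv.swap i j) = permute (Equiv.swap i j) (xiCoord xi w I) := by
  have h : xiCoord xi (sTilde i j w) =
      fun I => permute (Equiv.swap i j) (xiCoord xi w (I ∘ Equiv.swap i j)) := by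
    apply xiCoord_unique hxi
    conv_rhs => rw [← sum_xiCoord hxi w, sTilde_sum]
    let e : (Fin n → Fin N) ≃ (Fin n → Fin N) := ⟨fun I => I ∘ Equiv.swap i j,
      fun I => I ∘ Equiv.swap i j, fun I => comp_swap_swap i j I, fun I => comp_swap_swap i j I⟩
    rw [← Equiv.sum_comp e]
    refine sum_congr rfl fun I _ => ?_
    change permute _ (xiCoord xi w ((I ∘ Equiv.swap i j) ∘ Equiv.swap i j)) • xi (I ∘ Equiv.swap i j) = _
    rw [comp_swap_swap, hxi.2 I i j hij, sTilde_smul]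
  rw [h]
  simp only [comp_swap_swap]

/-- Coordinates of a vector supported on a set that is stable for the vectors `ξ_I`. -/
theorem xiCoord_of_support (hxi : IsXi xi) (S : Set (Fin n → Fin N))
    (hS : ∀ I ∈ S, ∀ J, xi I J ≠ 0 → J ∈ S) {w : V N n} (hw : ∀ J, w J ≠ 0 → J ∈ S) :
    ∀ I ∉ S, xiCoord xi w I = 0 := by
  classical
  by_contra! hne
  obtain ⟨I, hI, hmax⟩ := exists_max_image (univ.filter fun I => I ∉ S ∧ xiCoord xi w I ≠ 0) inv
    (by obtain ⟨I, hI⟩ := hne; exact ⟨I, by simpa using hI⟩)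
  simp only [mem_filter, mem_univ, true_and] at hI hmax
  have h1 := congrFun (sum_xiCoord hxi w) I
  have h2 : w I = 0 := by
    by_contra h; exact hI.1 (hw I h)
  rw [Finset.sum_apply, sum_eq_single I, h2] at h1
  · rw [Pi.smul_apply, xi_diag hxi, smul_eq_mul] at h1
    exact (mul_ne_zero hI.2 (xiDiag_ne_zero I)) h1
  · intro I' _ hI'
    rw [Pi.smul_apply, smul_eq_mul]
    by_contra h
    have h0 := right_ne_zero_of_mul h
    have h2 := (xi_support hxi I' I h0).1
    have h3 := hmax I' ⟨fun h4 => hI.1 (hS I' h4 I h0), left_ne_zero_of_mul h⟩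
    rcases h2 with h2 | h2
    · exact hI' h2.symm
    · omega
  · intro h; exact absurd (mem_univ _) h

/-- The leading coordinate of such a vector. -/
theorem xiCoord_leading (hxi : IsXi xi) (S : Set (Fin n → Fin N))
    (hS : ∀ I ∈ S, ∀ J, xi I J ≠ 0 → J ∈ S) {w : V N n} (hw : ∀ J, w J ≠ 0 → J ∈ S)
    {I : Fin n → Fin N} (hI : ∀ I' ∈ S, inv I' ≤ inv I) : xiCoord xi w I * xiDiag I = w I := by
  have h1 := congrFun (sum_xiCoord hxi w) I
  rw [Finset.sum_apply, sum_eq_single I] at h1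
  · rwa [Pi.smul_apply, xi_diag hxi, smul_eq_mul] at h1
  · intro I' _ hI'
    rw [Pi.smul_apply, smul_eq_mul]
    by_contra h
    have h2 := (xi_support hxi I' I (right_ne_zero_of_mul h)).1
    have h3 : I' ∈ S := by
      by_contra h4
      exact (left_ne_zero_of_mul h) (xiCoord_of_support hxi S hS hw I' h4)
    have h4 := hI I' h3
    rcases h2 with h2 | h2
    · exact hI' h2.symm
    · omega
  · intro h; exact absurd (mem_univ _) h

/-- The symmetric group is generated by the adjacent transpositions. -/
theorem perm_induction {P : Equiv.Perm (Fin n) → Prop} (h1 : P 1)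
    (hs : ∀ i j : Fin n, (i : ℕ) + 1 = j → P (Equiv.swap i j))
    (hm : ∀ π ρ, P π → P ρ → P (π * ρ)) (π : Equiv.Perm (Fin n)) : P π := by
  obtain _ | n := n
  · rwa [Subsingleton.elim π 1]
  have hπ : π ∈ Submonoid.closure (Set.range fun i : Fin n ↦ Equiv.swap i.castSucc i.succ) := by
    rw [Equiv.Perm.mclosure_swap_castSucc_succ]; trivial
  induction hπ using Submonoid.closure_induction with
  | mem x hx =>
    obtain ⟨i, rfl⟩ := hx
    exact hs _ _ (by simp)
  | one => exact h1
  | mul x y _ _ hx hy => exact hm x y hx hy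

/-- Equivariance for adjacent transpositions implies equivariance for all permutations. -/
theorem equivariant_perm {c : (Fin n → Fin N) → RatF (Fin n)}
    (hc : ∀ i j : Fin n, (i : ℕ) + 1 = j → ∀ I, c (I ∘ Equiv.swap i j) = permute (Equiv.swap i j) (c I))
    (π : Equiv.Perm (Fin n)) : ∀ I, permute π (c (I ∘ π)) = c I := by
  refine perm_induction (P := fun π => ∀ I, permute π (c (I ∘ π)) = c I) (fun I => permute_one _)
    (fun i j hij I => ?_) (fun x y hx hy I => ?_) π
  · rw [hc _ _ hij, permute_permute, Equiv.swap_mul_self, permute_one]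
  · rw [← permute_permute, Equiv.Perm.coe_mul, ← Function.comp_assoc, hy, hx]

end Basis

end LoopK

end

noncomputable section

namespace LoopK

open Finset Matrix

/-! ### Symmetric Laurent polynomials and localization -/

section Averages

variable {σ τ : Type}

/-- The average of a Laurent polynomial over a finite group of permutations of the variables. -/
def avg {G : Type} [Group G] [Fintype G] (ρ : G → σ → σ) : Laurent σ →ₗ[Coef] Laurent σ :=
  (Fintype.card G : Coef)⁻¹ • ∑ g, (rename (ρ g)).toLinearMap

theorem avg_apply {G : Type} [Group G] [Fintype G] (ρ : G → σ → σ) (f : Laurent σ) :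
    avg ρ f = (Fintype.card G : Coef)⁻¹ • ∑ g, rename (ρ g) f := by
  simp [avg]

theorem rename_avg {G : Type} [Group G] [Fintype G] {ρ : G → σ → σ}
    (hρ : ∀ g h, ρ (g * h) = ρ g ∘ ρ h) (g : G) (f : Laurent σ) : rename (ρ g) (avg ρ f) = avg ρ f := by
  rw [avg_apply, map_smul, map_sum]
  congr 1
  simp only [rename_rename, ← hρ]
  exact Equiv.sum_comp (Equiv.mulLeft g) fun h => rename (ρ h) f

theorem avg_mul {G : Type} [Group G] [Fintype G] {ρ : G → σ → σ} {a : Laurent σ}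
    (ha : ∀ g, rename (ρ g) a = a) (f : Laurent σ) : avg ρ (f * a) = avg ρ f * a := by
  rw [avg_apply, avg_apply, smul_mul_assoc, sum_mul]
  simp only [map_mul, ha]

theorem avg_eq_self {G : Type} [Group G] [Fintype G] {ρ : G → σ → σ} {a : Laurent σ}
    (ha : ∀ g, rename (ρ g) a = a) : avg ρ a = a := by
  rw [avg_apply]
  simp only [ha, sum_const, card_univ]
  rw [← Nat.cast_smul_eq_nsmul Coef, smul_smul, inv_mul_cancel₀, one_smul]
  exact Nat.cast_ne_zero.2 Fintype.card_ne_zero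

theorem laurent_sum_induction {P : Laurent (σ ⊕ τ) → Prop} (h0 : P 0)
    (hadd : ∀ f g, P f → P g → P (f + g))
    (hmul : ∀ (f : Laurent σ) (g : Laurent τ), P (rename Sum.inl f * rename Sum.inr g))
    (f : Laurent (σ ⊕ τ)) : P f := by
  refine AddMonoidAlgebra.induction_linear f h0 hadd fun m c => ?_
  have key : (AddMonoidAlgebra.single m c : Laurent (σ ⊕ τ)) =
      rename Sum.inl (AddMonoidAlgebra.single (m.comapDomain Sum.inl Sum.inl_injective.injOn) 1) *
        rename Sum.inr (AddMonoidAlgebra.single (m.comapDomain Sum.inr Sum.inr_injective.injOn) c) := by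
    have hm : m = Finsupp.mapDomain Sum.inl (m.comapDomain Sum.inl Sum.inl_injective.injOn) +
        Finsupp.mapDomain Sum.inr (m.comapDomain Sum.inr Sum.inr_injective.injOn) := by
      ext x
      rcases x with x | x
      · rw [Finsupp.add_apply, Finsupp.mapDomain_apply Sum.inl_injective,
          Finsupp.mapDomain_of_notMem_range _ _ (by simp)]
        simp
      · rw [Finsupp.add_apply, Finsupp.mapDomain_apply Sum.inr_injective,
          Finsupp.mapDomain_of_notMem_range _ _ (by simp)]
        simp
    conv_lhs => rw [hm]
    simp [rename, AddMonoidAlgebra.mapDomainAlgHom, AddMonoidAlgebra.single_mul_single]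
  rw [key]
  exact hmul _ _

theorem prod_primes_dvd {ι : Type*} (s : Finset ι) (q : ι → Laurent σ) (hq : ∀ i ∈ s, Prime (q i))
    (hne : ∀ i ∈ s, ∀ j ∈ s, i ≠ j → ¬ q i ∣ q j) {A : Laurent σ} (hA : ∀ i ∈ s, q i ∣ A) :
    ∏ i ∈ s, q i ∣ A := by
  classical
  induction s using Finset.induction_on with
  | empty => simp
  | insert i s hi ih =>
    obtain ⟨G, hG⟩ := ih (fun j hj => hq j (mem_insert_of_mem hj))
      (fun j hj k hk => hne j (mem_insert_of_mem hj) k (mem_insert_of_mem hk))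
      (fun j hj => hA j (mem_insert_of_mem hj))
    have hp := hq i (mem_insert_self i s)
    have h1 : q i ∣ (∏ i ∈ s, q i) * G := hG ▸ hA i (mem_insert_self i s)
    have h2 : ¬ q i ∣ ∏ i ∈ s, q i := by
      rw [hp.dvd_finsetProd_iff]
      rintro ⟨j, hj, h⟩
      exact hne i (mem_insert_self i s) j (mem_insert_of_mem hj) (by rintro rfl; exact hi hj) h
    obtain ⟨H, hH⟩ := (hp.dvd_or_dvd h1).resolve_left h2
    exact ⟨H, by rw [prod_insert hi, hG, hH]; ring⟩

end Averages

section SymLaurent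

variable {N n : ℕ} {lam : Fin N → ℕ}

theorem sigma_cast_eq {k : Fin N} (y : Roots lam) (h : y.1 = k) :
    (⟨k, Fin.cast (congrArg lam h) y.2⟩ : Roots lam) = y := by
  subst h; rfl

theorem exists_sigmaCongrRight (τ : Equiv.Perm (Roots lam)) (hτ : ∀ x, (τ x).1 = x.1) :
    ∃ π : ∀ k, Equiv.Perm (Fin (lam k)), ∀ x, τ x = Equiv.sigmaCongrRight π x := by
  have hinj : ∀ k, Function.Injective fun j : Fin (lam k) =>
      Fin.cast (congrArg lam (hτ ⟨k, j⟩)) (τ ⟨k, j⟩).2 := by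
    intro k i j hij
    have h1 := (sigma_cast_eq (τ ⟨k, i⟩) (hτ ⟨k, i⟩)).symm.trans
      ((congrArg (Sigma.mk k) hij).trans (sigma_cast_eq (τ ⟨k, j⟩) (hτ ⟨k, j⟩)))
    simpa using h1
  refine ⟨fun k => Equiv.ofBijective _ (Finite.injective_iff_bijective.1 (hinj k)), ?_⟩
  rintro ⟨k, j⟩
  exact (sigma_cast_eq (τ ⟨k, j⟩) (hτ ⟨k, j⟩)).symm

theorem symLaurent_rename {f : Laurent (Roots lam ⊕ Fin n)} (hf : f ∈ symLaurent n lam)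
    (τ : Equiv.Perm (Roots lam)) (hτ : ∀ x, (τ x).1 = x.1) : rename (Sum.map τ id) f = f := by
  obtain ⟨π, hπ⟩ := exists_sigmaCongrRight τ hτ
  have : (τ : Roots lam → Roots lam) = Equiv.sigmaCongrRight π := funext hπ
  rw [this]
  exact hf π

/-- The substitution `Γ ↦ z_I` may be made in any order. -/
theorem locPre_eq (I : Part n lam) (f : symLaurent n lam) (e : Roots lam ≃ Fin n)
    (he : ∀ x, I.1 (e x) = x.1) :
    locPre I f = rename (Sum.elim e id) (f : Laurent (Roots lam ⊕ Fin n)) := by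
  let L := Equiv.ofBijective _ (locVar_bijective I)
  have hL : ∀ x, I.1 (L x) = x.1 := colour_locVar I
  have h := symLaurent_rename f.2 (e.trans L.symm) fun x => by
    rw [← hL, Equiv.trans_apply, Equiv.apply_symm_apply, he]
  change rename (Sum.elim L id) (f : Laurent (Roots lam ⊕ Fin n)) = _
  rw [← congrArg (rename (Sum.elim L id)) h, rename_rename]
  congr 2
  ext x
  rcases x with x | x <;> simp

theorem card_fiber (e : Roots lam ≃ Fin n) (k : Fin N) :
    (univ.filter fun a => (e.symm a).1 = k).card = lam k := by
  rw [← Fintype.card_fin (lam k), ← card_univ]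
  refine (card_bij (fun j _ => e ⟨k, j⟩) (by simp) ?_ ?_).symm
  · intro a _ b _ h
    simpa using h
  · intro a ha
    have h1 : (e.symm a).1 = k := by simpa using ha
    refine ⟨Fin.cast (congrArg lam h1) (e.symm a).2, mem_univ _, ?_⟩
    rw [sigma_cast_eq _ h1, Equiv.apply_symm_apply]

/-- The action of `S_λ` on the variables. -/
def rootAct (n : ℕ) (lam : Fin N → ℕ) (π : ∀ k, Equiv.Perm (Fin (lam k))) :
    Roots lam ⊕ Fin n → Roots lam ⊕ Fin n := Sum.map (Equiv.sigmaCongrRight π) id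

theorem rootAct_mul (π ρ : ∀ k, Equiv.Perm (Fin (lam k))) :
    rootAct n lam (π * ρ) = rootAct n lam π ∘ rootAct n lam ρ := by
  ext x
  rcases x with ⟨k, x⟩ | x <;> rfl

theorem avg_rootAct_mem (f : Laurent (Roots lam ⊕ Fin n)) :
    avg (rootAct n lam) f ∈ symLaurent n lam :=
  fun π => rename_avg rootAct_mul π f

theorem avg_rootAct_eq {f : Laurent (Roots lam ⊕ Fin n)} (hf : f ∈ symLaurent n lam) :
    avg (rootAct n lam) f = f := avg_eq_self hf

theorem exists_mem_relIdeal_of_mul (e : Fin n ≃ Roots lam) {a : Laurent (Fin n)}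
    (ha : ∀ π : Equiv.Perm (Fin n), rename π a = a) (g : Laurent (Roots lam ⊕ Fin n)) :
    ∃ y ∈ relIdeal n lam, (y : Laurent (Roots lam ⊕ Fin n)) =
      avg (rootAct n lam) (g * (rename (Sum.inl ∘ e) a - rename Sum.inr a)) := by
  have hr : ∀ π, rename (rootAct n lam π) (rename (Sum.inl ∘ e) a - rename Sum.inr a) =
      rename (Sum.inl ∘ e) a - rename Sum.inr a := by
    intro π
    rw [map_sub, rename_rename, rename_rename]
    congr 1
    have : rootAct n lam π ∘ Sum.inl ∘ e =
        (Sum.inl ∘ e) ∘ ((e.trans (Equiv.sigmaCongrRight π)).trans e.symm) := by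
      ext y
      simp [rootAct]
    rw [this, ← rename_rename, ha]
  rw [avg_mul hr]
  let u : symLaurent n lam := ⟨avg (rootAct n lam) g, avg_rootAct_mem g⟩
  let v : symLaurent n lam := ⟨rename (Sum.inl ∘ e) a - rename Sum.inr a, hr⟩
  have hv : v ∈ relIdeal n lam := Ideal.subset_span ⟨a, ha, e, rfl⟩
  exact ⟨u * v, Ideal.mul_mem_left _ u hv, (symLaurent n lam).coe_mul u v⟩

/-- The difference of the values of a function `G(w, Γ, z)` that is symmetric in `w` at `w = Γ` and
`w = z`. -/
theorem exists_mem_relIdeal (e : Fin n ≃ Roots lam) {G : Laurent (Fin n ⊕ (Roots lam ⊕ Fin n))}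
    (hG : ∀ π : Equiv.Perm (Fin n), rename (Sum.map π id) G = G) :
    ∃ y ∈ relIdeal n lam, (y : Laurent (Roots lam ⊕ Fin n)) =
      avg (rootAct n lam) (rename (Sum.elim (Sum.inl ∘ e) id) G - rename (Sum.elim Sum.inr id) G) := by
  let ρ (π : Equiv.Perm (Fin n)) : Fin n ⊕ (Roots lam ⊕ Fin n) → Fin n ⊕ (Roots lam ⊕ Fin n) :=
    Sum.map π id
  rw [← avg_eq_self (ρ := ρ) hG]
  refine laurent_sum_induction (P := fun H => ∃ y ∈ relIdeal n lam,
    (y : Laurent (Roots lam ⊕ Fin n)) = avg (rootAct n lam)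
      (rename (Sum.elim (Sum.inl ∘ e) id) (avg ρ H) - rename (Sum.elim Sum.inr id) (avg ρ H)))
    ?_ ?_ ?_ G
  · refine ⟨0, zero_mem _, ?_⟩
    rw [map_zero, map_zero, map_zero, sub_zero, map_zero]
    rfl
  · rintro f g ⟨y, hy, h1⟩ ⟨z, hz, h2⟩
    refine ⟨y + z, add_mem hy hz, ?_⟩
    change (y : Laurent (Roots lam ⊕ Fin n)) + z = _
    rw [h1, h2, ← map_add]
    congr 1
    rw [map_add, map_add, map_add, add_sub_add_comm]
  · intro f g
    have hρ : avg ρ (rename Sum.inl f * rename Sum.inr g) =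
        rename Sum.inl (avg (fun π : Equiv.Perm (Fin n) => (π : Fin n → Fin n)) f) *
          rename Sum.inr g := by
      rw [mul_comm, mul_comm _ (rename Sum.inr g), avg_apply, avg_apply, map_smul, mul_smul_comm,
        map_sum, mul_sum]
      congr 1
      refine sum_congr rfl fun π _ => ?_
      rw [map_mul, rename_rename, rename_rename, rename_rename]
      rfl
    have hsym : ∀ π : Equiv.Perm (Fin n),
        rename π (avg (fun π : Equiv.Perm (Fin n) => (π : Fin n → Fin n)) f) =
          avg (fun π : Equiv.Perm (Fin n) => (π : Fin n → Fin n)) f := fun π =>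
      rename_avg (ρ := fun π : Equiv.Perm (Fin n) => (π : Fin n → Fin n)) (fun _ _ => rfl) π f
    obtain ⟨y, hy, h1⟩ := exists_mem_relIdeal_of_mul e hsym g
    refine ⟨y, hy, h1.trans (congrArg _ ?_)⟩
    rw [hρ, map_mul, map_mul, rename_rename, rename_rename, rename_rename, rename_rename,
      Sum.elim_comp_inl, Sum.elim_comp_inr, Sum.elim_comp_inl, Sum.elim_comp_inr, rename_id, ← sub_mul,
      mul_comm]

/-- A class vanishes if all its restrictions to the fixed points vanish. -/
theorem mem_relIdeal_of_locPre (hlam : ∑ k, lam k = n) (x : symLaurent n lam)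
    (hx : ∀ I : Part n lam, locPre I x = 0) : x ∈ relIdeal n lam := by
  obtain ⟨e⟩ : Nonempty (Fin n ≃ Roots lam) := Fintype.card_eq.1 (by simp [hlam])
  let F (s : Equiv.Perm (Fin n)) : Laurent (Fin n ⊕ (Roots lam ⊕ Fin n)) :=
    rename (Sum.elim (fun y => Sum.inl (s (e.symm y))) (fun a => Sum.inr (Sum.inr a)))
      (x : Laurent (Roots lam ⊕ Fin n))
  let Bf (s : Equiv.Perm (Fin n)) : Laurent (Fin n ⊕ (Roots lam ⊕ Fin n)) :=
    ∏ p ∈ ltPairs n, (var (Sum.inl (s p.1)) - var (Sum.inr (Sum.inl (e p.2))))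
  let A : Laurent (Fin n ⊕ (Roots lam ⊕ Fin n)) :=
    ∑ s : Equiv.Perm (Fin n), (Equiv.Perm.sign s : ℤ) • (F s * Bf s)
  have hA : ∀ π : Equiv.Perm (Fin n),
      rename (Sum.map π id) A = (Equiv.Perm.sign π : ℤ) • A := by
    intro π
    have h1 : ∀ s, rename (Sum.map π id) (F s * Bf s) = F (π * s) * Bf (π * s) := by
      intro s
      rw [map_mul, rename_rename, map_prod]
      congr 1
      · congr 2
        ext y
        rcases y with y | y <;> rfl
      · refine prod_congr rfl fun p _ => ?_
        rw [map_sub, rename_var, rename_var]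
        rfl
    have h2 := Equiv.sum_comp (Equiv.mulLeft π)
      fun s : Equiv.Perm (Fin n) => (Equiv.Perm.sign s : ℤ) • (F s * Bf s)
    change rename (Sum.map π id) A = (Equiv.Perm.sign π : ℤ) •
      ∑ s : Equiv.Perm (Fin n), (Equiv.Perm.sign s : ℤ) • (F s * Bf s)
    rw [← h2, map_sum, smul_sum]
    refine sum_congr rfl fun s _ => ?_
    rw [map_zsmul, h1, Equiv.coe_mulLeft, smul_smul, Equiv.Perm.sign_mul, Units.val_mul, ← mul_assoc,
      ← Units.val_mul, Int.units_mul_self, Units.val_one, one_mul]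
  let q (p : Fin n × Fin n) : Laurent (Fin n ⊕ (Roots lam ⊕ Fin n)) :=
    binom (Sum.inl p.1) (Sum.inl p.2) ((1 : Coefˣ) : Coef)
  have hq : ∀ p ∈ ltPairs n, Prime (q p) := fun p hp =>
    prime_binom 1 fun h => (mem_ltPairs.1 hp).ne (Sum.inl_injective h)
  have hqA : ∀ p ∈ ltPairs n, q p ∣ A := by
    intro p hp
    have hne : (Sum.inl p.1 : Fin n ⊕ (Roots lam ⊕ Fin n)) ≠ Sum.inl p.2 :=
      fun h => (mem_ltPairs.1 hp).ne (Sum.inl_injective h)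
    have h1 := binom_dvd_swap_sub hne A
    have h2 : (Equiv.swap (Sum.inl p.1) (Sum.inl p.2) : Fin n ⊕ (Roots lam ⊕ Fin n) → _) =
        Sum.map (Equiv.swap p.1 p.2) id := by
      ext x
      rcases x with x | x
      · rw [← Sum.inl_injective.map_swap]; rfl
      · rw [Equiv.swap_apply_of_ne_of_ne (by simp) (by simp)]; rfl
    rw [h2, hA, Equiv.Perm.sign_swap (mem_ltPairs.1 hp).ne] at h1
    have h3 : ((-1 : ℤˣ) : ℤ) • A - A = algebraMap Coef _ (-2) * A := by
      rw [map_neg, map_ofNat]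
      simp
      ring
    rw [h3] at h1
    refine ((hq p hp).dvd_or_dvd h1).resolve_left fun h4 => (hq p hp).not_isUnit ?_
    exact isUnit_of_dvd_unit h4 (IsUnit.map _ (isUnit_iff_ne_zero.2 (by norm_num)))
  obtain ⟨G, hG⟩ := prod_primes_dvd (ltPairs n) q hq (by
    rintro ⟨b, a⟩ hp ⟨d, c⟩ hp' hne h
    have h1 := mem_ltPairs.1 hp
    have h2 := mem_ltPairs.1 hp'
    rcases eq_of_binom_dvd (fun h => h1.ne (Sum.inl_injective h)) (one_ne_zero) h
      (fun h => h2.ne (Sum.inl_injective h)) with ⟨e1, e2, -⟩ | ⟨e1, e2, -⟩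
    · exact hne (Prod.ext (Sum.inl_injective e1).symm (Sum.inl_injective e2).symm)
    · rw [Sum.inl_injective e1, Sum.inl_injective e2] at h2
      exact h1.not_gt h2) hqA
  have hΔ0 : ∏ p ∈ ltPairs n, q p ≠ 0 := prod_ne_zero_iff.2 fun p hp => (hq p hp).ne_zero
  have hGsym : ∀ π : Equiv.Perm (Fin n), rename (Sum.map π id) G = G := by
    refine perm_induction ?_ (fun i j hij => ?_) (fun π ρ h1 h2 => ?_)
    · have : (Sum.map ((1 : Equiv.Perm (Fin n)) : Fin n → Fin n) id :
          Fin n ⊕ (Roots lam ⊕ Fin n) → _) = id := by ext x; rcases x with x | x <;> rfl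
      rw [this, rename_id]
    · have h1 := prod_ltPairs_swap hij (fun b a => (binom (Sum.inl b) (Sum.inl a) ((1 : Coefˣ) : Coef) :
        Laurent (Fin n ⊕ (Roots lam ⊕ Fin n))))
      have h2 : (binom (Sum.inl j) (Sum.inl i) ((1 : Coefˣ) : Coef) :
          Laurent (Fin n ⊕ (Roots lam ⊕ Fin n))) =
          -binom (Sum.inl i) (Sum.inl j) ((1 : Coefˣ) : Coef) := by
        rw [binom, binom, Units.val_one, map_one, one_mul, one_mul, neg_sub]
      have hb : (binom (Sum.inl i) (Sum.inl j) ((1 : Coefˣ) : Coef) :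
          Laurent (Fin n ⊕ (Roots lam ⊕ Fin n))) ≠ 0 :=
        binom_ne_zero (Or.inl fun h => adj_ne hij (Sum.inl_injective h))
      rw [h2, neg_mul, mul_comm, ← mul_neg] at h1
      have h3 := mul_left_cancel₀ hb h1
      have h4 := hA (Equiv.swap i j)
      rw [hG, map_mul, map_prod, Equiv.Perm.sign_swap (adj_ne hij)] at h4
      simp only [q, rename_binom, Sum.map_inl] at h4
      rw [Units.val_neg, Units.val_one (α := ℤ), neg_smul, one_smul, h3, neg_mul, neg_inj] at h4
      exact mul_left_cancel₀ hΔ0 h4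
    · have : (Sum.map ((π * ρ : Equiv.Perm (Fin n)) : Fin n → Fin n) id :
          Fin n ⊕ (Roots lam ⊕ Fin n) → _) = Sum.map π id ∘ Sum.map ρ id := by
        ext x; rcases x with x | x <;> rfl
      rw [this, ← rename_rename, h2, h1]
  let E1 : Fin n ⊕ (Roots lam ⊕ Fin n) → Roots lam ⊕ Fin n := Sum.elim (Sum.inl ∘ e) id
  let E2 : Fin n ⊕ (Roots lam ⊕ Fin n) → Roots lam ⊕ Fin n := Sum.elim Sum.inr id
  have hE1 : rename E1 G = x := by
    have h1 : rename E1 A = (x : Laurent (Roots lam ⊕ Fin n)) * rename E1 (∏ p ∈ ltPairs n, q p) := by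
      change rename E1 (∑ s : Equiv.Perm (Fin n), (Equiv.Perm.sign s : ℤ) • (F s * Bf s)) = _
      rw [map_sum, sum_eq_single 1]
      · rw [Equiv.Perm.sign_one, Units.val_one, one_smul, map_mul, rename_rename, map_prod, map_prod]
        congr 1
        · convert rename_id (x : Laurent (Roots lam ⊕ Fin n)) using 2
          congr 1
          ext y
          rcases y with y | y <;> simp [E1]
        · refine prod_congr rfl fun p _ => ?_
          rw [map_sub, rename_var, rename_var, rename_binom, binom, Units.val_one, map_one, one_mul]
          rfl
      · intro s _ hs
        obtain ⟨k, hk⟩ := (perm_moves s hs).1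
        rw [map_zsmul, map_mul, map_prod,
          prod_eq_zero (i := (k, s k)) (mem_ltPairs.2 hk), mul_zero, smul_zero]
        rw [map_sub, rename_var, rename_var]
        exact sub_self _
      · intro h; exact absurd (mem_univ _) h
    rw [hG, map_mul, mul_comm] at h1
    refine mul_right_cancel₀ ?_ h1
    rw [map_prod]
    refine prod_ne_zero_iff.2 fun p hp => ?_
    rw [rename_binom]
    refine binom_ne_zero (Or.inl fun h => (mem_ltPairs.1 hp).ne ?_)
    simpa [E1] using h
  have hE2 : rename E2 G = 0 := by
    have h1 : rename E2 A = 0 := by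
      change rename E2 (∑ s : Equiv.Perm (Fin n), (Equiv.Perm.sign s : ℤ) • (F s * Bf s)) = _
      rw [map_sum]
      refine sum_eq_zero fun s _ => ?_
      rw [map_zsmul, map_mul, rename_rename]
      let e' : Roots lam ≃ Fin n := e.symm.trans s
      have h2 := locPre_eq ⟨fun a => (e'.symm a).1, card_fiber e'⟩ x e' (by simp)
      rw [hx] at h2
      have h3 : E2 ∘ (Sum.elim (fun y => Sum.inl (s (e.symm y))) (fun a => Sum.inr (Sum.inr a))) =
          Sum.inr ∘ Sum.elim e' id := by
        ext y
        rcases y with y | y <;> rfl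
      rw [h3, ← rename_rename, ← h2, map_zero, zero_mul, smul_zero]
    rw [hG, map_mul] at h1
    refine (mul_eq_zero.1 h1).resolve_left ?_
    rw [map_prod]
    refine prod_ne_zero_iff.2 fun p hp => ?_
    rw [rename_binom]
    refine binom_ne_zero (Or.inl fun h => (mem_ltPairs.1 hp).ne ?_)
    simpa [E2] using h
  obtain ⟨y, hy, h1⟩ := exists_mem_relIdeal e hGsym
  rw [hE1, hE2, sub_zero, avg_rootAct_eq x.2] at h1
  rwa [← Subtype.ext h1]

end SymLaurent

end LoopK

end

noncomputable section

namespace LoopK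

open Finset Matrix

section Coordinates

variable {N n : ℕ} {xi : (Fin n → Fin N) → V N n}

theorem xiCoord_add (w w' : V N n) : xiCoord xi (w + w') = xiCoord xi w + xiCoord xi w' :=
  mulVec_add _ _ _

theorem xiCoord_smul (c : RatF (Fin n)) (w : V N n) : xiCoord xi (c • w) = c • xiCoord xi w :=
  mulVec_smul _ _ _

theorem xiCoord_sum {ι : Type*} (s : Finset ι) (w : ι → V N n) :
    xiCoord xi (∑ k ∈ s, w k) = ∑ k ∈ s, xiCoord xi (w k) :=
  map_sum (AddMonoidHom.mk' (xiCoord xi) xiCoord_add) w s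

theorem xiCoord_xi (hxi : IsXi xi) (I : Fin n → Fin N) : xiCoord xi (xi I) = Pi.single I 1 := by
  apply xiCoord_unique hxi
  rw [sum_eq_single I]
  · rw [Pi.single_eq_same, one_smul]
  · intro J _ hJ
    rw [Pi.single_eq_of_ne hJ, zero_smul]
  · intro h; exact absurd (mem_univ _) h

theorem nuLam_apply (lam : Fin N → ℕ) (x : KLam n lam) : nuLam xi lam x = ∑ I : Part n lam,
    (algebraMap (Laurent (Fin n)) (RatF (Fin n)) (loc I x) / Rz I.1) • xi I.1 := rfl

theorem nu_inc (lam : Weight N n) (x : KLam n lam.1) : nu xi (inc lam x) = nuLam xi lam.1 x := by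
  classical
  rw [nu, inc]
  exact DirectSum.toModule_lof (M := fun lam : Weight N n => KLam n lam.1) Coef lam x

theorem loc_cls {lam : Fin N → ℕ} (I : Part n lam) (f : symLaurent n lam) :
    loc I (cls f) = locPre I f := rfl

theorem cls_surjective {lam : Fin N → ℕ} (x : KLam n lam) : ∃ f, cls f = x :=
  Ideal.Quotient.mk_surjective x

theorem xiCoord_nuLam (hxi : IsXi xi) (lam : Fin N → ℕ) (x : KLam n lam) (I : Part n lam) :
    xiCoord xi (nuLam xi lam x) I.1 = algebraMap _ (RatF (Fin n)) (loc I x) / Rz I.1 := by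
  rw [nuLam_apply, xiCoord_sum, Finset.sum_apply, sum_eq_single I]
  · rw [xiCoord_smul, xiCoord_xi hxi, Pi.smul_apply, Pi.single_eq_same, smul_eq_mul, mul_one]
  · intro J _ hJ
    rw [xiCoord_smul, xiCoord_xi hxi, Pi.smul_apply, Pi.single_eq_of_ne (fun h => hJ (Subtype.ext h.symm)),
      smul_zero]
  · intro h; exact absurd (mem_univ _) h

theorem part_weight_eq {lam mu : Fin N → ℕ} (I : Part n lam) (J : Part n mu) (h : I.1 = J.1) :
    lam = mu := by
  ext k
  rw [← I.2 k, ← J.2 k, h]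

theorem xiCoord_nuLam_of_ne (hxi : IsXi xi) {lam mu : Fin N → ℕ} (hne : mu ≠ lam) (x : KLam n mu)
    (I : Part n lam) : xiCoord xi (nuLam xi mu x) I.1 = 0 := by
  rw [nuLam_apply, xiCoord_sum, Finset.sum_apply]
  refine sum_eq_zero fun J _ => ?_
  rw [xiCoord_smul, xiCoord_xi hxi, Pi.smul_apply,
    Pi.single_eq_of_ne (fun h => hne (part_weight_eq J I h.symm)), smul_zero]

theorem Rz_ne_zero (I : Fin n → Fin N) : Rz I ≠ 0 := by
  refine prod_ne_zero_iff.2 fun a _ => prod_ne_zero_iff.2 fun b _ => ?_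
  split_ifs with h
  · have h1 : (rvar a : RatF (Fin n)) ≠ 0 := rvar_ne_zero a
    rw [one_sub_div h1]
    exact div_ne_zero (rvar_sub_ne_zero (by rintro rfl; exact h.ne rfl)) h1
  · exact one_ne_zero

theorem KT_induction {P : KT N n → Prop} (h0 : P 0) (hadd : ∀ x y, P x → P y → P (x + y))
    (hinc : ∀ (lam : Weight N n) (f : symLaurent n lam.1), P (inc lam (cls f))) (x : KT N n) : P x := by
  classical
  refine DirectSum.induction_on x h0 (fun lam y => ?_) hadd
  obtain ⟨f, rfl⟩ := cls_surjective y
  exact hinc lam f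

theorem xiCoord_nu (hxi : IsXi xi) (x : KT N n) (lam : Weight N n) (I : Part n lam.1) :
    xiCoord xi (nu xi x) I.1 = algebraMap _ (RatF (Fin n)) (loc I (x lam)) / Rz I.1 := by
  classical
  refine KT_induction (P := fun x => xiCoord xi (nu xi x) I.1 =
    algebraMap _ (RatF (Fin n)) (loc I (x lam)) / Rz I.1) ?_ ?_ ?_ x
  · rw [map_zero, DirectSum.zero_apply, map_zero, map_zero, zero_div]
    exact congrFun (mulVec_zero _) _
  · intro x y hx hy
    rw [map_add, xiCoord_add, Pi.add_apply, hx, hy, DirectSum.add_apply, map_add, map_add, add_div]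
  · intro mu f
    rw [nu_inc]
    by_cases h : mu = lam
    · subst h
      rw [xiCoord_nuLam hxi]
      congr 3
      exact (DirectSum.of_eq_same (β := fun lam : Weight N n => KLam n lam.1) mu (cls f)).symm
    · rw [xiCoord_nuLam_of_ne hxi (fun h' => h (Subtype.ext h'))]
      have : (inc mu (cls f) : KT N n) lam = 0 :=
        DirectSum.of_eq_of_ne (β := fun lam : Weight N n => KLam n lam.1) mu lam (cls f) (Ne.symm h)
      rw [this, map_zero, map_zero, zero_div]

theorem nu_injective (hxi : IsXi xi) : Function.Injective (nu xi) := by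
  intro x y hxy
  refine DFinsupp.ext fun lam => ?_
  obtain ⟨f, hf⟩ := cls_surjective (x lam)
  obtain ⟨g, hg⟩ := cls_surjective (y lam)
  change x lam = y lam
  rw [← hf, ← hg]
  refine Ideal.Quotient.eq.2 (mem_relIdeal_of_locPre lam.2 _ fun I => ?_)
  have h1 := xiCoord_nu hxi x lam I
  rw [hxy, xiCoord_nu hxi y lam I, div_left_inj' (Rz_ne_zero _)] at h1
  rw [map_sub, ← loc_cls, ← loc_cls, hf, hg, IsFractionRing.injective _ _ h1, sub_self]

theorem Rz_perm (I : Fin n → Fin N) (π : Equiv.Perm (Fin n)) : permute π (Rz (I ∘ π)) = Rz I := by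
  rw [Rz, Rz, map_prod]
  refine Eq.trans (prod_congr rfl fun a _ => ?_) (Equiv.prod_comp π _)
  rw [map_prod]
  refine Eq.trans (prod_congr rfl fun b _ => ?_) (Equiv.prod_comp π _)
  rw [apply_ite (permute π), map_one, map_sub, map_one, map_div₀, permute_rvar, permute_rvar]
  rfl

/-- `R(z_I)⁻¹` as a product over all pairs of different indices. -/
theorem Rz_inv (I : Fin n → Fin N) : (Rz I)⁻¹ = ∏ p ∈ (univ : Finset (Fin n)).offDiag,
    if I p.1 < I p.2 then rvar p.1 * (rvar p.1 - rvar p.2 : RatF (Fin n))⁻¹ else 1 := by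
  rw [Rz, ← prod_product', ← prod_inv_distrib]
  refine Eq.trans (prod_subset (s₁ := univ.offDiag) (fun p hp => by simp) fun p _ hp => ?_).symm ?_
  · have : p.1 = p.2 := by simpa using hp
    simp [this]
  · refine prod_congr rfl fun p hp => ?_
    split_ifs with h
    · have h1 : (rvar p.1 : RatF (Fin n)) ≠ 0 := rvar_ne_zero _
      rw [one_sub_div h1, inv_div, div_eq_mul_inv]
    · exact inv_one

end Coordinates

section Image

variable {N n : ℕ} {xi : (Fin n → Fin N) → V N n}

theorem algebraMap_binom_one {σ : Type} (a b : σ) :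
    algebraMap _ (RatF σ) (binom a b ((1 : Coefˣ) : Coef)) = rvar a - rvar b := by
  rw [algebraMap_binom, Units.val_one, map_one, one_mul]

theorem inv_sub_rh_mem_Reg {σ : Type} {a b : σ} (hab : a ≠ b) {c d : σ} (hcd : c ≠ d) :
    (rvar c - rh * rvar d : RatF σ)⁻¹ ∈ Reg (prime_binom (1 : Coefˣ) hab) := by
  rw [rh, ← algebraMap_binom]
  refine inv_mem_Reg _ fun h => ?_
  rcases eq_of_binom_dvd hab hh_ne_zero h hcd with ⟨-, -, h1⟩ | ⟨-, -, h1⟩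
  · exact hh_ne_one h1
  · rw [Units.val_one, mul_one] at h1
    exact hh_ne_one h1

theorem inv_sub_mem_Reg {σ : Type} {a b : σ} (hab : a ≠ b) {c d : σ} (hcd : c ≠ d)
    (h1 : ¬ (c = a ∧ d = b)) (h2 : ¬ (c = b ∧ d = a)) :
    (rvar c - rvar d : RatF σ)⁻¹ ∈ Reg (prime_binom (1 : Coefˣ) hab) := by
  rw [← algebraMap_binom_one]
  refine inv_mem_Reg _ fun h => ?_
  rcases eq_of_binom_dvd hab (Units.ne_zero _) h hcd with ⟨e1, e2, -⟩ | ⟨e1, e2, -⟩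
  · exact h1 ⟨e1, e2⟩
  · exact h2 ⟨e1, e2⟩

theorem laurentRange_le_Reg {σ : Type} {q : Laurent σ} (hq : Prime q) : laurentRange σ ≤ Reg hq := by
  rintro _ ⟨f, rfl⟩
  exact algebraMap_mem_Reg hq f

theorem sub_mul_inv_sub_swap {E : Type*} [Field E] {x y : E} (h : x - y ≠ 0) :
    (x - y) * (y - x)⁻¹ = -1 := by
  rw [← neg_sub x y, inv_neg, mul_neg, mul_inv_cancel₀ h]

theorem sub_mul_Rz_inv_mem_Reg {a b : Fin n} (hab : a ≠ b) (I : Fin n → Fin N) :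
    (rvar a - rvar b) * (Rz I)⁻¹ ∈ Reg (prime_binom (1 : Coefˣ) hab) := by
  classical
  have hv : ∀ c : Fin n, rvar c ∈ Reg (prime_binom (1 : Coefˣ) hab) := fun c => algebraMap_mem_Reg _ _
  have hm1 : (a, b) ∈ (univ : Finset (Fin n)).offDiag := by simpa using hab
  have hm2 : (b, a) ∈ ((univ : Finset (Fin n)).offDiag).erase (a, b) := by
    rw [mem_erase]; exact ⟨fun h => hab (Prod.mk.inj h).2, by simpa using hab.symm⟩
  have h0 : (rvar a - rvar b : RatF (Fin n)) ≠ 0 := rvar_sub_ne_zero hab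
  rw [Rz_inv, ← mul_prod_erase _ _ hm1, ← mul_prod_erase _ _ hm2, ← mul_assoc, ← mul_assoc]
  refine mul_mem ?_ (prod_mem fun p hp => ?_)
  · by_cases h1 : I a < I b
    · rw [if_pos h1, if_neg h1.not_gt, mul_one, mul_left_comm, mul_inv_cancel₀ h0, mul_one]
      exact hv a
    · by_cases h2 : I b < I a
      · rw [if_neg h1, if_pos h2, mul_one, mul_left_comm, sub_mul_inv_sub_swap h0, mul_neg, mul_one]
        exact neg_mem (hv b)
      · rw [if_neg h1, if_neg h2, mul_one, mul_one]
        exact sub_mem (hv a) (hv b)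
  · simp only [mem_erase, mem_offDiag] at hp
    split_ifs
    · refine mul_mem (hv _) (inv_sub_mem_Reg hab hp.2.2.2.2 ?_ ?_)
      · rintro ⟨e1, e2⟩; exact hp.2.1 (Prod.ext e1 e2)
      · rintro ⟨e1, e2⟩; exact hp.1 (Prod.ext e1 e2)
    · exact one_mem _

theorem inv_denD_mem_Reg {a b : Fin n} (hab : a ≠ b) : (denD n)⁻¹ ∈ Reg (prime_binom (1 : Coefˣ) hab) := by
  rw [denD, ← prod_inv_distrib]
  exact prod_mem fun p hp => inv_sub_rh_mem_Reg hab (mem_ltPairs.1 hp).ne'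

theorem denD_ne_zero : denD n ≠ 0 :=
  prod_ne_zero_iff.2 fun _ _ => rvar_sub_rh_mul_ne_zero _ _

theorem xi_mem_Reg (hxi : IsXi xi) {a b : Fin n} (hab : a ≠ b) (I J : Fin n → Fin N) :
    xi I J ∈ Reg (prime_binom (1 : Coefˣ) hab) := by
  have := mul_mem (inv_denD_mem_Reg hab) (laurentRange_le_Reg (prime_binom 1 hab) (denD_mul_xi hxi I J))
  rwa [inv_mul_cancel_left₀ denD_ne_zero] at this

/-- An invariant function with at most simple poles at `z_i = z_{i+1}` is regular there. -/
theorem mem_Reg_of_sTilde {i j : Fin n} (hij : (i : ℕ) + 1 = j) {v : V N n} (hv : sTilde i j v = v)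
    (h1 : ∀ J, (rvar i - rvar j) * v J ∈ Reg (prime_binom (1 : Coefˣ) (adj_ne hij))) (J : Fin n → Fin N) :
    v J ∈ Reg (prime_binom (1 : Coefˣ) (adj_ne hij)) := by
  have hp := prime_binom (1 : Coefˣ) (adj_ne hij)
  have hsw : rename (Equiv.swap i j) (binom i j ((1 : Coefˣ) : Coef)) ∣ binom i j ((1 : Coefˣ) : Coef) := by
    rw [rename_binom, Equiv.swap_apply_left, Equiv.swap_apply_right]
    exact ⟨-1, by rw [binom, binom, Units.val_one, map_one, one_mul, one_mul]; ring⟩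
  have h2 : ∀ J, (rvar i - rvar j) * permute (Equiv.swap i j) (v J) ∈ Reg hp := by
    intro J
    have := neg_mem (permute_mem_Reg hp hp (Equiv.swap i j) hsw (h1 J))
    rw [map_mul, map_sub, permute_rvar, permute_rvar, Equiv.swap_apply_left, Equiv.swap_apply_right,
      ← neg_mul, neg_sub] at this
    exact this
  refine mem_Reg_of_swap (adj_ne hij) (by rw [algebraMap_binom_one]; exact h1 J) ?_
  have h3 := congrFun hv J
  rw [sTilde_apply] at h3
  have h0 : (rvar j - rh * rvar i : RatF (Fin n)) ≠ 0 := rvar_sub_rh_mul_ne_zero j i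
  have hrh : (rh : RatF (Fin n)) ∈ Reg hp := laurentRange_le_Reg hp rh_mem_laurentRange
  have h4 := inv_mul_cancel₀ h0
  have hinv := inv_sub_rh_mem_Reg (adj_ne hij) (adj_ne hij).symm
  rcases lt_trichotomy (J i) (J j) with h | h | h
  · rw [wa_gt _ _ _ h, wb_gt _ _ _ h] at h3
    have : v J - permute (Equiv.swap i j) (v J) = (rvar j - rh * rvar i : RatF (Fin n))⁻¹ *
        (-(rh * ((rvar i - rvar j) * permute (Equiv.swap i j) (v (J ∘ Equiv.swap i j)))) +
          (rvar i - rvar j) * permute (Equiv.swap i j) (v J)) := by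
      linear_combination -h3 + permute (Equiv.swap i j) (v J) * h4
    rw [this]
    exact mul_mem hinv (add_mem (neg_mem (mul_mem hrh (h2 _))) (h2 _))
  · rw [comp_swap_of_eq h, h, wa_self, wb_self, zero_mul, add_zero, inv_mul_cancel_left₀ h0] at h3
    rw [h3, sub_self]
    exact zero_mem _
  · rw [wa_lt _ _ _ h, wb_lt _ _ _ h] at h3
    have : v J - permute (Equiv.swap i j) (v J) = (rvar j - rh * rvar i : RatF (Fin n))⁻¹ *
        (-((rvar i - rvar j) * permute (Equiv.swap i j) (v (J ∘ Equiv.swap i j))) +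
          rh * ((rvar i - rvar j) * permute (Equiv.swap i j) (v J))) := by
      linear_combination -h3 + permute (Equiv.swap i j) (v J) * h4
    rw [this]
    exact mul_mem hinv (add_mem (neg_mem (h2 _)) (mul_mem hrh (h2 _)))

theorem mem_Reg_of_invariant {v : V N n}
    (hv : ∀ i j : Fin n, (i : ℕ) + 1 = j → sTilde i j v = v)
    (h1 : ∀ {a b : Fin n} (hab : a ≠ b) J, (rvar a - rvar b) * v J ∈ Reg (prime_binom (1 : Coefˣ) hab))
    {a b : Fin n} (hab : a < b) (J : Fin n → Fin N) : v J ∈ Reg (prime_binom (1 : Coefˣ) hab.ne) := by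
  obtain ⟨b, hb⟩ := b
  induction b generalizing J with
  | zero => exact absurd (Fin.lt_def.1 hab) (Nat.not_lt_zero _)
  | succ c ih =>
    by_cases hac : (a : ℕ) = c
    · have hij : (a : ℕ) + 1 = (⟨c + 1, hb⟩ : Fin n) := by simp [hac]
      exact mem_Reg_of_sTilde hij (hv _ _ hij) (h1 hab.ne) J
    · have hac' : (a : ℕ) < c := by
        have := Fin.lt_def.1 hab
        simp only at this
        omega
      have hc : c < n := by omega
      have hij : ((⟨c, hc⟩ : Fin n) : ℕ) + 1 = (⟨c + 1, hb⟩ : Fin n) := rfl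
      have ih' := fun J => ih J hc (Fin.lt_def.2 hac')
      have hq := prime_binom (1 : Coefˣ) (Fin.ne_of_lt (Fin.lt_def.2 hac' : a < ⟨c, hc⟩))
      have hq' := prime_binom (1 : Coefˣ) hab.ne
      have hren : rename (Equiv.swap (⟨c, hc⟩ : Fin n) ⟨c + 1, hb⟩)
          (binom a ⟨c, hc⟩ ((1 : Coefˣ) : Coef)) ∣ binom a ⟨c + 1, hb⟩ ((1 : Coefˣ) : Coef) := by
        rw [rename_binom, Equiv.swap_apply_left, Equiv.swap_apply_of_ne_of_ne]
        · exact Fin.ne_of_lt (Fin.lt_def.2 hac')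
        · exact hab.ne
      have h3 := congrFun (hv _ _ hij) J
      rw [sTilde_apply] at h3
      rw [← h3]
      have hL := laurentRange_le_Reg hq'
      refine mul_mem (inv_sub_rh_mem_Reg hab.ne (adj_ne hij).symm) (add_mem (mul_mem ?_ ?_) (mul_mem ?_ ?_))
      · exact wa_mem _ (hL rh_mem_laurentRange) (hL (rvar_mem_laurentRange _)) (hL (rvar_mem_laurentRange _)) _ _
      · exact permute_mem_Reg hq hq' _ hren (ih' _)
      · exact wb_mem _ (hL rh_mem_laurentRange) (hL (rvar_mem_laurentRange _)) (hL (rvar_mem_laurentRange _)) _ _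
      · exact permute_mem_Reg hq hq' _ hren (ih' _)

end Image

end LoopK

end

noncomputable section

namespace LoopK

open Finset Matrix

section Range

variable {N n : ℕ} {xi : (Fin n → Fin N) → V N n}

theorem inv_rvar_mem_laurentRange {σ : Type} (i : σ) : (rvar i : RatF σ)⁻¹ ∈ laurentRange σ := by
  obtain ⟨u, hu⟩ := isUnit_var i
  refine ⟨(u⁻¹ : (Laurent σ)ˣ), eq_inv_of_mul_eq_one_left ?_⟩
  rw [rvar, ← hu, ← map_mul, Units.inv_mul, map_one]

/-- The weight of a colouring. -/
def wt (I : Fin n → Fin N) : Weight N n :=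
  ⟨fun k => (univ.filter fun a => I a = k).card, by
    rw [← card_eq_sum_card_fiberwise (fun _ _ => mem_univ _), card_univ, Fintype.card_fin]⟩

/-- A colouring as a set partition of its weight. -/
def toPart (I : Fin n → Fin N) : Part n (wt I).1 := ⟨I, fun _ => rfl⟩

theorem part_comp {lam : Fin N → ℕ} (I : Part n lam) (π : Equiv.Perm (Fin n)) (k : Fin N) :
    (univ.filter fun a => (I.1 ∘ π) a = k).card = lam k := by
  rw [← I.2 k]
  refine card_bij (fun a _ => π a) (fun a ha => by simpa using ha) (fun a _ b _ h => π.injective h)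
    fun a ha => ⟨π.symm a, by simpa using ha, by simp⟩

/-- The set partition with the colouring `I ∘ π`. -/
def Part.comp {lam : Fin N → ℕ} (I : Part n lam) (π : Equiv.Perm (Fin n)) : Part n lam :=
  ⟨I.1 ∘ π, part_comp I π⟩

/-- The substitution of `z_I` as a bijection. -/
def locEquiv {lam : Fin N → ℕ} (I : Part n lam) : Roots lam ≃ Fin n :=
  Equiv.ofBijective _ (locVar_bijective I)

theorem colour_locEquiv {lam : Fin N → ℕ} (I : Part n lam) (x : Roots lam) : I.1 (locEquiv I x) = x.1 :=
  colour_locVar I x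

theorem locPre_comp {lam : Fin N → ℕ} (I : Part n lam) {f : symLaurent n lam} {f' : Laurent (Roots lam)}
    (hf : (f : Laurent (Roots lam ⊕ Fin n)) = rename Sum.inl f') (π : Equiv.Perm (Fin n)) :
    rename π (locPre (I.comp π) f) = locPre I f := by
  rw [locPre_eq I f ((locEquiv (I.comp π)).trans π) fun x => colour_locEquiv (I.comp π) x,
    locPre_eq (I.comp π) f (locEquiv (I.comp π)) (colour_locEquiv _), hf, rename_rename, rename_rename,
    rename_rename]
  rfl

theorem xiCoord_ext (hxi : IsXi xi) {v w : V N n} (h : ∀ I, xiCoord xi v I = xiCoord xi w I) : v = w := by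
  rw [← sum_xiCoord hxi v, ← sum_xiCoord hxi w]
  simp only [h]

theorem sTilde_nuLam (hxi : IsXi xi) {lam : Fin N → ℕ} {f : symLaurent n lam} {f' : Laurent (Roots lam)}
    (hf : (f : Laurent (Roots lam ⊕ Fin n)) = rename Sum.inl f') {i j : Fin n} (hij : (i : ℕ) + 1 = j) :
    sTilde i j (nuLam xi lam (cls f)) = nuLam xi lam (cls f) := by
  refine xiCoord_ext hxi fun I => ?_
  rw [← comp_swap_swap i j I, xiCoord_sTilde hxi hij]
  by_cases h : (wt I).1 = lam
  · subst h
    have e : xiCoord xi (nuLam xi (wt I).1 (cls f)) I = _ := xiCoord_nuLam hxi _ (cls f) (toPart I)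
    have e' : xiCoord xi (nuLam xi (wt I).1 (cls f)) (I ∘ Equiv.swap i j) = _ :=
      xiCoord_nuLam hxi _ (cls f) ((toPart I).comp (Equiv.swap i j))
    rw [comp_swap_swap, e, e', map_div₀, permute_algebraMap, loc_cls, loc_cls, locPre_comp _ hf]
    congr 1
    exact Rz_perm I (Equiv.swap i j)
  · have e : xiCoord xi (nuLam xi lam (cls f)) I = 0 :=
      xiCoord_nuLam_of_ne hxi (fun h' => h h'.symm) (cls f) (toPart I)
    have e' : xiCoord xi (nuLam xi lam (cls f)) (I ∘ Equiv.swap i j) = 0 :=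
      xiCoord_nuLam_of_ne hxi (fun h' => h h'.symm) (cls f) ((toPart I).comp (Equiv.swap i j))
    rw [comp_swap_swap, e, e', map_zero]

theorem Rz_inv_mul_prod_mem (I : Fin n → Fin N) :
    (Rz I)⁻¹ * ∏ p ∈ (univ : Finset (Fin n)).offDiag, (rvar p.1 - rvar p.2) ∈ laurentRange (Fin n) := by
  rw [Rz_inv, ← prod_mul_distrib]
  refine prod_mem fun p hp => ?_
  have hp' : p.1 ≠ p.2 := by simpa using hp
  split_ifs
  · rw [mul_assoc, inv_mul_cancel₀ (rvar_sub_ne_zero hp'), mul_one]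
    exact rvar_mem_laurentRange _
  · rw [one_mul]
    exact sub_mem (rvar_mem_laurentRange _) (rvar_mem_laurentRange _)

theorem nuLam_apply_apply {lam : Fin N → ℕ} (x : KLam n lam) (J : Fin n → Fin N) :
    nuLam xi lam x J = ∑ I : Part n lam,
      algebraMap (Laurent (Fin n)) (RatF (Fin n)) (loc I x) * (Rz I.1)⁻¹ * xi I.1 J := by
  rw [nuLam_apply, Finset.sum_apply]
  rfl

theorem nuLam_mem_DVminus (hxi : IsXi xi) {lam : Fin N → ℕ} {f : symLaurent n lam}
    {f' : Laurent (Roots lam)} (hf : (f : Laurent (Roots lam ⊕ Fin n)) = rename Sum.inl f') :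
    nuLam xi lam (cls f) ∈ DVminus N n := by
  have hinv := fun i j hij => sTilde_nuLam hxi hf (i := i) (j := j) hij
  refine ⟨fun J => ?_, hinv⟩
  set v := nuLam xi lam (cls f) with hv
  have hreg : ∀ {a b : Fin n} (hab : a ≠ b), v J ∈ Reg (prime_binom (1 : Coefˣ) hab) := by
    have hlt : ∀ {a b : Fin n} (hab : a < b), v J ∈ Reg (prime_binom (1 : Coefˣ) hab.ne) := by
      intro a b hab
      refine mem_Reg_of_invariant hinv (fun hab J => ?_) hab J
      rw [hv, nuLam_apply_apply, mul_sum]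
      refine sum_mem fun I _ => ?_
      have := mul_mem (mul_mem (algebraMap_mem_Reg (prime_binom 1 hab) (loc I (cls f)))
        (sub_mul_Rz_inv_mem_Reg hab I.1)) (xi_mem_Reg hxi hab I.1 J)
      convert this using 1
      ring
    intro a b hab
    rcases lt_or_gt_of_ne hab with h | h
    · exact hlt h
    · have h1 : rename (1 : Equiv.Perm (Fin n)) (binom b a ((1 : Coefˣ) : Coef)) ∣
          binom a b ((1 : Coefˣ) : Coef) := by
        rw [rename_binom]
        exact ⟨-1, by
          rw [binom, binom, Units.val_one, map_one, one_mul, one_mul, mul_neg_one, neg_sub]; rfl⟩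
      have := permute_mem_Reg (prime_binom (1 : Coefˣ) h.ne) (prime_binom (1 : Coefˣ) hab) 1 h1 (hlt h)
      rwa [permute_one] at this
  have hden : denD n * v J ∈ laurentRange (Fin n) := by
    refine mem_laurentRange_of_prod univ.offDiag (fun p => binom p.1 p.2 ((1 : Coefˣ) : Coef))
      (fun p hp => prime_binom 1 (by simpa using hp)) ?_ fun p hp => ?_
    · rw [map_prod]
      simp only [algebraMap_binom_one]
      rw [hv, nuLam_apply_apply, mul_sum, sum_mul]
      refine sum_mem fun I _ => ?_
      have := mul_mem (mul_mem (⟨loc I (cls f), rfl⟩ : algebraMap _ _ (loc I (cls f)) ∈ laurentRange (Fin n))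
        (Rz_inv_mul_prod_mem I.1)) (denD_mul_xi hxi I.1 J)
      convert this using 1
      ring
    · refine mul_mem (prod_mem fun q _ => ?_) (hreg (by simpa using hp))
      have h := laurentRange_le_Reg (prime_binom (1 : Coefˣ) (by simpa using hp : p.1 ≠ p.2))
      exact sub_mem (h (rvar_mem_laurentRange _)) (mul_mem (h rh_mem_laurentRange) (h (rvar_mem_laurentRange _)))
  have : DD n * v J ∈ laurentRange (Fin n) := by
    rw [DD_eq, ← prod_inv_distrib, mul_right_comm]
    exact mul_mem hden (prod_mem fun _ _ => inv_rvar_mem_laurentRange _)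
  exact this

/-- A Laurent polynomial in the `z`'s as an element of the symmetric Laurent polynomials. -/
def zPart (lam : Fin N → ℕ) (g : Laurent (Fin n)) : symLaurent n lam :=
  ⟨rename Sum.inr g, fun π => by rw [rename_rename]; rfl⟩

theorem locPre_zPart {lam : Fin N → ℕ} (I : Part n lam) (g : Laurent (Fin n)) :
    locPre I (zPart lam g) = g := by
  change rename (Sum.elim (locVar I) id) (rename Sum.inr g) = g
  rw [rename_rename]
  exact rename_id g

theorem nuLam_mul_zPart {lam : Fin N → ℕ} (f : symLaurent n lam) (g : Laurent (Fin n)) :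
    nuLam xi lam (cls (f * zPart lam g)) = g • nuLam xi lam (cls f) := by
  rw [nuLam_apply, nuLam_apply, smul_sum]
  refine sum_congr rfl fun I _ => ?_
  rw [loc_cls, loc_cls, map_mul, locPre_zPart, ← smul_assoc, map_mul]
  congr 1
  rw [Algebra.smul_def, mul_comm (algebraMap _ (RatF (Fin n)) (locPre I f)), mul_div_assoc]

theorem nuLam_cls_add {lam : Fin N → ℕ} (f g : symLaurent n lam) :
    nuLam xi lam (cls (f + g)) = nuLam xi lam (cls f) + nuLam xi lam (cls g) :=
  map_add (nuLam xi lam) (cls f) (cls g)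

theorem nuLam_cls_zero {lam : Fin N → ℕ} : nuLam xi lam (cls 0) = 0 :=
  map_zero (nuLam xi lam)

theorem nuLam_mem_DVz (hxi : IsXi xi) {lam : Fin N → ℕ} (f : symLaurent n lam) :
    nuLam xi lam (cls f) ∈ DVz N n := by
  have key : ∀ (F : Laurent (Roots lam ⊕ Fin n)) (f : symLaurent n lam), f.1 = avg (rootAct n lam) F →
      nuLam xi lam (cls f) ∈ DVz N n := by
    intro F
    induction F using laurent_sum_induction with
    | h0 =>
      intro f hf
      have : f = 0 := Subtype.ext (hf.trans (map_zero _))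
      rw [this, nuLam_cls_zero]
      exact zero_mem _
    | hadd F G hF hG =>
      intro f hf
      have : f = ⟨avg (rootAct n lam) F, avg_rootAct_mem F⟩ + ⟨avg (rootAct n lam) G, avg_rootAct_mem G⟩ :=
        Subtype.ext (hf.trans (map_add _ _ _))
      rw [this, nuLam_cls_add]
      exact add_mem (hF _ rfl) (hG _ rfl)
    | hmul f' g =>
      intro f hf
      have : f = ⟨avg (rootAct n lam) (rename Sum.inl f'), avg_rootAct_mem _⟩ * zPart lam g := by
        refine Subtype.ext (hf.trans (avg_mul (fun π => ?_) _))
        rw [rename_rename]; rfl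
      rw [this, nuLam_mul_zPart]
      refine Submodule.smul_mem _ _ (Submodule.subset_span (nuLam_mem_DVminus hxi
        (f' := (Fintype.card (∀ k, Equiv.Perm (Fin (lam k))) : Coef)⁻¹ •
          ∑ π, rename (Equiv.sigmaCongrRight π) f') ?_))
      change avg (rootAct n lam) (rename Sum.inl f') = _
      rw [avg_apply, map_smul, map_sum]
      congr 1
      refine sum_congr rfl fun π _ => ?_
      rw [rename_rename, rename_rename]
      rfl
  exact key f f (avg_rootAct_eq f.2).symm

theorem nu_mem_DVz (hxi : IsXi xi) (x : KT N n) : nu xi x ∈ DVz N n := by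
  refine KT_induction (P := fun x => nu xi x ∈ DVz N n) ?_ ?_ ?_ x
  · rw [map_zero]; exact zero_mem _
  · intro x y hx hy
    rw [map_add]; exact add_mem hx hy
  · intro lam f
    rw [nu_inc]; exact nuLam_mem_DVz hxi f

theorem exists_smul_nu (g : Laurent (Fin n)) (x : KT N n) : ∃ y, nu xi y = g • nu xi x := by
  refine KT_induction (P := fun x => ∃ y, nu xi y = g • nu xi x) ?_ ?_ ?_ x
  · exact ⟨0, by rw [map_zero, smul_zero]⟩
  · rintro x y ⟨x', hx⟩ ⟨y', hy⟩
    exact ⟨x' + y', by rw [map_add, map_add, hx, hy, smul_add]⟩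
  · intro lam f
    exact ⟨inc lam (cls (f * zPart lam.1 g)), by rw [nu_inc, nu_inc, nuLam_mul_zPart]⟩

theorem exists_antitone_perm (I : Fin n → Fin N) : ∃ π : Equiv.Perm (Fin n), Antitone (I ∘ π) :=
  ⟨(Fin.revPerm : Equiv.Perm (Fin n)).trans (Tuple.sort I), fun _ _ h =>
    Tuple.monotone_sort I (Fin.rev_le_rev.2 h)⟩

theorem Rz_of_antitone {I : Fin n → Fin N} (hI : Antitone I) : Rz I = ∏ p ∈ ltPairs n,
    if I p.2 < I p.1 then (1 - rvar p.1 / rvar p.2 : RatF (Fin n)) else 1 := by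
  rw [Rz, prod_comm, ← prod_product', univ_product_univ]
  refine (prod_subset (subset_univ _) fun p _ hp => if_neg fun h => hp ?_).symm
  rw [mem_ltPairs]
  by_contra h'
  exact absurd (hI (not_lt.1 h')) h.not_ge

/-- The fixed point restrictions that correspond to an invariant function. -/
theorem xiCoord_mul_Rz_mem (hxi : IsXi xi) {w : V N n} (hw : w ∈ DVminus N n) :
    (∀ I, xiCoord xi w I * Rz I ∈ laurentRange (Fin n)) ∧
      ∀ π I, permute π (xiCoord xi w (I ∘ π) * Rz (I ∘ π)) = xiCoord xi w I * Rz I := by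
  have heq : ∀ (π : Equiv.Perm (Fin n)) I,
      permute π (xiCoord xi w (I ∘ π) * Rz (I ∘ π)) = xiCoord xi w I * Rz I := by
    intro π I
    rw [map_mul, Rz_perm, equivariant_perm (c := xiCoord xi w) (fun i j hij I => ?_) π I]
    rw [← xiCoord_sTilde hxi hij, hw.2 i j hij]
  refine ⟨?_, heq⟩
  have hanti : ∀ I : Fin n → Fin N, Antitone I → xiCoord xi w I * Rz I ∈ laurentRange (Fin n) := by
    intro I hI
    have hlead : xiCoord xi w I * xiDiag I = w I := by
      conv_rhs => rw [← sum_xiCoord hxi w]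
      rw [Finset.sum_apply, sum_eq_single I]
      · rw [Pi.smul_apply, smul_eq_mul, xi_diag hxi]
      · intro K _ hK
        rw [Pi.smul_apply, smul_eq_mul]
        by_cases h : xi K I = 0
        · rw [h, mul_zero]
        · exfalso
          obtain ⟨h1, π, hπ⟩ := xi_support hxi K I h
          rcases h1 with h1 | h1
          · exact hK h1.symm
          · have h2 := inv_le_of_antitone hI π⁻¹
            have h3 : I ∘ ⇑π⁻¹ = K := by rw [hπ]; ext; simp
            rw [h3] at h2
            omega
      · intro h; exact absurd (mem_univ _) h
    set P := (ltPairs n).filter fun p => I p.1 = I p.2 with hP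
    set x := xiCoord xi w I * Rz I with hx
    have hprod : x * ∏ p ∈ P, (rvar p.2 - rh * rvar p.1) ∈ laurentRange (Fin n) := by
      have hDD : denD n * w I ∈ laurentRange (Fin n) := by
        have h1 : DD n * w I ∈ laurentRange (Fin n) := hw.1 I
        have h2 := mul_mem h1 (prod_mem fun p (_ : p ∈ ltPairs n) => rvar_mem_laurentRange p.2)
        have h3 : (∏ p ∈ ltPairs n, rvar p.2 : RatF (Fin n)) ≠ 0 :=
          prod_ne_zero_iff.2 fun _ _ => rvar_ne_zero _
        rw [DD_eq, mul_right_comm, inv_mul_cancel_right₀ h3] at h2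
        exact h2
      have hRz : Rz I * ∏ p ∈ P, (rvar p.2 - rh * rvar p.1) = xiDiag I * denD n *
          ∏ p ∈ ltPairs n, if I p.2 < I p.1 then (rvar p.2 : RatF (Fin n))⁻¹ else 1 := by
        rw [Rz_of_antitone hI, hP, prod_filter, xiDiag, denD, ← prod_mul_distrib, ← prod_mul_distrib,
          ← prod_mul_distrib]
        refine prod_congr rfl fun p hp => ?_
        have hle := hI (mem_ltPairs.1 hp).le
        rcases hle.lt_or_eq with h | h
        · rw [if_pos h, if_neg h.ne', if_pos h, if_pos h, mul_one, one_sub_div (rvar_ne_zero _),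
            div_mul_cancel₀ _ (rvar_sub_rh_mul_ne_zero _ _), div_eq_mul_inv]
        · rw [if_neg h.not_lt, if_pos h.symm, if_neg h.not_lt, if_neg h.not_lt]
          ring
      rw [hx, mul_assoc, hRz, ← mul_assoc, ← mul_assoc, hlead, mul_comm (w I)]
      refine mul_mem hDD (prod_mem fun p _ => ?_)
      split_ifs
      · exact inv_rvar_mem_laurentRange _
      · exact one_mem _
    have hne : ∀ p ∈ P, p.2 ≠ p.1 := fun p hp => (mem_ltPairs.1 (mem_filter.1 hp).1).ne'
    let c : Coefˣ := Units.mk0 hh hh_ne_zero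
    have hb : ∀ p : Fin n × Fin n, algebraMap _ (RatF (Fin n)) (binom p.2 p.1 (c : Coef)) =
        rvar p.2 - rh * rvar p.1 := fun p => algebraMap_binom _ _ _
    refine mem_laurentRange_of_prod P (fun p => binom p.2 p.1 (c : Coef))
      (fun p hp => prime_binom c (hne p hp)) ?_ fun p hp => ?_
    · rw [map_prod]
      simp only [hb]
      exact hprod
    · have hq := prime_binom c (hne p hp).symm
      have h1 : x ∈ Reg hq := by
        have h2 := laurentRange_le_Reg hq hprod
        have h3 : (∏ q ∈ P, (rvar q.2 - rh * rvar q.1) : RatF (Fin n))⁻¹ ∈ Reg hq := by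
          rw [← prod_inv_distrib]
          refine prod_mem fun q hqP => ?_
          rw [← hb]
          refine inv_mem_Reg _ fun h => ?_
          rcases eq_of_binom_dvd (hne p hp).symm hh_ne_zero h (hne q hqP) with ⟨e1, e2, -⟩ | ⟨-, -, e⟩
          · have h4 := mem_ltPairs.1 (mem_filter.1 hp).1
            have h5 := mem_ltPairs.1 (mem_filter.1 hqP).1
            rw [e1, e2] at h5
            exact absurd h4 h5.not_gt
          · exact hh_mul_hh_ne_one e
        have h4 := mul_mem h2 h3
        rwa [mul_inv_cancel_right₀] at h4
        exact prod_ne_zero_iff.2 fun _ _ => rvar_sub_rh_mul_ne_zero _ _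
      have h2 := permute_mem_Reg hq (prime_binom c (hne p hp)) (Equiv.swap p.1 p.2)
        (by rw [rename_binom, Equiv.swap_apply_left, Equiv.swap_apply_right]) h1
      have h3 := heq (Equiv.swap p.1 p.2) I
      rw [comp_swap_of_eq (mem_filter.1 hp).2] at h3
      rwa [h3] at h2
  intro I
  obtain ⟨π, hπ⟩ := exists_antitone_perm I
  rw [← heq π I]
  exact permute_mem_laurentRange π (hanti _ hπ)

/-- Interpolation: a compatible family of restrictions comes from a symmetric Laurent polynomial. -/
theorem exists_locPre_eq (lam : Fin N → ℕ) {F : (Fin n → Fin N) → RatF (Fin n)}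
    (hF : ∀ I, F I ∈ laurentRange (Fin n)) (hp : ∀ π I, permute π (F (I ∘ π)) = F I) :
    ∃ f : symLaurent n lam, ∀ I : Part n lam, algebraMap _ (RatF (Fin n)) (locPre I f) = F I.1 := by
  choose G hG using hF
  have hGp : ∀ (π : Equiv.Perm (Fin n)) I, rename π (G (I ∘ π)) = G I := by
    intro π I
    apply IsFractionRing.injective (Laurent (Fin n)) (RatF (Fin n))
    rw [← permute_algebraMap]
    have := hp π I
    rw [← hG, ← hG] at this
    exact this
  by_cases hne : Nonempty (Part n lam)
  · obtain ⟨I₀⟩ := hne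
    refine ⟨⟨rename (Sum.inl ∘ (locEquiv I₀).symm) (G I₀.1), fun π => ?_⟩, fun I => ?_⟩
    · let ρ : Equiv.Perm (Fin n) := ((locEquiv I₀).symm.trans (Equiv.sigmaCongrRight π)).trans (locEquiv I₀)
      have h1 : I₀.1 ∘ ρ = I₀.1 := by
        ext1 a
        change I₀.1 (locEquiv I₀ _) = _
        rw [colour_locEquiv]
        change ((locEquiv I₀).symm a).1 = _
        rw [← colour_locEquiv I₀, Equiv.apply_symm_apply]
      have h2 := hGp ρ I₀.1
      rw [h1] at h2
      conv_rhs => rw [← h2]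
      rw [rename_rename, rename_rename]
      congr 2
      ext1 a
      change Sum.inl (Equiv.sigmaCongrRight π ((locEquiv I₀).symm a)) =
        Sum.inl ((locEquiv I₀).symm (locEquiv I₀ _))
      rw [Equiv.symm_apply_apply]
      rfl
    · let ρ : Equiv.Perm (Fin n) := (locEquiv I₀).symm.trans (locEquiv I)
      have h1 : I.1 ∘ ρ = I₀.1 := by
        ext1 a
        change I.1 (locEquiv I _) = _
        rw [colour_locEquiv, ← colour_locEquiv I₀, Equiv.apply_symm_apply]
      have h2 := hGp ρ I.1
      rw [h1] at h2
      change algebraMap _ _ (rename (Sum.elim (locVar I) id) (rename _ _)) = _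
      have h3 := hG I.1
      rw [← h2] at h3
      rw [rename_rename]
      exact h3
  · exact ⟨0, fun I => absurd ⟨I⟩ hne⟩

theorem DVminus_subset_range (hxi : IsXi xi) {w : V N n} (hw : w ∈ DVminus N n) : ∃ x, nu xi x = w := by
  classical
  obtain ⟨h1, h2⟩ := xiCoord_mul_Rz_mem hxi hw
  choose f hf using fun lam : Fin N → ℕ => exists_locPre_eq lam h1 h2
  refine ⟨∑ lam ∈ (univ : Finset (Fin n → Fin N)).image wt,
    inc (N := N) (n := n) lam (cls (f lam.1)), xiCoord_ext hxi fun I => ?_⟩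
  rw [map_sum, xiCoord_sum, Finset.sum_apply, sum_eq_single (wt I)]
  · rw [nu_inc]
    have := xiCoord_nuLam hxi _ (cls (f (wt I).1)) (toPart I)
    rw [loc_cls, hf, mul_div_cancel_right₀ _ (Rz_ne_zero _)] at this
    exact this
  · intro lam _ hlam
    rw [nu_inc]
    exact xiCoord_nuLam_of_ne hxi (fun h => hlam (Subtype.ext h)) _ (toPart I)
  · intro h
    exact absurd (mem_image_of_mem _ (mem_univ _)) h

theorem range_nu (hxi : IsXi xi) : Set.range (nu xi) = (DVz N n : Set (V N n)) := by
  ext w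
  constructor
  · rintro ⟨x, rfl⟩
    exact nu_mem_DVz hxi x
  · intro hw
    refine Submodule.span_induction (p := fun w _ => w ∈ Set.range (nu xi)) ?_ ?_ ?_ ?_ hw
    · intro w hw
      exact DVminus_subset_range hxi hw
    · exact ⟨0, map_zero _⟩
    · rintro _ _ - - ⟨x, rfl⟩ ⟨y, rfl⟩
      exact ⟨x + y, map_add _ _ _⟩
    · rintro g _ - ⟨x, rfl⟩
      exact exists_smul_nu g x

end Range

end LoopK

end

noncomputable section

namespace LoopK

open Finset Matrix

section DescendingProducts

variable {M : Type*} [Monoid M] {n : ℕ}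

/-- The product `F (n - 1) ⋯ F 1 F 0`. -/
def dprod (F : Fin n → M) : M := ((List.finRange n).reverse.map F).prod

theorem dprod_zero (F : Fin 0 → M) : dprod F = 1 := rfl

theorem dprod_succ (F : Fin (n + 1) → M) :
    dprod F = F (Fin.last n) * dprod fun k : Fin n => F k.castSucc := by
  rw [dprod, dprod, List.finRange_succ_last, List.reverse_append, List.reverse_singleton,
    List.singleton_append, List.map_cons, List.prod_cons, ← List.map_reverse, List.map_map]
  rfl

theorem dprod_mul {F G : Fin n → M} (h : ∀ k l, k ≠ l → Commute (F k) (G l)) :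
    dprod F * dprod G = dprod fun k => F k * G k := by
  induction n with
  | zero => simp [dprod_zero]
  | succ n ih =>
    have hc : Commute (dprod fun k : Fin n => F k.castSucc) (G (Fin.last n)) := by
      unfold dprod
      refine (Commute.list_prod_left _ _ fun x hx => ?_)
      obtain ⟨k, -, rfl⟩ := List.mem_map.1 hx
      exact h _ _ (Fin.castSucc_lt_last k).ne
    rw [dprod_succ, dprod_succ, dprod_succ, ← ih fun k l hkl => h _ _ fun h' => hkl (Fin.castSucc_injective _ h')]
    rw [mul_assoc, ← mul_assoc _ (G (Fin.last n)), hc.eq]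
    simp only [mul_assoc]

theorem mul_dprod {F G : Fin n → M} {X : M} (h : ∀ k, X * F k = G k * X) :
    X * dprod F = dprod G * X := by
  induction n with
  | zero => simp [dprod_zero]
  | succ n ih =>
    rw [dprod_succ, dprod_succ, ← mul_assoc, h, mul_assoc, ih fun k => h _, mul_assoc]

theorem mul_dprod_adj {F G : Fin n → M} {X : M} {i j : Fin n} (hij : (i : ℕ) + 1 = j)
    (h : ∀ k, k ≠ i → k ≠ j → X * F k = G k * X) (h2 : X * (F j * F i) = G j * G i * X) :
    X * dprod F = dprod G * X := by
  induction n with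
  | zero => exact i.elim0
  | succ n ih =>
    rw [dprod_succ F, dprod_succ G]
    by_cases hj : j = Fin.last n
    · subst hj
      obtain _ | m := n
      · exact absurd hij (by simp)
      · have hi : i = (Fin.last m).castSucc := Fin.ext (by simpa using hij)
        subst hi
        rw [dprod_succ, dprod_succ, ← mul_assoc, ← mul_assoc, mul_assoc X, h2, mul_assoc, mul_dprod
          (G := fun k : Fin m => G k.castSucc.castSucc), ← mul_assoc, ← mul_assoc]
        intro k
        refine h _ (fun h' => ?_) fun h' => ?_
        · exact (Fin.castSucc_lt_last k).ne (Fin.castSucc_injective _ h')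
        · exact (Fin.castSucc_lt_last _).ne h'
    · have hj' : (j : ℕ) < n := by
        have := j.2
        have h' : (j : ℕ) ≠ n := fun h' => hj (Fin.ext h')
        omega
      rw [← mul_assoc, h _ (fun h' => ?_) (Ne.symm hj), mul_assoc, ih (F := fun k : Fin n => F k.castSucc) (G := fun k : Fin n => G k.castSucc)
        (i := ⟨i, by omega⟩) (j := ⟨j, hj'⟩) hij ?_ h2, mul_assoc]
      · intro k hk1 hk2
        exact h _ (fun h' => hk1 (Fin.ext (by simpa using congrArg Fin.val h')))
          fun h' => hk2 (Fin.ext (by simpa using congrArg Fin.val h'))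
      · have := congrArg Fin.val h'
        simp only [Fin.val_last] at this
        omega

end DescendingProducts

section Monodromy

variable {E : Type*} [CommRing E] {N n : ℕ}

theorem dprod_intertwine {E' A B : Type*} [CommRing E'] [AddCommGroup A] [Module E A] [AddCommGroup B]
    [Module E' B] {F : Fin n → Module.End E A} {G : Fin n → Module.End E' B} {φ : A → B}
    (h : ∀ k f, φ (F k f) = G k (φ f)) (f : A) : φ (dprod F f) = dprod G (φ f) := by
  induction n with
  | zero => rfl
  | succ n ih =>
    rw [dprod_succ, dprod_succ, Module.End.mul_apply, Module.End.mul_apply, h, ih fun k f => h _ f]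

/-- The monodromy matrix as an operator; the auxiliary factor is the one with the number `0`. -/
def Mon (h : E) (s t : Fin n → E) : Module.End E ((Fin (n + 1) → Fin N) → E) :=
  dprod fun k => Rop h (s k) (t k) 0 k.succ

/-- The entries of the monodromy matrix. -/
def Lent (h : E) (s t : Fin n → E) (i j : Fin N) : Matrix (Fin n → Fin N) (Fin n → Fin N) E :=
  Matrix.of fun I J => Mon h s t (Pi.single (Fin.cons j J : Fin (n + 1) → Fin N) 1) (Fin.cons i I)

theorem Mon_apply (h : E) (s t : Fin n → E) (f : (Fin (n + 1) → Fin N) → E) (i : Fin N)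
    (I : Fin n → Fin N) :
    Mon h s t f (Fin.cons i I) = ∑ j, ∑ J, Lent h s t i j I J * f (Fin.cons j J) := by
  have hf : f = ∑ K, f K • (Pi.single K 1 : (Fin (n + 1) → Fin N) → E) := by
    ext K
    rw [Finset.sum_apply, sum_eq_single K]
    · simp
    · intro K' _ hK'
      rw [Pi.smul_apply, Pi.single_eq_of_ne hK'.symm, smul_zero]
    · intro h; exact absurd (mem_univ _) h
  conv_lhs => rw [hf]
  rw [map_sum, Finset.sum_apply, ← Fintype.sum_prod_type']
  refine (Fintype.sum_equiv (Fin.consEquiv fun _ => Fin N) _ _ fun x => ?_).symm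
  rw [map_smul, Pi.smul_apply, smul_eq_mul, mul_comm]
  rfl

variable {ι : Type*} [DecidableEq ι]

/-- The monodromy matrix with the auxiliary factor `r`. -/
def Top (h : E) (s t : Fin n → E) (r : ι) : Module.End E ((ι ⊕ Fin n → Fin N) → E) :=
  dprod fun k => Rop h (s k) (t k) (Sum.inl r) (Sum.inr k)

/-- The inclusion of an auxiliary factor and the sites. -/
def auxEmb (r : ι) : Fin (n + 1) → ι ⊕ Fin n := Fin.cons (Sum.inl r) Sum.inr

omit [DecidableEq ι] in
theorem auxEmb_injective (r : ι) : Function.Injective (auxEmb r : Fin (n + 1) → ι ⊕ Fin n) := by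
  intro x y
  induction x using Fin.cases <;> induction y using Fin.cases <;> simp [auxEmb]

theorem extend_auxEmb (r : ι) (b : Fin N) (J : Fin n → Fin N) (A : ι → Fin N) (I : Fin n → Fin N) :
    Function.extend (auxEmb r) (Fin.cons b J : Fin (n + 1) → Fin N) (Sum.elim A I) =
      Sum.elim (Function.update A r b) J := by
  ext x
  congr 1
  rcases x with x | x
  · by_cases hx : x = r
    · subst hx
      have := (auxEmb_injective (n := n) x).extend_apply (Fin.cons b J : Fin (n + 1) → Fin N) (Sum.elim A I) 0
      rw [Sum.elim_inl, Function.update_self]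
      exact this
    · rw [Function.extend_apply', Sum.elim_inl, Sum.elim_inl, Function.update_of_ne hx]
      rintro ⟨k, hk⟩
      induction k using Fin.cases with
      | zero => exact hx (Sum.inl.inj hk).symm
      | succ k => exact Sum.inr_ne_inl hk
  · exact (auxEmb_injective (n := n) r).extend_apply (Fin.cons b J : Fin (n + 1) → Fin N) (Sum.elim A I) x.succ

theorem Top_apply (h : E) (s t : Fin n → E) (r : ι) (f : (ι ⊕ Fin n → Fin N) → E) (A : ι → Fin N)
    (I : Fin n → Fin N) :
    Top h s t r f (Sum.elim A I) =
      ∑ b, ∑ J, Lent h s t (A r) b I J * f (Sum.elim (Function.update A r b) J) := by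
  have h1 : resAt (auxEmb r) (Sum.elim A I) (Top h s t r f) =
      Mon h s t (resAt (auxEmb r) (Sum.elim A I) f) := by
    refine dprod_intertwine (φ := resAt (auxEmb r) (Sum.elim A I)) (fun k f => ?_) f
    exact resAt_Rop (auxEmb_injective r) _ _ _ _ 0 k.succ f
  have h2 := congrFun h1 (Fin.cons (A r) I)
  rw [Mon_apply] at h2
  simp only [resAt, extend_auxEmb, Function.update_eq_self] at h2
  exact h2

theorem map_Lent {E' : Type*} [CommRing E'] (φ : E →+* E') (h : E) (s t : Fin n → E) (i j : Fin N)
    (I J : Fin n → Fin N) :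
    φ (Lent h s t i j I J) = Lent (φ h) (fun k => φ (s k)) (fun k => φ (t k)) i j I J := by
  have h1 : ∀ f : (Fin (n + 1) → Fin N) → E, (fun K => φ (Mon h s t f K)) =
      Mon (φ h) (fun k => φ (s k)) (fun k => φ (t k)) (fun K => φ (f K)) := by
    refine dprod_intertwine (A := (Fin (n + 1) → Fin N) → E) (B := (Fin (n + 1) → Fin N) → E')
      (φ := fun f K => φ (f K)) fun k f => ?_
    ext K
    simp only [Rop_apply, map_add, map_mul, map_wa, map_wb]
  refine (congrFun (h1 _) (Fin.cons i I)).trans ?_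
  refine congrArg (fun f => Mon (φ h) (fun k => φ (s k)) (fun k => φ (t k)) f (Fin.cons i I))
    (funext fun K => ?_)
  rw [Pi.single_apply, Pi.single_apply, apply_ite φ, map_one, map_zero]

theorem Rop_comm (h s t s' t' : E) {i j k l : ι} (hij : i ≠ j) (hkl : k ≠ l) (hik : i ≠ k) (hil : i ≠ l) (hjk : j ≠ k) (hjl : j ≠ l) :
    Commute (Rop h s t i j : Module.End E ((ι → Fin N) → E)) (Rop h s' t' k l) := by
  refine LinearMap.ext fun f => funext fun I => ?_
  have e : (I ∘ Equiv.swap i j) ∘ Equiv.swap k l = (I ∘ Equiv.swap k l) ∘ Equiv.swap i j := by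
    ext x
    simp only [Function.comp_apply]
    have : Commute (Equiv.swap i j) (Equiv.swap k l) :=
      (Equiv.Perm.disjoint_swap_swap (by simp [*])).commute
    have h2 := congrArg (fun σ : Equiv.Perm ι => σ x) this.eq
    simp only [Equiv.Perm.mul_apply] at h2
    rw [h2]
  simp only [Module.End.mul_apply, Rop_apply, Function.comp_apply,
    Equiv.swap_apply_of_ne_of_ne hik.symm hjk.symm, Equiv.swap_apply_of_ne_of_ne hil.symm hjl.symm,
    Equiv.swap_apply_of_ne_of_ne hik hil, Equiv.swap_apply_of_ne_of_ne hjk hjl]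
  rw [e]
  ring

theorem Rop_mul_Top (h u v : E) (z c c' : Fin n → E) {r r' : ι} (hr : r ≠ r') :
    (Rop h u v (Sum.inl r) (Sum.inl r') * (Top h (fun k => c k * u) (fun k => c k * z k) r *
      Top h (fun k => c' k * v) (fun k => c' k * z k) r') : Module.End E ((ι ⊕ Fin n → Fin N) → E)) =
    (Top h (fun k => c' k * v) (fun k => c' k * z k) r' * Top h (fun k => c k * u) (fun k => c k * z k) r) *
      Rop h u v (Sum.inl r) (Sum.inl r') := by
  have hr' : (Sum.inl r : ι ⊕ Fin n) ≠ Sum.inl r' := fun h => hr (Sum.inl.inj h)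
  rw [Top, Top, dprod_mul, dprod_mul]
  · refine mul_dprod fun k => ?_
    rw [Rop_smul, Rop_smul, smul_mul_smul_comm, smul_mul_smul_comm, mul_smul_comm, smul_mul_assoc,
      ← mul_assoc, yang_baxter h u v (z k) hr' Sum.inl_ne_inr Sum.inl_ne_inr, mul_comm (c k)]
  · intro k l hkl
    exact Rop_comm _ _ _ _ _ Sum.inl_ne_inr Sum.inl_ne_inr hr'.symm Sum.inl_ne_inr Sum.inr_ne_inl fun h => hkl (Sum.inr.inj h)
  · intro k l hkl
    exact Rop_comm _ _ _ _ _ Sum.inl_ne_inr Sum.inl_ne_inr hr' Sum.inl_ne_inr Sum.inr_ne_inl fun h => hkl (Sum.inr.inj h)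

omit [DecidableEq ι] in
theorem single_elim (A B : ι → Fin N) (I J : Fin n → Fin N) [Fintype ι] :
    (Pi.single (Sum.elim B J) 1 : (ι ⊕ Fin n → Fin N) → E) (Sum.elim A I) =
      if A = B ∧ I = J then 1 else 0 := by
  rw [Pi.single_apply]
  congr 1
  rw [Sum.elim_eq_iff]

theorem Rop_aux_apply (h u v : E) (f : (Fin 2 ⊕ Fin n → Fin N) → E) (a b : Fin N) (I : Fin n → Fin N) :
    Rop h u v (Sum.inl 0) (Sum.inl 1) f (Sum.elim ![a, b] I) =
      ∑ e, ∑ d, Rhom N h u v (a, b) (e, d) * f (Sum.elim ![e, d] I) := by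
  have hs : (Sum.elim ![a, b] I ∘ Equiv.swap (Sum.inl 0) (Sum.inl 1) : Fin 2 ⊕ Fin n → Fin N) =
      Sum.elim ![b, a] I := by
    ext x
    congr 1
    rcases x with x | x
    · fin_cases x
      · rw [Function.comp_apply]
        erw [Equiv.swap_apply_left]
        rfl
      · rw [Function.comp_apply]
        erw [Equiv.swap_apply_right]
        rfl
    · rw [Function.comp_apply, Equiv.swap_apply_of_ne_of_ne Sum.inr_ne_inl Sum.inr_ne_inl]
      rfl
  rw [Rop_apply, hs]
  simp only [Rhom_apply, add_mul, sum_add_distrib, ite_mul, zero_mul, ite_and]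
  simp

theorem Lent_rll (h u v : E) (z c c' : Fin n → E) (a b i j : Fin N) :
    (∑ e, ∑ d, Rhom N h u v (a, b) (e, d) • (Lent h (fun k => c k * u) (fun k => c k * z k) e i *
      Lent h (fun k => c' k * v) (fun k => c' k * z k) d j)) =
    ∑ e, ∑ d, Rhom N h u v (e, d) (i, j) • (Lent h (fun k => c' k * v) (fun k => c' k * z k) b d *
      Lent h (fun k => c k * u) (fun k => c k * z k) a e) := by
  ext I J
  have h1 := congrArg (fun F => F (Pi.single (Sum.elim ![i, j] J) 1) (Sum.elim ![a, b] I))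
    (Rop_mul_Top (N := N) h u v z c c' (zero_ne_one : (0 : Fin 2) ≠ 1))
  have u0 : ∀ x y w : Fin N, Function.update ![x, y] 0 w = ![w, y] := fun x y w => by
    ext k; fin_cases k <;> rfl
  have u1 : ∀ x y w : Fin N, Function.update ![x, y] 1 w = ![x, w] := fun x y w => by
    ext k; fin_cases k <;> rfl
  have hv : ∀ x y w w' : Fin N, ![x, y] = ![w, w'] ↔ x = w ∧ y = w' := fun x y w w' => by
    simp [funext_iff, Fin.forall_fin_two]
  simp only [Module.End.mul_apply, Rop_aux_apply, Top_apply, u0, u1, Matrix.cons_val_zero,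
    Matrix.cons_val_one, single_elim, hv] at h1
  simp only [Matrix.sum_apply, Matrix.smul_apply, Matrix.mul_apply, smul_eq_mul]
  convert h1 using 1
  · refine sum_congr rfl fun e _ => sum_congr rfl fun d _ => ?_
    congr 1
    rw [sum_eq_single i (fun x _ hx => by simp [hx]) (fun h => absurd (mem_univ _) h)]
    refine sum_congr rfl fun K _ => ?_
    congr 1
    rw [sum_eq_single j (fun x _ hx => by simp [hx]) (fun h => absurd (mem_univ _) h)]
    simp
  · rw [sum_comm]
    refine sum_congr rfl fun d _ => ?_
    simp only [mul_sum]
    rw [sum_comm]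
    refine sum_congr rfl fun K _ => ?_
    refine sum_congr rfl fun e _ => ?_
    rw [sum_eq_single J (fun x _ hx => by simp [hx]) (fun h => absurd (mem_univ _) h),
      sum_eq_single i (fun x _ hx => by simp [hx]) (fun h => absurd (mem_univ _) h),
      sum_eq_single j (fun x _ hx => by simp [hx]) (fun h => absurd (mem_univ _) h), if_pos ⟨⟨rfl, rfl⟩, rfl⟩]
    ring

/-- Exchanging two adjacent sites. -/
theorem Rch_mul_Mon (h u : E) (z c : Fin n → E) {i j : Fin n} (hij : (i : ℕ) + 1 = j) :
    (Rch h (z i) (z j) i.succ j.succ * Mon h (fun k => c (Equiv.swap i j k) * u)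
      (fun k => c (Equiv.swap i j k) * z (Equiv.swap i j k)) :
      Module.End E ((Fin (n + 1) → Fin N) → E)) =
    Mon h (fun k => c k * u) (fun k => c k * z k) * Rch h (z i) (z j) i.succ j.succ := by
  have hne := adj_ne hij
  refine mul_dprod_adj hij (fun k hk1 hk2 => ?_) ?_
  · beta_reduce
    rw [Equiv.swap_apply_of_ne_of_ne hk1 hk2]
    refine LinearMap.ext fun f => funext fun I => ?_
    have e1 : Equiv.swap i.succ j.succ 0 = 0 :=
      Equiv.swap_apply_of_ne_of_ne (Fin.succ_ne_zero _).symm (Fin.succ_ne_zero _).symm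
    have e2 : Equiv.swap i.succ j.succ k.succ = k.succ :=
      Equiv.swap_apply_of_ne_of_ne (fun h => hk1 (Fin.succ_injective _ h)) (fun h => hk2 (Fin.succ_injective _ h))
    have hc := congrArg (fun F => F f (I ∘ Equiv.swap i.succ j.succ)) (Rop_comm (N := N) h (c k * u) (c k * z k)
      (z j) (z i) (Fin.succ_ne_zero k).symm (fun h => hne (Fin.succ_injective _ h)) (Fin.succ_ne_zero i).symm (Fin.succ_ne_zero j).symm
      (fun h => hk1 (Fin.succ_injective _ h)) (fun h => hk2 (Fin.succ_injective _ h))).eq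
    change Rop h (z j) (z i) i.succ j.succ (Rop h (c k * u) (c k * z k) 0 k.succ f)
      (I ∘ Equiv.swap i.succ j.succ) = _
    refine hc.symm.trans ?_
    have e3 : (I ∘ Equiv.swap i.succ j.succ) ∘ Equiv.swap 0 k.succ =
        (I ∘ Equiv.swap 0 k.succ) ∘ Equiv.swap i.succ j.succ := by
      ext x
      simp only [Function.comp_apply]
      have h1 := Equiv.swap_apply_apply (Equiv.swap i.succ j.succ) 0 k.succ
      rw [e1, e2] at h1
      have h2 := congrArg (fun σ : Equiv.Perm _ => σ (Equiv.swap i.succ j.succ x)) h1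
      simp only [Equiv.Perm.mul_apply] at h2
      rw [h2]
      simp
    simp only [Module.End.mul_apply]
    rw [Rop_apply, e3, Function.comp_apply, Function.comp_apply, e1, e2]
    rfl
  · beta_reduce
    rw [Equiv.swap_apply_left, Equiv.swap_apply_right, Rop_smul, Rop_smul, Rop_smul, Rop_smul,
      smul_mul_smul_comm, smul_mul_smul_comm, mul_smul_comm, smul_mul_assoc, ← mul_assoc,
      intertwine_Rch h u (z i) (z j) (Fin.succ_ne_zero i).symm (Fin.succ_ne_zero j).symm
        (fun h => hne (Fin.succ_injective _ h)), mul_comm (c i)]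

end Monodromy

end LoopK

end

noncomputable section

namespace LoopK

open Finset Matrix

section Kernels

variable {E : Type*} [Field E]

/-- The series `1 - a X`. -/
theorem constantCoeff_one_sub_mul_X (a : E) :
    PowerSeries.constantCoeff (1 - PowerSeries.C a * PowerSeries.X) ≠ 0 := by simp

theorem one_sub_mul_X_inv (a : E) :
    (1 - PowerSeries.C a * PowerSeries.X) * (1 - PowerSeries.C a * PowerSeries.X)⁻¹ = 1 :=
  PowerSeries.mul_inv_cancel _ (constantCoeff_one_sub_mul_X a)

theorem fKer_sub_eKer (al : Sgn) (g : E) : fKer al g - eKer al g = 1 := by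
  cases al with
  | plus => simp only [fKer, eKer]; linear_combination one_sub_mul_X_inv g⁻¹
  | minus => simp only [fKer, eKer]; linear_combination one_sub_mul_X_inv g

/-- The formal variable `u^{-1}` or `u`, whichever is a power series, relates the two kernels. -/
theorem ker_plus {g : E} (hg : g ≠ 0) : fKer .plus g * PowerSeries.C g = eKer .plus g * PowerSeries.X := by
  have : PowerSeries.C g⁻¹ * PowerSeries.C g = 1 := by rw [← map_mul, inv_mul_cancel₀ hg, map_one]
  simp only [fKer, eKer]
  linear_combination (-PowerSeries.X * (1 - PowerSeries.C g⁻¹ * PowerSeries.X)⁻¹) * this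

theorem ker_minus (g : E) : fKer .minus g * PowerSeries.C g * PowerSeries.X = eKer .minus g := by
  simp only [fKer, eKer]; ring

/-- `u` as a Laurent series in `u^{±1}`. -/
def uLaurent (al : Sgn) : LaurentSeries E := HahnSeries.single al.val 1

theorem uvar_eq (n : ℕ) (al : Sgn) : uvar n al = uLaurent al := by cases al <;> rfl

theorem ker_uLaurent (al : Sgn) {g : E} (hg : g ≠ 0) :
    HahnSeries.ofPowerSeries ℤ E (eKer al g) * uLaurent al =
      HahnSeries.ofPowerSeries ℤ E (fKer al g) * HahnSeries.C g := by
  cases al with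
  | plus =>
    have := congrArg (HahnSeries.ofPowerSeries ℤ E) (ker_plus hg)
    rw [map_mul, map_mul, HahnSeries.ofPowerSeries_X, HahnSeries.ofPowerSeries_C] at this
    exact this.symm
  | minus =>
    have := congrArg (HahnSeries.ofPowerSeries ℤ E) (ker_minus g)
    rw [map_mul, map_mul, HahnSeries.ofPowerSeries_X, HahnSeries.ofPowerSeries_C] at this
    rw [← this, mul_assoc]
    have h1 : (HahnSeries.single 1 1 * uLaurent .minus : LaurentSeries E) = 1 := by
      rw [uLaurent, HahnSeries.single_mul_single]
      simp [Sgn.val]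
    rw [h1, mul_one]

theorem uLaurent_ne_zero (al : Sgn) : (uLaurent al : LaurentSeries E) ≠ 0 :=
  HahnSeries.single_ne_zero one_ne_zero

theorem fKer_mul_sub (al : Sgn) {g : E} (hg : g ≠ 0) :
    HahnSeries.ofPowerSeries ℤ E (fKer al g) * (uLaurent al - HahnSeries.C g) = uLaurent al := by
  have h1 := ker_uLaurent al hg
  have h2 := congrArg (HahnSeries.ofPowerSeries ℤ E) (fKer_sub_eKer al g)
  rw [map_sub, map_one] at h2
  linear_combination uLaurent al * h2 + h1

theorem uLaurent_sub_ne_zero (al : Sgn) {g : E} (hg : g ≠ 0) : uLaurent al - HahnSeries.C g ≠ 0 := by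
  intro h
  have := fKer_mul_sub al hg
  rw [h, mul_zero] at this
  exact uLaurent_ne_zero al this.symm

theorem fKer_coe (al : Sgn) {g : E} (hg : g ≠ 0) :
    HahnSeries.ofPowerSeries ℤ E (fKer al g) = (uLaurent al - HahnSeries.C g)⁻¹ * uLaurent al := by
  rw [eq_inv_mul_iff_mul_eq₀ (uLaurent_sub_ne_zero al hg), mul_comm, fKer_mul_sub al hg]

theorem eKer_coe (al : Sgn) {g : E} (hg : g ≠ 0) :
    HahnSeries.ofPowerSeries ℤ E (eKer al g) = (uLaurent al - HahnSeries.C g)⁻¹ * HahnSeries.C g := by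
  have h2 := congrArg (HahnSeries.ofPowerSeries ℤ E) (fKer_sub_eKer al g)
  rw [map_sub, map_one, fKer_coe al hg] at h2
  have h3 := inv_mul_cancel₀ (uLaurent_sub_ne_zero al hg)
  linear_combination -h2 + h3

end Kernels

section LaurentExpansion

variable {N n : ℕ}

/-- The matrix entries of `L(u)` as power series in `u^{±1}`. -/
def Lps (n : ℕ) (al : Sgn) (i j : Fin N) :
    Matrix (Fin n → Fin N) (Fin n → Fin N) (PowerSeries (RatF (Fin n))) :=
  Lent (PowerSeries.C rh) (fun k => fKer al (rvar k)) (fun k => eKer al (rvar k)) i j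

theorem smul_prod_mulVec {E ι : Type*} [Field E] [Fintype ι] [DecidableEq ι] {n : ℕ} (c : Fin n → E)
    (A : Fin n → Matrix ι ι E) {G : Fin n → Module.End E (ι → E)}
    (h : ∀ k f, c k • (A k *ᵥ f) = G k f) (f : ι → E) :
    ((∏ k, c k) • (List.ofFn A).reverse.prod) *ᵥ f = dprod G f := by
  induction n with
  | zero => simp [dprod_zero]
  | succ n ih =>
    rw [dprod_succ, Module.End.mul_apply, ← ih (fun k => c k.castSucc) (fun k => A k.castSucc) fun k => h _,
      ← h, List.ofFn_succ_last, List.reverse_append, List.reverse_singleton, List.singleton_append,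
      List.prod_cons, Fin.prod_univ_castSucc, mul_comm (∏ k, c _), mul_smul, smul_mulVec, ← mul_smul_comm,
      ← mulVec_mulVec]

theorem ofPowerSeries_Lps (al : Sgn) (i j : Fin N) (I J : Fin n → Fin N) :
    HahnSeries.ofPowerSeries ℤ _ (Lps n al i j I J) =
      Lent (HahnSeries.C rh)
        (fun k => (uLaurent al - HahnSeries.C (rvar k))⁻¹ * uLaurent al)
        (fun k => (uLaurent al - HahnSeries.C (rvar k))⁻¹ * HahnSeries.C (rvar k)) i j I J := by
  rw [Lps, map_Lent, HahnSeries.ofPowerSeries_C]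
  congr 1
  · funext k; exact fKer_coe al (rvar_ne_zero k)
  · funext k; exact eKer_coe al (rvar_ne_zero k)

theorem normalization {F : Type*} [Field F] {u z h : F} (hu : u ≠ 0) (huz : u - z ≠ 0)
    (hhz : u - h * z ≠ 0) :
    (1 - h * (z / u)) / (1 - z / u) * (1 - h * (z / u))⁻¹ = (u - z)⁻¹ * u := by
  have e1 : 1 - h * (z / u) = (u - h * z) / u := by rw [← mul_div_assoc, one_sub_div hu]
  have e2 : 1 - z / u = (u - z) / u := by rw [one_sub_div hu]
  rw [e1, e2]
  field_simp

theorem mul_div_of_ne_zero {F : Type*} [Field F] {u z : F} (hu : u ≠ 0) : u * (z / u) = z :=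
  mul_div_cancel₀ z hu

theorem Lop_apply (al : Sgn) (i j : Fin N) (I J : Fin n → Fin N) :
    Lop N n (HahnSeries.C rh) (fun a => HahnSeries.C (rvar a)) (uvar n al) (Fin.cons i I) (Fin.cons j J) =
      HahnSeries.ofPowerSeries ℤ _ (Lps n al i j I J) := by
  rw [ofPowerSeries_Lps, uvar_eq]
  have h1 : ∀ A : Matrix (Fin (n + 1) → Fin N) (Fin (n + 1) → Fin N) (LaurentSeries (RatF (Fin n))),
      A (Fin.cons i I) (Fin.cons j J) = (A *ᵥ Pi.single (Fin.cons j J) 1) (Fin.cons i I) := fun A => by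
    rw [mulVec_single_one]; rfl
  refine (h1 _).trans ?_
  rw [Lop, smul_prod_mulVec _ _ (G := fun k => Rop (HahnSeries.C rh)
      ((uLaurent al - HahnSeries.C (rvar k))⁻¹ * uLaurent al)
      ((uLaurent al - HahnSeries.C (rvar k))⁻¹ * HahnSeries.C (rvar k)) 0 k.succ)]
  · rfl
  · intro k f
    set u : LaurentSeries (RatF (Fin n)) := uLaurent al
    set z : LaurentSeries (RatF (Fin n)) := HahnSeries.C (rvar k)
    set h : LaurentSeries (RatF (Fin n)) := HahnSeries.C rh
    have hu : u ≠ 0 := uLaurent_ne_zero al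
    have huz : u - z ≠ 0 := uLaurent_sub_ne_zero al (rvar_ne_zero k)
    have hhz : u - h * z ≠ 0 := by
      have := uLaurent_sub_ne_zero al (mul_ne_zero rh_ne_zero (rvar_ne_zero k) : rh * rvar k ≠ (0 : RatF (Fin n)))
      rwa [map_mul] at this
    rw [Rij_mulVec, smul_smul, normalization hu huz hhz, ← LinearMap.smul_apply, ← Rop_smul, mul_one,
      mul_assoc (u - z)⁻¹ u, mul_div_of_ne_zero hu]

theorem Lcoef_apply (al : Sgn) (i j : Fin N) (s : ℕ) (I J : Fin n → Fin N) :
    Lcoef n al i j s I J = PowerSeries.coeff s (Lps n al i j I J) := by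
  rw [← HahnSeries.ofPowerSeries_apply_coeff (Γ := ℤ), ← Lop_apply]
  rfl

/-- The coefficient of `u^k`, for any integer `k`. -/
def Lz (n : ℕ) (al : Sgn) (i j : Fin N) (k : ℤ) :
    Matrix (Fin n → Fin N) (Fin n → Fin N) (RatF (Fin n)) :=
  Matrix.of fun I J => (HahnSeries.ofPowerSeries ℤ _ (Lps n al i j I J)).coeff (al.val * k)

theorem Lz_eq (al : Sgn) (i j : Fin N) (k : ℤ) :
    Lz n al i j k = if 0 ≤ al.val * k then Lcoef n al i j k.natAbs else 0 := by
  ext I J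
  have h1 : (al.val * k).natAbs = k.natAbs := by cases al <;> simp [Sgn.val]
  have h2 := PowerSeries.coeff_coe (Lps n al i j I J) (al.val * k)
  rw [h1] at h2
  refine h2.trans ?_
  split_ifs with h3 h4 h4
  · omega
  · rfl
  · rw [Lcoef_apply]
  · omega

end LaurentExpansion

section TwoVariables

variable {K : Type*} [Field K]

/-- Laurent series in two variables. -/
abbrev Laurent2 (K : Type*) [Field K] : Type _ := LaurentSeries (LaurentSeries K)

/-- The series in the first variable. -/
def fstVar (K : Type*) [Field K] : PowerSeries K →+* Laurent2 K :=
  (HahnSeries.C : LaurentSeries K →+* Laurent2 K).comp (HahnSeries.ofPowerSeries ℤ K)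

/-- The series in the second variable. -/
def sndVar (K : Type*) [Field K] : PowerSeries K →+* Laurent2 K :=
  (HahnSeries.ofPowerSeries ℤ (LaurentSeries K)).comp (PowerSeries.map HahnSeries.C)

/-- The constants. -/
def const2 (K : Type*) [Field K] : K →+* Laurent2 K :=
  (HahnSeries.C : LaurentSeries K →+* Laurent2 K).comp HahnSeries.C

/-- The coefficient of `u^k v^l`. -/
def coeff2 (k l : ℤ) : Laurent2 K →+ K where
  toFun F := (F.coeff l).coeff k
  map_zero' := rfl
  map_add' _ _ := rfl

theorem sndVar_C (x : K) : sndVar K (PowerSeries.C x) = const2 K x := by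
  rw [sndVar, RingHom.comp_apply, PowerSeries.map_C, HahnSeries.ofPowerSeries_C]; rfl

theorem coeff2_const2_mul (k l : ℤ) (x : K) (F : Laurent2 K) :
    coeff2 k l (const2 K x * F) = x * coeff2 k l F := by
  change ((HahnSeries.C (HahnSeries.C x) * F).coeff l).coeff k = x * _
  rw [HahnSeries.C_mul_eq_smul, HahnSeries.coeff_smul, smul_eq_mul, HahnSeries.C_mul_eq_smul,
    HahnSeries.coeff_smul]
  rfl

theorem sndVar_coeff (B : PowerSeries K) (l : ℤ) :
    (sndVar K B).coeff l = HahnSeries.C ((HahnSeries.ofPowerSeries ℤ K B).coeff l) := by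
  change ((PowerSeries.map HahnSeries.C B : PowerSeries (LaurentSeries K)) :
    LaurentSeries (LaurentSeries K)).coeff l = _
  rw [PowerSeries.coeff_coe, PowerSeries.coeff_coe]
  split_ifs
  · rw [map_zero]
  · rw [PowerSeries.coeff_map]

theorem coeff2_mul (k l : ℤ) (A : LaurentSeries K) (B : PowerSeries K) :
    coeff2 k l (HahnSeries.C A * sndVar K B) =
      A.coeff k * (HahnSeries.ofPowerSeries ℤ K B).coeff l := by
  change ((HahnSeries.C A * sndVar K B).coeff l).coeff k = _
  rw [HahnSeries.C_mul_eq_smul, HahnSeries.coeff_smul, smul_eq_mul, sndVar_coeff, mul_comm,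
    HahnSeries.C_mul_eq_smul, HahnSeries.coeff_smul, smul_eq_mul, mul_comm]

/-- The first variable. -/
def uFst (K : Type*) [Field K] (al : Sgn) : Laurent2 K := HahnSeries.C (uLaurent al)

/-- The second variable. -/
def uSnd (K : Type*) [Field K] (al : Sgn) : Laurent2 K := uLaurent al

theorem coeff2_uFst_mul (al be : Sgn) (k l : ℤ) (A B : PowerSeries K) :
    coeff2 (al.val * k) (be.val * l) (uFst K al * (fstVar K A * sndVar K B)) =
      (HahnSeries.ofPowerSeries ℤ K A).coeff (al.val * (k - 1)) *
        (HahnSeries.ofPowerSeries ℤ K B).coeff (be.val * l) := by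
  rw [← mul_assoc, uFst, fstVar, RingHom.comp_apply, ← map_mul, coeff2_mul, uLaurent,
    HahnSeries.coeff_single_mul, one_mul, mul_sub, mul_one]

theorem coeff2_uSnd_mul (al be : Sgn) (k l : ℤ) (A B : PowerSeries K) :
    coeff2 (al.val * k) (be.val * l) (uSnd K be * (fstVar K A * sndVar K B)) =
      (HahnSeries.ofPowerSeries ℤ K A).coeff (al.val * k) *
        (HahnSeries.ofPowerSeries ℤ K B).coeff (be.val * (l - 1)) := by
  change ((uSnd K be * (fstVar K A * sndVar K B)).coeff (be.val * l)).coeff (al.val * k) = _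
  rw [uSnd, uLaurent, HahnSeries.coeff_single_mul, one_mul]
  refine (coeff2_mul _ _ _ B).trans ?_
  rw [mul_sub, mul_one]

theorem ker_sndVar (be : Sgn) {g : K} (hg : g ≠ 0) :
    sndVar K (eKer be g) * uSnd K be = sndVar K (fKer be g) * const2 K g := by
  cases be with
  | plus =>
    have := congrArg (sndVar K) (ker_plus hg)
    rw [map_mul, map_mul, sndVar_C] at this
    rw [this, sndVar, RingHom.comp_apply, RingHom.comp_apply, PowerSeries.map_X, HahnSeries.ofPowerSeries_X]
    rfl
  | minus =>
    have := congrArg (sndVar K) (ker_minus g)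
    rw [map_mul, map_mul, sndVar_C] at this
    have hX : sndVar K PowerSeries.X * uSnd K .minus = 1 := by
      rw [sndVar, RingHom.comp_apply, PowerSeries.map_X, HahnSeries.ofPowerSeries_X, uSnd, uLaurent,
        HahnSeries.single_mul_single]
      simp [Sgn.val]
    rw [← this, mul_assoc, hX, mul_one]

end TwoVariables

section RLL

variable {N n : ℕ}

theorem fstVar_Lps (al : Sgn) (i j : Fin N) (I J : Fin n → Fin N) :
    fstVar _ (Lps n al i j I J) = Lent (const2 _ rh)
      (fun k => HahnSeries.C (uLaurent al - HahnSeries.C (rvar k))⁻¹ * uFst _ al)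
      (fun k => HahnSeries.C (uLaurent al - HahnSeries.C (rvar k))⁻¹ * const2 _ (rvar k)) i j I J := by
  rw [fstVar, RingHom.comp_apply, ofPowerSeries_Lps, map_Lent]
  simp only [map_mul]
  rfl

theorem sndVar_Lps (be : Sgn) (i j : Fin N) (I J : Fin n → Fin N) :
    sndVar _ (Lps n be i j I J) = Lent (const2 _ rh)
      (fun k => (sndVar _ (eKer be (rvar k)) * const2 _ (rvar k)⁻¹) * uSnd _ be)
      (fun k => (sndVar _ (eKer be (rvar k)) * const2 _ (rvar k)⁻¹) * const2 _ (rvar k)) i j I J := by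
  have h1 : ∀ k : Fin n, const2 (RatF (Fin n)) (rvar k)⁻¹ * const2 _ (rvar k) = 1 := fun k => by
    rw [← map_mul, inv_mul_cancel₀ (rvar_ne_zero k), map_one]
  rw [Lps, map_Lent, sndVar_C]
  congr 1
  · funext k
    linear_combination -sndVar _ (fKer be (rvar k)) * h1 k -
      const2 _ (rvar k)⁻¹ * ker_sndVar be (rvar_ne_zero k)
  · funext k
    rw [mul_assoc, h1, mul_one]

theorem Rhom_linear {E : Type*} [CommRing E] (h u v : E) (x y : Fin N × Fin N) :
    Rhom N h u v x y = Rhom N h 1 0 x y * u + Rhom N h 0 1 x y * v := by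
  simp only [Rhom, Matrix.of_apply]
  split_ifs <;> ring

theorem map_Rhom {E F : Type*} [CommRing E] [CommRing F] (φ : E →+* F) (h u v : E) (x y : Fin N × Fin N) :
    φ (Rhom N h u v x y) = Rhom N (φ h) (φ u) (φ v) x y := by
  simp only [Rhom, Matrix.of_apply]
  split_ifs <;> simp

theorem Rhom_uv (al be : Sgn) (x y : Fin N × Fin N) :
    Rhom N (const2 (RatF (Fin n)) rh) (uFst _ al) (uSnd _ be) x y =
      const2 _ (algebraMap Coef _ (Rhom N hh 1 0 x y)) * uFst _ al +
        const2 _ (algebraMap Coef _ (Rhom N hh 0 1 x y)) * uSnd _ be := by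
  rw [Rhom_linear, map_Rhom, map_Rhom, map_Rhom, map_Rhom, map_one, map_zero, map_one, map_zero]
  rfl

theorem Lz_rll (al be : Sgn) (a b c d : Fin N) (k l : ℤ) :
    (∑ e, ∑ f, (Rhom N hh 1 0 (a, b) (e, f) • (Lz n al e c (k - 1) * Lz n be f d l) +
      Rhom N hh 0 1 (a, b) (e, f) • (Lz n al e c k * Lz n be f d (l - 1)))) =
    ∑ e, ∑ f, (Rhom N hh 1 0 (e, f) (c, d) • (Lz n be b f l * Lz n al a e (k - 1)) +
      Rhom N hh 0 1 (e, f) (c, d) • (Lz n be b f (l - 1) * Lz n al a e k)) := by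
  have h1 := Lent_rll (N := N) (const2 (RatF (Fin n)) rh) (uFst _ al) (uSnd _ be)
    (fun k => const2 _ (rvar k)) (fun k => HahnSeries.C (uLaurent al - HahnSeries.C (rvar k))⁻¹)
    (fun k => sndVar _ (eKer be (rvar k)) * const2 _ (rvar k)⁻¹) a b c d
  ext I J
  have h2 := congrArg (coeff2 (al.val * k) (be.val * l)) (congrFun (congrFun h1 I) J)
  simp only [Matrix.sum_apply, Matrix.smul_apply, Matrix.mul_apply, smul_eq_mul, ← fstVar_Lps,
    ← sndVar_Lps] at h2
  simp only [map_sum, Rhom_uv, add_mul, map_add, mul_sum, mul_assoc, coeff2_const2_mul] at h2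
  have hc : ∀ A B : PowerSeries (RatF (Fin n)), sndVar _ A * fstVar _ B = fstVar _ B * sndVar _ A :=
    fun _ _ => mul_comm _ _
  simp only [hc, coeff2_uFst_mul, coeff2_uSnd_mul] at h2
  have hc1 : ∀ A B : LaurentSeries (RatF (Fin n)), A.coeff (be.val * l) * B.coeff (al.val * (k - 1)) =
      B.coeff (al.val * (k - 1)) * A.coeff (be.val * l) := fun _ _ => mul_comm _ _
  have hc2 : ∀ A B : LaurentSeries (RatF (Fin n)), A.coeff (be.val * (l - 1)) * B.coeff (al.val * k) =
      B.coeff (al.val * k) * A.coeff (be.val * (l - 1)) := fun _ _ => mul_comm _ _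
  simp only [Matrix.sum_apply, Matrix.add_apply, Matrix.smul_apply, Matrix.mul_apply, Lz, Matrix.of_apply,
    hc1, hc2]
  simp only [Algebra.smul_def, mul_sum, ← sum_add_distrib]
  exact h2

end RLL

end LoopK

end

noncomputable section

namespace LoopK

open Finset Matrix

section KernelCoefficients

variable {E F : Type*} [Field E] [Field F]

theorem one_sub_mul_X_inv_eq (a : E) :
    (1 - PowerSeries.C a * PowerSeries.X)⁻¹ = PowerSeries.mk fun s => a ^ s := by
  rw [eq_comm, PowerSeries.eq_inv_iff_mul_eq_one (constantCoeff_one_sub_mul_X a)]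
  ext s
  rw [mul_sub, mul_one, ← mul_assoc, map_sub]
  cases s with
  | zero => simp
  | succ s =>
    rw [PowerSeries.coeff_succ_mul_X, mul_comm, PowerSeries.coeff_C_mul, PowerSeries.coeff_mk,
      PowerSeries.coeff_mk, PowerSeries.coeff_one, if_neg (Nat.succ_ne_zero s), pow_succ', sub_self]

theorem coeff_eKer (al : Sgn) (g : E) (s : ℕ) : PowerSeries.coeff s (eKer al g) =
    match al with
    | .plus => -(g⁻¹ ^ s)
    | .minus => if s = 0 then 0 else g ^ s := by
  cases al with
  | plus => rw [eKer, one_sub_mul_X_inv_eq, map_neg, PowerSeries.coeff_mk]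
  | minus =>
    rw [eKer, one_sub_mul_X_inv_eq, mul_assoc, PowerSeries.coeff_C_mul]
    cases s with
    | zero => simp
    | succ s =>
      rw [mul_comm PowerSeries.X, PowerSeries.coeff_succ_mul_X, PowerSeries.coeff_mk, ← pow_succ']
      rfl

theorem coeff_fKer (al : Sgn) (g : E) (s : ℕ) : PowerSeries.coeff s (fKer al g) =
    match al with
    | .plus => if s = 0 then 0 else -(g⁻¹ ^ s)
    | .minus => g ^ s := by
  have h := congrArg (PowerSeries.coeff s) (fKer_sub_eKer al g)
  rw [map_sub, coeff_eKer, PowerSeries.coeff_one, sub_eq_iff_eq_add] at h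
  rw [h]
  cases al <;> cases s <;> simp

theorem map_eKer (φ : E →+* F) (al : Sgn) (g : E) : PowerSeries.map φ (eKer al g) = eKer al (φ g) := by
  ext s
  rw [PowerSeries.coeff_map, coeff_eKer, coeff_eKer]
  cases al
  · simp
  · simp only; split_ifs <;> simp

theorem map_fKer (φ : E →+* F) (al : Sgn) (g : E) : PowerSeries.map φ (fKer al g) = fKer al (φ g) := by
  ext s
  rw [PowerSeries.coeff_map, coeff_fKer, coeff_fKer]
  cases al
  · simp only; split_ifs <;> simp
  · simp

theorem coeff_eKer_mem (S : Subring E) (al : Sgn) {g : E} (h1 : g ∈ S) (h2 : g⁻¹ ∈ S) (s : ℕ) :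
    PowerSeries.coeff s (eKer al g) ∈ S := by
  rw [coeff_eKer]
  cases al
  · exact neg_mem (pow_mem h2 s)
  · simp only
    split_ifs
    exacts [zero_mem _, pow_mem h1 s]

theorem coeff_fKer_mem (S : Subring E) (al : Sgn) {g : E} (h1 : g ∈ S) (h2 : g⁻¹ ∈ S) (s : ℕ) :
    PowerSeries.coeff s (fKer al g) ∈ S := by
  rw [coeff_fKer]
  cases al
  · simp only
    split_ifs
    exacts [zero_mem _, neg_mem (pow_mem h2 s)]
  · exact pow_mem h1 s

end KernelCoefficients

section Triangular

variable {E : Type*} [CommRing E] {N n : ℕ}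

theorem cons_comp_swap (b : Fin N) (J : Fin n → Fin N) (k : Fin n) :
    (Fin.cons b J : Fin (n + 1) → Fin N) ∘ Equiv.swap 0 k.succ =
      Fin.cons (J k) (Function.update J k b) := by
  ext x
  congr 1
  induction x using Fin.cases with
  | zero => simp
  | succ x =>
    by_cases hx : x = k
    · subst hx; simp
    · rw [Function.comp_apply, Equiv.swap_apply_of_ne_of_ne (Fin.succ_ne_zero _)
        (fun h => hx (Fin.succ_injective _ h)), Fin.cons_succ, Fin.cons_succ, Function.update_of_ne hx]

theorem dprod_tri {m : ℕ} (h : E) (s t : Fin m → E) (e : Fin m → Fin n) (S : Set (Fin N)) (i : Fin N)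
    (hS : ∀ k b, (b ∈ S ∨ b = i) → ∀ x, x ∉ S → wb h (s k) (t k) b x = 0)
    {f : (Fin (n + 1) → Fin N) → E} (hf : ∀ b ∈ S, ∀ J, f (Fin.cons b J) = 0) :
    (∀ b ∈ S, ∀ J, dprod (fun k => Rop h (s k) (t k) 0 (e k).succ) f (Fin.cons b J) = 0) ∧
      ∀ I, dprod (fun k => Rop h (s k) (t k) 0 (e k).succ) f (Fin.cons i I) =
        (∏ k, wa h (s k) (t k) i (I (e k))) * f (Fin.cons i I) := by
  induction m with
  | zero => simpa [dprod_zero] using hf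
  | succ m ih =>
    obtain ⟨h1, h2⟩ := ih (fun k => s k.castSucc) (fun k => t k.castSucc) (fun k => e k.castSucc)
      fun k => hS k.castSucc
    set G := dprod (fun k : Fin m => (Rop h (s k.castSucc) (t k.castSucc) 0 (e k.castSucc).succ :
      Module.End E ((Fin (n + 1) → Fin N) → E))) f with hG
    have key : ∀ b, (b ∈ S ∨ b = i) → ∀ J,
        dprod (fun k => Rop h (s k) (t k) 0 (e k).succ) f (Fin.cons b J) =
          wa h (s (Fin.last m)) (t (Fin.last m)) b (J (e (Fin.last m))) * G (Fin.cons b J) := by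
      intro b hb J
      rw [dprod_succ, Module.End.mul_apply, ← hG, Rop_apply, cons_comp_swap, Fin.cons_zero, Fin.cons_succ]
      by_cases hx : J (e (Fin.last m)) ∈ S
      · rw [h1 _ hx, mul_zero, add_zero]
      · rw [hS _ b hb _ hx, zero_mul, add_zero]
    refine ⟨fun b hb J => ?_, fun I => ?_⟩
    · rw [key b (Or.inl hb), h1 b hb, mul_zero]
    · rw [key i (Or.inr rfl), h2, Fin.prod_univ_castSucc]
      ring

theorem cons_inj_iff (a b : Fin N) (I J : Fin n → Fin N) :
    (Fin.cons a I : Fin (n + 1) → Fin N) = Fin.cons b J ↔ a = b ∧ I = J := Fin.cons_inj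

theorem Lent_tri (h : E) (s t : Fin n → E) (S : Set (Fin N)) (i j : Fin N)
    (hS : ∀ k b, (b ∈ S ∨ b = i) → ∀ x, x ∉ S → wb h (s k) (t k) b x = 0) (hj : j ∉ S)
    (I J : Fin n → Fin N) :
    Lent h s t i j I J = (∏ k, wa h (s k) (t k) i (I k)) * if i = j ∧ I = J then 1 else 0 := by
  have h1 := (dprod_tri h s t id S i hS (f := Pi.single (Fin.cons j J) 1) fun b hb K => by
    rw [Pi.single_apply, if_neg]
    rw [cons_inj_iff]
    rintro ⟨rfl, -⟩
    exact hj hb).2 I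
  refine h1.trans ?_
  rw [Pi.single_apply]
  simp only [cons_inj_iff, id]

end Triangular

section Action

variable {N n : ℕ}

theorem Lcoef_zero_apply (al : Sgn) (i j : Fin N) (I J : Fin n → Fin N) :
    Lcoef n al i j 0 I J = Lent rh
      (fun _ => match al with | .plus => 0 | .minus => 1)
      (fun _ => match al with | .plus => -1 | .minus => 0) i j I J := by
  rw [Lcoef_apply, Lps, PowerSeries.coeff_zero_eq_constantCoeff_apply, map_Lent,
    PowerSeries.constantCoeff_C]
  congr 1
  · funext k
    rw [← PowerSeries.coeff_zero_eq_constantCoeff_apply, coeff_fKer]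
    cases al <;> simp
  · funext k
    rw [← PowerSeries.coeff_zero_eq_constantCoeff_apply, coeff_eKer]
    cases al <;> simp

theorem Lcoef_plus_zero {i j : Fin N} (hij : i ≤ j) :
    Lcoef n .plus i j 0 = if i = j then diagonal fun I => ∏ k, if I k ≤ i then rh else 1 else 0 := by
  ext I J
  rw [Lcoef_zero_apply, Lent_tri _ _ _ {b | b < i} i j (fun k b hb x hx => ?_) (not_lt.2 hij)]
  · have h1 : ∀ x, wa rh 0 (-1) i x = if x ≤ i then (rh : RatF (Fin n)) else 1 := fun x => by
      rcases lt_trichotomy i x with h | h | h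
      · rw [wa_lt _ _ _ h, if_neg h.not_ge]; ring
      · rw [h, wa_self, if_pos le_rfl]; ring
      · rw [wa_gt _ _ _ h, if_pos h.le]; ring
    simp only [h1]
    by_cases h2 : i = j
    · simp [h2, diagonal_apply]
    · simp [h2]
  · have hx' : i ≤ x := not_lt.1 hx
    have hb' : b ≤ i := by
      rcases hb with hb | rfl
      exacts [le_of_lt hb, le_rfl]
    rcases (hb'.trans hx').lt_or_eq with h | h
    · rw [wb_lt _ _ _ h, mul_zero]
    · rw [h, wb_self]

theorem Lcoef_minus_zero {i j : Fin N} (hij : j ≤ i) :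
    Lcoef n .minus i j 0 = if i = j then diagonal fun I => ∏ k, if I k < i then rh else 1 else 0 := by
  ext I J
  rw [Lcoef_zero_apply, Lent_tri _ _ _ {b | i < b} i j (fun k b hb x hx => ?_) (not_lt.2 hij)]
  · have h1 : ∀ x, wa rh 1 0 i x = if x < i then (rh : RatF (Fin n)) else 1 := fun x => by
      rcases lt_trichotomy i x with h | h | h
      · rw [wa_lt _ _ _ h, if_neg h.not_gt]; ring
      · rw [h, wa_self, if_neg (lt_irrefl _)]; ring
      · rw [wa_gt _ _ _ h, if_pos h]; ring
    simp only [h1]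
    by_cases h2 : i = j
    · simp [h2, diagonal_apply]
    · simp [h2]
  · have hx' : x ≤ i := not_lt.1 hx
    have hb' : i ≤ b := by
      rcases hb with hb | rfl
      exacts [le_of_lt hb, le_rfl]
    rcases (hx'.trans hb').lt_or_eq with h | h
    · rw [wb_gt _ _ _ h, mul_zero]
    · rw [h, wb_self]

theorem isUnit_det_Lcoef (i : Fin N) : IsUnit (Lcoef n .plus i i 0).det := by
  rw [Lcoef_plus_zero le_rfl, if_pos rfl, det_diagonal, isUnit_iff_ne_zero]
  refine prod_ne_zero_iff.2 fun I _ => prod_ne_zero_iff.2 fun k _ => ?_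
  split_ifs
  exacts [rh_ne_zero, one_ne_zero]

/-- The action of the generators. -/
def phiFree (N n : ℕ) :
    FreeAlgebra Coef (Gen N) →ₐ[Coef] Matrix (Fin n → Fin N) (Fin n → Fin N) (RatF (Fin n)) :=
  FreeAlgebra.lift Coef fun
    | .L al i j s => Lcoef n al i j s
    | .Linv i => (Lcoef n .plus i i 0)⁻¹

theorem phiFree_L (al : Sgn) (i j : Fin N) (s : ℕ) :
    phiFree N n (FreeAlgebra.ι Coef (.L al i j s)) = Lcoef n al i j s :=
  FreeAlgebra.lift_ι_apply _ _

theorem phiFree_Linv (i : Fin N) :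
    phiFree N n (FreeAlgebra.ι Coef (.Linv i)) = (Lcoef n .plus i i 0)⁻¹ :=
  FreeAlgebra.lift_ι_apply _ _

theorem phiFree_Lco (al : Sgn) (i j : Fin N) (k : ℤ) : phiFree N n (Lco al i j k) = Lz n al i j k := by
  rw [Lco, Lz_eq, apply_ite (phiFree N n), phiFree_L, map_zero]

theorem phiFree_Lco_zero (al : Sgn) (i j : Fin N) :
    phiFree N n (Lco al i j 0) = Lcoef n al i j 0 := by
  rw [phiFree_Lco, Lz_eq]
  simp

theorem phiFree_rel {x y : FreeAlgebra Coef (Gen N)} (h : Rel N x y) : phiFree N n x = phiFree N n y := by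
  cases h with
  | upper_plus i j h => rw [phiFree_Lco_zero, Lcoef_plus_zero h.le, if_neg h.ne, map_zero]
  | lower_minus i j h => rw [phiFree_Lco_zero, Lcoef_minus_zero h.le, if_neg h.ne', map_zero]
  | mul_inv i => rw [map_mul, phiFree_Lco_zero, phiFree_Linv, mul_nonsing_inv _ (isUnit_det_Lcoef i), map_one]
  | inv_mul i => rw [map_mul, phiFree_Lco_zero, phiFree_Linv, nonsing_inv_mul _ (isUnit_det_Lcoef i), map_one]
  | first i h =>
    rw [phiFree_Lco_zero, Lcoef_minus_zero le_rfl, if_pos rfl, map_one, ← diagonal_one]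
    congr 1
    funext I
    refine prod_eq_one fun k _ => if_neg fun h' => ?_
    have := Fin.lt_def.1 h'
    omega
  | next i j h =>
    rw [phiFree_Lco_zero, phiFree_Lco_zero, Lcoef_minus_zero le_rfl, Lcoef_plus_zero le_rfl, if_pos rfl,
      if_pos rfl]
    congr 1
    funext I
    refine prod_congr rfl fun k _ => ?_
    have : I k ≤ i ↔ I k < j := by rw [Fin.le_def, Fin.lt_def]; omega
    simp only [this]
  | rll al be a b c d k l _ =>
    simp only [map_sum, map_add, map_smul, map_mul, phiFree_Lco]
    exact Lz_rll al be a b c d k l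

/-- The action of `U_h` on vector-valued functions. -/
def phi (N n : ℕ) : U N →ₐ[Coef] Matrix (Fin n → Fin N) (Fin n → Fin N) (RatF (Fin n)) :=
  RingQuot.liftAlgHom Coef ⟨phiFree N n, fun _ _ h => phiFree_rel h⟩

theorem phi_mk (x : FreeAlgebra Coef (Gen N)) :
    phi N n (RingQuot.mkAlgHom Coef (Rel N) x) = phiFree N n x :=
  RingQuot.liftAlgHom_mkAlgHom_apply _ _ _ _

theorem phi_LL (al : Sgn) (i j : Fin N) (s : ℕ) : phi N n (LL al i j s) = Lcoef n al i j s := by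
  rw [LL, phi_mk, phiFree_L]

end Action

section Symmetry

variable {N n : ℕ}

theorem map_permute_Lps (π : Equiv.Perm (Fin n)) (al : Sgn) (a b : Fin N) (I J : Fin n → Fin N) :
    PowerSeries.map (permute π) (Lps n al a b I J) =
      Lent (PowerSeries.C rh) (fun k => fKer al (rvar (π k))) (fun k => eKer al (rvar (π k))) a b I J := by
  rw [Lps, map_Lent, PowerSeries.map_C, permute_rh]
  simp only [map_fKer, map_eKer, permute_rvar]

theorem Rch_cons {E : Type*} [CommRing E] (h x y : E) (i j : Fin n) (f : (Fin (n + 1) → Fin N) → E)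
    (a : Fin N) (I : Fin n → Fin N) :
    Rch h x y i.succ j.succ f (Fin.cons a I) = Rch h x y i j (fun K => f (Fin.cons a K)) I := by
  have he : ∀ K : Fin n → Fin N, Function.extend Fin.succ K (Fin.cons a I : Fin (n + 1) → Fin N) =
      Fin.cons a K := by
    intro K
    ext x
    congr 1
    induction x using Fin.cases with
    | zero =>
      rw [Function.extend_apply', Fin.cons_zero, Fin.cons_zero]
      rintro ⟨k, hk⟩
      exact Fin.succ_ne_zero k hk
    | succ x => rw [(Fin.succ_injective n).extend_apply, Fin.cons_succ]
  have h1 := congrFun (resAt_Rch (Fin.succ_injective n) (Fin.cons a I) h x y i j f) I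
  have h2 : resAt Fin.succ (Fin.cons a I) f = fun K => f (Fin.cons a K) :=
    funext fun K => congrArg f (he K)
  rw [h2] at h1
  simpa only [resAt, he] using h1

theorem Lcoef_Rch {i j : Fin n} (hij : (i : ℕ) + 1 = j) (al : Sgn) (a b : Fin N) (s : ℕ) (g : V N n) :
    Rch rh (rvar i) (rvar j) i j ((Lcoef n al a b s).map (permute (Equiv.swap i j)) *ᵥ g) =
      Lcoef n al a b s *ᵥ Rch rh (rvar i) (rvar j) i j g := by
  let Cr : RatF (Fin n) →+* LaurentSeries (RatF (Fin n)) := HahnSeries.C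
  let ps := HahnSeries.ofPowerSeries ℤ (RatF (Fin n))
  ext I
  have h1 := congrArg (fun F => F (fun x => if x 0 = b then Cr (g (Fin.tail x)) else 0) (Fin.cons a I))
    (Rch_mul_Mon (N := N) (Cr rh) (uLaurent al) (fun k => Cr (rvar k))
      (fun k => (uLaurent al - Cr (rvar k))⁻¹) hij)
  simp only [Module.End.mul_apply, Rch_cons, Mon_apply, Fin.cons_zero, Fin.tail_cons] at h1
  have hA : ∀ K J, Lent (Cr rh) (fun k => (uLaurent al - Cr (rvar k))⁻¹ * uLaurent al)
      (fun k => (uLaurent al - Cr (rvar k))⁻¹ * Cr (rvar k)) a b K J = ps (Lps n al a b K J) :=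
    fun K J => (ofPowerSeries_Lps al a b K J).symm
  have hA' : ∀ K J, Lent (Cr rh)
      (fun k => (uLaurent al - Cr (rvar (Equiv.swap i j k)))⁻¹ * uLaurent al)
      (fun k => (uLaurent al - Cr (rvar (Equiv.swap i j k)))⁻¹ * Cr (rvar (Equiv.swap i j k))) a b K J =
      ps (PowerSeries.map (permute (Equiv.swap i j)) (Lps n al a b K J)) := by
    intro K J
    rw [map_permute_Lps, map_Lent]
    simp only [ps, fKer_coe al (rvar_ne_zero _), eKer_coe al (rvar_ne_zero _), HahnSeries.ofPowerSeries_C]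
    rfl
  have hsum : ∀ (A : Fin N → (Fin n → Fin N) → LaurentSeries (RatF (Fin n))) (B : (Fin n → Fin N) →
      LaurentSeries (RatF (Fin n))), (∑ c, ∑ K, A c K * if c = b then B K else 0) = ∑ K, A b K * B K := by
    intro A B
    rw [sum_eq_single b]
    · simp
    · intro c _ hc; simp [hc]
    · intro h; exact absurd (mem_univ _) h
  have hR : ∀ c K, Rch (Cr rh) (Cr (rvar i)) (Cr (rvar j)) i j
      (fun K => if c = b then Cr (g K) else 0) K =
      if c = b then Cr (Rch rh (rvar i) (rvar j) i j g K) else 0 := by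
    intro c K
    rw [Rch_apply, Rch_apply]
    split_ifs
    · rw [map_add, map_mul, map_mul, map_wa, map_wb]
    · rw [mul_zero, mul_zero, add_zero]
  simp only [hR, hsum, hA, hA'] at h1
  have h2 := congrArg (fun F : LaurentSeries (RatF (Fin n)) => F.coeff (s : ℤ)) h1
  have hcm : ∀ (x : RatF (Fin n)) (F : LaurentSeries (RatF (Fin n))) (k : ℤ),
      (Cr x * F).coeff k = x * F.coeff k := by
    intro x F k
    rw [HahnSeries.C_mul_eq_smul, HahnSeries.coeff_smul, smul_eq_mul]
  have hmc : ∀ (x : RatF (Fin n)) (F : LaurentSeries (RatF (Fin n))) (k : ℤ),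
      (F * Cr x).coeff k = F.coeff k * x := by
    intro x F k
    rw [mul_comm, hcm, mul_comm]
  have hps : ∀ F : PowerSeries (RatF (Fin n)), (ps F).coeff (s : ℤ) = PowerSeries.coeff s F :=
    fun F => HahnSeries.ofPowerSeries_apply_coeff F s
  simp only [Rch_apply, ← map_wa, ← map_wb, HahnSeries.coeff_add, hcm, HahnSeries.coeff_sum, hmc, hps,
    PowerSeries.coeff_map, ← Lcoef_apply] at h2
  simp only [Rch_apply, mulVec, dotProduct, Matrix.map_apply]
  exact h2

theorem sTilde_Lcoef {i j : Fin n} (hij : (i : ℕ) + 1 = j) (al : Sgn) (a b : Fin N) (s : ℕ) (f : V N n) :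
    sTilde i j (Lcoef n al a b s *ᵥ f) = Lcoef n al a b s *ᵥ sTilde i j f := by
  rw [sTilde_eq, sTilde_eq, mulVec_smul, ← Lcoef_Rch hij]
  congr 2
  ext I
  simp only [permVec, mulVec, dotProduct, map_sum, map_mul, Matrix.map_apply]

theorem Lent_mem {E : Type*} [CommRing E] (T : Subring E) {h : E} {s t : Fin n → E} (hh : h ∈ T)
    (hs : ∀ k, s k ∈ T) (ht : ∀ k, t k ∈ T) (i j : Fin N) (I J : Fin n → Fin N) :
    Lent h s t i j I J ∈ T := by
  have := map_Lent T.subtype ⟨h, hh⟩ (fun k => ⟨s k, hs k⟩) (fun k => ⟨t k, ht k⟩) i j I J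
  rw [show Lent h s t i j I J = _ from this.symm]
  exact Subtype.property _

/-- The power series with coefficients in a subring. -/
def coeffSubring {E : Type*} [CommRing E] (S : Subring E) : Subring (PowerSeries E) where
  carrier := {F | ∀ s, PowerSeries.coeff s F ∈ S}
  zero_mem' s := by rw [map_zero]; exact zero_mem _
  one_mem' s := by
    rw [PowerSeries.coeff_one]
    split_ifs
    exacts [one_mem _, zero_mem _]
  add_mem' ha hb s := by rw [map_add]; exact add_mem (ha s) (hb s)
  neg_mem' ha s := by rw [map_neg]; exact neg_mem (ha s)
  mul_mem' ha hb s := by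
    rw [PowerSeries.coeff_mul]
    exact sum_mem fun p _ => mul_mem (ha _) (hb _)

theorem C_mem_coeffSubring {E : Type*} [CommRing E] {S : Subring E} {x : E} (hx : x ∈ S) :
    PowerSeries.C x ∈ coeffSubring S := by
  intro s
  rw [PowerSeries.coeff_C]
  split_ifs
  exacts [hx, zero_mem _]

theorem Lcoef_mem (al : Sgn) (i j : Fin N) (s : ℕ) (I J : Fin n → Fin N) :
    Lcoef n al i j s I J ∈ laurentRange (Fin n) := by
  rw [Lcoef_apply]
  exact Lent_mem (coeffSubring (laurentRange (Fin n))) (C_mem_coeffSubring rh_mem_laurentRange)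
    (fun k => coeff_fKer_mem _ al (rvar_mem_laurentRange k) (inv_rvar_mem_laurentRange k))
    (fun k => coeff_eKer_mem _ al (rvar_mem_laurentRange k) (inv_rvar_mem_laurentRange k)) i j I J s

/-- The matrices with Laurent polynomial entries that commute with all `s̃_i`. -/
def symMat (N n : ℕ) :
    Subalgebra Coef (Matrix (Fin n → Fin N) (Fin n → Fin N) (RatF (Fin n))) where
  carrier := {M | (∀ I J, M I J ∈ laurentRange (Fin n)) ∧
    ∀ i j : Fin n, (i : ℕ) + 1 = j → ∀ f, sTilde i j (M *ᵥ f) = M *ᵥ sTilde i j f}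
  mul_mem' := by
    rintro A B ⟨hA, hA'⟩ ⟨hB, hB'⟩
    refine ⟨fun I J => ?_, fun i j hij f => ?_⟩
    · rw [Matrix.mul_apply]
      exact sum_mem fun K _ => mul_mem (hA _ _) (hB _ _)
    · rw [← mulVec_mulVec, hA' i j hij, hB' i j hij, mulVec_mulVec]
  add_mem' := by
    rintro A B ⟨hA, hA'⟩ ⟨hB, hB'⟩
    refine ⟨fun I J => add_mem (hA _ _) (hB _ _), fun i j hij f => ?_⟩
    rw [add_mulVec, sTilde_add, hA' i j hij, hB' i j hij, add_mulVec]
  algebraMap_mem' c := by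
    refine ⟨fun I J => ?_, fun i j hij f => ?_⟩
    · rw [algebraMap_matrix_apply]
      split_ifs
      exacts [coef_mem_laurentRange c, zero_mem _]
    · have : ∀ g : V N n, algebraMap Coef (Matrix (Fin n → Fin N) (Fin n → Fin N) (RatF (Fin n))) c *ᵥ g =
          (algebraMap Coef (RatF (Fin n)) c) • g := by
        intro g
        ext I
        rw [mulVec, dotProduct, sum_eq_single I]
        · rw [algebraMap_matrix_apply, if_pos rfl]; rfl
        · intro J _ hJ
          rw [algebraMap_matrix_apply, if_neg hJ.symm, zero_mul]
        · intro h; exact absurd (mem_univ _) h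
      rw [this, this, sTilde_smul, permute_coef]

theorem phi_mem_symMat (X : U N) : phi N n X ∈ symMat N n := by
  obtain ⟨x, rfl⟩ := RingQuot.mkAlgHom_surjective Coef (Rel N) X
  rw [phi_mk]
  induction x using FreeAlgebra.induction with
  | grade0 c => rw [AlgHom.commutes]; exact (symMat N n).algebraMap_mem c
  | grade1 g =>
    cases g with
    | L al i j s =>
      rw [phiFree_L]
      exact ⟨Lcoef_mem al i j s, fun i' j' hij f => sTilde_Lcoef hij al i j s f⟩
    | Linv i =>
      rw [phiFree_Linv]
      refine ⟨fun I J => ?_, fun i' j' hij f => ?_⟩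
      · rw [Lcoef_plus_zero le_rfl, if_pos rfl, inv_diagonal, diagonal_apply]
        split_ifs
        · have : IsUnit (fun I : Fin n → Fin N => ∏ k, if I k ≤ i then (rh : RatF (Fin n)) else 1) := by
            rw [Pi.isUnit_iff]
            intro I
            refine isUnit_iff_ne_zero.2 (prod_ne_zero_iff.2 fun k _ => ?_)
            split_ifs
            exacts [rh_ne_zero, one_ne_zero]
          obtain ⟨u, hu⟩ := this
          have h2 : Ring.inverse (fun I : Fin n → Fin N => ∏ k, if I k ≤ i then (rh : RatF (Fin n)) else 1) I =
              (∏ k, if I k ≤ i then (rh : RatF (Fin n)) else 1)⁻¹ := by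
            rw [← hu, Ring.inverse_unit]
            refine eq_inv_of_mul_eq_one_left ?_
            have := congrFun u.inv_mul I
            rw [Pi.mul_apply, hu] at this
            exact this
          rw [h2, ← prod_inv_distrib]
          refine prod_mem fun k _ => ?_
          split_ifs
          · rw [rh, ← map_inv₀]; exact coef_mem_laurentRange _
          · rw [inv_one]; exact one_mem _
        · exact zero_mem _
      · have hu := isUnit_det_Lcoef (n := n) i
        have h1 := sTilde_Lcoef hij .plus i i 0 ((Lcoef n .plus i i 0)⁻¹ *ᵥ f)
        rw [mulVec_mulVec, mul_nonsing_inv _ hu, one_mulVec] at h1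
        rw [h1, mulVec_mulVec, nonsing_inv_mul _ hu, one_mulVec]
  | mul x y hx hy => rw [map_mul]; exact mul_mem hx hy
  | add x y hx hy => rw [map_add]; exact add_mem hx hy

theorem mulVec_laurent_smul (M : Matrix (Fin n → Fin N) (Fin n → Fin N) (RatF (Fin n)))
    (g : Laurent (Fin n)) (w : V N n) : M *ᵥ (g • w) = g • (M *ᵥ w) := by
  have h : ∀ w : V N n, g • w = (algebraMap _ (RatF (Fin n)) g) • w := fun w => by
    ext I; rw [Pi.smul_apply, Algebra.smul_def]; rfl
  rw [h, h, mulVec_smul]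

theorem mulVec_mem_DVz {M : Matrix (Fin n → Fin N) (Fin n → Fin N) (RatF (Fin n))} (hM : M ∈ symMat N n)
    {w : V N n} (hw : w ∈ DVz N n) : M *ᵥ w ∈ DVz N n := by
  refine Submodule.span_induction (p := fun w _ => M *ᵥ w ∈ DVz N n) ?_ ?_ ?_ ?_ hw
  · intro w hw
    refine Submodule.subset_span ⟨fun I => ?_, fun i j hij => ?_⟩
    · have : DD n * (M *ᵥ w) I ∈ laurentRange (Fin n) := by
        rw [mulVec, dotProduct, mul_sum]
        refine sum_mem fun K _ => ?_
        rw [mul_left_comm]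
        exact mul_mem (hM.1 _ _) (hw.1 K)
      exact this
    · rw [hM.2 i j hij, hw.2 i j hij]
  · rw [mulVec_zero]; exact zero_mem _
  · intro x y _ _ hx hy
    rw [mulVec_add]; exact add_mem hx hy
  · intro g x _ hx
    rw [mulVec_laurent_smul]; exact Submodule.smul_mem _ _ hx

end Symmetry

section Transport

variable {N n : ℕ} {xi : (Fin n → Fin N) → V N n}

theorem exists_nu_eq (hxi : IsXi xi) (X : U N) (x : KT N n) : ∃ y, nu xi y = phi N n X *ᵥ nu xi x := by
  have h := mulVec_mem_DVz (phi_mem_symMat X) (nu_mem_DVz hxi x)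
  have h2 : phi N n X *ᵥ nu xi x ∈ Set.range (nu xi) := by rw [range_nu hxi]; exact h
  exact h2

theorem smul_V (c : Coef) (w : V N n) : c • w = (algebraMap Coef (RatF (Fin n)) c) • w := by
  ext I; rw [Pi.smul_apply, Algebra.smul_def]; rfl

theorem algebraMap_mulVec (c : Coef) (g : V N n) :
    algebraMap Coef (Matrix (Fin n → Fin N) (Fin n → Fin N) (RatF (Fin n))) c *ᵥ g = c • g := by
  rw [Algebra.algebraMap_eq_smul_one, smul_mulVec, one_mulVec]

/-- The action of `U_h` on the K-theory. -/
theorem exists_rho (hxi : IsXi xi) : ∃ rho : U N →ₐ[Coef] Module.End Coef (KT N n),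
    ∀ X x, nu xi (rho X x) = phi N n X *ᵥ nu xi x := by
  choose r hr using exists_nu_eq (n := n) hxi
  have hinj := nu_injective hxi
  let f : U N → Module.End Coef (KT N n) := fun X =>
    { toFun := r X
      map_add' := fun x y => hinj (by rw [map_add, hr, hr, hr, map_add, mulVec_add])
      map_smul' := fun c x => hinj (by
        rw [RingHom.id_apply, map_smul, hr, hr, map_smul, smul_V, smul_V, mulVec_smul]) }
  have hf : ∀ X x, nu xi (f X x) = phi N n X *ᵥ nu xi x := hr
  refine ⟨{ toFun := f
            map_one' := LinearMap.ext fun x => hinj (by rw [hf, map_one, one_mulVec]; rfl)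
            map_mul' := fun X Y => LinearMap.ext fun x => hinj (by
              rw [hf, map_mul, ← mulVec_mulVec, Module.End.mul_apply, hf, hf])
            map_zero' := LinearMap.ext fun x => hinj (by
              rw [hf, map_zero, zero_mulVec, LinearMap.zero_apply, map_zero])
            map_add' := fun X Y => LinearMap.ext fun x => hinj (by
              rw [hf, map_add, add_mulVec, LinearMap.add_apply, map_add, hf, hf])
            commutes' := fun c => LinearMap.ext fun x => hinj (by
              rw [hf, AlgHom.commutes, algebraMap_mulVec, Module.algebraMap_end_apply, map_smul]) }, hf⟩

end Transport

end LoopK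

end

noncomputable section

namespace LoopK

open Finset Matrix

section Fusion

variable {E : Type*} [CommRing E] {N n m : ℕ}

theorem elim_comp_swap {ι : Type*} [DecidableEq ι] (A : ι → Fin N) (I : Fin n → Fin N) (r : ι) (k : Fin n) :
    (Sum.elim A I : ι ⊕ Fin n → Fin N) ∘ Equiv.swap (Sum.inl r) (Sum.inr k) =
      Sum.elim (Function.update A r (I k)) (Function.update I k (A r)) := by
  ext x
  congr 1
  rcases x with x | x
  · by_cases hx : x = r
    · subst hx; simp
    · rw [Function.comp_apply, Equiv.swap_apply_of_ne_of_ne (fun h => hx (Sum.inl.inj h)) Sum.inl_ne_inr,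
        Sum.elim_inl, Sum.elim_inl, Function.update_of_ne hx]
  · by_cases hx : x = k
    · subst hx; simp
    · rw [Function.comp_apply, Equiv.swap_apply_of_ne_of_ne Sum.inr_ne_inl (fun h => hx (Sum.inr.inj h)),
        Sum.elim_inr, Sum.elim_inr, Function.update_of_ne hx]

/-- The product of the R-matrices of the auxiliary factors in the list `l` with the site `k`. -/
def siteProd {ι : Type*} [DecidableEq ι] (h : E) (s t : ι → Fin n → E) (k : Fin n) (l : List ι) :
    Module.End E ((ι ⊕ Fin n → Fin N) → E) :=
  (l.map fun r => Rop h (s r k) (t r k) (Sum.inl r) (Sum.inr k)).prod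

/-- The function is supported on the multi-indices with the colour `c` at the site `k`. -/
def Conc {ι : Type*} (k : Fin n) (c : Fin N) (F : (ι ⊕ Fin n → Fin N) → E) : Prop :=
  ∀ A I, I k ≠ c → F (Sum.elim A I) = 0

section SiteProd

variable {ι : Type*} [DecidableEq ι] {h : E} {s t : ι → Fin n → E} {k : Fin n} {c : Fin N}
  {F : (ι ⊕ Fin n → Fin N) → E}

theorem siteProd_cons (r : ι) (l : List ι) (A : ι → Fin N) (I : Fin n → Fin N) :
    siteProd h s t k (r :: l) F (Sum.elim A I) =
      wa h (s r k) (t r k) (A r) (I k) * siteProd h s t k l F (Sum.elim A I) +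
        wb h (s r k) (t r k) (A r) (I k) *
          siteProd h s t k l F (Sum.elim (Function.update A r (I k)) (Function.update I k (A r))) := by
  rw [siteProd, List.map_cons, List.prod_cons, Module.End.mul_apply, Rop_apply, elim_comp_swap]
  rfl

theorem siteProd_eq_zero (hF : Conc k c F) {l : List ι} (hl : l.Nodup) :
    ∀ (A : ι → Fin N) (I : Fin n → Fin N), (∀ r ∈ l, A r ≠ c) → I k ≠ c →
      siteProd h s t k l F (Sum.elim A I) = 0 := by
  induction l with
  | nil => exact fun A I _ hI => hF A I hI
  | cons r l ih =>
    intro A I hA hI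
    rw [List.nodup_cons] at hl
    rw [siteProd_cons, ih hl.2 A I (fun r' hr' => hA r' (List.mem_cons_of_mem _ hr')) hI, ih hl.2, mul_zero,
      mul_zero, add_zero]
    · intro r' hr'
      rw [Function.update_of_ne (by rintro rfl; exact hl.1 hr')]
      exact hA r' (List.mem_cons_of_mem _ hr')
    · rw [Function.update_self]
      exact hA r List.mem_cons_self

/-- The diagonal weights after fusion. -/
def wd (h x : E) (a c : Fin N) : E := if a = c then x else if a < c then 1 else h

theorem wa_eq_wd {h s t : E} (hst : s - t = 1) {a c : Fin N} (hac : a ≠ c) (x : E) :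
    wa h s t a c = wd h x a c := by
  rw [wa, wd, if_neg hac, if_neg hac, hst, mul_one]

theorem siteProd_eq (hst : ∀ r k, s r k - t r k = 1) (x : E) (hF : Conc k c F) {l : List ι} (hl : l.Nodup)
    (A : ι → Fin N) (I : Fin n → Fin N) (hA : ∀ r ∈ l, A r ≠ c) (hI : I k = c) :
    siteProd h s t k l F (Sum.elim A I) = (l.map fun r => wd h x (A r) c).prod * F (Sum.elim A I) := by
  induction l with
  | nil => simp [siteProd]
  | cons r l ih =>
    rw [List.nodup_cons] at hl
    rw [siteProd_cons, ih hl.2 fun r' hr' => hA r' (List.mem_cons_of_mem _ hr'),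
      siteProd_eq_zero hF hl.2 (Function.update A r (I k)), mul_zero, add_zero, hI, wa_eq_wd (hst r k) (hA r List.mem_cons_self) x, List.map_cons,
      List.prod_cons, mul_assoc]
    · intro r' hr'
      rw [Function.update_of_ne (by rintro rfl; exact hl.1 hr')]
      exact hA r' (List.mem_cons_of_mem _ hr')
    · rw [Function.update_self]
      exact hA r List.mem_cons_self

omit [DecidableEq ι] in
theorem anti_Rop {ι : Type*} [DecidableEq ι] {s t : E} {i j k l : ι} (hij : i ≠ j) (hkl : k ≠ l) (hik : i ≠ k)
    (hil : i ≠ l) (hjk : j ≠ k) (hjl : j ≠ l) {f : (ι → Fin N) → E} (hf : Anti i j f) :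
    Anti i j (Rop h s t k l f) := by
  refine ⟨fun I => ?_, fun I hI => ?_⟩
  swap
  · rw [Rop_apply, hf.2 I hI, hf.2, mul_zero, mul_zero, add_zero]
    rw [Function.comp_apply, Function.comp_apply, Equiv.swap_apply_of_ne_of_ne hik hil,
      Equiv.swap_apply_of_ne_of_ne hjk hjl, hI]
  have e : (I ∘ Equiv.swap i j) ∘ Equiv.swap k l = (I ∘ Equiv.swap k l) ∘ Equiv.swap i j := by
    ext x
    simp only [Function.comp_apply]
    have : Commute (Equiv.swap i j) (Equiv.swap k l) :=
      (Equiv.Perm.disjoint_swap_swap (by simp [*])).commute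
    have h2 := congrArg (fun σ : Equiv.Perm ι => σ x) this.eq
    simp only [Equiv.Perm.mul_apply] at h2
    rw [h2]
  rw [Rop_apply, Rop_apply, e, hf.1, hf.1, Function.comp_apply, Function.comp_apply,
    Equiv.swap_apply_of_ne_of_ne hik.symm hjk.symm, Equiv.swap_apply_of_ne_of_ne hil.symm hjl.symm]
  ring

theorem anti_siteProd_of_notMem {i j : ι} (hij : i ≠ j) {l : List ι} (hi : i ∉ l) (hj : j ∉ l)
    (hF : Anti (Sum.inl i) (Sum.inl j) F) : Anti (Sum.inl i) (Sum.inl j) (siteProd h s t k l F) := by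
  induction l with
  | nil => exact hF
  | cons r l ih =>
    rw [List.mem_cons, not_or] at hi hj
    rw [siteProd, List.map_cons, List.prod_cons, Module.End.mul_apply]
    exact anti_Rop (fun h => hij (Sum.inl.inj h)) Sum.inl_ne_inr (fun h => hi.1 (Sum.inl.inj h))
      Sum.inl_ne_inr (fun h => hj.1 (Sum.inl.inj h)) Sum.inl_ne_inr (ih hi.2 hj.2)

end SiteProd

/-- Antisymmetry in all auxiliary factors. -/
def AntiAll (F : (Fin m ⊕ Fin n → Fin N) → E) : Prop :=
  (∀ (σ : Equiv.Perm (Fin m)) A I, F (Sum.elim (A ∘ σ) I) = (Equiv.Perm.sign σ : ℤ) * F (Sum.elim A I)) ∧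
    ∀ A I, ∀ i j, i ≠ j → A i = A j → F (Sum.elim A I) = 0

theorem elim_comp_swap_inl (A : Fin m → Fin N) (I : Fin n → Fin N) (i j : Fin m) :
    (Sum.elim A I : Fin m ⊕ Fin n → Fin N) ∘ Equiv.swap (Sum.inl i) (Sum.inl j) =
      Sum.elim (A ∘ Equiv.swap i j) I := by
  ext x
  congr 1
  rcases x with x | x
  · rw [Function.comp_apply, Sum.inl_injective.swap_apply]
    rfl
  · rw [Function.comp_apply, Equiv.swap_apply_of_ne_of_ne Sum.inr_ne_inl Sum.inr_ne_inl]
    rfl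

theorem AntiAll.anti {F : (Fin m ⊕ Fin n → Fin N) → E} (hF : AntiAll F) {i j : Fin m} (hij : i ≠ j) :
    Anti (Sum.inl i) (Sum.inl j) F := by
  refine ⟨fun I => ?_, fun I hI => ?_⟩
  · have h1 := hF.1 (Equiv.swap i j) (I ∘ Sum.inl) (I ∘ Sum.inr)
    rw [← elim_comp_swap_inl, Sum.elim_comp_inl_inr, Equiv.Perm.sign_swap hij] at h1
    rw [h1]
    simp
  · have h1 := hF.2 (I ∘ Sum.inl) (I ∘ Sum.inr) i j hij hI
    rwa [Sum.elim_comp_inl_inr] at h1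

theorem antiAll_of_adjacent {F : (Fin m ⊕ Fin n → Fin N) → E}
    (h : ∀ i j : Fin m, (i : ℕ) + 1 = j → Anti (Sum.inl i) (Sum.inl j) F) : AntiAll F := by
  have hperm : ∀ (σ : Equiv.Perm (Fin m)) A I,
      F (Sum.elim (A ∘ σ) I) = (Equiv.Perm.sign σ : ℤ) * F (Sum.elim A I) := by
   intro σ
   induction σ using perm_induction with
   | h1 => intro A I; simp
   | hs i j hij =>
    intro A I
    have h1 := (h i j hij).1 (Sum.elim A I)
    rw [elim_comp_swap_inl] at h1
    rw [h1, Equiv.Perm.sign_swap (adj_ne hij)]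
    simp
   | hm σ τ hσ hτ =>
    intro A I
    have : A ∘ ⇑(σ * τ) = (A ∘ σ) ∘ τ := rfl
    rw [this, hτ, hσ, Equiv.Perm.sign_mul, Units.val_mul, Int.cast_mul]
    ring
  have hlt : ∀ A I, ∀ i j : Fin m, i < j → A i = A j → F (Sum.elim A I) = 0 := by
    intro A I i j hij hA
    have hi : (i : ℕ) + 1 < m := by
      have h1 := Fin.lt_def.1 hij
      have h2 := j.2
      omega
    have h1 := hperm (Equiv.swap (⟨i + 1, hi⟩ : Fin m) j) A I
    rw [(h i ⟨i + 1, hi⟩ rfl).2] at h1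
    · rcases Int.units_eq_one_or (Equiv.Perm.sign (Equiv.swap (⟨i + 1, hi⟩ : Fin m) j)) with e | e <;>
        rw [e] at h1 <;> simpa using h1.symm
    · rw [Sum.elim_inl, Sum.elim_inl, Function.comp_apply, Function.comp_apply, Equiv.swap_apply_left,
        Equiv.swap_apply_of_ne_of_ne _ hij.ne, hA]
      exact adj_ne (j := ⟨i + 1, hi⟩) rfl
  refine ⟨hperm, fun A I i j hij hA => ?_⟩
  rcases lt_or_gt_of_ne hij with h' | h'
  · exact hlt A I i j h' hA
  · exact hlt A I j i h' hA.symm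

theorem exists_finRange_eq {i j : Fin m} (hij : (i : ℕ) + 1 = j) :
    ∃ l₁ l₂, List.finRange m = l₁ ++ i :: j :: l₂ := by
  refine ⟨(List.finRange m).take i, (List.finRange m).drop (i + 2), ?_⟩
  conv_lhs => rw [← List.take_append_drop i (List.finRange m)]
  congr 1
  rw [List.drop_eq_getElem_cons (by simp), List.drop_eq_getElem_cons (by simp; omega)]
  simp only [List.getElem_finRange]
  congr 1
  congr 1
  exact Fin.ext hij

variable {h : E} {s t : Fin (m + 1) → Fin n → E} {k : Fin n} {c : Fin N}
  {F : (Fin (m + 1) ⊕ Fin n → Fin N) → E}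

/-- The fused R-matrix of all auxiliary factors with the site `k`. -/
def siteOp (h : E) (s t : Fin (m + 1) → Fin n → E) (k : Fin n) :
    Module.End E ((Fin (m + 1) ⊕ Fin n → Fin N) → E) :=
  siteProd h s t k (List.finRange (m + 1))

theorem AntiAll.siteOp (hfus : ∀ i j : Fin (m + 1), (i : ℕ) + 1 = j → ∀ k, h * s i k * t j k = s j k * t i k)
    (hF : AntiAll F) (k : Fin n) : AntiAll (siteOp h s t k F) := by
  refine antiAll_of_adjacent fun i j hij => ?_
  obtain ⟨l₁, l₂, hl⟩ := exists_finRange_eq hij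
  have hnd := List.nodup_finRange (m + 1)
  rw [hl] at hnd
  have hne := adj_ne hij
  have hnd2 := List.nodup_append.1 hnd
  have hi1 : i ∉ l₁ := fun h' => hnd2.2.2 _ h' _ (by simp) rfl
  have hj1 : j ∉ l₁ := fun h' => hnd2.2.2 _ h' _ (by simp) rfl
  have h3 := List.nodup_cons.1 hnd2.2.1
  have h4 := List.nodup_cons.1 h3.2
  have hi2 : i ∉ l₂ := fun h' => h3.1 (List.mem_cons_of_mem _ h')
  have e : LoopK.siteOp h s t k F = siteProd h s t k l₁ (Rop h (s i k) (t i k) (Sum.inl i) (Sum.inr k)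
      (Rop h (s j k) (t j k) (Sum.inl j) (Sum.inr k) (siteProd h s t k l₂ F))) := by
    rw [LoopK.siteOp, hl]
    simp only [siteProd, List.map_append, List.map_cons, List.prod_append, List.prod_cons,
      Module.End.mul_apply]
  rw [e]
  exact anti_siteProd_of_notMem hne hi1 hj1 (anti_fusion h _ _ _ _ (hfus i j hij k)
    (fun h => hne (Sum.inl.inj h)) Sum.inl_ne_inr Sum.inl_ne_inr
    (anti_siteProd_of_notMem hne hi2 h4.1 (hF.anti hne)))

theorem siteOp_zero_apply (hst : ∀ r k, s r k - t r k = 1) (hF : Conc k c F) {A : Fin (m + 1) → Fin N}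
    (h0 : A 0 = c) (hA : ∀ r : Fin m, A r.succ ≠ c) (I : Fin n → Fin N) :
    siteOp h s t k F (Sum.elim A I) =
      (∏ r : Fin m, wd h (s 0 k - h * t 0 k) (A r.succ) c) *
        if I k = c then (s 0 k - h * t 0 k) * F (Sum.elim A I)
        else wb h (s 0 k) (t 0 k) c (I k) * F (Sum.elim (Function.update A 0 (I k)) (Function.update I k c)) := by
  have hnd : ((List.finRange m).map Fin.succ).Nodup :=
    (List.nodup_finRange m).map (Fin.succ_injective m)
  have hprod : ∀ A' : Fin (m + 1) → Fin N,
      (((List.finRange m).map Fin.succ).map fun r => wd h (s 0 k - h * t 0 k) (A' r) c).prod =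
        ∏ r : Fin m, wd h (s 0 k - h * t 0 k) (A' r.succ) c := by
    intro A'
    rw [List.map_map, ← List.ofFn_eq_map, List.prod_ofFn]
    rfl
  have hmem : ∀ r ∈ (List.finRange m).map Fin.succ, A r ≠ c := by
    intro r hr
    obtain ⟨r', -, rfl⟩ := List.mem_map.1 hr
    exact hA r'
  rw [siteOp, List.finRange_succ, siteProd_cons, h0]
  split_ifs with hI
  · rw [hI, wa_self, wb_self, zero_mul, add_zero,
      siteProd_eq hst (s 0 k - h * t 0 k) hF hnd A I hmem hI, hprod]
    ring
  · rw [siteProd_eq_zero hF hnd A I hmem hI, mul_zero, zero_add,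
      siteProd_eq hst (s 0 k - h * t 0 k) hF hnd _ _ _ (Function.update_self _ _ _), hprod]
    · simp only [Function.update_of_ne (Fin.succ_ne_zero _)]
      ring
    · intro r hr
      obtain ⟨r', -, rfl⟩ := List.mem_map.1 hr
      rw [Function.update_of_ne (Fin.succ_ne_zero _)]
      exact hA r'

theorem siteOp_of_notMem (hst : ∀ r k, s r k - t r k = 1) (x : E) (hF : Conc k c F)
    {A : Fin (m + 1) → Fin N} (hA : ∀ r, A r ≠ c) (I : Fin n → Fin N) :
    siteOp h s t k F (Sum.elim A I) =
      if I k = c then (∏ r, wd h x (A r) c) * F (Sum.elim A I) else 0 := by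
  split_ifs with hI
  · rw [siteOp, siteProd_eq hst x hF (List.nodup_finRange _) A I (fun r _ => hA r) hI,
      ← List.ofFn_eq_map, List.prod_ofFn]
  · exact siteProd_eq_zero hF (List.nodup_finRange _) A I (fun r _ => hA r) hI

theorem siteOp_of_mem (hst : ∀ r k, s r k - t r k = 1)
    (hfus : ∀ i j : Fin (m + 1), (i : ℕ) + 1 = j → ∀ k, h * s i k * t j k = s j k * t i k)
    (hF : AntiAll F) (hc : Conc k c F) {A : Fin (m + 1) → Fin N} {j : Fin (m + 1)}
    (hj : A j = c) (hA : ∀ r, r ≠ j → A r ≠ c) (I : Fin n → Fin N) :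
    siteOp h s t k F (Sum.elim A I) =
        if I k = c then (∏ r, wd h (s 0 k - h * t 0 k) (A r) c) * F (Sum.elim A I)
        else (∏ r ∈ univ.erase j, wd h (s 0 k - h * t 0 k) (A r) c) * (wb h (s 0 k) (t 0 k) c (I k) *
          F (Sum.elim (Function.update A j (I k)) (Function.update I k c))) := by
  set σ := Equiv.swap 0 j with hσ
  have h0 : (A ∘ σ) 0 = c := by rw [Function.comp_apply, hσ, Equiv.swap_apply_left, hj]
  have hA' : ∀ r : Fin m, (A ∘ σ) r.succ ≠ c := by
    intro r
    refine hA _ fun h => ?_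
    have : r.succ = σ j := by rw [← h, hσ, Equiv.swap_apply_self]
    rw [hσ, Equiv.swap_apply_right] at this
    exact Fin.succ_ne_zero _ this
  have h1 := siteOp_zero_apply hst hc h0 hA' I (h := h)
  have hsq : ((Equiv.Perm.sign σ : ℤ) : E) * ((Equiv.Perm.sign σ : ℤ) : E) = 1 := by
    rw [← Int.cast_mul, ← Units.val_mul, Int.units_mul_self, Units.val_one, Int.cast_one]
  have hprod : ∏ r : Fin m, wd h (s 0 k - h * t 0 k) ((A ∘ σ) r.succ) c =
      ∏ r ∈ univ.erase j, wd h (s 0 k - h * t 0 k) (A r) c := by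
    have e1 : ∏ r : Fin m, wd h (s 0 k - h * t 0 k) ((A ∘ σ) r.succ) c =
        ∏ r ∈ univ.erase (0 : Fin (m + 1)), wd h (s 0 k - h * t 0 k) ((A ∘ σ) r) c := by
      have e2 : univ.erase (0 : Fin (m + 1)) = univ.image Fin.succ := by
        ext r
        induction r using Fin.cases <;> simp
      rw [e2, prod_image (fun _ _ _ _ h => Fin.succ_injective _ h)]
    rw [e1]
    refine prod_bij (fun r _ => σ r) (fun r hr => ?_) (fun _ _ _ _ h => σ.injective h) (fun r hr => ?_)
      fun r _ => rfl
    · rw [mem_erase] at hr ⊢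
      refine ⟨fun h => hr.1 ?_, mem_univ _⟩
      have : r = σ j := by rw [← h, hσ, Equiv.swap_apply_self]
      rw [this, hσ, Equiv.swap_apply_right]
    · rw [mem_erase] at hr
      refine ⟨σ r, ?_, by rw [hσ, Equiv.swap_apply_self]⟩
      rw [mem_erase]
      refine ⟨fun h => hr.1 ?_, mem_univ _⟩
      have : r = σ 0 := by rw [← h, hσ, Equiv.swap_apply_self]
      rw [this, hσ, Equiv.swap_apply_left]
  have h2 := (hF.siteOp hfus k).1 σ A I
  have h3 : siteOp h s t k F (Sum.elim A I) =
      (Equiv.Perm.sign σ : ℤ) * siteOp h s t k F (Sum.elim (A ∘ σ) I) := by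
    rw [h2, ← mul_assoc, hsq, one_mul]
  rw [h3, h1, hprod]
  split_ifs with hI
  · rw [hF.1, ← mul_prod_erase _ _ (mem_univ j), hj, wd, if_pos rfl]
    linear_combination (∏ r ∈ univ.erase j, wd h (s 0 k - h * t 0 k) (A r) c) *
      (s 0 k - h * t 0 k) * F (Sum.elim A I) * hsq
  · have e : Function.update (A ∘ σ) 0 (I k) = Function.update A j (I k) ∘ σ := by
      ext r
      congr 1
      by_cases hr : r = 0
      · subst hr
        rw [Function.update_self, Function.comp_apply, hσ, Equiv.swap_apply_left, Function.update_self]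
      · rw [Function.update_of_ne hr, Function.comp_apply, Function.comp_apply, Function.update_of_ne]
        intro h
        have : r = σ j := by rw [← h, hσ, Equiv.swap_apply_self]
        rw [hσ, Equiv.swap_apply_right] at this
        exact hr this
    rw [e, hF.1]
    linear_combination (∏ r ∈ univ.erase j, wd h (s 0 k - h * t 0 k) (A r) c) *
      wb h (s 0 k) (t 0 k) c (I k) * F (Sum.elim (Function.update A j (I k)) (Function.update I k c)) * hsq

end Fusion

end LoopK

end

noncomputable section

namespace LoopK

open Finset Matrix

section Minors

variable {E : Type*} [CommRing E] {N n m : ℕ}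

theorem dprod_induction {A : Type*} [AddCommGroup A] [Module E A] (G : Fin n → Module.End E A)
    {P : ℕ → A → Prop} {f : A} (h0 : P 0 f) (hs : ∀ (k : Fin n) f, P k f → P (k + 1) (G k f)) :
    P n (dprod G f) := by
  induction n with
  | zero => exact h0
  | succ n ih =>
    rw [dprod_succ, Module.End.mul_apply]
    exact hs (Fin.last n) _ (ih (fun k => G k.castSucc) fun k f hf => hs k.castSucc f hf)

/-- The antisymmetrized basis vector `v_j ∧ ⋯` of the auxiliary factors, times `v_J`. -/
def altVec (j : Fin m → Fin N) (J : Fin n → Fin N) : (Fin m ⊕ Fin n → Fin N) → E :=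
  ∑ σ : Equiv.Perm (Fin m), ((Equiv.Perm.sign σ : ℤ) : E) • Pi.single (Sum.elim (j ∘ σ) J) 1

theorem altVec_apply (j : Fin m → Fin N) (J : Fin n → Fin N) (A : Fin m → Fin N) (I : Fin n → Fin N) :
    (altVec j J : _ → E) (Sum.elim A I) =
      ∑ σ : Equiv.Perm (Fin m), ((Equiv.Perm.sign σ : ℤ) : E) * if A = j ∘ σ ∧ I = J then 1 else 0 := by
  rw [altVec, Finset.sum_apply]
  refine sum_congr rfl fun σ _ => ?_
  rw [Pi.smul_apply, smul_eq_mul, single_elim]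

theorem altVec_ne_zero {j : Fin m → Fin N} {J : Fin n → Fin N} {A : Fin m → Fin N} {I : Fin n → Fin N}
    (h : (altVec j J : _ → E) (Sum.elim A I) ≠ 0) : (∃ σ : Equiv.Perm (Fin m), A = j ∘ σ) ∧ I = J := by
  rw [altVec_apply] at h
  obtain ⟨σ, -, hσ⟩ := exists_ne_zero_of_sum_ne_zero h
  have : A = j ∘ σ ∧ I = J := by
    by_contra h'
    rw [if_neg h', mul_zero] at hσ
    exact hσ rfl
  exact ⟨⟨σ, this.1⟩, this.2⟩

theorem altVec_self {j : Fin m → Fin N} (hj : Function.Injective j) (J I : Fin n → Fin N) :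
    (altVec j J : _ → E) (Sum.elim j I) = if I = J then 1 else 0 := by
  rw [altVec_apply, sum_eq_single 1]
  · simp
  · intro σ _ hσ
    rw [if_neg, mul_zero]
    rintro ⟨h1, -⟩
    refine hσ (Equiv.ext fun r => hj ?_)
    exact (congrFun h1 r).symm
  · intro h; exact absurd (mem_univ _) h

theorem antiAll_altVec {j : Fin m → Fin N} (hj : Function.Injective j) (J : Fin n → Fin N) :
    AntiAll (altVec j J : _ → E) := by
  refine ⟨fun τ A I => ?_, fun A I i i' hi hA => ?_⟩
  · rw [altVec_apply, altVec_apply, mul_sum]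
    refine Fintype.sum_equiv (Equiv.mulRight τ⁻¹) _ _ fun σ => ?_
    have e1 : A ∘ ⇑τ = j ∘ ⇑σ ↔ A = j ∘ ⇑(σ * τ⁻¹) := by
      constructor
      · intro h
        funext r
        simpa using congrFun h (τ⁻¹ r)
      · rintro rfl
        funext r
        simp
    rw [Equiv.coe_mulRight, if_congr (and_congr_left' e1) rfl rfl, Equiv.Perm.sign_mul, Equiv.Perm.sign_inv,
      Units.val_mul, Int.cast_mul]
    have hsq : ((Equiv.Perm.sign τ : ℤ) : E) * ((Equiv.Perm.sign τ : ℤ) : E) = 1 := by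
      rw [← Int.cast_mul, ← Units.val_mul, Int.units_mul_self, Units.val_one, Int.cast_one]
    linear_combination (-((Equiv.Perm.sign σ : ℤ) : E) * if A = j ∘ ⇑(σ * τ⁻¹) ∧ I = J then 1 else 0) * hsq
  · by_contra h
    obtain ⟨⟨σ, rfl⟩, -⟩ := altVec_ne_zero h
    exact hi (σ.injective (hj hA))

/-- The general properties of the antisymmetrized vector after passing the first `q` sites. -/
structure Stage (j : Fin m → Fin N) (J : Fin n → Fin N) (q : ℕ) (F : (Fin m ⊕ Fin n → Fin N) → E) :
    Prop where
  anti : AntiAll F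
  conc : ∀ A I, F (Sum.elim A I) ≠ 0 → ∀ k : Fin n, q ≤ k → I k = J k
  colour : ∀ A I, F (Sum.elim A I) ≠ 0 → ∀ r, A r ∈ Set.range j ∨ ∃ k : Fin n, (k : ℕ) < q ∧ J k = A r

theorem stage_zero {j : Fin m → Fin N} (hj : Function.Injective j) (J : Fin n → Fin N) :
    Stage j J 0 (altVec j J : _ → E) := by
  refine ⟨antiAll_altVec hj J, fun A I h k _ => ?_, fun A I h r => ?_⟩
  · rw [(altVec_ne_zero h).2]
  · obtain ⟨⟨σ, rfl⟩, -⟩ := altVec_ne_zero h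
    exact Or.inl ⟨σ r, rfl⟩

theorem siteProd_support {ι : Type*} [DecidableEq ι] {h : E} {s t : ι → Fin n → E} {k : Fin n}
    {F : (ι ⊕ Fin n → Fin N) → E} (l : List ι) :
    ∀ (A : ι → Fin N) (I : Fin n → Fin N), siteProd h s t k l F (Sum.elim A I) ≠ 0 →
      ∃ A' I', F (Sum.elim A' I') ≠ 0 ∧ (∀ k', k' ≠ k → I' k' = I k') ∧
        (∀ r, A r ∈ Set.range A' ∨ A r = I' k) ∧ (I k ∈ Set.range A' ∨ I k = I' k) := by
  induction l with
  | nil => exact fun A I h => ⟨A, I, h, fun _ _ => rfl, fun r => Or.inl ⟨r, rfl⟩, Or.inr rfl⟩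
  | cons r l ih =>
    intro A I hne
    rw [siteProd_cons] at hne
    by_cases h1 : siteProd h s t k l F (Sum.elim A I) = 0
    · rw [h1, mul_zero, zero_add] at hne
      obtain ⟨A', I', h2, h3, h4, h5⟩ := ih _ _ (right_ne_zero_of_mul hne)
      rw [Function.update_self] at h5
      refine ⟨A', I', h2, fun k' hk' => by rw [h3 k' hk', Function.update_of_ne hk'], fun r' => ?_, ?_⟩
      · by_cases hr : r' = r
        · rw [hr]; exact h5
        · have := h4 r'
          rwa [Function.update_of_ne hr] at this
      · have := h4 r
        rwa [Function.update_self] at this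
    · exact ih A I h1

variable {h : E} {s t : Fin (m + 1) → Fin n → E}

theorem Stage.toConc {j : Fin (m + 1) → Fin N} {J : Fin n → Fin N} {k : Fin n}
    {F : (Fin (m + 1) ⊕ Fin n → Fin N) → E} (hF : Stage j J k F) : Conc k (J k) F := by
  intro A I hI
  by_contra h
  exact hI (hF.conc A I h k le_rfl)

theorem Stage.step (hfus : ∀ i j : Fin (m + 1), (i : ℕ) + 1 = j → ∀ k, h * s i k * t j k = s j k * t i k)
    {j : Fin (m + 1) → Fin N} {J : Fin n → Fin N} {k : Fin n} {F : (Fin (m + 1) ⊕ Fin n → Fin N) → E}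
    (hF : Stage j J k F) : Stage j J (k + 1) (siteOp h s t k F) := by
  refine ⟨hF.anti.siteOp hfus k, fun A I hne k' hk' => ?_, fun A I hne r => ?_⟩
  · obtain ⟨A', I', h1, h2, -, -⟩ := siteProd_support _ A I hne
    rw [← h2 k' (fun h => by rw [h] at hk'; omega)]
    exact hF.conc A' I' h1 k' (by omega)
  · obtain ⟨A', I', h1, h2, h3, -⟩ := siteProd_support _ A I hne
    rcases h3 r with ⟨r', hr'⟩ | h3
    · rw [← hr']
      rcases hF.colour A' I' h1 r' with h4 | ⟨k', hk', h4⟩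
      · exact Or.inl h4
      · exact Or.inr ⟨k', by omega, h4⟩
    · exact Or.inr ⟨k, by omega, by rw [h3, hF.conc A' I' h1 k le_rfl]⟩

/-- The product of a function of the site over the first `q` sites. -/
theorem prod_filter_succ (d : Fin n → E) (k : Fin n) :
    ∏ l ∈ univ.filter (fun l : Fin n => (l : ℕ) < k + 1), d l =
      d k * ∏ l ∈ univ.filter (fun l : Fin n => (l : ℕ) < k), d l := by
  have : univ.filter (fun l : Fin n => (l : ℕ) < k + 1) =
      insert k (univ.filter fun l : Fin n => (l : ℕ) < k) := by
    ext l
    simp only [mem_filter, mem_univ, true_and, mem_insert, Fin.ext_iff]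
    omega
  rw [this, prod_insert (by simp)]

end Minors

section PrincipalMinors

variable {E : Type*} [CommRing E] {N n p : ℕ} (hp : p + 1 < N) {h : E} {s t : Fin (p + 1) → Fin n → E}

theorem idxI_val (r : Fin (p + 1)) : (idxI hp r : ℕ) = r := rfl

theorem idxJ_val (r : Fin (p + 1)) : (idxJ hp r : ℕ) = if (r : ℕ) = p then p + 1 else r := by
  rw [idxJ]; split_ifs <;> rfl

theorem idxI_injective : Function.Injective (idxI hp) := fun r r' h =>
  Fin.ext (by simpa [idxI_val] using congrArg Fin.val h)

theorem idxJ_injective : Function.Injective (idxJ hp) := by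
  intro r r' h
  have := congrArg Fin.val h
  rw [idxJ_val, idxJ_val] at this
  refine Fin.ext ?_
  split_ifs at this <;> omega

theorem range_idxI {c : Fin N} (hc : c ∈ Set.range (idxI hp)) : (c : ℕ) ≤ p := by
  obtain ⟨r, rfl⟩ := hc
  rw [idxI_val]; omega

theorem range_idxJ {c : Fin N} (hc : c ∈ Set.range (idxJ hp)) : (c : ℕ) < p ∨ (c : ℕ) = p + 1 := by
  obtain ⟨r, rfl⟩ := hc
  rw [idxJ_val]; split_ifs <;> omega

/-- The eigenvalue of the principal minor at one site. -/
def minorEig (h x : E) (c : Fin N) : E := ∏ r : Fin (p + 1), wd h x (idxI hp r) c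

theorem minorEig_of_gt (x : E) {c : Fin N} (hc : p < c) : minorEig hp h x c = 1 := by
  refine prod_eq_one fun r _ => ?_
  have h1 : idxI hp r < c := by rw [Fin.lt_def, idxI_val]; omega
  rw [wd, if_neg h1.ne, if_pos h1]

theorem prod_wd_idxJ_of_gt (x : E) {c : Fin N} (hc : p + 1 < c) : ∏ r, wd h x (idxJ hp r) c = 1 := by
  refine prod_eq_one fun r _ => ?_
  have h1 : idxJ hp r < c := by rw [Fin.lt_def, idxJ_val]; split_ifs <;> omega
  rw [wd, if_neg h1.ne, if_pos h1]

theorem prod_wd_idxJ_of_lt (x : E) {c : Fin N} (hc : c < p) :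
    ∏ r, wd h x (idxJ hp r) c = minorEig hp h x c := by
  refine prod_congr rfl fun r _ => ?_
  by_cases hr : (r : ℕ) = p
  · have h1 : c < idxJ hp r := by rw [Fin.lt_def, idxJ_val, if_pos hr]; omega
    have h2 : c < idxI hp r := by rw [Fin.lt_def, idxI_val]; omega
    rw [wd, wd, if_neg h1.ne', if_neg h1.not_gt, if_neg h2.ne', if_neg h2.not_gt]
  · have : idxJ hp r = idxI hp r := Fin.ext (by rw [idxJ_val, idxI_val, if_neg hr])
    rw [this]

theorem prod_erase_last_idxJ (x : E) : ∏ r ∈ univ.erase (Fin.last p), wd h x (idxJ hp r) ⟨p + 1, hp⟩ = 1 := by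
  refine prod_eq_one fun r hr => ?_
  have hr' : (r : ℕ) ≠ p := fun h => (mem_erase.1 hr).1 (Fin.ext h)
  have h1 : idxJ hp r < ⟨p + 1, hp⟩ := by rw [Fin.lt_def, idxJ_val, if_neg hr']; simp only; omega
  rw [wd, if_neg h1.ne, if_pos h1]

theorem prod_erase_last_idxI (x : E) :
    ∏ r ∈ univ.erase (Fin.last p), wd h x (idxI hp r) ⟨p, by omega⟩ = 1 := by
  refine prod_eq_one fun r hr => ?_
  have hr' : (r : ℕ) ≠ p := fun h => (mem_erase.1 hr).1 (Fin.ext h)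
  have h1 : idxI hp r < ⟨p, by omega⟩ := by rw [Fin.lt_def, idxI_val]; simp only; omega
  rw [wd, if_neg h1.ne, if_pos h1]

theorem update_idxJ : Function.update (idxJ hp) (Fin.last p) ⟨p, by omega⟩ = idxI hp := by
  ext r
  by_cases hr : r = Fin.last p
  · rw [hr, Function.update_self]; rfl
  · have : (r : ℕ) ≠ p := fun h => hr (Fin.ext h)
    rw [Function.update_of_ne hr, idxJ_val, if_neg this, idxI_val]

theorem update_idxI : Function.update (idxI hp) (Fin.last p) ⟨p + 1, hp⟩ = idxJ hp := by
  ext r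
  by_cases hr : r = Fin.last p
  · rw [hr, Function.update_self, idxJ_val, if_pos (Fin.val_last p)]
  · have : (r : ℕ) ≠ p := fun h => hr (Fin.ext h)
    rw [Function.update_of_ne hr, idxJ_val, if_neg this, idxI_val]

variable {hp}

/-- The operator of all sites. -/
def allSites (h : E) (s t : Fin (p + 1) → Fin n → E) :
    Module.End E ((Fin (p + 1) ⊕ Fin n → Fin N) → E) := dprod fun k => siteOp h s t k

theorem AntiAll.update_eq_zero {m : ℕ} {F : (Fin m ⊕ Fin n → Fin N) → E} (hF : AntiAll F) {A : Fin m → Fin N}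
    {j r : Fin m} (hr : r ≠ j) {c : Fin N} (hc : A r = c) (I : Fin n → Fin N) :
    F (Sum.elim (Function.update A j c) I) = 0 :=
  hF.2 _ _ r j hr (by rw [Function.update_of_ne hr, Function.update_self, hc])

/-- The product of the eigenvalues over the first `q` sites. -/
def eigProd (hp : p + 1 < N) (h : E) (s t : Fin (p + 1) → Fin n → E) (J : Fin n → Fin N) (q : ℕ) : E :=
  ∏ l ∈ univ.filter (fun l : Fin n => (l : ℕ) < q), minorEig hp h (s 0 l - h * t 0 l) (J l)

theorem eigProd_succ (J : Fin n → Fin N) (k : Fin n) : eigProd hp h s t J (k + 1) =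
    minorEig hp h (s 0 k - h * t 0 k) (J k) * eigProd hp h s t J k := prod_filter_succ _ k

variable (hst : ∀ r k, s r k - t r k = 1)
  (hfus : ∀ i j : Fin (p + 1), (i : ℕ) + 1 = j → ∀ k, h * s i k * t j k = s j k * t i k)
  {J : Fin n → Fin N} (hJ : Monotone J)

include hst hfus hJ

/-- One step of the computation of the principal minor. -/
theorem principal_step {k : Fin n} {F : (Fin (p + 1) ⊕ Fin n → Fin N) → E} (hF : Stage (idxI hp) J k F)
    (hd : ∀ I, F (Sum.elim (idxI hp) I) = if I = J then eigProd hp h s t J k else 0) (I : Fin n → Fin N) :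
    siteOp h s t k F (Sum.elim (idxI hp) I) = if I = J then eigProd hp h s t J (k + 1) else 0 := by
  have hIJ : I k ≠ J k → I ≠ J := fun h h' => h (by rw [h'])
  rw [eigProd_succ]
  by_cases hk : (J k : ℕ) ≤ p
  · have hj : idxI hp ⟨J k, by omega⟩ = J k := rfl
    rw [siteOp_of_mem hst hfus hF.anti hF.toConc hj fun r hr h => hr (idxI_injective hp (h.trans hj.symm)), hd]
    split_ifs with h1 h2 h2
    · rfl
    · rw [mul_zero]
    · exact absurd h2 (hIJ h1)
    · suffices F (Sum.elim (Function.update (idxI hp) ⟨J k, by omega⟩ (I k)) (Function.update I k (J k))) = 0 by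
        rw [this, mul_zero, mul_zero]
      by_cases hc : (I k : ℕ) ≤ p
      · refine hF.anti.update_eq_zero (r := ⟨I k, by omega⟩) (fun h => h1 ?_) rfl _
        exact Fin.ext (by simpa using congrArg Fin.val h)
      · by_contra hne
        have := hF.colour _ _ hne ⟨J k, by omega⟩
        rw [Function.update_self] at this
        rcases this with h3 | ⟨k', hk', h3⟩
        · exact hc (range_idxI hp h3)
        · have h4 := Fin.le_def.1 (hJ (Fin.le_def.2 hk'.le))
          rw [h3] at h4
          omega
  · rw [siteOp_of_notMem hst (s 0 k - h * t 0 k) hF.toConc (fun r h => ?_), hd]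
    · split_ifs with h1 h2 h2
      · rfl
      · rw [mul_zero]
      · exact absurd h2 (hIJ h1)
      · rfl
    · rw [← h, idxI_val] at hk
      omega

theorem principal_minor (I : Fin n → Fin N) : allSites h s t (altVec (idxI hp) J) (Sum.elim (idxI hp) I) =
    if I = J then eigProd hp h s t J n else 0 := by
  have := dprod_induction (fun k => siteOp h s t k) (f := altVec (idxI hp) J)
    (P := fun q F => Stage (idxI hp) J q F ∧
      ∀ I, F (Sum.elim (idxI hp) I) = if I = J then eigProd hp h s t J q else 0)
    ⟨stage_zero (idxI_injective hp) J, fun I => ?_⟩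
    fun k F hF => ⟨hF.1.step hfus, principal_step hst hfus hJ hF.1 hF.2⟩
  · exact this.2 I
  · rw [altVec_self (idxI_injective hp), eigProd]
    simp

/-- One step of the computation of the minor that raises. -/
theorem raising_step {k : Fin n} {F : (Fin (p + 1) ⊕ Fin n → Fin N) → E} (hF : Stage (idxI hp) J k F)
    (hd : ∀ I, F (Sum.elim (idxI hp) I) = if I = J then eigProd hp h s t J k else 0)
    (hsupp : ∀ I, F (Sum.elim (idxJ hp) I) ≠ 0 → ∃ a : Fin n, (a : ℕ) < k ∧ J a = ⟨p + 1, hp⟩ ∧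
      I = Function.update J a ⟨p, by omega⟩)
    (hval : ∀ e : Fin n, J e = ⟨p + 1, hp⟩ → (∀ l, J l = ⟨p + 1, hp⟩ → l ≤ e) → e < k →
      F (Sum.elim (idxJ hp) (Function.update J e ⟨p, by omega⟩)) = (1 - h) * t 0 e * eigProd hp h s t J k) :
    (∀ I, siteOp h s t k F (Sum.elim (idxJ hp) I) ≠ 0 → ∃ a : Fin n, (a : ℕ) < k + 1 ∧ J a = ⟨p + 1, hp⟩ ∧
      I = Function.update J a ⟨p, by omega⟩) ∧
    (∀ e : Fin n, J e = ⟨p + 1, hp⟩ → (∀ l, J l = ⟨p + 1, hp⟩ → l ≤ e) → (e : ℕ) < k + 1 →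
      siteOp h s t k F (Sum.elim (idxJ hp) (Function.update J e ⟨p, by omega⟩)) =
        (1 - h) * t 0 e * eigProd hp h s t J (k + 1)) := by
  have hmono : ∀ a : Fin n, (a : ℕ) < k + 1 → (J a : ℕ) ≤ J k := fun a ha =>
    Fin.le_def.1 (hJ (Fin.le_def.2 (by omega)))
  have hlow : (J k : ℕ) ≤ p → ∀ I, F (Sum.elim (idxJ hp) I) = 0 := by
    intro hk I
    by_contra hne
    obtain ⟨a, ha, h1, -⟩ := hsupp I hne
    have := hmono a (by omega)
    rw [h1] at this
    simp only at this
    omega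
  have hnoval : (J k : ℕ) ≤ p → ∀ e : Fin n, J e = ⟨p + 1, hp⟩ → ¬ (e : ℕ) < k + 1 := by
    intro hk e he hek
    have := hmono e hek
    rw [he] at this
    simp only at this
    omega
  rcases lt_trichotomy (J k : ℕ) (p + 1) with hk | hk | hk
  · have hzero : ∀ I, siteOp h s t k F (Sum.elim (idxJ hp) I) = 0 := by
      intro I
      rcases (Nat.lt_succ_iff.1 hk).lt_or_eq with hk' | hk'
      · have hj : idxJ hp ⟨J k, by omega⟩ = J k := Fin.ext (by rw [idxJ_val]; simp only; rw [if_neg hk'.ne])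
        rw [siteOp_of_mem hst hfus hF.anti hF.toConc hj fun r hr h => hr (idxJ_injective hp (h.trans hj.symm)),
          hlow (by omega), mul_zero]
        split_ifs
        · rfl
        · suffices F (Sum.elim (Function.update (idxJ hp) ⟨J k, by omega⟩ (I k)) (Function.update I k (J k))) = 0 by
            rw [this, mul_zero, mul_zero]
          by_contra hne
          have := hF.colour _ _ hne (Fin.last p)
          have hl : Fin.last p ≠ ⟨J k, by omega⟩ := fun h => by
            have := congrArg Fin.val h
            simp only [Fin.val_last] at this
            omega
          rw [Function.update_of_ne hl] at this
          have hv : (idxJ hp (Fin.last p) : ℕ) = p + 1 := by rw [idxJ_val, if_pos (Fin.val_last p)]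
          rcases this with h3 | ⟨k', hk', h3⟩
          · have := range_idxI hp h3
            omega
          · have h4 := hmono k' (by omega)
            rw [h3] at h4
            omega
      · rw [siteOp_of_notMem hst (s 0 k - h * t 0 k) hF.toConc (fun r h => ?_), hlow (by omega), mul_zero, ite_self]
        have := range_idxJ hp ⟨r, h⟩
        omega
    exact ⟨fun I hI => absurd (hzero I) hI, fun e he _ hek => absurd hek (hnoval (by omega) e he)⟩
  · have hkc : J k = ⟨p + 1, hp⟩ := Fin.ext hk
    have hj : idxJ hp (Fin.last p) = J k := Fin.ext (by rw [idxJ_val, if_pos (Fin.val_last p), hk])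
    have hform := fun I => siteOp_of_mem (I := I) hst hfus hF.anti hF.toConc hj
      fun r hr h => hr (idxJ_injective hp (h.trans hj.symm))
    refine ⟨fun I hI => ?_, fun e he hlast hek => ?_⟩
    · rw [hform] at hI
      split_ifs at hI with h1
      · obtain ⟨a, ha, h2⟩ := hsupp I (right_ne_zero_of_mul hI)
        exact ⟨a, by omega, h2⟩
      · have hne := right_ne_zero_of_mul (right_ne_zero_of_mul hI)
        have hc : I k = ⟨p, by omega⟩ := by
          by_contra hc
          have hc' : (I k : ℕ) ≠ p := fun h => hc (Fin.ext h)
          have h1' : (I k : ℕ) ≠ p + 1 := fun h => h1 (Fin.ext (h.trans hk.symm))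
          by_cases hlt : (I k : ℕ) < p
          · refine hne (hF.anti.update_eq_zero (r := ⟨I k, by omega⟩) (fun h => ?_) ?_ _)
            · have := congrArg Fin.val h
              simp only [Fin.val_last] at this
              omega
            · exact Fin.ext (by rw [idxJ_val]; simp only; rw [if_neg hc'])
          · have := hF.colour _ _ hne (Fin.last p)
            rw [Function.update_self] at this
            rcases this with h3 | ⟨k', hk', h3⟩
            · have := range_idxI hp h3
              omega
            · have h4 := hmono k' (by omega)
              rw [h3] at h4
              omega
        rw [hc, update_idxJ, hd] at hne
        have h3 : Function.update I k (J k) = J := by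
          by_contra h3
          exact hne (if_neg h3)
        refine ⟨k, by omega, hkc, ?_⟩
        rw [← h3, Function.update_idem, ← hc, Function.update_eq_self]
    · have hek' : e = k := by
        refine le_antisymm (Fin.le_def.2 (by omega)) (hlast k hkc)
      subst hek'
      have hb : (⟨p, by omega⟩ : Fin N) < J e := by rw [Fin.lt_def, hk]; simp
      rw [hform, if_neg (by rw [Function.update_self]; exact hb.ne), Function.update_self, update_idxJ, hd,
        Function.update_idem, Function.update_eq_self, if_pos rfl, eigProd_succ, minorEig_of_gt _ _ (by omega),
        wb_gt _ _ _ hb]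
      rw [hkc, prod_erase_last_idxJ]
      ring
  · have hnot : ∀ r, idxJ hp r ≠ J k := fun r h => by
      have := range_idxJ hp ⟨r, h⟩
      omega
    have hform := fun I => siteOp_of_notMem (h := h) (I := I) hst (s 0 k - h * t 0 k) hF.toConc hnot
    refine ⟨fun I hI => ?_, fun e he hlast hek => ?_⟩
    · rw [hform] at hI
      split_ifs at hI with h1
      · obtain ⟨a, ha, h2⟩ := hsupp I (right_ne_zero_of_mul hI)
        exact ⟨a, by omega, h2⟩
      · exact absurd rfl hI
    · have hne : k ≠ e := by
        rintro rfl
        rw [he] at hk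
        simp at hk
      rw [hform, if_pos (Function.update_of_ne hne _ _), prod_wd_idxJ_of_gt _ _ hk, one_mul, eigProd_succ,
        minorEig_of_gt _ _ (by omega), one_mul]
      refine hval e he hlast (Fin.lt_def.2 ?_)
      have : (e : ℕ) ≠ k := fun h => hne (Fin.ext h.symm)
      omega

theorem raising_minor :
    (∀ I, allSites h s t (altVec (idxI hp) J) (Sum.elim (idxJ hp) I) ≠ 0 →
      ∃ a, J a = ⟨p + 1, hp⟩ ∧ I = Function.update J a ⟨p, by omega⟩) ∧
    ∀ e, J e = ⟨p + 1, hp⟩ → (∀ l, J l = ⟨p + 1, hp⟩ → l ≤ e) →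
      allSites h s t (altVec (idxI hp) J) (Sum.elim (idxJ hp) (Function.update J e ⟨p, by omega⟩)) =
        (1 - h) * t 0 e * eigProd hp h s t J n := by
  have := dprod_induction (fun k => siteOp h s t k) (f := altVec (idxI hp) J)
    (P := fun q F => (Stage (idxI hp) J q F ∧
      ∀ I, F (Sum.elim (idxI hp) I) = if I = J then eigProd hp h s t J q else 0) ∧
      (∀ I, F (Sum.elim (idxJ hp) I) ≠ 0 → ∃ a : Fin n, (a : ℕ) < q ∧ J a = ⟨p + 1, hp⟩ ∧
        I = Function.update J a ⟨p, by omega⟩) ∧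
      ∀ e : Fin n, J e = ⟨p + 1, hp⟩ → (∀ l, J l = ⟨p + 1, hp⟩ → l ≤ e) → (e : ℕ) < q →
        F (Sum.elim (idxJ hp) (Function.update J e ⟨p, by omega⟩)) = (1 - h) * t 0 e * eigProd hp h s t J q)
    ⟨⟨stage_zero (idxI_injective hp) J, fun I => ?_⟩, fun I hI => ?_, fun e _ _ h => absurd h (Nat.not_lt_zero _)⟩
    fun k F hF => ⟨⟨hF.1.1.step hfus, principal_step hst hfus hJ hF.1.1 hF.1.2⟩,
      raising_step hst hfus hJ hF.1.1 hF.1.2 hF.2.1 hF.2.2⟩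
  · refine ⟨fun I hI => ?_, fun e he hl => this.2.2 e he hl e.2⟩
    obtain ⟨a, -, h1⟩ := this.2.1 I hI
    exact ⟨a, h1⟩
  · rw [altVec_self (idxI_injective hp), eigProd]
    simp
  · obtain ⟨⟨σ, hσ⟩, -⟩ := altVec_ne_zero hI
    have h1 := range_idxI hp ⟨σ (Fin.last p), (congrFun hσ (Fin.last p)).symm⟩
    rw [idxJ_val, if_pos (Fin.val_last p)] at h1
    omega

/-- One step of the computation of the minor that lowers. -/
theorem lowering_step {k : Fin n} {F : (Fin (p + 1) ⊕ Fin n → Fin N) → E} (hF : Stage (idxJ hp) J k F)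
    (hQ : (∀ l : Fin n, (l : ℕ) < k → (J l : ℕ) ≤ p) → ∀ I, F (Sum.elim (idxJ hp) I) ≠ 0 → I = J)
    (hQv : (∀ l : Fin n, (l : ℕ) < k → (J l : ℕ) < p) →
      F (Sum.elim (idxJ hp) J) = eigProd hp h s t J k)
    (hsupp : ∀ I, F (Sum.elim (idxI hp) I) ≠ 0 → ∃ a : Fin n, (a : ℕ) < k ∧ J a = ⟨p, by omega⟩ ∧
      I = Function.update J a ⟨p + 1, hp⟩)
    (hval : ∀ e : Fin n, J e = ⟨p, by omega⟩ → (∀ l, J l = ⟨p, by omega⟩ → e ≤ l) → e < k →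
      minorEig hp h (s 0 e - h * t 0 e) (J e) * F (Sum.elim (idxI hp) (Function.update J e ⟨p + 1, hp⟩)) =
        (1 - h) * s 0 e * eigProd hp h s t J k) :
    ((∀ l : Fin n, (l : ℕ) < k + 1 → (J l : ℕ) ≤ p) →
      ∀ I, siteOp h s t k F (Sum.elim (idxJ hp) I) ≠ 0 → I = J) ∧
    ((∀ l : Fin n, (l : ℕ) < k + 1 → (J l : ℕ) < p) →
      siteOp h s t k F (Sum.elim (idxJ hp) J) = eigProd hp h s t J (k + 1)) ∧
    (∀ I, siteOp h s t k F (Sum.elim (idxI hp) I) ≠ 0 → ∃ a : Fin n, (a : ℕ) < k + 1 ∧ J a = ⟨p, by omega⟩ ∧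
      I = Function.update J a ⟨p + 1, hp⟩) ∧
    (∀ e : Fin n, J e = ⟨p, by omega⟩ → (∀ l, J l = ⟨p, by omega⟩ → e ≤ l) → (e : ℕ) < k + 1 →
      minorEig hp h (s 0 e - h * t 0 e) (J e) *
        siteOp h s t k F (Sum.elim (idxI hp) (Function.update J e ⟨p + 1, hp⟩)) =
        (1 - h) * s 0 e * eigProd hp h s t J (k + 1)) := by
  have hmono : ∀ a : Fin n, (a : ℕ) < k + 1 → (J a : ℕ) ≤ J k := fun a ha =>
    Fin.le_def.1 (hJ (Fin.le_def.2 (by omega)))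
  refine ⟨fun hle I hI => ?_, fun hlt => ?_, ?_⟩
  · have hk := hle k (by omega)
    have hQ' := hQ fun l hl => hle l (by omega)
    rcases hk.lt_or_eq with hk' | hk'
    · have hj : idxJ hp ⟨J k, by omega⟩ = J k := Fin.ext (by rw [idxJ_val]; simp only; rw [if_neg hk'.ne])
      rw [siteOp_of_mem hst hfus hF.anti hF.toConc hj
        fun r hr h => hr (idxJ_injective hp (h.trans hj.symm))] at hI
      split_ifs at hI with h1
      · exact hQ' I (right_ne_zero_of_mul hI)
      · exfalso
        have hne := right_ne_zero_of_mul (right_ne_zero_of_mul hI)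
        by_cases hc : I k ∈ Set.range (idxJ hp)
        · obtain ⟨r, hr⟩ := hc
          refine hne (hF.anti.update_eq_zero (r := r) (fun h => h1 ?_) hr _)
          rw [← hr, h, hj]
        · have hc' : p ≤ (I k : ℕ) := by
            by_contra hlt
            refine hc ⟨⟨I k, by omega⟩, Fin.ext ?_⟩
            rw [idxJ_val]; simp only; rw [if_neg (by omega)]
          have := hF.colour _ _ hne ⟨J k, by omega⟩
          rw [Function.update_self] at this
          rcases this with h3 | ⟨k', hk', h3⟩
          · exact hc h3
          · have h4 := hmono k' (by omega)
            rw [h3] at h4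
            omega
    · rw [siteOp_of_notMem hst (s 0 k - h * t 0 k) hF.toConc (fun r h => ?_)] at hI
      · split_ifs at hI with h1
        · exact hQ' I (right_ne_zero_of_mul hI)
        · exact absurd rfl hI
      · have := range_idxJ hp ⟨r, h⟩
        omega
  · have hk' := hlt k (by omega)
    have hj : idxJ hp ⟨J k, by omega⟩ = J k := Fin.ext (by rw [idxJ_val]; simp only; rw [if_neg hk'.ne])
    rw [siteOp_of_mem hst hfus hF.anti hF.toConc hj
      fun r hr h => hr (idxJ_injective hp (h.trans hj.symm)), if_pos rfl, prod_wd_idxJ_of_lt _ _ hk',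
      hQv fun l hl => hlt l (by omega), eigProd_succ]
  · by_cases hk : (J k : ℕ) ≤ p
    · have hj : idxI hp ⟨J k, by omega⟩ = J k := rfl
      have hform := fun I => siteOp_of_mem (I := I) hst hfus hF.anti hF.toConc hj
        fun r hr h => hr (idxI_injective hp (h.trans hj.symm))
      refine ⟨fun I hI => ?_, fun e he hfirst hek => ?_⟩
      · rw [hform] at hI
        split_ifs at hI with h1
        · obtain ⟨a, ha, h2⟩ := hsupp I (right_ne_zero_of_mul hI)
          exact ⟨a, by omega, h2⟩
        · have hne := right_ne_zero_of_mul (right_ne_zero_of_mul hI)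
          have hkp : (J k : ℕ) = p := by
            by_contra hkp
            have := hF.colour _ _ hne (Fin.last p)
            have hl : Fin.last p ≠ ⟨J k, by omega⟩ := fun h => hkp (congrArg Fin.val h).symm
            rw [Function.update_of_ne hl] at this
            have hv : (idxI hp (Fin.last p) : ℕ) = p := rfl
            rcases this with h3 | ⟨k', hk', h3⟩
            · have := range_idxJ hp h3
              omega
            · have h4 := hmono k' (by omega)
              rw [h3] at h4
              omega
          have hl : (⟨J k, by omega⟩ : Fin (p + 1)) = Fin.last p := Fin.ext hkp
          rw [hl] at hne
          have hc : I k = ⟨p + 1, hp⟩ := by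
            by_contra hc
            have hc' : (I k : ℕ) ≠ p + 1 := fun h => hc (Fin.ext h)
            have h1' : (I k : ℕ) ≠ p := fun h => h1 (Fin.ext (h.trans hkp.symm))
            by_cases hlt : (I k : ℕ) < p
            · refine hne (hF.anti.update_eq_zero (r := ⟨I k, by omega⟩) (fun h => ?_) rfl _)
              have := congrArg Fin.val h
              simp only [Fin.val_last] at this
              omega
            · have := hF.colour _ _ hne (Fin.last p)
              rw [Function.update_self] at this
              rcases this with h3 | ⟨k', hk', h3⟩
              · have := range_idxJ hp h3
                omega
              · have h4 := hmono k' (by omega)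
                rw [h3] at h4
                omega
          rw [hc, update_idxI] at hne
          have h3 := hQ (fun l hl => (hmono l (by omega)).trans hk) _ hne
          refine ⟨k, by omega, Fin.ext hkp, ?_⟩
          rw [← h3, Function.update_idem, ← hc, Function.update_eq_self]
      · by_cases hke : k = e
        · subst hke
          have hkp : (J k : ℕ) = p := by rw [he]
          have hl : (⟨J k, by omega⟩ : Fin (p + 1)) = Fin.last p := Fin.ext hkp
          have hb : J k < (⟨p + 1, hp⟩ : Fin N) := by rw [Fin.lt_def, hkp]; simp
          rw [hform, if_neg (by rw [Function.update_self]; exact hb.ne'), Function.update_self, hl, update_idxI,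
            Function.update_idem, Function.update_eq_self, hQv, eigProd_succ, wb_lt _ _ _ hb]
          · have h5 : ∏ r ∈ univ.erase (Fin.last p), wd h (s 0 k - h * t 0 k) (idxI hp r) (J k) = 1 := by
              rw [he]; exact prod_erase_last_idxI hp _
            rw [h5]
            ring
          · intro l hl'
            refine lt_of_le_of_ne ((hmono l (by omega)).trans hk) fun h => ?_
            have := Fin.le_def.1 (hfirst l (Fin.ext h))
            omega
        · have h1 : (Function.update J e ⟨p + 1, hp⟩) k = J k := Function.update_of_ne hke _ _
          have h2 := hval e he hfirst (Fin.lt_def.2 (by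
            have : (e : ℕ) ≠ k := fun h => hke (Fin.ext h.symm)
            omega))
          rw [hform, if_pos h1, eigProd_succ, mul_left_comm, h2, minorEig]
          ring
    · have hnot : ∀ r, idxI hp r ≠ J k := fun r h => hk (range_idxI hp ⟨r, h⟩)
      have hform := fun I => siteOp_of_notMem (h := h) (I := I) hst (s 0 k - h * t 0 k) hF.toConc hnot
      refine ⟨fun I hI => ?_, fun e he hfirst hek => ?_⟩
      · rw [hform] at hI
        split_ifs at hI with h1
        · obtain ⟨a, ha, h2⟩ := hsupp I (right_ne_zero_of_mul hI)
          exact ⟨a, by omega, h2⟩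
        · exact absurd rfl hI
      · have hke : k ≠ e := by
          rintro rfl
          rw [he] at hk
          exact hk le_rfl
        have h1 : (Function.update J e ⟨p + 1, hp⟩) k = J k := Function.update_of_ne hke _ _
        have h2 := hval e he hfirst (Fin.lt_def.2 (by
          have : (e : ℕ) ≠ k := fun h => hke (Fin.ext h.symm)
          omega))
        rw [hform, if_pos h1, eigProd_succ, mul_left_comm, h2, minorEig]
        ring

theorem lowering_minor :
    (∀ I, allSites h s t (altVec (idxJ hp) J) (Sum.elim (idxI hp) I) ≠ 0 →
      ∃ a, J a = ⟨p, by omega⟩ ∧ I = Function.update J a ⟨p + 1, hp⟩) ∧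
    ∀ e, J e = ⟨p, by omega⟩ → (∀ l, J l = ⟨p, by omega⟩ → e ≤ l) →
      minorEig hp h (s 0 e - h * t 0 e) (J e) *
        allSites h s t (altVec (idxJ hp) J) (Sum.elim (idxI hp) (Function.update J e ⟨p + 1, hp⟩)) =
        (1 - h) * s 0 e * eigProd hp h s t J n := by
  have := dprod_induction (fun k => siteOp h s t k) (f := altVec (idxJ hp) J)
    (P := fun q F => Stage (idxJ hp) J q F ∧
      ((∀ l : Fin n, (l : ℕ) < q → (J l : ℕ) ≤ p) → ∀ I, F (Sum.elim (idxJ hp) I) ≠ 0 → I = J) ∧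
      ((∀ l : Fin n, (l : ℕ) < q → (J l : ℕ) < p) → F (Sum.elim (idxJ hp) J) = eigProd hp h s t J q) ∧
      (∀ I, F (Sum.elim (idxI hp) I) ≠ 0 → ∃ a : Fin n, (a : ℕ) < q ∧ J a = ⟨p, by omega⟩ ∧
        I = Function.update J a ⟨p + 1, hp⟩) ∧
      ∀ e : Fin n, J e = ⟨p, by omega⟩ → (∀ l, J l = ⟨p, by omega⟩ → e ≤ l) → (e : ℕ) < q →
        minorEig hp h (s 0 e - h * t 0 e) (J e) *
          F (Sum.elim (idxI hp) (Function.update J e ⟨p + 1, hp⟩)) = (1 - h) * s 0 e * eigProd hp h s t J q)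
    ⟨stage_zero (idxJ_injective hp) J, fun _ I hI => (altVec_ne_zero hI).2, fun _ => ?_, fun I hI => ?_,
      fun e _ _ h => absurd h (Nat.not_lt_zero _)⟩
    fun k F hF => ⟨hF.1.step hfus, lowering_step hst hfus hJ hF.1 hF.2.1 hF.2.2.1 hF.2.2.2.1 hF.2.2.2.2⟩
  · refine ⟨fun I hI => ?_, fun e he hl => this.2.2.2.2 e he hl e.2⟩
    obtain ⟨a, -, h1⟩ := this.2.2.2.1 I hI
    exact ⟨a, h1⟩
  · rw [altVec_self (idxJ_injective hp), eigProd]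
    simp
  · obtain ⟨⟨σ, hσ⟩, -⟩ := altVec_ne_zero hI
    have h1 := range_idxJ hp ⟨σ (Fin.last p), (congrFun hσ (Fin.last p)).symm⟩
    rw [idxI_val, Fin.val_last] at h1
    omega

end PrincipalMinors

end LoopK

end

noncomputable section

namespace LoopK

open Finset Matrix

section SeveralMonodromies

variable {E : Type*} [CommRing E] {N n : ℕ} {ι : Type*} [DecidableEq ι]

theorem dprod_one {M : Type*} [Monoid M] : dprod (fun _ : Fin n => (1 : M)) = 1 := by
  rw [dprod]
  exact List.prod_eq_one fun x hx => by
    obtain ⟨k, -, rfl⟩ := List.mem_map.1 hx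
    rfl

theorem prod_Top (h : E) (s t : ι → Fin n → E) {l : List ι} (hl : l.Nodup) :
    (l.map fun r => Top (N := N) h (s r) (t r) r).prod = dprod fun k => siteProd h s t k l := by
  induction l with
  | nil => exact dprod_one.symm
  | cons r l ih =>
    obtain ⟨hr, hl'⟩ := List.nodup_cons.1 hl
    rw [List.map_cons, List.prod_cons, ih hl', Top, dprod_mul]
    · rfl
    · intro k k' hk
      refine Commute.list_prod_right _ _ fun x hx => ?_
      obtain ⟨r', hr', rfl⟩ := List.mem_map.1 hx
      have hne : r ≠ r' := fun h => hr (h ▸ hr')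
      exact Rop_comm _ _ _ _ _ Sum.inl_ne_inr Sum.inl_ne_inr (fun h => hne (Sum.inl.inj h)) Sum.inl_ne_inr
        Sum.inr_ne_inl fun h => hk (Sum.inr.inj h)

theorem prod_Top_single [Fintype ι] (h : E) (s t : ι → Fin n → E) {l : List ι} (hl : l.Nodup) (B : ι → Fin N)
    (J : Fin n → Fin N) : ∀ (A : ι → Fin N) (I : Fin n → Fin N),
    (l.map fun r => Top (N := N) h (s r) (t r) r).prod (Pi.single (Sum.elim B J) 1) (Sum.elim A I) =
      if ∀ r, r ∉ l → A r = B r then (l.map fun r => Lent h (s r) (t r) (A r) (B r)).prod I J else 0 := by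
  induction l with
  | nil =>
    intro A I
    rw [List.map_nil, List.prod_nil, List.map_nil, List.prod_nil, Module.End.one_apply, single_elim,
      Matrix.one_apply, ← ite_and]
    refine if_congr (and_congr_left' ?_) rfl rfl
    simp [funext_iff]
  | cons r l ih =>
    intro A I
    obtain ⟨hr, hl'⟩ := List.nodup_cons.1 hl
    rw [List.map_cons, List.prod_cons, Module.End.mul_apply, Top_apply]
    simp only [ih hl']
    rw [sum_eq_single (B r)]
    · by_cases hA : ∀ r', r' ∉ r :: l → A r' = B r'
      · rw [if_pos hA, List.map_cons, List.prod_cons, Matrix.mul_apply]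
        refine sum_congr rfl fun K _ => ?_
        rw [if_pos]
        · have e : (l.map fun r' => Lent h (s r') (t r') (Function.update A r (B r) r') (B r')) =
              l.map fun r' => Lent h (s r') (t r') (A r') (B r') :=
            List.map_congr_left fun r' hr' => by
              have hne : r' ≠ r := fun h => hr (h ▸ hr')
              rw [Function.update_of_ne hne]
          rw [e]
        · intro r' hr'
          by_cases h' : r' = r
          · rw [h', Function.update_self]
          · rw [Function.update_of_ne h']
            exact hA r' (by simp [h', hr'])
      · rw [if_neg hA]
        refine sum_eq_zero fun K _ => ?_
        rw [if_neg, mul_zero]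
        intro h'
        refine hA fun r' hr' => ?_
        rw [List.mem_cons, not_or] at hr'
        have := h' r' hr'.2
        rwa [Function.update_of_ne hr'.1] at this
    · intro b _ hb
      refine sum_eq_zero fun K _ => ?_
      rw [if_neg, mul_zero]
      intro h'
      have := h' r hr
      rw [Function.update_self] at this
      exact hb this
    · intro h'; exact absurd (mem_univ _) h'

theorem minor_eq_allSites {p : ℕ} (h : E) (s t : Fin (p + 1) → Fin n → E) (i j : Fin (p + 1) → Fin N)
    (I J : Fin n → Fin N) :
    ∑ σ : Equiv.Perm (Fin (p + 1)), ((Equiv.Perm.sign σ : ℤ) : E) *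
      (List.ofFn fun k => Lent h (s k) (t k) (i k) (j (σ k))).prod I J =
      allSites h s t (altVec j J) (Sum.elim i I) := by
  have e : (allSites h s t : Module.End E ((Fin (p + 1) ⊕ Fin n → Fin N) → E)) =
      ((List.finRange (p + 1)).map fun r => Top (N := N) h (s r) (t r) r).prod :=
    (prod_Top h s t (List.nodup_finRange _)).symm
  rw [e, altVec, map_sum, Finset.sum_apply]
  refine sum_congr rfl fun σ _ => ?_
  rw [map_smul, Pi.smul_apply, prod_Top_single h s t (List.nodup_finRange _), if_pos, smul_eq_mul,
    List.ofFn_eq_map]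
  · rfl
  · intro r hr
    exact absurd (List.mem_finRange r) hr

end SeveralMonodromies

section SeriesOfMatrices

variable {A K ι : Type*} [Ring A] [CommRing K] [Fintype ι] [DecidableEq ι]

/-- A representation by matrices, extended to power series coefficientwise. -/
def matSer (φ : A →+* Matrix ι ι K) : PowerSeries A →+* Matrix ι ι (PowerSeries K) where
  toFun X := Matrix.of fun I J => PowerSeries.mk fun s => φ (PowerSeries.coeff s X) I J
  map_one' := by
    ext I J s
    rw [Matrix.of_apply, PowerSeries.coeff_mk, PowerSeries.coeff_one, Matrix.one_apply, apply_ite φ, map_one, map_zero]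
    split_ifs with h1 h2 h2 <;> simp [h1, h2, PowerSeries.coeff_one, Matrix.one_apply]
  map_mul' X Y := by
    ext I J s
    rw [Matrix.of_apply, PowerSeries.coeff_mk, PowerSeries.coeff_mul, map_sum, Matrix.mul_apply, map_sum,
      Matrix.sum_apply]
    simp only [map_mul, Matrix.mul_apply, PowerSeries.coeff_mul, Matrix.of_apply, PowerSeries.coeff_mk]
    exact sum_comm
  map_zero' := by
    ext I J s
    simp
  map_add' X Y := by
    ext I J s
    simp

theorem coeff_matSer (φ : A →+* Matrix ι ι K) (X : PowerSeries A) (I J : ι) (s : ℕ) :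
    PowerSeries.coeff s (matSer φ X I J) = φ (PowerSeries.coeff s X) I J := by
  change PowerSeries.coeff s (PowerSeries.mk fun s => φ (PowerSeries.coeff s X) I J) = _
  rw [PowerSeries.coeff_mk]

end SeriesOfMatrices

section Minors

variable {N n : ℕ}

/-- The kernels of the monodromy matrices with shifted arguments. -/
def shiftF (n : ℕ) (al : Sgn) (r : ℕ) (k : Fin n) : PowerSeries (RatF (Fin n)) :=
  PowerSeries.rescale (rh ^ (al.val * r)) (fKer al (rvar k))

/-- The other kernels of the monodromy matrices with shifted arguments. -/
def shiftE (n : ℕ) (al : Sgn) (r : ℕ) (k : Fin n) : PowerSeries (RatF (Fin n)) :=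
  PowerSeries.rescale (rh ^ (al.val * r)) (eKer al (rvar k))

theorem rescale_C {E : Type*} [CommRing E] (a x : E) : PowerSeries.rescale a (PowerSeries.C x) = PowerSeries.C x := by
  ext s
  rw [PowerSeries.coeff_rescale, PowerSeries.coeff_C]
  split_ifs with h
  · rw [h, pow_zero, one_mul]
  · rw [mul_zero]

theorem shiftF_sub_shiftE (al : Sgn) (r : ℕ) (k : Fin n) : shiftF n al r k - shiftE n al r k = 1 := by
  rw [shiftF, shiftE, ← map_sub, fKer_sub_eKer, map_one]

theorem shiftF_zero (al : Sgn) (k : Fin n) : shiftF n al 0 k = fKer al (rvar k) := by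
  rw [shiftF]; simp

theorem shiftE_zero (al : Sgn) (k : Fin n) : shiftE n al 0 k = eKer al (rvar k) := by
  rw [shiftE]; simp

theorem fusion_aux {K : Type*} [Field K] {h g : K} (hh : h ≠ 0) (hg : g ≠ 0) (al : Sgn) (r : ℕ) :
    PowerSeries.C h * PowerSeries.rescale (h ^ (al.val * r)) (fKer al g) *
      PowerSeries.rescale (h ^ (al.val * (r + 1 : ℕ))) (eKer al g) =
      PowerSeries.rescale (h ^ (al.val * (r + 1 : ℕ))) (fKer al g) *
        PowerSeries.rescale (h ^ (al.val * r)) (eKer al g) := by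
  have hX : ∀ a : K, PowerSeries.rescale a PowerSeries.X = PowerSeries.C a * PowerSeries.X := by
    intro a; rw [PowerSeries.rescale_X]
  cases al with
  | plus =>
    have e : ∀ a : K, PowerSeries.rescale a (fKer .plus g) * PowerSeries.C g =
        PowerSeries.rescale a (eKer .plus g) * (PowerSeries.C a * PowerSeries.X) := by
      intro a
      rw [← hX, ← map_mul, ← ker_plus hg, map_mul, rescale_C]
    have h1 := e (h ^ (Sgn.plus.val * r))
    have h2 := e (h ^ (Sgn.plus.val * (r + 1 : ℕ)))
    have h3 : (PowerSeries.C (h ^ (Sgn.plus.val * (r + 1 : ℕ))) : PowerSeries K) =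
        PowerSeries.C h * PowerSeries.C (h ^ (Sgn.plus.val * r)) := by
      rw [← map_mul]
      congr 1
      simp only [Sgn.val, one_mul, zpow_natCast]
      ring
    have hC : (PowerSeries.C g : PowerSeries K) ≠ 0 := fun h' => hg (by simpa using h')
    refine mul_right_cancel₀ hC ?_
    rw [h3] at h2
    linear_combination (PowerSeries.C h * PowerSeries.rescale (h ^ (Sgn.plus.val * (r + 1 : ℕ))) (eKer .plus g)) * h1 -
      PowerSeries.rescale (h ^ (Sgn.plus.val * r)) (eKer .plus g) * h2
  | minus =>
    have e : ∀ a : K, PowerSeries.rescale a (fKer .minus g) * PowerSeries.C g * (PowerSeries.C a * PowerSeries.X) =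
        PowerSeries.rescale a (eKer .minus g) := by
      intro a
      rw [← hX, ← ker_minus g, map_mul, map_mul, rescale_C]
    have h1 := e (h ^ (Sgn.minus.val * r))
    have h2 := e (h ^ (Sgn.minus.val * (r + 1 : ℕ)))
    have h3 : (PowerSeries.C (h ^ (Sgn.minus.val * r)) : PowerSeries K) =
        PowerSeries.C h * PowerSeries.C (h ^ (Sgn.minus.val * (r + 1 : ℕ))) := by
      rw [← map_mul]
      congr 1
      rw [← zpow_one_add₀ hh]
      congr 1
      simp only [Sgn.val, Nat.cast_add, Nat.cast_one]
      ring
    rw [← h1, ← h2, h3]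
    ring

theorem shift_fusion (al : Sgn) {p : ℕ} (i j : Fin (p + 1)) (hij : (i : ℕ) + 1 = j) (k : Fin n) :
    PowerSeries.C rh * shiftF n al i k * shiftE n al j k = shiftF n al j k * shiftE n al i k := by
  rw [← hij]
  exact fusion_aux rh_ne_zero (rvar_ne_zero k) al i

theorem matSer_Lser (al : Sgn) (i j : Fin N) (r : ℕ) :
    matSer (phi N n : U N →+* _) (Lser al i j r) = Lent (PowerSeries.C rh) (shiftF n al r) (shiftE n al r) i j := by
  have hL : ∀ I J, PowerSeries.rescale (rh ^ (al.val * r)) (Lps n al i j I J) =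
      Lent (PowerSeries.C rh) (shiftF n al r) (shiftE n al r) i j I J := by
    intro I J
    rw [Lps, map_Lent, rescale_C]
    rfl
  ext I J s
  rw [coeff_matSer, ← hL, PowerSeries.coeff_rescale, ← Lcoef_apply, Lser, PowerSeries.coeff_mk]
  change phi N n (_ • LL al i j s) I J = _
  rw [map_smul, phi_LL, Matrix.smul_apply, Algebra.smul_def, map_zpow₀, ← mul_assoc, _root_.zpow_mul, zpow_natCast]
  rfl

theorem matSer_minor (al : Sgn) {p : ℕ} (i j : Fin (p + 1) → Fin N) (I J : Fin n → Fin N) :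
    matSer (phi N n : U N →+* _) (minor al i j) I J =
      allSites (PowerSeries.C rh) (fun r => shiftF n al r) (fun r => shiftE n al r) (altVec j J)
        (Sum.elim i I) := by
  rw [← minor_eq_allSites, minor, map_sum, Matrix.sum_apply]
  refine sum_congr rfl fun σ _ => ?_
  have e : (matSer (phi N n : U N →+* _) ∘ fun k : Fin (p + 1) => Lser al (i k) (j (σ k)) k) =
      fun k : Fin (p + 1) => Lent (PowerSeries.C rh) (shiftF n al k) (shiftE n al k) (i k) (j (σ k)) :=
    funext fun k => matSer_Lser al (i k) (j (σ k)) k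
  rw [Units.smul_def, map_zsmul, map_list_prod, List.map_ofFn, e, Matrix.smul_apply, zsmul_eq_mul]

end Minors

end LoopK

end

noncomputable section

namespace LoopK

open Finset Matrix

section XiBasis

variable {N n : ℕ} {xi : (Fin n → Fin N) → V N n}

theorem xiMat_inv_mul (hxi : IsXi xi) : (xiMat xi)⁻¹ * xiMat xi = 1 :=
  Matrix.nonsing_inv_mul _ ((Matrix.isUnit_iff_isUnit_det _).1 (isUnit_xiMat hxi))

theorem xiMat_mul_inv (hxi : IsXi xi) : xiMat xi * (xiMat xi)⁻¹ = 1 :=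
  Matrix.mul_nonsing_inv _ ((Matrix.isUnit_iff_isUnit_det _).1 (isUnit_xiMat hxi))

/-- The representation `phi` in the basis of the vectors `ξ_I`. -/
def psi (hxi : IsXi xi) : U N →+* Matrix (Fin n → Fin N) (Fin n → Fin N) (RatF (Fin n)) where
  toFun X := (xiMat xi)⁻¹ * phi N n X * xiMat xi
  map_one' := by rw [map_one, mul_one, xiMat_inv_mul hxi]
  map_mul' X Y := by
    rw [map_mul]
    calc (xiMat xi)⁻¹ * (phi N n X * phi N n Y) * xiMat xi =
        (xiMat xi)⁻¹ * phi N n X * 1 * phi N n Y * xiMat xi := by rw [mul_one]; simp only [mul_assoc]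
      _ = _ := by rw [← xiMat_mul_inv hxi]; simp only [mul_assoc]
  map_zero' := by rw [map_zero, mul_zero, zero_mul]
  map_add' X Y := by rw [map_add, mul_add, add_mul]

theorem psi_apply (hxi : IsXi xi) (X : U N) (I J : Fin n → Fin N) :
    psi hxi X I J = xiCoord xi (phi N n X *ᵥ xi J) I := by
  change ((xiMat xi)⁻¹ * phi N n X * xiMat xi) I J = _
  rw [xiCoord, mulVec_mulVec]
  rfl

theorem psi_smul (hxi : IsXi xi) (c : Coef) (X : U N) (I J : Fin n → Fin N) :
    psi hxi (c • X) I J = algebraMap Coef (RatF (Fin n)) c * psi hxi X I J := by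
  rw [psi_apply, psi_apply, map_smul, Matrix.smul_mulVec, smul_V, xiCoord_smul, Pi.smul_apply, smul_eq_mul]

theorem psi_equivariant (hxi : IsXi xi) (X : U N) (π : Equiv.Perm (Fin n)) :
    ∀ I J, permute π (psi hxi X (I ∘ π) (J ∘ π)) = psi hxi X I J := by
  refine perm_induction (P := fun π => ∀ I J, permute π (psi hxi X (I ∘ π) (J ∘ π)) = psi hxi X I J)
    (fun I J => permute_one _) (fun i j hij I J => ?_) (fun x y hx hy I J => ?_) π
  · rw [psi_apply, hxi.2 J i j hij, ← (phi_mem_symMat X).2 i j hij, xiCoord_sTilde hxi hij, permute_permute,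
      Equiv.swap_mul_self, permute_one, psi_apply]
  · rw [← permute_permute, Equiv.Perm.coe_mul, ← Function.comp_assoc, ← Function.comp_assoc, hy, hx]

theorem matSer_psi_equivariant (hxi : IsXi xi) (X : PowerSeries (U N)) (π : Equiv.Perm (Fin n))
    (I J : Fin n → Fin N) :
    PowerSeries.map (permute π) (matSer (psi hxi) X (I ∘ π) (J ∘ π)) = matSer (psi hxi) X I J := by
  ext s
  rw [PowerSeries.coeff_map, coeff_matSer, coeff_matSer, psi_equivariant]

theorem matSer_psi_smul (hxi : IsXi xi) (c : Coef) (X : PowerSeries (U N)) (I J : Fin n → Fin N) :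
    matSer (psi hxi) (c • X) I J = PowerSeries.C (algebraMap Coef (RatF (Fin n)) c) * matSer (psi hxi) X I J := by
  ext s
  rw [PowerSeries.coeff_C_mul, coeff_matSer, coeff_matSer]
  exact psi_smul hxi c _ I J

theorem psi_of_monotone (hxi : IsXi xi) (X : U N) (I : Fin n → Fin N) {J : Fin n → Fin N} (hJ : Monotone J) :
    psi hxi X I J = xiCoord xi (fun K => phi N n X K J) I := by
  rw [psi_apply, hxi.1 J hJ]
  congr 1
  ext K
  rw [Matrix.mulVec_single_one]
  rfl

theorem matSer_psi_eq_zero (hxi : IsXi xi) (X : PowerSeries (U N)) {J : Fin n → Fin N} (hJ : Monotone J)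
    (S : Set (Fin n → Fin N)) (hS : ∀ I ∈ S, ∀ K, xi I K ≠ 0 → K ∈ S)
    (hX : ∀ K, matSer (phi N n : U N →+* Matrix (Fin n → Fin N) (Fin n → Fin N) (RatF (Fin n))) X K J ≠ 0 → K ∈ S) {I : Fin n → Fin N} (hI : I ∉ S) :
    matSer (psi hxi) X I J = 0 := by
  ext s
  rw [coeff_matSer, psi_of_monotone hxi _ _ hJ]
  refine xiCoord_of_support hxi S hS (fun K hK => hX K fun h => hK ?_) I hI
  have := congrArg (PowerSeries.coeff s) h
  rw [coeff_matSer, map_zero] at this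
  exact this

theorem matSer_psi_leading (hxi : IsXi xi) (X : PowerSeries (U N)) {J : Fin n → Fin N} (hJ : Monotone J)
    (S : Set (Fin n → Fin N)) (hS : ∀ I ∈ S, ∀ K, xi I K ≠ 0 → K ∈ S)
    (hX : ∀ K, matSer (phi N n : U N →+* Matrix (Fin n → Fin N) (Fin n → Fin N) (RatF (Fin n))) X K J ≠ 0 → K ∈ S) {I : Fin n → Fin N}
    (hI : ∀ I' ∈ S, inv I' ≤ inv I) :
    matSer (psi hxi) X I J * PowerSeries.C (xiDiag I) = matSer (phi N n : U N →+* Matrix (Fin n → Fin N) (Fin n → Fin N) (RatF (Fin n))) X I J := by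
  ext s
  rw [PowerSeries.coeff_mul_C, coeff_matSer, coeff_matSer, psi_of_monotone hxi _ _ hJ,
    xiCoord_leading hxi S hS (fun K hK => hX K fun h => hK ?_) hI]
  · rfl
  · have := congrArg (PowerSeries.coeff s) h
    rw [coeff_matSer, map_zero] at this
    exact this

theorem xiDiag_of_monotone {J : Fin n → Fin N} (hJ : Monotone J) : xiDiag J = 1 :=
  prod_eq_one fun p hp => by rw [if_neg (hJ (mem_ltPairs.1 hp).le).not_gt]

theorem xi_of_monotone_stable (hxi : IsXi xi) {J : Fin n → Fin N} (hJ : Monotone J) :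
    ∀ I ∈ ({J} : Set (Fin n → Fin N)), ∀ K, xi I K ≠ 0 → K ∈ ({J} : Set (Fin n → Fin N)) := by
  rintro I rfl K hK
  by_contra h
  rw [hxi.1 I hJ] at hK
  exact hK (Pi.single_eq_of_ne h _)

end XiBasis

section Transport

variable {N n : ℕ}

theorem update_comp_perm (J : Fin n → Fin N) (a : Fin n) (y : Fin N) (π : Equiv.Perm (Fin n)) :
    Function.update J (π a) y ∘ π = Function.update (J ∘ π) a y := by
  rw [Function.update_comp_equiv, Equiv.symm_apply_apply]

/-- An equivariant family of matrix entries is determined by its columns at monotone colourings and by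
one entry of each of them. -/
theorem equivariant_column {x y : Fin N} {M : (Fin n → Fin N) → (Fin n → Fin N) → PowerSeries (RatF (Fin n))}
    (hM : ∀ π I J, PowerSeries.map (permute π) (M (I ∘ π) (J ∘ π)) = M I J)
    {G : (Fin n → Fin N) → Fin n → PowerSeries (RatF (Fin n))}
    (hG : ∀ π J a, PowerSeries.map (permute π) (G (J ∘ π) a) = G J (π a))
    (h1 : ∀ J, Monotone J → ∀ I, M I J ≠ 0 → ∃ a, J a = x ∧ I = Function.update J a y)
    (h2 : ∀ J, Monotone J → ∀ a, J a = x → ∃ e, J e = x ∧ M (Function.update J e y) J = G J e)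
    (J : Fin n → Fin N) :
    (∀ I, M I J ≠ 0 → ∃ a, J a = x ∧ I = Function.update J a y) ∧
    ∀ a, J a = x → M (Function.update J a y) J = G J a := by
  have hmono : Monotone (J ∘ Tuple.sort J) := Tuple.monotone_sort J
  set π := Tuple.sort J
  refine ⟨fun I hI => ?_, fun a ha => ?_⟩
  · obtain ⟨a, ha, h3⟩ := h1 _ hmono (I ∘ π) fun h => hI (by rw [← hM π, h, map_zero])
    refine ⟨π a, ha, ?_⟩
    rw [← update_comp_perm] at h3
    exact π.surjective.injective_comp_right h3
  · obtain ⟨e, he, h3⟩ := h2 _ hmono (π.symm a) (by simpa using ha)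
    set τ := π * Equiv.swap e (π.symm a) with hτ
    have hJ : J ∘ τ = J ∘ π := by
      rw [hτ, Equiv.Perm.coe_mul, ← Function.comp_assoc]
      exact comp_swap_of_eq (by rw [he]; simpa using ha.symm)
    have hτe : τ e = a := by simp [hτ]
    rw [← hM τ, ← hτe, update_comp_perm, hJ, h3, ← hJ, hG]

end Transport

section Neighbours

variable {N n : ℕ} {xi : (Fin n → Fin N) → V N n} {J : Fin n → Fin N} {x y : Fin N}

theorem update_comp_swap {i j : Fin n} (hi : J i = x) (hj : J j = x) :
    Function.update J i y ∘ Equiv.swap i j = Function.update J j y := by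
  have h := update_comp_perm J j y (Equiv.swap i j)
  rw [Equiv.swap_apply_right, comp_swap_of_eq (hi.trans hj.symm)] at h
  exact h

/-- The colourings that are obtained by changing one colour from `x` to `y`. -/
def neighbours (J : Fin n → Fin N) (x y : Fin N) : Set (Fin n → Fin N) :=
  {K | ∃ a, J a = x ∧ K = Function.update J a y}

theorem neighbours_stable (hxi : IsXi xi) (hJ : Monotone J) (hlt : ∀ c, c < x → c ≤ y) (hgt : ∀ c, x < c → y ≤ c)
    (K : Fin n → Fin N) : K ∈ neighbours J x y → ∀ L, xi K L ≠ 0 → L ∈ neighbours J x y := by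
  induction hk : inv K using Nat.strong_induction_on generalizing K with
  | _ m ih =>
    subst hk
    rintro ⟨a, ha, hK⟩ L hL
    by_cases hm : Monotone K
    · have : L = K := by
        by_contra h
        rw [hxi.1 K hm] at hL
        exact hL (Pi.single_eq_of_ne h _)
      exact ⟨a, ha, this.trans hK⟩
    obtain ⟨i, j, hij, h2⟩ := exists_descent hm
    have hne := adj_ne hij
    have hJij : J i ≤ J j := hJ (Fin.le_def.2 (by omega))
    have key : J i = x ∧ J j = x ∧ K ∘ Equiv.swap i j ∈ neighbours J x y := by
      by_cases hai : a = i
      · subst hai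
        rw [hK, Function.update_self, Function.update_of_ne hne.symm] at h2
        have hj : J j = x := by
          refine le_antisymm ?_ (ha ▸ hJij)
          by_contra h3
          exact absurd (hgt _ (not_le.1 h3)) h2.not_ge
        exact ⟨ha, hj, j, hj, by rw [hK, update_comp_swap ha hj]⟩
      · by_cases haj : a = j
        · subst haj
          rw [hK, Function.update_self, Function.update_of_ne hne] at h2
          have hi : J i = x := by
            refine le_antisymm (ha ▸ hJij) ?_
            by_contra h3
            exact absurd (hlt _ (not_le.1 h3)) h2.not_ge
          refine ⟨hi, ha, i, hi, ?_⟩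
          rw [hK, Equiv.swap_comm, update_comp_swap ha hi]
        · rw [hK, Function.update_of_ne (Ne.symm hai), Function.update_of_ne (Ne.symm haj)] at h2
          exact absurd hJij h2.not_ge
    obtain ⟨hi, hj, hK'⟩ := key
    have hIH := ih _ (inv_swap_lt hij h2) _ rfl hK'
    have hxiK : xi K = sTilde i j (xi (K ∘ Equiv.swap i j)) := by
      rw [← hxi.2 _ i j hij, comp_swap_swap]
    rw [hxiK] at hL
    rcases (sTilde_apply_ne_zero hL).symm with h3 | h3
    · exact hIH _ h3
    · obtain ⟨b, hb, h4⟩ := hIH _ h3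
      have hJs : J ∘ Equiv.swap i j = J := comp_swap_of_eq (hi.trans hj.symm)
      refine ⟨Equiv.swap i j b, by rw [← Function.comp_apply (f := J), hJs, hb], ?_⟩
      rw [← comp_swap_swap i j L, h4]
      have h5 := update_comp_perm J (Equiv.swap i j b) y (Equiv.swap i j)
      rwa [Equiv.swap_apply_self, hJs] at h5

theorem inv_update_of_lt (hJ : Monotone J) (hyx : y < x) (d : ℕ) : ∀ a e : Fin n, (e : ℕ) = a + d → J a = x → J e = x →
    inv (Function.update J a y) ≤ inv (Function.update J e y) := by
  induction d with
  | zero =>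
    intro a e hd _ _
    rw [show a = e from Fin.ext (by omega)]
  | succ d ih =>
    intro a e hd ha he
    have hi : (⟨a + 1, by omega⟩ : Fin n) ≤ e := Fin.le_def.2 (by simp only; omega)
    have h1 : J ⟨a + 1, by omega⟩ = x :=
      le_antisymm (he ▸ hJ hi) (ha ▸ hJ (Fin.le_def.2 (by simp)))
    refine le_trans ?_ (ih ⟨a + 1, by omega⟩ e (by simp only; omega) h1 he)
    have hij : (a : ℕ) + 1 = (⟨a + 1, by omega⟩ : Fin n) := rfl
    have hne := adj_ne hij
    rw [← update_comp_swap h1 ha, Equiv.swap_comm]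
    refine (inv_swap_lt hij ?_).le
    rwa [Function.update_self, Function.update_of_ne hne, ha]

theorem inv_update_of_gt (hJ : Monotone J) (hyx : x < y) (d : ℕ) : ∀ a e : Fin n, (a : ℕ) = e + d → J a = x → J e = x →
    inv (Function.update J a y) ≤ inv (Function.update J e y) := by
  induction d with
  | zero =>
    intro a e hd _ _
    rw [show a = e from Fin.ext (by omega)]
  | succ d ih =>
    intro a e hd ha he
    have hi : (⟨e + 1, by omega⟩ : Fin n) ≤ a := Fin.le_def.2 (by simp only; omega)
    have h1 : J ⟨e + 1, by omega⟩ = x :=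
      le_antisymm (ha ▸ hJ hi) (he ▸ hJ (Fin.le_def.2 (by simp)))
    refine le_trans (ih a ⟨e + 1, by omega⟩ (by simp only; omega) ha h1) ?_
    have hij : (e : ℕ) + 1 = (⟨e + 1, by omega⟩ : Fin n) := rfl
    have hne := adj_ne hij
    rw [← update_comp_swap he h1]
    refine (inv_swap_lt hij ?_).le
    rwa [Function.update_self, Function.update_of_ne hne.symm, h1]

/-- The other sites of the same colour. -/
def peers (J : Fin n → Fin N) (a : Fin n) : Finset (Fin n) := univ.filter fun b => b ≠ a ∧ J b = J a

theorem xiDiag_update_of_lt (hJ : Monotone J) (hlt : ∀ c, c < x → c ≤ y) (hyx : y < x) {e : Fin n} (he : J e = x)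
    (hl : ∀ b, J b = x → b ≤ e) : xiDiag (Function.update J e y) =
      ∏ b ∈ peers J e, (rvar e - rvar b) / (rvar e - rh * rvar b) := by
  have hset : (ltPairs n).filter (fun p => Function.update J e y p.2 < Function.update J e y p.1) =
      (peers J e).image fun b => (b, e) := by
    ext ⟨b, c⟩
    simp only [mem_filter, mem_ltPairs, mem_image, peers, mem_univ, true_and, Prod.mk.injEq]
    constructor
    · rintro ⟨hbc, h1⟩
      have hJbc := hJ hbc.le
      by_cases hc : c = e
      · subst hc
        rw [Function.update_self, Function.update_of_ne hbc.ne] at h1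
        refine ⟨b, ⟨hbc.ne, ?_⟩, rfl, rfl⟩
        refine le_antisymm hJbc ?_
        by_contra h3
        exact absurd (hlt _ (he ▸ not_le.1 h3)) h1.not_ge
      · exfalso
        rw [Function.update_of_ne hc] at h1
        by_cases hb : b = e
        · subst hb
          rw [Function.update_self] at h1
          exact absurd (he ▸ hJbc) (h1.trans hyx).not_ge
        · rw [Function.update_of_ne hb] at h1
          exact absurd hJbc h1.not_ge
    · rintro ⟨b', ⟨hb, hJb⟩, rfl, rfl⟩
      refine ⟨lt_of_le_of_ne (hl _ (hJb.trans he)) hb, ?_⟩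
      rwa [Function.update_self, Function.update_of_ne hb, hJb, he]
  rw [xiDiag, ← prod_filter, hset, prod_image fun b _ b' _ h => (Prod.mk.inj h).1]

theorem xiDiag_update_of_gt (hJ : Monotone J) (hgt : ∀ c, x < c → y ≤ c) (hxy : x < y) {e : Fin n} (he : J e = x)
    (hl : ∀ b, J b = x → e ≤ b) : xiDiag (Function.update J e y) =
      ∏ b ∈ peers J e, (rvar b - rvar e) / (rvar b - rh * rvar e) := by
  have hset : (ltPairs n).filter (fun p => Function.update J e y p.2 < Function.update J e y p.1) =
      (peers J e).image fun b => (e, b) := by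
    ext ⟨b, c⟩
    simp only [mem_filter, mem_ltPairs, mem_image, peers, mem_univ, true_and, Prod.mk.injEq]
    constructor
    · rintro ⟨hbc, h1⟩
      have hJbc := hJ hbc.le
      by_cases hb : b = e
      · subst hb
        rw [Function.update_self, Function.update_of_ne hbc.ne'] at h1
        refine ⟨c, ⟨hbc.ne', ?_⟩, rfl, rfl⟩
        refine le_antisymm ?_ hJbc
        by_contra h3
        exact absurd (hgt _ (he ▸ not_le.1 h3)) h1.not_ge
      · exfalso
        rw [Function.update_of_ne hb] at h1
        by_cases hc : c = e
        · subst hc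
          rw [Function.update_self] at h1
          exact absurd (he ▸ hJbc) (hxy.trans h1).not_ge
        · rw [Function.update_of_ne hc] at h1
          exact absurd hJbc h1.not_ge
    · rintro ⟨b', ⟨hb, hJb⟩, rfl, rfl⟩
      refine ⟨lt_of_le_of_ne (hl _ (hJb.trans he)) (Ne.symm hb), ?_⟩
      rwa [Function.update_self, Function.update_of_ne hb, hJb, he]
  rw [xiDiag, ← prod_filter, hset, prod_image fun b _ b' _ h => (Prod.mk.inj h).2]

theorem prod_peers_comp (π : Equiv.Perm (Fin n)) (J : Fin n → Fin N) (a : Fin n) {M : Type*} [CommMonoid M]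
    (f : Fin n → M) : ∏ b ∈ peers (J ∘ π) a, f (π b) = ∏ b ∈ peers J (π a), f b := by
  refine prod_bij (fun b _ => π b) (fun b hb => ?_) (fun _ _ _ _ h => π.injective h) (fun b hb => ?_)
    fun _ _ => rfl
  · simpa [peers] using hb
  · refine ⟨π.symm b, ?_, by simp⟩
    have hb' : b ≠ π a ∧ J b = J (π a) := by simpa [peers] using hb
    have : π.symm b ≠ a := fun h => hb'.1 (by rw [← h]; simp)
    simp [peers, this, hb'.2]

end Neighbours

end LoopK

end

noncomputable section

namespace LoopK

open Finset Matrix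

section Currents

variable {N n : ℕ} {xi : (Fin n → Fin N) → V N n} {p : ℕ} {hp : p + 1 < N} {al : Sgn}

/-- The eigenvalue of the principal minor at `ξ_J`. -/
def xiEig (hp : p + 1 < N) (al : Sgn) (J : Fin n → Fin N) : PowerSeries (RatF (Fin n)) :=
  ∏ k, minorEig hp (PowerSeries.C rh) (fKer al (rvar k) - PowerSeries.C rh * eKer al (rvar k)) (J k)

theorem map_minorEig {E E' : Type*} [CommRing E] [CommRing E'] (φ : E →+* E') (h x : E) (c : Fin N) :
    φ (minorEig hp h x c) = minorEig hp (φ h) (φ x) c := by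
  rw [minorEig, map_prod]
  refine prod_congr rfl fun r _ => ?_
  rw [wd, wd, apply_ite φ, apply_ite φ, map_one]

theorem div_mul_div_swap {F : Type*} [Field F] {a b : F} (ha : a ≠ 0) (hb : b ≠ 0) : a / b * (b / a) = 1 := by
  field_simp

theorem map_permute_C_rh (π : Equiv.Perm (Fin n)) :
    PowerSeries.map (permute π) (PowerSeries.C rh) = PowerSeries.C rh := by
  rw [PowerSeries.map_C, permute_rh]

theorem xiEig_equivariant (π : Equiv.Perm (Fin n)) (J : Fin n → Fin N) :
    PowerSeries.map (permute π) (xiEig hp al (J ∘ π)) = xiEig hp al J := by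
  rw [xiEig, map_prod, xiEig]
  refine Fintype.prod_equiv π _ _ fun k => ?_
  rw [map_minorEig, map_sub, map_mul, map_permute_C_rh, map_fKer, map_eKer, permute_rvar, Function.comp_apply]

theorem eigProd_shift (J : Fin n → Fin N) :
    eigProd hp (PowerSeries.C rh) (fun r => shiftF n al r) (fun r => shiftE n al r) J n = xiEig hp al J := by
  have : univ.filter (fun l : Fin n => (l : ℕ) < n) = univ := by ext l; simp
  rw [eigProd, this, xiEig]
  refine prod_congr rfl fun k _ => ?_
  rw [Fin.val_zero, shiftF_zero, shiftE_zero]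

variable (hxi : IsXi xi)
include hxi

theorem psi_principal_of_monotone {J : Fin n → Fin N} (hJ : Monotone J) (I : Fin n → Fin N) :
    matSer (psi hxi) (minor al (idxI hp) (idxI hp)) I J = if I = J then xiEig hp al J else 0 := by
  have h1 := fun I => principal_minor (hp := hp) (h := PowerSeries.C (rh : RatF (Fin n)))
    (s := fun r => shiftF n al r) (t := fun r => shiftE n al r) (fun r k => shiftF_sub_shiftE al r k)
    (fun i j hij k => shift_fusion al i j hij k) hJ I
  simp only [← matSer_minor, eigProd_shift] at h1
  have hX : ∀ K, matSer (phi N n : U N →+* Matrix (Fin n → Fin N) (Fin n → Fin N) (RatF (Fin n)))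
      (minor al (idxI hp) (idxI hp)) K J ≠ 0 → K ∈ ({J} : Set (Fin n → Fin N)) := by
    intro K hK
    by_contra h
    rw [h1, if_neg fun h' : K = J => h h'] at hK
    exact hK rfl
  split_ifs with h
  · have h2 := matSer_psi_leading hxi _ hJ {J} (xi_of_monotone_stable hxi hJ) hX (I := J) (by
      rintro I' rfl; exact le_rfl)
    rw [xiDiag_of_monotone hJ, map_one, mul_one, h1, if_pos rfl] at h2
    rw [h, h2]
  · exact matSer_psi_eq_zero hxi _ hJ {J} (xi_of_monotone_stable hxi hJ) hX h

theorem psi_principal (I J : Fin n → Fin N) :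
    matSer (psi hxi) (minor al (idxI hp) (idxI hp)) I J = if I = J then xiEig hp al J else 0 := by
  have hmono : Monotone (J ∘ Tuple.sort J) := Tuple.monotone_sort J
  rw [← matSer_psi_equivariant hxi _ (Tuple.sort J), psi_principal_of_monotone hxi hmono,
    apply_ite (PowerSeries.map _), map_zero, xiEig_equivariant]
  exact if_congr (Tuple.sort J).surjective.injective_comp_right.eq_iff rfl rfl

theorem xiEig_ne_zero (J : Fin n → Fin N) : xiEig hp al J ≠ 0 := by
  have h1 := (isUnit_minor al hp).mul_val_inv
  have h2 := congrArg (fun X => matSer (psi hxi) X J J) h1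
  simp only [map_mul, Matrix.mul_apply, psi_principal, map_one, Matrix.one_apply_eq] at h2
  intro h
  rw [sum_eq_zero] at h2
  · exact zero_ne_one h2
  · intro K _
    split_ifs with hJ
    · rw [← hJ, h, zero_mul]
    · rw [zero_mul]

omit hxi in
theorem C_one_sub_hh : (PowerSeries.C (algebraMap Coef (RatF (Fin n)) (1 - hh))⁻¹ : PowerSeries (RatF (Fin n))) *
    (1 - PowerSeries.C rh) = 1 := by
  have : (1 : PowerSeries (RatF (Fin n))) - PowerSeries.C rh = PowerSeries.C (1 - rh) := by
    rw [map_sub, map_one]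
  rw [this, ← map_mul, map_sub, map_one]
  exact (congrArg _ (inv_mul_cancel₀ one_sub_rh_ne_zero)).trans (map_one _)

theorem psi_Eser (I J : Fin n → Fin N) :
    matSer (psi hxi) (Eser al hp) I J * xiEig hp al J * (1 - PowerSeries.C rh) =
      matSer (psi hxi) (minor al (idxJ hp) (idxI hp)) I J := by
  have h1 : minor al (idxJ hp) (idxI hp) * ↑(isUnit_minor (N := N) al hp).unit⁻¹ * minor al (idxI hp) (idxI hp) =
      minor al (idxJ hp) (idxI hp) := by
    rw [mul_assoc, IsUnit.val_inv_mul, mul_one]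
  have h2 : (matSer (psi hxi) (minor al (idxJ hp) (idxI hp) * ↑(isUnit_minor (N := N) al hp).unit⁻¹) *
      matSer (psi hxi) (minor al (idxI hp) (idxI hp))) I J = matSer (psi hxi) (minor al (idxJ hp) (idxI hp)) I J := by
    rw [← map_mul, h1]
  rw [Matrix.mul_apply, sum_eq_single J, psi_principal, if_pos rfl] at h2
  · rw [Eser, matSer_psi_smul, ← h2, map_inv₀]
    linear_combination (matSer (psi hxi) (minor al (idxJ hp) (idxI hp) * ↑(isUnit_minor (N := N) al hp).unit⁻¹) I J *
      xiEig hp al J) * C_one_sub_hh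
  · intro K _ hK
    rw [psi_principal, if_neg hK, mul_zero]
  · intro h; exact absurd (mem_univ _) h

theorem psi_Fser (I J : Fin n → Fin N) :
    matSer (psi hxi) (Fser al hp) I J * xiEig hp al I * (1 - PowerSeries.C rh) =
      matSer (psi hxi) (minor al (idxI hp) (idxJ hp)) I J := by
  have h1 : minor al (idxI hp) (idxI hp) * (↑(isUnit_minor (N := N) al hp).unit⁻¹ * minor al (idxI hp) (idxJ hp)) =
      minor al (idxI hp) (idxJ hp) := by
    rw [← mul_assoc, IsUnit.mul_val_inv, one_mul]
  have h2 : (matSer (psi hxi) (minor al (idxI hp) (idxI hp)) *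
      matSer (psi hxi) (↑(isUnit_minor (N := N) al hp).unit⁻¹ * minor al (idxI hp) (idxJ hp))) I J =
      matSer (psi hxi) (minor al (idxI hp) (idxJ hp)) I J := by
    rw [← map_mul, h1]
  rw [Matrix.mul_apply, sum_eq_single I, psi_principal, if_pos rfl] at h2
  · rw [Fser, matSer_psi_smul, ← h2, map_inv₀]
    linear_combination (matSer (psi hxi) (↑(isUnit_minor (N := N) al hp).unit⁻¹ * minor al (idxI hp) (idxJ hp)) I J *
      xiEig hp al I) * C_one_sub_hh
  · intro K _ hK
    rw [psi_principal, if_neg (Ne.symm hK), zero_mul]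
  · intro h; exact absurd (mem_univ _) h

omit hxi in
/-- The matrix entries of the raising currents in the basis of the vectors `ξ_I`. -/
def rCoef (al : Sgn) (J : Fin n → Fin N) (a : Fin n) : PowerSeries (RatF (Fin n)) :=
  PowerSeries.C (∏ b ∈ peers J a, (rvar a - rh * rvar b) / (rvar a - rvar b)) * eKer al (rvar a)

omit hxi in
/-- The matrix entries of the lowering currents in the basis of the vectors `ξ_I`. -/
def lCoef (al : Sgn) (J : Fin n → Fin N) (a : Fin n) : PowerSeries (RatF (Fin n)) :=
  PowerSeries.C (∏ b ∈ peers J a, (rvar b - rh * rvar a) / (rvar b - rvar a)) * fKer al (rvar a)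

omit hxi in
theorem rCoef_equivariant (π : Equiv.Perm (Fin n)) (J : Fin n → Fin N) (a : Fin n) :
    PowerSeries.map (permute π) (rCoef al (J ∘ π) a) = rCoef al J (π a) := by
  rw [rCoef, map_mul, PowerSeries.map_C, map_eKer, map_prod, permute_rvar, rCoef, ← prod_peers_comp]
  simp only [map_div₀, map_sub, map_mul, permute_rvar, permute_rh]

omit hxi in
theorem lCoef_equivariant (π : Equiv.Perm (Fin n)) (J : Fin n → Fin N) (a : Fin n) :
    PowerSeries.map (permute π) (lCoef al (J ∘ π) a) = lCoef al J (π a) := by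
  rw [lCoef, map_mul, PowerSeries.map_C, map_fKer, map_prod, permute_rvar, lCoef, ← prod_peers_comp]
  simp only [map_div₀, map_sub, map_mul, permute_rvar, permute_rh]

omit hxi in
theorem exists_last {J : Fin n → Fin N} {x : Fin N} {a : Fin n} (ha : J a = x) :
    ∃ e, J e = x ∧ ∀ b, J b = x → b ≤ e := by
  obtain ⟨e, he, h⟩ := exists_max_image (univ.filter fun b => J b = x) id ⟨a, by simpa using ha⟩
  exact ⟨e, by simpa using he, fun b hb => h b (by simpa using hb)⟩

omit hxi in
theorem exists_first {J : Fin n → Fin N} {x : Fin N} {a : Fin n} (ha : J a = x) :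
    ∃ e, J e = x ∧ ∀ b, J b = x → e ≤ b := by
  obtain ⟨e, he, h⟩ := exists_min_image (univ.filter fun b => J b = x) id ⟨a, by simpa using ha⟩
  exact ⟨e, by simpa using he, fun b hb => h b (by simpa using hb)⟩

theorem psi_Eser_column (J : Fin n → Fin N) :
    (∀ I, matSer (psi hxi) (Eser al hp) I J ≠ 0 →
      ∃ a, J a = ⟨p + 1, hp⟩ ∧ I = Function.update J a ⟨p, by omega⟩) ∧
    ∀ a, J a = ⟨p + 1, hp⟩ →
      matSer (psi hxi) (Eser al hp) (Function.update J a ⟨p, by omega⟩) J = rCoef al J a := by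
  have h1r : (1 - PowerSeries.C rh : PowerSeries (RatF (Fin n))) ≠ 0 := right_ne_zero_of_mul_eq_one (C_one_sub_hh)
  have hlt : ∀ c : Fin N, c < ⟨p + 1, hp⟩ → c ≤ ⟨p, by omega⟩ := fun c hc => by
    simp only [Fin.lt_def, Fin.le_def] at *; omega
  have hyx : (⟨p, by omega⟩ : Fin N) < ⟨p + 1, hp⟩ := by simp [Fin.lt_def]
  have hgt : ∀ c : Fin N, ⟨p + 1, hp⟩ < c → ⟨p, by omega⟩ ≤ c := fun c hc => (hyx.trans hc).le
  refine equivariant_column (M := fun I J => matSer (psi hxi) (Eser al hp) I J)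
    (fun π I J => matSer_psi_equivariant hxi _ π I J) rCoef_equivariant (fun J hJ => ?_) (fun J hJ a ha => ?_) J
  all_goals
    obtain ⟨h1, h2⟩ := raising_minor (hp := hp) (h := PowerSeries.C (rh : RatF (Fin n)))
      (s := fun r => shiftF n al r) (t := fun r => shiftE n al r) (fun r k => shiftF_sub_shiftE al r k)
      (fun i j hij k => shift_fusion al i j hij k) hJ
    simp only [← matSer_minor, eigProd_shift] at h1 h2
  · intro I hI
    by_contra h
    have h3 := matSer_psi_eq_zero hxi _ hJ _ (neighbours_stable hxi hJ hlt hgt) h1 h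
    rw [← psi_Eser] at h3
    exact mul_ne_zero (mul_ne_zero hI (xiEig_ne_zero hxi J)) h1r h3
  · obtain ⟨e, he, hl⟩ := exists_last ha
    refine ⟨e, he, ?_⟩
    have h3 := matSer_psi_leading hxi _ hJ _ (neighbours_stable hxi hJ hlt hgt) h1
      (I := Function.update J e ⟨p, by omega⟩) (by
        rintro _ ⟨b, hb, rfl⟩
        have := Fin.le_def.1 (hl b hb)
        exact inv_update_of_lt hJ hyx (e - b) b e (by omega) hb he)
    rw [h2 e he hl, ← psi_Eser, Fin.val_zero, shiftE_zero, xiDiag_update_of_lt hJ hlt hyx he hl] at h3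
    have h4 : (PowerSeries.C (∏ b ∈ peers J e, (rvar e - rvar b) / (rvar e - rh * rvar b)) :
        PowerSeries (RatF (Fin n))) * PowerSeries.C (∏ b ∈ peers J e, (rvar e - rh * rvar b) / (rvar e - rvar b)) = 1 := by
      rw [← map_mul, ← prod_mul_distrib, prod_eq_one, map_one]
      intro b hb
      exact div_mul_div_swap (rvar_sub_ne_zero (Ne.symm (mem_filter.1 hb).2.1)) (rvar_sub_rh_mul_ne_zero _ _)
    refine mul_right_cancel₀ (mul_ne_zero (xiEig_ne_zero (al := al) (hp := hp) hxi J) h1r) ?_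
    rw [rCoef]
    linear_combination PowerSeries.C (∏ b ∈ peers J e, (rvar e - rh * rvar b) / (rvar e - rvar b)) * h3 -
      (matSer (psi hxi) (Eser al hp) (Function.update J e ⟨p, by omega⟩) J * xiEig hp al J *
        (1 - PowerSeries.C rh)) * h4

theorem psi_Fser_column (J : Fin n → Fin N) :
    (∀ I, matSer (psi hxi) (Fser al hp) I J ≠ 0 →
      ∃ a, J a = ⟨p, by omega⟩ ∧ I = Function.update J a ⟨p + 1, hp⟩) ∧
    ∀ a, J a = ⟨p, by omega⟩ →
      matSer (psi hxi) (Fser al hp) (Function.update J a ⟨p + 1, hp⟩) J = lCoef al J a := by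
  have h1r : (1 - PowerSeries.C rh : PowerSeries (RatF (Fin n))) ≠ 0 := right_ne_zero_of_mul_eq_one (C_one_sub_hh)
  have hgt : ∀ c : Fin N, ⟨p, by omega⟩ < c → ⟨p + 1, hp⟩ ≤ c := fun c hc => by
    simp only [Fin.lt_def, Fin.le_def] at *; omega
  have hxy : (⟨p, by omega⟩ : Fin N) < ⟨p + 1, hp⟩ := by simp [Fin.lt_def]
  have hlt : ∀ c : Fin N, c < ⟨p, by omega⟩ → c ≤ ⟨p + 1, hp⟩ := fun c hc => (hc.trans hxy).le
  refine equivariant_column (M := fun I J => matSer (psi hxi) (Fser al hp) I J)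
    (fun π I J => matSer_psi_equivariant hxi _ π I J) lCoef_equivariant (fun J hJ => ?_) (fun J hJ a ha => ?_) J
  all_goals
    obtain ⟨h1, h2⟩ := lowering_minor (hp := hp) (h := PowerSeries.C (rh : RatF (Fin n)))
      (s := fun r => shiftF n al r) (t := fun r => shiftE n al r) (fun r k => shiftF_sub_shiftE al r k)
      (fun i j hij k => shift_fusion al i j hij k) hJ
    simp only [← matSer_minor, eigProd_shift] at h1 h2
  · intro I hI
    by_contra h
    have h3 := matSer_psi_eq_zero hxi _ hJ _ (neighbours_stable hxi hJ hlt hgt) h1 h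
    rw [← psi_Fser] at h3
    exact mul_ne_zero (mul_ne_zero hI (xiEig_ne_zero hxi I)) h1r h3
  · obtain ⟨e, he, hl⟩ := exists_first ha
    refine ⟨e, he, ?_⟩
    have h3 := matSer_psi_leading hxi _ hJ _ (neighbours_stable hxi hJ hlt hgt) h1
      (I := Function.update J e ⟨p + 1, hp⟩) (by
        rintro _ ⟨b, hb, rfl⟩
        have := Fin.le_def.1 (hl b hb)
        exact inv_update_of_gt hJ hxy (b - e) b e (by omega) hb he)
    have h2' := h2 e he hl
    rw [← h3, ← psi_Fser, Fin.val_zero, shiftF_zero, shiftE_zero, xiDiag_update_of_gt hJ hgt hxy he hl] at h2'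
    have h4 : (PowerSeries.C (∏ b ∈ peers J e, (rvar b - rvar e) / (rvar b - rh * rvar e)) :
        PowerSeries (RatF (Fin n))) * PowerSeries.C (∏ b ∈ peers J e, (rvar b - rh * rvar e) / (rvar b - rvar e)) = 1 := by
      rw [← map_mul, ← prod_mul_distrib, prod_eq_one, map_one]
      intro b hb
      exact div_mul_div_swap (rvar_sub_ne_zero (mem_filter.1 hb).2.1) (rvar_sub_rh_mul_ne_zero _ _)
    have h5 : minorEig hp (PowerSeries.C rh) (fKer al (rvar e) - PowerSeries.C rh * eKer al (rvar e)) (J e) *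
        xiEig hp al (Function.update J e ⟨p + 1, hp⟩) = xiEig hp al J := by
      rw [xiEig, xiEig, ← mul_prod_erase univ _ (mem_univ e), Function.update_self,
        minorEig_of_gt (c := ⟨p + 1, hp⟩) _ _ (Nat.lt_succ_self p), one_mul, ← mul_prod_erase univ _ (mem_univ e)]
      congr 1
      refine prod_congr rfl fun k hk => ?_
      rw [Function.update_of_ne (mem_erase.1 hk).1]
    refine mul_right_cancel₀ (mul_ne_zero (xiEig_ne_zero (al := al) (hp := hp) hxi J) h1r) ?_
    rw [lCoef]
    rw [← h5] at h2' ⊢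
    linear_combination PowerSeries.C (∏ b ∈ peers J e, (rvar b - rh * rvar e) / (rvar b - rvar e)) * h2' -
      (minorEig hp (PowerSeries.C rh) (fKer al (rvar e) - PowerSeries.C rh * eKer al (rvar e)) (J e) *
        matSer (psi hxi) (Fser al hp) (Function.update J e ⟨p + 1, hp⟩) J *
        xiEig hp al (Function.update J e ⟨p + 1, hp⟩) * (1 - PowerSeries.C rh)) * h4

end Currents

end LoopK

end

noncomputable section

namespace LoopK

open Finset Matrix

section Specialization

variable {σ τ : Type}

/-- The pairs of a rational function and its value under the substitution `x_i ↦ x_{g i}`. -/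
def specGraph (g : σ → τ) : Subring (RatF σ × RatF τ) where
  carrier := {x | ∃ a d : Laurent σ, rename g d ≠ 0 ∧ x.1 * algebraMap _ (RatF σ) d = algebraMap _ (RatF σ) a ∧
    x.2 * algebraMap _ (RatF τ) (rename g d) = algebraMap _ (RatF τ) (rename g a)}
  zero_mem' := ⟨0, 1, by rw [map_one]; exact one_ne_zero, by simp, by simp⟩
  one_mem' := ⟨1, 1, by rw [map_one]; exact one_ne_zero, by simp, by simp⟩
  neg_mem' := by
    rintro x ⟨a, d, hd, h1, h2⟩
    exact ⟨-a, d, hd, by rw [Prod.fst_neg, neg_mul, h1, map_neg], by rw [Prod.snd_neg, neg_mul, h2, map_neg, map_neg]⟩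
  add_mem' := by
    rintro x y ⟨a, d, hd, h1, h2⟩ ⟨a', d', hd', h1', h2'⟩
    refine ⟨a * d' + a' * d, d * d', by rw [map_mul]; exact mul_ne_zero hd hd', ?_, ?_⟩
    · rw [Prod.fst_add, map_add, map_mul, map_mul, map_mul, ← h1, ← h1']
      ring
    · simp only [Prod.snd_add, map_add, map_mul, ← h2, ← h2']
      ring
  mul_mem' := by
    rintro x y ⟨a, d, hd, h1, h2⟩ ⟨a', d', hd', h1', h2'⟩
    refine ⟨a * a', d * d', by rw [map_mul]; exact mul_ne_zero hd hd', ?_, ?_⟩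
    · rw [Prod.fst_mul, map_mul, map_mul, ← h1, ← h1']
      ring
    · simp only [Prod.snd_mul, map_mul, ← h2, ← h2']
      ring

variable {g : σ → τ}

theorem algebraMap_mem_specGraph (f : Laurent σ) :
    (algebraMap _ (RatF σ) f, algebraMap _ (RatF τ) (rename g f)) ∈ specGraph g :=
  ⟨f, 1, by rw [map_one]; exact one_ne_zero, by simp, by simp⟩

theorem eq_of_mem_specGraph {f : Laurent σ} {v : RatF τ} (h : (algebraMap _ (RatF σ) f, v) ∈ specGraph g) :
    v = algebraMap _ (RatF τ) (rename g f) := by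
  obtain ⟨a, d, hd, h1, h2⟩ := h
  simp only at h1 h2
  rw [← map_mul] at h1
  rw [← IsFractionRing.injective _ _ h1, map_mul, map_mul] at h2
  exact mul_right_cancel₀ (algebraMap_ratF_ne_zero hd) h2

theorem inv_mem_specGraph {x : RatF σ} {v : RatF τ} (h : (x, v) ∈ specGraph g) (hv : v ≠ 0) :
    (x⁻¹, v⁻¹) ∈ specGraph g := by
  obtain ⟨a, d, hd, h1, h2⟩ := h
  simp only at h1 h2
  have ha : rename g a ≠ 0 := by
    intro h
    rw [h, map_zero] at h2
    exact mul_ne_zero hv (algebraMap_ratF_ne_zero hd) h2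
  have ha' : a ≠ 0 := by rintro rfl; exact ha (map_zero _)
  have hx : x ≠ 0 := by
    rintro rfl
    rw [zero_mul] at h1
    exact algebraMap_ratF_ne_zero ha' h1.symm
  refine ⟨d, a, ha, ?_, ?_⟩
  · rw [← h1]; exact inv_mul_cancel_left₀ hx _
  · rw [← h2]; exact inv_mul_cancel_left₀ hv _

theorem sub_mem_specGraph {x y : RatF σ} {v w : RatF τ} (h : (x, v) ∈ specGraph g) (h' : (y, w) ∈ specGraph g) :
    (x - y, v - w) ∈ specGraph g := sub_mem h h'

theorem mul_mem_specGraph {x y : RatF σ} {v w : RatF τ} (h : (x, v) ∈ specGraph g) (h' : (y, w) ∈ specGraph g) :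
    (x * y, v * w) ∈ specGraph g := mul_mem h h'

theorem one_mem_specGraph : ((1 : RatF σ), (1 : RatF τ)) ∈ specGraph g := one_mem _

theorem div_mem_specGraph {x y : RatF σ} {v w : RatF τ} (h : (x, v) ∈ specGraph g) (h' : (y, w) ∈ specGraph g)
    (hw : w ≠ 0) : (x / y, v / w) ∈ specGraph g := by
  rw [div_eq_mul_inv, div_eq_mul_inv]
  exact mul_mem_specGraph h (inv_mem_specGraph h' hw)

theorem sum_mem_specGraph {ι : Type*} (s : Finset ι) {x : ι → RatF σ} {v : ι → RatF τ}
    (h : ∀ i ∈ s, (x i, v i) ∈ specGraph g) : (∑ i ∈ s, x i, ∑ i ∈ s, v i) ∈ specGraph g := by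
  have h1 := sum_mem h
  have e : ∑ i ∈ s, (x i, v i) = (∑ i ∈ s, x i, ∑ i ∈ s, v i) :=
    Prod.ext (by rw [Prod.fst_sum]) (by rw [Prod.snd_sum])
  rwa [e] at h1

theorem prod_mem_specGraph {ι : Type*} (s : Finset ι) {x : ι → RatF σ} {v : ι → RatF τ}
    (h : ∀ i ∈ s, (x i, v i) ∈ specGraph g) : (∏ i ∈ s, x i, ∏ i ∈ s, v i) ∈ specGraph g := by
  have h1 := prod_mem h
  have e : ∏ i ∈ s, (x i, v i) = (∏ i ∈ s, x i, ∏ i ∈ s, v i) :=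
    Prod.ext (by rw [Prod.fst_prod]) (by rw [Prod.snd_prod])
  rwa [e] at h1

theorem rvar_mem_specGraph (i : σ) : ((rvar i : RatF σ), (rvar (g i) : RatF τ)) ∈ specGraph g := by
  have := algebraMap_mem_specGraph (g := g) (var i)
  rwa [rename_var] at this

theorem rh_mem_specGraph : ((rh : RatF σ), (rh : RatF τ)) ∈ specGraph g := by
  have := algebraMap_mem_specGraph (g := g) (algebraMap Coef (Laurent σ) hh)
  rwa [AlgHom.commutes, ← IsScalarTower.algebraMap_apply, ← IsScalarTower.algebraMap_apply] at this

theorem coeff_eKer_mem_specGraph (al : Sgn) (s : ℕ) (i : σ) :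
    (PowerSeries.coeff s (eKer al (rvar i : RatF σ)), PowerSeries.coeff s (eKer al (rvar (g i) : RatF τ))) ∈
      specGraph g := by
  have h := rvar_mem_specGraph (g := g) i
  have h' := inv_mem_specGraph h (rvar_ne_zero _)
  rw [coeff_eKer, coeff_eKer]
  cases al
  · exact neg_mem (pow_mem h' s)
  · simp only
    split_ifs
    exacts [zero_mem _, pow_mem h s]

theorem coeff_fKer_mem_specGraph (al : Sgn) (s : ℕ) (i : σ) :
    (PowerSeries.coeff s (fKer al (rvar i : RatF σ)), PowerSeries.coeff s (fKer al (rvar (g i) : RatF τ))) ∈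
      specGraph g := by
  have h := rvar_mem_specGraph (g := g) i
  have h' := inv_mem_specGraph h (rvar_ne_zero _)
  rw [coeff_fKer, coeff_fKer]
  cases al
  · simp only
    split_ifs
    exacts [zero_mem _, neg_mem (pow_mem h' s)]
  · exact pow_mem h s

end Specialization

section SymmetrizedSums

variable {σ : Type} {m : ℕ}

/-- A symmetric sum with simple poles along the diagonals is a Laurent polynomial. -/
theorem sum_mem_laurentRange [DecidableEq σ] {x : Fin m → σ} (hx : Function.Injective x) {A : Fin m → RatF σ}
    {φ : σ → σ → RatF σ} (hA : ∀ i, A i ∈ laurentRange σ)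
    (hφ : ∀ a b, a ≠ b → φ a b * (rvar a - rvar b) ∈ laurentRange σ)
    (hinv : ∀ i j, i ≠ j → permute (Equiv.swap (x i) (x j)) (∑ k, A k * ∏ l ∈ univ.erase k, φ (x k) (x l)) =
      ∑ k, A k * ∏ l ∈ univ.erase k, φ (x k) (x l)) :
    ∑ k, A k * ∏ l ∈ univ.erase k, φ (x k) (x l) ∈ laurentRange σ := by
  have hne : ∀ p ∈ (univ : Finset (Fin m)).sigma fun i => univ.erase i, x p.1 ≠ x p.2 := fun p hp h =>
    (mem_erase.1 (mem_sigma.1 hp).2).1 (hx h).symm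
  have hreg : ∀ {a b c d : σ} (hab : a ≠ b), c ≠ d → ¬ (c = a ∧ d = b) → ¬ (c = b ∧ d = a) →
      φ c d ∈ Reg (prime_binom (1 : Coefˣ) hab) := by
    intro a b c d hab hcd h1 h2
    have h3 := mul_mem (laurentRange_le_Reg (prime_binom (1 : Coefˣ) hab) (hφ c d hcd)) (inv_sub_mem_Reg hab hcd h1 h2)
    rwa [mul_assoc, mul_inv_cancel₀ (rvar_sub_ne_zero hcd), mul_one] at h3
  refine mem_laurentRange_of_prod (univ.sigma fun i => univ.erase i)
    (fun p => binom (x p.1) (x p.2) ((1 : Coefˣ) : Coef)) (fun p hp => prime_binom 1 (hne p hp)) ?_ fun p hp => ?_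
  · rw [sum_mul]
    refine sum_mem fun k _ => ?_
    rw [prod_sigma, ← mul_prod_erase univ _ (mem_univ k), map_mul]
    simp only [map_prod, algebraMap_binom_one]
    have : (A k * ∏ l ∈ univ.erase k, φ (x k) (x l)) * ((∏ l ∈ univ.erase k, (rvar (x k) - rvar (x l))) *
        ∏ i ∈ univ.erase k, ∏ j ∈ univ.erase i, (rvar (x i) - rvar (x j))) =
        A k * (∏ l ∈ univ.erase k, φ (x k) (x l) * (rvar (x k) - rvar (x l))) *
        ∏ i ∈ univ.erase k, ∏ j ∈ univ.erase i, (rvar (x i) - rvar (x j)) := by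
      rw [prod_mul_distrib]; ring
    rw [this]
    refine mul_mem (mul_mem (hA k) (prod_mem fun l hl => hφ _ _ fun h => (mem_erase.1 hl).1 (hx h).symm)) ?_
    exact prod_mem fun i _ => prod_mem fun j _ => sub_mem (rvar_mem_laurentRange _) (rvar_mem_laurentRange _)
  · obtain ⟨i, j⟩ := p
    have hij : j ≠ i := (mem_erase.1 (mem_sigma.1 hp).2).1
    have hab := hne _ hp
    refine mem_Reg_of_swap hab ?_ ?_
    · rw [mul_sum]
      refine sum_mem fun k _ => ?_
      have key : ∀ l, l ≠ k → ¬ (k = i ∧ l = j) → ¬ (k = j ∧ l = i) →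
          φ (x k) (x l) ∈ Reg (prime_binom (1 : Coefˣ) hab) := fun l hl h1 h2 =>
        hreg hab (fun h => hl (hx h).symm) (fun h => h1 ⟨hx h.1, hx h.2⟩) (fun h => h2 ⟨hx h.1, hx h.2⟩)
      have hAk := laurentRange_le_Reg (prime_binom (1 : Coefˣ) hab) (hA k)
      rw [algebraMap_binom_one]
      by_cases hki : k = i
      · subst hki
        rw [← mul_prod_erase (univ.erase k) _ (mem_erase.2 ⟨hij, mem_univ j⟩)]
        have : (rvar (x k) - rvar (x j)) * (A k * (φ (x k) (x j) * ∏ l ∈ (univ.erase k).erase j, φ (x k) (x l))) =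
          A k * (φ (x k) (x j) * (rvar (x k) - rvar (x j))) * ∏ l ∈ (univ.erase k).erase j, φ (x k) (x l) := by ring
        rw [this]
        refine mul_mem (mul_mem hAk (laurentRange_le_Reg _ (hφ _ _ hab))) (prod_mem fun l hl => ?_)
        have hl' := mem_erase.1 hl
        exact key l (mem_erase.1 hl'.2).1 (fun h => hl'.1 h.2) (fun h => hij h.1.symm)
      · by_cases hkj : k = j
        · subst hkj
          rw [← mul_prod_erase (univ.erase k) _ (mem_erase.2 ⟨hij.symm, mem_univ i⟩)]
          have : (rvar (x i) - rvar (x k)) * (A k * (φ (x k) (x i) * ∏ l ∈ (univ.erase k).erase i, φ (x k) (x l))) =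
            -(A k * (φ (x k) (x i) * (rvar (x k) - rvar (x i))) * ∏ l ∈ (univ.erase k).erase i, φ (x k) (x l)) := by ring
          rw [this]
          refine neg_mem (mul_mem (mul_mem hAk (laurentRange_le_Reg _ (hφ _ _ hab.symm))) (prod_mem fun l hl => ?_))
          have hl' := mem_erase.1 hl
          exact key l (mem_erase.1 hl'.2).1 (fun h => hki h.1) (fun h => hl'.1 h.2)
        · refine mul_mem (sub_mem (algebraMap_mem_Reg _ _) (algebraMap_mem_Reg _ _)) (mul_mem hAk (prod_mem fun l hl => ?_))
          exact key l (mem_erase.1 hl).1 (fun h => hki h.1) (fun h => hkj h.1)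
    · rw [hinv i j hij.symm, sub_self]
      exact zero_mem _

/-- The three kinds of factors in the symmetrization formulas, as functions of the variables. -/
structure Shape where
  w : ∀ {σ : Type}, σ → RatF σ
  φ : ∀ {σ : Type}, σ → σ → RatF σ
  B : ∀ {σ : Type}, σ → σ → RatF σ
  w_mem : ∀ {σ : Type} (a : σ), w a ∈ laurentRange σ
  φ_mem : ∀ {σ : Type} (a b : σ), a ≠ b → φ a b * (rvar a - rvar b) ∈ laurentRange σ
  B_mem : ∀ {σ : Type} (a b : σ), B a b ∈ laurentRange σ
  w_permute : ∀ {σ : Type} (π : Equiv.Perm σ) (a : σ), permute π (w a) = w (π a)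
  φ_permute : ∀ {σ : Type} (π : Equiv.Perm σ) (a b : σ), permute π (φ a b) = φ (π a) (π b)
  B_permute : ∀ {σ : Type} (π : Equiv.Perm σ) (a b : σ), permute π (B a b) = B (π a) (π b)
  w_spec : ∀ {σ τ : Type} (g : σ → τ) (a : σ), (w a, w (g a)) ∈ specGraph g
  φ_spec : ∀ {σ τ : Type} (g : σ → τ) (a b : σ), g a ≠ g b → (φ a b, φ (g a) (g b)) ∈ specGraph g
  B_spec : ∀ {σ τ : Type} (g : σ → τ) (a b : σ), (B a b, B (g a) (g b)) ∈ specGraph g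

theorem one_sub_div_ne_zero {σ : Type} {a b : σ} (hab : a ≠ b) : (1 - rvar a / rvar b : RatF σ) ≠ 0 := by
  intro h
  rw [sub_eq_zero, eq_comm] at h
  have h2 := (div_eq_one_iff_eq (rvar_ne_zero b)).1 h
  exact rvar_sub_ne_zero hab (sub_eq_zero.2 h2)

theorem pole_aux {F : Type*} [Field F] {a b : F} (hb : b ≠ 0) (hab : a - b ≠ 0) : 1 / (1 - a / b) * (a - b) = -b := by
  have : b - a ≠ 0 := fun h => hab (by rw [← neg_sub, h, neg_zero])
  field_simp
  ring

theorem rvar_div_mem_laurentRange {σ : Type} (a b : σ) : (rvar a / rvar b : RatF σ) ∈ laurentRange σ := by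
  rw [div_eq_mul_inv]
  exact mul_mem (rvar_mem_laurentRange a) (inv_rvar_mem_laurentRange b)

theorem rvar_div_mem_specGraph {σ τ : Type} (g : σ → τ) (a b : σ) :
    ((rvar a / rvar b : RatF σ), (rvar (g a) / rvar (g b) : RatF τ)) ∈ specGraph g :=
  div_mem_specGraph (rvar_mem_specGraph a) (rvar_mem_specGraph b) (rvar_ne_zero _)

theorem one_sub_rh_mul_mem_laurentRange {σ : Type} (a b : σ) : (1 - rh * (rvar a / rvar b) : RatF σ) ∈ laurentRange σ :=
  sub_mem (one_mem _) (mul_mem rh_mem_laurentRange (rvar_div_mem_laurentRange a b))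

theorem one_sub_rh_mul_mem_specGraph {σ τ : Type} (g : σ → τ) (a b : σ) :
    ((1 - rh * (rvar a / rvar b) : RatF σ), (1 - rh * (rvar (g a) / rvar (g b)) : RatF τ)) ∈ specGraph g :=
  sub_mem_specGraph one_mem_specGraph (mul_mem_specGraph rh_mem_specGraph (rvar_div_mem_specGraph g a b))

theorem permute_coeff_eKer {σ : Type} (π : Equiv.Perm σ) (al : Sgn) (s : ℕ) (a : σ) :
    permute π (PowerSeries.coeff s (eKer al (rvar a))) = PowerSeries.coeff s (eKer al (rvar (π a))) := by
  rw [← PowerSeries.coeff_map, map_eKer, permute_rvar]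

theorem permute_coeff_fKer {σ : Type} (π : Equiv.Perm σ) (al : Sgn) (s : ℕ) (a : σ) :
    permute π (PowerSeries.coeff s (fKer al (rvar a))) = PowerSeries.coeff s (fKer al (rvar (π a))) := by
  rw [← PowerSeries.coeff_map, map_fKer, permute_rvar]

/-- The factors of the raising currents. -/
def raisingShape (al : Sgn) (s : ℕ) : Shape where
  w a := PowerSeries.coeff s (eKer al (rvar a))
  φ a b := 1 / (1 - rvar a / rvar b)
  B a k := 1 - rh * (rvar k / rvar a)
  w_mem a := coeff_eKer_mem _ al (rvar_mem_laurentRange a) (inv_rvar_mem_laurentRange a) s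
  φ_mem a b hab := by
    rw [pole_aux (rvar_ne_zero b) (rvar_sub_ne_zero hab)]
    exact neg_mem (rvar_mem_laurentRange b)
  B_mem a b := one_sub_rh_mul_mem_laurentRange b a
  w_permute π a := permute_coeff_eKer π al s a
  φ_permute π a b := by rw [map_div₀, map_sub, map_one, map_div₀, permute_rvar, permute_rvar]
  B_permute π a b := by rw [map_sub, map_one, map_mul, map_div₀, permute_rh, permute_rvar, permute_rvar]
  w_spec g a := coeff_eKer_mem_specGraph al s a
  φ_spec g a b hab := div_mem_specGraph one_mem_specGraph
    (sub_mem_specGraph one_mem_specGraph (rvar_div_mem_specGraph g a b)) (one_sub_div_ne_zero hab)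
  B_spec g a b := one_sub_rh_mul_mem_specGraph g b a

/-- The factors of the lowering currents. -/
def loweringShape (al : Sgn) (s : ℕ) : Shape where
  w a := PowerSeries.coeff s (fKer al (rvar a))
  φ a b := 1 / (1 - rvar b / rvar a)
  B a k := 1 - rh * (rvar a / rvar k)
  w_mem a := coeff_fKer_mem _ al (rvar_mem_laurentRange a) (inv_rvar_mem_laurentRange a) s
  φ_mem a b hab := by
    have h := pole_aux (rvar_ne_zero a) (rvar_sub_ne_zero hab.symm)
    rw [← neg_sub (rvar b) (rvar a), mul_neg, h, neg_neg]
    exact rvar_mem_laurentRange a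
  B_mem a b := one_sub_rh_mul_mem_laurentRange a b
  w_permute π a := permute_coeff_fKer π al s a
  φ_permute π a b := by rw [map_div₀, map_sub, map_one, map_div₀, permute_rvar, permute_rvar]
  B_permute π a b := by rw [map_sub, map_one, map_mul, map_div₀, permute_rh, permute_rvar, permute_rvar]
  w_spec g a := coeff_fKer_mem_specGraph al s a
  φ_spec g a b hab := div_mem_specGraph one_mem_specGraph
    (sub_mem_specGraph one_mem_specGraph (rvar_div_mem_specGraph g b a)) (one_sub_div_ne_zero hab.symm)
  B_spec g a b := one_sub_rh_mul_mem_specGraph g a b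

end SymmetrizedSums

section MovedRoots

variable {N n : ℕ} {mu lam : Fin N → ℕ} {c d : Fin N}

theorem permute_subst {e : Fin (lam c) → (Roots mu ≃ Roots lam)} (he : ∀ i, Moves ⟨c, i⟩ d (e i))
    (f : symLaurent n mu) (π : ∀ k, Equiv.Perm (Fin (lam k))) (i : Fin (lam c)) :
    permute (Equiv.sumCongr (Equiv.sigmaCongrRight π) (Equiv.refl (Fin n))) (subst (e i) f) =
      subst (e (π c i)) f := by
  set τ := Equiv.sigmaCongrRight π
  have hτ : τ ⟨c, i⟩ = ⟨c, π c i⟩ := rfl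
  have hcol : ∀ x, (τ x).1 = x.1 := fun x => rfl
  rw [subst, subst, permute_algebraMap, rename_rename]
  congr 1
  have h1 := symLaurent_rename f.2 ((e i).trans (τ.trans (e (π c i)).symm)) fun x => by
    rw [he (π c i) _]
    simp only [Equiv.trans_apply, Equiv.apply_symm_apply]
    refine (if_congr ?_ rfl (hcol _)).trans (he i x).symm
    rw [← hτ, τ.apply_eq_iff_eq]
  conv_rhs => rw [← h1, rename_rename]
  congr 2
  funext x
  rcases x with x | x <;> simp

theorem sumCongr_mulSingle_swap (i j : Fin (lam c)) :
    Equiv.sumCongr (Equiv.sigmaCongrRight (Pi.mulSingle c (Equiv.swap i j) : ∀ k, Equiv.Perm (Fin (lam k))))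
      (Equiv.refl (Fin n)) = Equiv.swap (Sum.inl ⟨c, i⟩) (Sum.inl ⟨c, j⟩) := by
  rw [← Equiv.Perm.sumCongr_swap_refl]
  congr 1
  ext1 ⟨k, a⟩
  by_cases hk : k = c
  · subst hk
    simp only [Equiv.sigmaCongrRight_apply, Pi.mulSingle_eq_same, Equiv.swap_apply_def]
    split_ifs <;> simp_all
  · rw [Equiv.swap_apply_of_ne_of_ne]
    · simp [Pi.mulSingle_eq_of_ne hk]
    · exact fun h => hk (congrArg Sigma.fst h)
    · exact fun h => hk (congrArg Sigma.fst h)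

/-- The symmetrized sum over the roots that are moved. -/
def shapeSum (sh : Shape) (c d : Fin N) (e : Fin (lam c) → (Roots mu ≃ Roots lam)) (f : symLaurent n mu) :
    RatF (Roots lam ⊕ Fin n) :=
  ∑ i, subst (e i) f * sh.w (Sum.inl ⟨c, i⟩) * ((∏ j ∈ univ.erase i, sh.φ (Sum.inl ⟨c, i⟩) (Sum.inl ⟨c, j⟩)) *
    ∏ k, sh.B (Sum.inl ⟨c, i⟩) (Sum.inl ⟨d, k⟩))

theorem permute_shapeSum (sh : Shape) {e : Fin (lam c) → (Roots mu ≃ Roots lam)} (he : ∀ i, Moves ⟨c, i⟩ d (e i))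
    (f : symLaurent n mu) (π : ∀ k, Equiv.Perm (Fin (lam k))) :
    permute (Equiv.sumCongr (Equiv.sigmaCongrRight π) (Equiv.refl (Fin n))) (shapeSum sh c d e f) =
      shapeSum sh c d e f := by
  rw [shapeSum, map_sum]
  refine Fintype.sum_equiv (π c) _ _ fun i => ?_
  have h1 : ∀ k j, (Equiv.sumCongr (Equiv.sigmaCongrRight π) (Equiv.refl (Fin n))) (Sum.inl ⟨k, j⟩) =
      Sum.inl ⟨k, π k j⟩ := fun k j => rfl
  rw [map_mul, map_mul, map_mul, map_prod, map_prod, permute_subst he, sh.w_permute, h1]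
  simp only [sh.φ_permute, sh.B_permute, h1]
  congr 2
  · refine prod_bij (fun j _ => π c j) (fun j hj => ?_) (fun _ _ _ _ h => (π c).injective h) (fun j hj => ?_)
      fun _ _ => rfl
    · rw [mem_erase] at hj ⊢
      exact ⟨fun h => hj.1 ((π c).injective h), mem_univ _⟩
    · rw [mem_erase] at hj
      refine ⟨(π c).symm j, mem_erase.2 ⟨fun h => hj.1 ?_, mem_univ _⟩, by simp⟩
      rw [← h, Equiv.apply_symm_apply]
  · exact Fintype.prod_equiv (π d) _ _ fun k => rfl

theorem subst_mem (e : Roots mu ≃ Roots lam) (f : symLaurent n mu) : subst e f ∈ laurentRange (Roots lam ⊕ Fin n) :=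
  ⟨_, rfl⟩

theorem exists_shapeSum_eq (sh : Shape) {e : Fin (lam c) → (Roots mu ≃ Roots lam)} (he : ∀ i, Moves ⟨c, i⟩ d (e i))
    (f : symLaurent n mu) : ∃ g : symLaurent n lam,
      algebraMap (Laurent (Roots lam ⊕ Fin n)) (RatF (Roots lam ⊕ Fin n)) g = shapeSum sh c d e f := by
  have hform : shapeSum sh c d e f = ∑ i, (subst (e i) f * sh.w (Sum.inl ⟨c, i⟩) *
      ∏ k, sh.B (Sum.inl ⟨c, i⟩) (Sum.inl ⟨d, k⟩)) *
      ∏ j ∈ univ.erase i, sh.φ (Sum.inl ⟨c, i⟩) (Sum.inl ⟨c, j⟩) := by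
    rw [shapeSum]
    refine sum_congr rfl fun i _ => ?_
    ring
  have hinj : Function.Injective fun i : Fin (lam c) => (Sum.inl ⟨c, i⟩ : Roots lam ⊕ Fin n) := by
    intro i j hij
    simpa using hij
  have hmem : shapeSum sh c d e f ∈ laurentRange (Roots lam ⊕ Fin n) := by
    rw [hform]
    refine sum_mem_laurentRange (x := fun i : Fin (lam c) => (Sum.inl ⟨c, i⟩ : Roots lam ⊕ Fin n)) hinj (fun i => ?_)
      sh.φ_mem fun i j _ => ?_
    · exact mul_mem (mul_mem (subst_mem _ _) (sh.w_mem _)) (prod_mem fun k _ => sh.B_mem _ _)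
    · rw [← hform, ← sumCongr_mulSingle_swap, permute_shapeSum sh he]
  obtain ⟨g, hg⟩ := hmem
  refine ⟨⟨g, fun π => ?_⟩, hg⟩
  refine IsFractionRing.injective _ (RatF (Roots lam ⊕ Fin n)) ?_
  have h1 := permute_algebraMap (Equiv.sumCongr (Equiv.sigmaCongrRight π) (Equiv.refl (Fin n))) g
  rw [hg, permute_shapeSum sh he, ← hg] at h1
  exact h1.symm

theorem part_of_equiv {J : Fin n → Fin N} (E : Roots mu ≃ Fin n) (hE : ∀ x, J (E x) = x.1) (k : Fin N) :
    (univ.filter fun a => J a = k).card = mu k := by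
  rw [← Fintype.card_fin (mu k), ← card_univ]
  refine (card_bij (fun j _ => E ⟨k, j⟩) (fun j _ => ?_) (fun i _ j _ h => ?_) fun a ha => ?_).symm
  · simp [hE]
  · simpa using h
  · have ha' : J a = k := by simpa using ha
    have h1 := hE (E.symm a)
    rw [Equiv.apply_symm_apply, ha'] at h1
    subst h1
    exact ⟨(E.symm a).2, mem_univ _, by simp⟩

/-- The restriction of a symmetrized sum to a fixed point. -/
theorem locPre_shapeSum (sh : Shape) {e : Fin (lam c) → (Roots mu ≃ Roots lam)}
    (he : ∀ i, Moves ⟨c, i⟩ d (e i)) (f : symLaurent n mu) (g : symLaurent n lam)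
    (hg : algebraMap (Laurent (Roots lam ⊕ Fin n)) (RatF (Roots lam ⊕ Fin n)) g = shapeSum sh c d e f)
    {val : (Fin n → Fin N) → RatF (Fin n)} (hval : ∀ J : Part n mu, val J.1 = algebraMap _ (RatF (Fin n)) (locPre J f))
    (I : Part n lam) :
    algebraMap _ (RatF (Fin n)) (locPre I g) = ∑ a ∈ univ.filter (fun a => I.1 a = c),
      val (Function.update I.1 a d) * sh.w a * ((∏ b ∈ peers I.1 a, sh.φ a b) *
        ∏ b ∈ univ.filter (fun b => I.1 b = d), sh.B a b) := by
  set L := locEquiv I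
  have hL : ∀ x, I.1 (L x) = x.1 := colour_locEquiv I
  set G : Roots lam ⊕ Fin n → Fin n := Sum.elim L id with hG
  rw [locPre_eq I g L hL]
  symm
  apply eq_of_mem_specGraph
  have hsub : ∀ i, (subst (e i) f, val (Function.update I.1 (L ⟨c, i⟩) d)) ∈ specGraph G := by
    intro i
    have hE : ∀ x, Function.update I.1 (L ⟨c, i⟩) d (((e i).trans L) x) = x.1 := by
      intro x
      rw [he i x, Equiv.trans_apply]
      split_ifs with h
      · rw [h, Function.update_self]
      · rw [Function.update_of_ne fun h' => h (L.injective h'), hL]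
    have h1 := hval ⟨_, part_of_equiv _ hE⟩
    rw [h1, locPre_eq _ f ((e i).trans L) hE, subst]
    have h2 := algebraMap_mem_specGraph (g := G) (rename (Sum.map (e i) id) (f : Laurent (Roots mu ⊕ Fin n)))
    rw [rename_rename] at h2
    have h3 : G ∘ Sum.map (e i) id = Sum.elim ((e i).trans L) id := by
      funext x
      rcases x with x | x <;> rfl
    rwa [h3] at h2
  have hsum : ∑ a ∈ univ.filter (fun a => I.1 a = c), val (Function.update I.1 a d) * sh.w a *
      ((∏ b ∈ peers I.1 a, sh.φ a b) * ∏ b ∈ univ.filter (fun b => I.1 b = d), sh.B a b) =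
      ∑ i : Fin (lam c), val (Function.update I.1 (L ⟨c, i⟩) d) * sh.w (L ⟨c, i⟩) *
        ((∏ j ∈ univ.erase i, sh.φ (L ⟨c, i⟩) (L ⟨c, j⟩)) * ∏ k : Fin (lam d), sh.B (L ⟨c, i⟩) (L ⟨d, k⟩)) := by
    have hfib : ∀ (k : Fin N) (a : Fin n), I.1 a = k → ∃ i, L ⟨k, i⟩ = a := by
      rintro k a rfl
      have h1 := hL (L.symm a)
      rw [Equiv.apply_symm_apply] at h1
      rw [h1]
      exact ⟨(L.symm a).2, by simp⟩
    have hLinj : ∀ (k : Fin N) (i j : Fin (lam k)), L ⟨k, i⟩ = L ⟨k, j⟩ → i = j := fun k i j h => by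
      simpa using L.injective h
    symm
    refine sum_bij (fun i _ => L ⟨c, i⟩) (fun i _ => by simp [hL]) (fun i _ j _ h => hLinj c i j h)
      (fun a ha => ?_) fun i _ => ?_
    · obtain ⟨i, hi⟩ := hfib c a (by simpa using ha)
      exact ⟨i, mem_univ _, hi⟩
    · congr 2
      · refine prod_bij (fun j _ => L ⟨c, j⟩) (fun j hj => ?_) (fun i _ j _ h => hLinj c i j h) (fun b hb => ?_)
          fun _ _ => rfl
        · rw [peers, mem_filter, hL, hL]
          exact ⟨mem_univ _, fun h => (mem_erase.1 hj).1 (hLinj c _ _ h), rfl⟩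
        · rw [peers, mem_filter, hL] at hb
          obtain ⟨j, rfl⟩ := hfib c b hb.2.2
          exact ⟨j, mem_erase.2 ⟨fun h => hb.2.1 (by rw [h]), mem_univ _⟩, rfl⟩
      · refine prod_bij (fun k _ => L ⟨d, k⟩) (fun k _ => by simp [hL]) (fun i _ j _ h => hLinj d i j h) (fun b hb => ?_)
          fun _ _ => rfl
        obtain ⟨k, hk⟩ := hfib d b (by simpa using hb)
        exact ⟨k, mem_univ _, hk⟩
  rw [hg, hsum, shapeSum]
  refine sum_mem_specGraph _ fun i _ => mul_mem_specGraph (mul_mem_specGraph (hsub i) (sh.w_spec G (Sum.inl ⟨c, i⟩)))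
    (mul_mem_specGraph (prod_mem_specGraph _ fun j hj => sh.φ_spec G (Sum.inl ⟨c, i⟩) (Sum.inl ⟨c, j⟩) fun h => ?_)
      (prod_mem_specGraph _ fun k _ => sh.B_spec G (Sum.inl ⟨c, i⟩) (Sum.inl ⟨d, k⟩)))
  have h1 : (⟨c, i⟩ : Roots lam) = ⟨c, j⟩ := L.injective h
  exact (mem_erase.1 hj).1 (by simpa using h1.symm)

end MovedRoots

end LoopK

end

noncomputable section

namespace LoopK

open Finset Matrix

section Recolouring

variable {N n : ℕ}

theorem Rz_split (I : Fin n → Fin N) (a : Fin n) : Rz I =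
    (∏ b ∈ univ.erase a, (if I a < I b then 1 - rvar b / rvar a else 1) *
      if I b < I a then 1 - rvar a / rvar b else 1) *
    ∏ c ∈ univ.erase a, ∏ b ∈ univ.erase a, if I c < I b then 1 - rvar b / rvar c else (1 : RatF (Fin n)) := by
  rw [Rz, ← mul_prod_erase univ _ (mem_univ a), ← mul_prod_erase univ _ (mem_univ a), if_neg (lt_irrefl _), one_mul]
  have : ∏ c ∈ univ.erase a, ∏ b, (if I c < I b then 1 - rvar b / rvar c else (1 : RatF (Fin n))) =
      (∏ c ∈ univ.erase a, if I c < I a then 1 - rvar a / rvar c else 1) *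
      ∏ c ∈ univ.erase a, ∏ b ∈ univ.erase a, if I c < I b then 1 - rvar b / rvar c else 1 := by
    rw [← prod_mul_distrib]
    exact prod_congr rfl fun c _ => (mul_prod_erase univ _ (mem_univ a)).symm
  rw [this, prod_mul_distrib, mul_assoc]

theorem peers_eq (I : Fin n → Fin N) (a : Fin n) : peers I a = (univ.erase a).filter fun b => I b = I a := by
  ext b; simp [peers]

theorem peers_update {I : Fin n → Fin N} {a : Fin n} {d : Fin N} (h : I a ≠ d) :
    peers (Function.update I a d) a = univ.filter fun b => I b = d := by
  ext b
  simp only [peers, mem_filter, mem_univ, true_and, Function.update_self]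
  constructor
  · rintro ⟨h1, h2⟩
    rwa [Function.update_of_ne h1] at h2
  · intro h1
    have hb : b ≠ a := by rintro rfl; exact h h1
    exact ⟨hb, by rwa [Function.update_of_ne hb]⟩

/-- The change of `R(z_I)` when the colour of `a` is raised by one. -/
theorem Rz_update {I : Fin n → Fin N} {a : Fin n} {y : Fin N} (hy : (I a : ℕ) + 1 = y) :
    Rz I * ∏ b ∈ peers I a, (1 - rvar a / rvar b) =
      Rz (Function.update I a y) * ∏ b ∈ univ.filter (fun b => I b = y), (1 - rvar b / rvar a) := by
  have hne : I a ≠ y := fun h => by rw [h] at hy; omega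
  have e1 : univ.filter (fun b => I b = y) = (univ.erase a).filter fun b => I b = y := by
    ext b
    simp only [mem_filter, mem_univ, true_and, mem_erase, and_true]
    exact ⟨fun h => ⟨by rintro rfl; exact hne h, h⟩, fun h => h.2⟩
  have e2 : ∏ c ∈ univ.erase a, ∏ b ∈ univ.erase a,
      (if Function.update I a y c < Function.update I a y b then 1 - rvar b / rvar c else (1 : RatF (Fin n))) =
      ∏ c ∈ univ.erase a, ∏ b ∈ univ.erase a, if I c < I b then 1 - rvar b / rvar c else 1 := by
    refine prod_congr rfl fun c hc => prod_congr rfl fun b hb => ?_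
    rw [Function.update_of_ne (mem_erase.1 hc).1, Function.update_of_ne (mem_erase.1 hb).1]
  rw [Rz_split I a, Rz_split (Function.update I a y) a, e2, e1, peers_eq, prod_filter, prod_filter]
  refine (mul_right_comm _ _ _).trans (Eq.trans ?_ (mul_right_comm _ _ _))
  congr 1
  rw [← prod_mul_distrib, ← prod_mul_distrib]
  refine prod_congr rfl fun b hb => ?_
  rw [Function.update_self, Function.update_of_ne (mem_erase.1 hb).1]
  rcases lt_trichotomy (I b) (I a) with h | h | h
  · have h1 : I b < y := by rw [Fin.lt_def] at *; omega
    simp only [h.not_gt, h, h.ne, h1.not_gt, h1, h1.ne, if_true, if_false, mul_one]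
  · have h1 : I a < y := by rw [Fin.lt_def]; omega
    simp only [h, lt_irrefl, h1.not_gt, h1, h1.ne, if_true, if_false, mul_one, one_mul]
  · rcases (show y ≤ I b by rw [Fin.lt_def] at h; rw [Fin.le_def]; omega).eq_or_lt with h1 | h1
    · subst h1
      simp only [h, h.not_gt, h.ne', lt_irrefl, if_true, if_false, mul_one, one_mul]
    · simp only [h, h.not_gt, h.ne', h1, h1.not_gt, h1.ne', if_true, if_false, mul_one]

theorem wt_update (I : Fin n → Fin N) (a : Fin n) (y : Fin N) :
    (wt (Function.update I a y)).1 + Pi.single (I a) 1 = (wt I).1 + Pi.single y 1 := by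
  ext k
  change (univ.filter fun b => Function.update I a y b = k).card + _ = (univ.filter fun b => I b = k).card + _
  rw [card_filter, card_filter, ← add_sum_erase univ _ (mem_univ a), Function.update_self,
    ← add_sum_erase univ (fun b => if I b = k then 1 else 0) (mem_univ a)]
  have : ∑ b ∈ univ.erase a, (if Function.update I a y b = k then 1 else 0) =
      ∑ b ∈ univ.erase a, if I b = k then 1 else 0 :=
    sum_congr rfl fun b hb => by rw [Function.update_of_ne (mem_erase.1 hb).1]
  rw [this, Pi.single_apply, Pi.single_apply]
  simp only [eq_comm (a := k)]
  ring

theorem row_sum {K : Type*} [CommRing K] {x y : Fin N} (hxy : x ≠ y) {M : (Fin n → Fin N) → (Fin n → Fin N) → K}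
    {G : (Fin n → Fin N) → Fin n → K} (h1 : ∀ J I, M I J ≠ 0 → ∃ a, J a = x ∧ I = Function.update J a y)
    (h2 : ∀ J a, J a = x → M (Function.update J a y) J = G J a) (v : (Fin n → Fin N) → K) (I : Fin n → Fin N) :
    ∑ J, M I J * v J = ∑ a ∈ univ.filter (fun a => I a = y),
      G (Function.update I a x) a * v (Function.update I a x) := by
  have hback : ∀ a, I a = y → Function.update (Function.update I a x) a y = I := fun a ha => by
    rw [Function.update_idem, ← ha, Function.update_eq_self]
  have hinj : Set.InjOn (fun a => Function.update I a x) (univ.filter fun a => I a = y : Finset (Fin n)) := by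
    intro a ha b hb hab
    by_contra hne
    have h3 := congrFun hab a
    simp only [Function.update_self, Function.update_of_ne hne] at h3
    have ha' : I a = y := by simpa using ha
    exact hxy (h3.trans ha')
  have h3 : ∑ a ∈ univ.filter (fun a => I a = y), G (Function.update I a x) a * v (Function.update I a x) =
      ∑ J ∈ (univ.filter fun a => I a = y).image fun a => Function.update I a x, M I J * v J := by
    rw [sum_image hinj]
    refine sum_congr rfl fun a ha => ?_
    have ha' : I a = y := by simpa using ha
    have h4 := h2 (Function.update I a x) a (Function.update_self _ _ _)
    rw [hback a ha'] at h4
    rw [h4]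
  rw [h3]
  symm
  refine sum_subset (subset_univ _) fun J _ hJ => ?_
  by_contra hne
  obtain ⟨a, ha, h4⟩ := h1 J I (left_ne_zero_of_mul hne)
  refine hJ (mem_image.2 ⟨a, ?_, ?_⟩)
  · simp [h4]
  · rw [h4, Function.update_idem, ← ha, Function.update_eq_self]

end Recolouring

section ActionFormulas

variable {N n : ℕ} {xi : (Fin n → Fin N) → V N n} (hxi : IsXi xi)
  {rho : U N →ₐ[Coef] Module.End Coef (KT N n)} (hrho : ∀ X x, nu xi (rho X x) = phi N n X *ᵥ nu xi x)

include hxi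

theorem xiCoord_phi (X : U N) (w : V N n) (I : Fin n → Fin N) :
    xiCoord xi (phi N n X *ᵥ w) I = ∑ J, psi hxi X I J * xiCoord xi w J := by
  have h : xiCoord xi (phi N n X *ᵥ w) = psi hxi X *ᵥ xiCoord xi w := by
    change _ = ((xiMat xi)⁻¹ * phi N n X * xiMat xi) *ᵥ ((xiMat xi)⁻¹ *ᵥ w)
    rw [mulVec_mulVec, mul_assoc, xiMat_mul_inv hxi, mul_one, xiCoord, mulVec_mulVec]
  rw [h]
  rfl

theorem xiCoord_nu_inc_of_ne {mu : Weight N n} {J : Fin n → Fin N} (h : wt J ≠ mu) (x : KLam n mu.1) :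
    xiCoord xi (nu xi (inc mu x)) J = 0 := by
  rw [nu_inc]
  exact xiCoord_nuLam_of_ne hxi (fun h' => h (Subtype.ext h'.symm)) x (toPart J)

include hrho

variable {c d : Fin N} (hcd : c ≠ d) {X : U N} {G : (Fin n → Fin N) → Fin n → RatF (Fin n)}
  (h1 : ∀ J I, psi hxi X I J ≠ 0 → ∃ a, J a = d ∧ I = Function.update J a c)
  (h2 : ∀ J a, J a = d → psi hxi X (Function.update J a c) J = G J a)

include hcd h1 h2

theorem rho_inc_eq_zero {mu : Weight N n} (hmu : mu.1 d = 0) (x : KLam n mu.1) : rho X (inc mu x) = 0 := by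
  refine nu_injective hxi (xiCoord_ext hxi fun I => ?_)
  rw [hrho, xiCoord_phi hxi, row_sum hcd.symm h1 h2, map_zero]
  refine (sum_eq_zero fun a _ => ?_).trans (congrFun (mulVec_zero _) I).symm
  rw [xiCoord_nu_inc_of_ne hxi, mul_zero]
  rintro rfl
  have h3 : a ∈ univ.filter fun b => Function.update I a d b = d := by simp
  exact (card_pos.2 ⟨a, h3⟩).ne' hmu

theorem exists_rho_inc_eq {sh : Shape}
    (hG : ∀ I a, I a = c → G (Function.update I a d) a * Rz I = Rz (Function.update I a d) *
      (sh.w a * ((∏ b ∈ peers I a, sh.φ a b) * ∏ b ∈ univ.filter (fun b => I b = d), sh.B a b)))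
    {mu lam : Weight N n} (hw : lam.1 + Pi.single d 1 = mu.1 + Pi.single c 1) (f : symLaurent n mu.1)
    (e : Fin (lam.1 c) → (Roots mu.1 ≃ Roots lam.1)) (he : ∀ i, Moves ⟨c, i⟩ d (e i)) :
    ∃ g : symLaurent n lam.1,
      algebraMap (Laurent (Roots lam.1 ⊕ Fin n)) (RatF (Roots lam.1 ⊕ Fin n)) g = shapeSum sh c d e f ∧
      rho X (inc mu (cls f)) = inc lam (cls g) := by
  obtain ⟨g, hg⟩ := exists_shapeSum_eq sh he f
  refine ⟨g, hg, nu_injective hxi (xiCoord_ext hxi fun I => ?_)⟩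
  rw [hrho, xiCoord_phi hxi, row_sum hcd.symm h1 h2]
  by_cases hI : wt I = lam
  · subst hI
    have h3 := xiCoord_nuLam hxi (wt I).1 (cls g) (toPart I)
    have hval : ∀ J : Part n mu.1, xiCoord xi (nu xi (inc mu (cls f))) J.1 * Rz J.1 =
        algebraMap _ (RatF (Fin n)) (locPre J f) := fun J => by
      rw [nu_inc, xiCoord_nuLam hxi, loc_cls, div_mul_cancel₀ _ (Rz_ne_zero _)]
    rw [nu_inc (wt I)]
    refine Eq.trans ?_ h3.symm
    rw [loc_cls, locPre_shapeSum sh he f g hg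
      (val := fun J => xiCoord xi (nu xi (inc mu (cls f))) J * Rz J) hval (toPart I),
      eq_div_iff (Rz_ne_zero _), sum_mul]
    refine sum_congr rfl fun a ha => ?_
    have h4 := hG I a (mem_filter.1 ha).2
    change G (Function.update I a d) a * _ * Rz I = xiCoord xi _ (Function.update I a d) *
      Rz (Function.update I a d) * _ * ((∏ b ∈ peers I a, sh.φ a b) * ∏ b ∈ univ.filter (fun b => I b = d), sh.B a b)
    linear_combination xiCoord xi (nu xi (inc mu (cls f))) (Function.update I a d) * h4
  · rw [xiCoord_nu_inc_of_ne hxi hI]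
    refine sum_eq_zero fun a ha => ?_
    rw [xiCoord_nu_inc_of_ne hxi, mul_zero]
    rintro rfl
    refine hI (Subtype.ext ?_)
    have h3 := wt_update I a d
    rw [(mem_filter.1 ha).2, ← hw] at h3
    exact (add_right_cancel h3).symm

end ActionFormulas

section Currents

variable {N n : ℕ} {mu lam : Fin N → ℕ}

theorem coeff_eSum (al : Sgn) (c d : Fin N) (e : Fin (lam c) → (Roots mu ≃ Roots lam)) (f : symLaurent n mu) (s : ℕ) :
    PowerSeries.coeff s (eSum al c d e f) = shapeSum (raisingShape al s) c d e f := by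
  rw [eSum, map_sum]
  refine sum_congr rfl fun i _ => ?_
  rw [PowerSeries.coeff_mul_C, PowerSeries.coeff_C_mul]
  rfl

theorem coeff_fSum (al : Sgn) (d c : Fin N) (e : Fin (lam c) → (Roots mu ≃ Roots lam)) (f : symLaurent n mu) (s : ℕ) :
    PowerSeries.coeff s (fSum al d c e f) = shapeSum (loweringShape al s) c d e f := by
  rw [fSum, map_sum]
  refine sum_congr rfl fun i _ => ?_
  rw [PowerSeries.coeff_mul_C, PowerSeries.coeff_C_mul]
  rfl

theorem ratio_aux {F : Type*} [Field F] {R R' P P' Q w : F} (hP : P ≠ 0) (hP' : P' ≠ 0) (h : R * P = R' * P') :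
    Q / P' * w * R = R' * (w * (1 / P * Q)) := by
  field_simp
  linear_combination Q * w * h

theorem ratio_aux' {F : Type*} [Field F] {R R' P P' Q w : F} (hP : P ≠ 0) (hP' : P' ≠ 0) (h : R' * P' = R * P) :
    Q / P' * w * R = R' * (w * (1 / P * Q)) := ratio_aux hP hP' h.symm

theorem factor_aux {F : Type*} [Field F] {a b h : F} (ha : a ≠ 0) (hab : a - b ≠ 0) :
    (a - h * b) / (a - b) = (1 - h * (b / a)) / (1 - b / a) := by
  have : 1 - b / a ≠ 0 := by
    rw [one_sub_div ha]; exact div_ne_zero hab ha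
  rw [div_eq_div_iff hab this]
  field_simp

theorem prod_peers_ne_zero (I : Fin n → Fin N) (a : Fin n) :
    ∏ b ∈ peers I a, (1 - rvar a / rvar b : RatF (Fin n)) ≠ 0 ∧
    ∏ b ∈ peers I a, (1 - rvar b / rvar a : RatF (Fin n)) ≠ 0 :=
  ⟨prod_ne_zero_iff.2 fun _ hb => one_sub_div_ne_zero (Ne.symm (mem_filter.1 hb).2.1),
    prod_ne_zero_iff.2 fun _ hb => one_sub_div_ne_zero (mem_filter.1 hb).2.1⟩

theorem rCoef_ratio (al : Sgn) (s : ℕ) {I : Fin n → Fin N} {a : Fin n} {d : Fin N} (hd : (I a : ℕ) + 1 = d) :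
    PowerSeries.coeff s (rCoef al (Function.update I a d) a) * Rz I = Rz (Function.update I a d) *
      ((raisingShape al s).w a * ((∏ b ∈ peers I a, (raisingShape al s).φ a b) *
        ∏ b ∈ univ.filter (fun b => I b = d), (raisingShape al s).B a b)) := by
  have hne : I a ≠ d := fun h => by rw [h] at hd; omega
  have hP := (prod_peers_ne_zero (Function.update I a d) a).2
  have e : ∏ b ∈ peers (Function.update I a d) a, (rvar a - rh * rvar b : RatF (Fin n)) / (rvar a - rvar b) =
      (∏ b ∈ peers (Function.update I a d) a, (1 - rh * (rvar b / rvar a))) /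
        ∏ b ∈ peers (Function.update I a d) a, (1 - rvar b / rvar a) := by
    rw [← prod_div_distrib]
    exact prod_congr rfl fun b hb =>
      factor_aux (rvar_ne_zero a) (rvar_sub_ne_zero (Ne.symm (mem_filter.1 hb).2.1))
  rw [rCoef, PowerSeries.coeff_C_mul, e]
  rw [peers_update hne] at hP ⊢
  have := ratio_aux (Q := ∏ b ∈ univ.filter (fun b => I b = d), (1 - rh * (rvar b / rvar a) : RatF (Fin n)))
    (w := PowerSeries.coeff s (eKer al (rvar a))) (prod_peers_ne_zero I a).1 hP (Rz_update hd)
  rw [this]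
  simp only [raisingShape, prod_div_distrib, prod_const_one]

theorem lCoef_ratio (al : Sgn) (s : ℕ) {I : Fin n → Fin N} {a : Fin n} {d : Fin N} (hd : (d : ℕ) + 1 = I a) :
    PowerSeries.coeff s (lCoef al (Function.update I a d) a) * Rz I = Rz (Function.update I a d) *
      ((loweringShape al s).w a * ((∏ b ∈ peers I a, (loweringShape al s).φ a b) *
        ∏ b ∈ univ.filter (fun b => I b = d), (loweringShape al s).B a b)) := by
  have hne : I a ≠ d := fun h => by rw [h] at hd; omega
  have hP := (prod_peers_ne_zero (Function.update I a d) a).1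
  have e : ∏ b ∈ peers (Function.update I a d) a, (rvar b - rh * rvar a : RatF (Fin n)) / (rvar b - rvar a) =
      (∏ b ∈ peers (Function.update I a d) a, (1 - rh * (rvar a / rvar b))) /
        ∏ b ∈ peers (Function.update I a d) a, (1 - rvar a / rvar b) := by
    rw [← prod_div_distrib]
    exact prod_congr rfl fun b hb => factor_aux (rvar_ne_zero b) (rvar_sub_ne_zero (mem_filter.1 hb).2.1)
  have hu := Rz_update (I := Function.update I a d) (a := a) (y := I a) (by rw [Function.update_self]; exact hd)
  have hback : Function.update (Function.update I a d) a (I a) = I := by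
    rw [Function.update_idem, Function.update_eq_self]
  have hpe := peers_update (I := Function.update I a d) (a := a) (d := I a) (by
    rw [Function.update_self]; exact hne.symm)
  rw [← hpe, hback] at hu
  rw [lCoef, PowerSeries.coeff_C_mul, e]
  rw [peers_update hne] at hP hu ⊢
  have := ratio_aux' (Q := ∏ b ∈ univ.filter (fun b => I b = d), (1 - rh * (rvar a / rvar b) : RatF (Fin n)))
    (w := PowerSeries.coeff s (fKer al (rvar a))) (prod_peers_ne_zero I a).2 hP hu
  rw [this]
  simp only [loweringShape, prod_div_distrib, prod_const_one]

variable {xi : (Fin n → Fin N) → V N n} (hxi : IsXi xi) {p : ℕ} (hp : p + 1 < N) (al : Sgn) (s : ℕ)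

theorem psi_coeff_Eser_ne_zero (J I : Fin n → Fin N) (h : psi hxi (PowerSeries.coeff s (Eser al hp)) I J ≠ 0) :
    ∃ a, J a = ⟨p + 1, hp⟩ ∧ I = Function.update J a ⟨p, by omega⟩ := by
  refine (psi_Eser_column (hp := hp) (al := al) hxi J).1 I fun h' => h ?_
  rw [← coeff_matSer, h', map_zero]

theorem psi_coeff_Eser (J : Fin n → Fin N) (a : Fin n) (ha : J a = ⟨p + 1, hp⟩) :
    psi hxi (PowerSeries.coeff s (Eser al hp)) (Function.update J a ⟨p, by omega⟩) J =
      PowerSeries.coeff s (rCoef al J a) := by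
  rw [← (psi_Eser_column (hp := hp) (al := al) hxi J).2 a ha, coeff_matSer]

theorem psi_coeff_Fser_ne_zero (J I : Fin n → Fin N) (h : psi hxi (PowerSeries.coeff s (Fser al hp)) I J ≠ 0) :
    ∃ a, J a = ⟨p, by omega⟩ ∧ I = Function.update J a ⟨p + 1, hp⟩ := by
  refine (psi_Fser_column (hp := hp) (al := al) hxi J).1 I fun h' => h ?_
  rw [← coeff_matSer, h', map_zero]

theorem psi_coeff_Fser (J : Fin n → Fin N) (a : Fin n) (ha : J a = ⟨p, by omega⟩) :
    psi hxi (PowerSeries.coeff s (Fser al hp)) (Function.update J a ⟨p + 1, hp⟩) J =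
      PowerSeries.coeff s (lCoef al J a) := by
  rw [← (psi_Fser_column (hp := hp) (al := al) hxi J).2 a ha, coeff_matSer]

end Currents

end LoopK

end

open LoopK in
theorem theorem12p4 (N n : ℕ) :
    ∃ xi : (Fin n → Fin N) → V N n, IsXi xi ∧ (∀ xi', IsXi xi' → xi' = xi) ∧
    -- the map ν is an isomorphism onto its target
    Function.Injective (nu xi) ∧ Set.range (nu xi) = (DVz N n : Set (V N n)) ∧
    -- the action on vector-valued functions
    ∃ phi : U N →ₐ[Coef] Matrix (Fin n → Fin N) (Fin n → Fin N) (RatF (Fin n)),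
      (∀ al i j s, phi (LL al i j s) = Lcoef n al i j s) ∧
    -- the action on the K-theory obtained from it through ν
    ∃ rho : U N →ₐ[Coef] Module.End Coef (KT N n),
      (∀ X x, nu xi (rho X x) = Matrix.mulVec (phi X) (nu xi x)) ∧
      ∀ (al : Sgn) (p : ℕ) (hp : p + 1 < N) (mu : Weight N n),
        let b : Fin N := ⟨p, by omega⟩
        let b' : Fin N := ⟨p + 1, hp⟩
        -- the operators E
        (mu.1 b' = 0 → ∀ s x, rho (PowerSeries.coeff s (Eser al hp)) (inc mu x) = 0) ∧
        (∀ lam : Weight N n, lam.1 + Pi.single b' 1 = mu.1 + Pi.single b 1 →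
          ∀ (f : symLaurent n mu.1) (e : Fin (lam.1 b) → (Roots mu.1 ≃ Roots lam.1)),
            (∀ i, Moves ⟨b, i⟩ b' (e i)) → ∀ s, ∃ g : symLaurent n lam.1,
              algebraMap (Laurent (Roots lam.1 ⊕ Fin n)) (RatF (Roots lam.1 ⊕ Fin n)) g =
                PowerSeries.coeff s (eSum al b b' e f) ∧
              rho (PowerSeries.coeff s (Eser al hp)) (inc mu (cls f)) = inc lam (cls g)) ∧
        -- the operators F
        (mu.1 b = 0 → ∀ s x, rho (PowerSeries.coeff s (Fser al hp)) (inc mu x) = 0) ∧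
        (∀ lam : Weight N n, lam.1 + Pi.single b 1 = mu.1 + Pi.single b' 1 →
          ∀ (f : symLaurent n mu.1) (e : Fin (lam.1 b') → (Roots mu.1 ≃ Roots lam.1)),
            (∀ i, Moves ⟨b', i⟩ b (e i)) → ∀ s, ∃ g : symLaurent n lam.1,
              algebraMap (Laurent (Roots lam.1 ⊕ Fin n)) (RatF (Roots lam.1 ⊕ Fin n)) g =
                PowerSeries.coeff s (fSum al b b' e f) ∧
              rho (PowerSeries.coeff s (Fser al hp)) (inc mu (cls f)) = inc lam (cls g)) := by
  refine ⟨xiFun, isXi_xiFun, fun xi' h => (isXi_unique isXi_xiFun h), nu_injective isXi_xiFun, range_nu isXi_xiFun,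
    phi N n, phi_LL, ?_⟩
  obtain ⟨rho, hrho⟩ := exists_rho (N := N) (n := n) isXi_xiFun
  refine ⟨rho, hrho, fun al p hp mu => ?_⟩
  have hne : (⟨p, by omega⟩ : Fin N) ≠ ⟨p + 1, hp⟩ := by simp [Fin.ext_iff]
  refine ⟨fun hmu s x => ?_, fun lam hw f e he s => ?_, fun hmu s x => ?_, fun lam hw f e he s => ?_⟩
  · exact rho_inc_eq_zero isXi_xiFun hrho hne (psi_coeff_Eser_ne_zero isXi_xiFun hp al s)
      (psi_coeff_Eser isXi_xiFun hp al s) hmu x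
  · rw [coeff_eSum]
    exact exists_rho_inc_eq isXi_xiFun hrho hne (psi_coeff_Eser_ne_zero isXi_xiFun hp al s)
      (psi_coeff_Eser isXi_xiFun hp al s) (fun I a ha => rCoef_ratio al s (by rw [ha])) hw f e he
  · exact rho_inc_eq_zero isXi_xiFun hrho hne.symm (psi_coeff_Fser_ne_zero isXi_xiFun hp al s)
      (psi_coeff_Fser isXi_xiFun hp al s) hmu x
  · rw [coeff_fSum]
    exact exists_rho_inc_eq isXi_xiFun hrho hne.symm (psi_coeff_Fser_ne_zero isXi_xiFun hp al s)
      (psi_coeff_Fser isXi_xiFun hp al s) (fun I a ha => lCoef_ratio al s (by rw [ha])) hw f e he
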